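/- **Setting.** Let $q\in\mathbb C^*$ be not a root of unity, with a fixed square root $q^{1/2}$. Let $\mathfrak g$ be a simple Lie algebra with Cartan matrix $(C_{i,j})_{i,j\in I}$ and let $\sigma$ be a diagram automorphism of order $M>1$, so that $(\mathfrak g,M)$ is $(A_n,2)$ with $n\ge2$, $n\neq3$; $(D_{n+1},2)$ with $n\ge2$; $(D_4,3)$; or $(E_6,2)$. The vertices are labelled so that the chains are $1-\cdots-n$ for $A_n$; $1-\cdots-(n-1)$ with $n-1$ joined to $n$ and $n+1$ for $D_{n+1}$ (and $D_4=D_{3+1}$); $1-2-3-5-6$ with $3$ joined to $4$ for $E_6$. Let $I_0\subset I$ consist of the smallest vertex of each $\sigma$-orbit, $\zeta=e^{2\pi \mathrm i/M}$, $N_i=M$ if $\sigma(i)=i$ and $N_i=1$ otherwise, $q_i=q^{d_i}$ with $d_i=\frac12$ if $C_{i,\sigma(i)}=-1$ and $d_i=N_i$ otherwise. Let $\Lambda$ be the set of integral coweights $\mu=(\alpha_i(\mu))_{i\in I_0}\in\mathbb Z^{I_0}$ with $M\mid\alpha_i(\mu)$ whenever $\sigma(i)=i$. **Algebra.** For $\mu\in\Lambda$,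 $\mathcal U_q^\mu(\hat{\mathfrak g}^\sigma)$ is the $\mathbb C$-algebra with generators $x_{i,m}^\pm,\phi_{i,m}^\pm$ ($m\in\mathbb Z$), $h_{i,m}$ ($m\ne0$), $i\in I_0$, such that: $x^\pm_{i,m}=h_{i,m}=0$ if $N_i\nmid m$; all $\phi$'s and $h$'s commute; with $\mu_+=0$, $\mu_-=\mu$, $$\phi_i^\pm(z)=\sum_{r\in\mathbb Z}\phi^\pm_{i,\pm r}z^{\pm r}=z^{\mp\alpha_i(\mu_\pm)}\phi^\pm_{i,\mp\alpha_i(\mu_\pm)}\exp\Big(\pm(q_i-q_i^{-1})\sum_{m\ge1}h_{i,\pm m}z^{\pm m}\Big)$$ with $\phi^+_{i,0}$ and $\phi^-_{i,\alpha_i(\mu)}$ invertible; for $\delta=\pm1$, $\phi^+_{i,0}x^\delta_{j,r}=q^{\delta b_{ij}}x^\delta_{j,r}\phi^+_{i,0}$ and $\phi^-_{i,\alpha_i(\mu)}x^\delta_{j,r}=q^{-\delta b_{ij}}x^\delta_{j,r}\phi^-_{i,\alpha_i(\mu)}$, where $b_{ij}=\sum_{s=1}^MC_{i,\sigma^s(j)}$;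 $$[h_{i,m},x^\pm_{j,r}]=\pm\frac1m\Big(\sum_{s=1}^M\frac{q^{mC_{i,\sigma^s(j)}}-q^{-mC_{i,\sigma^s(j)}}}{q_i-q_i^{-1}}\zeta^{ms}\Big)x^\pm_{j,m+r},\qquad [x^+_{i,r},x^-_{j,r'}]=\frac{\sum_{s=1}^M\delta_{\sigma^s(i),j}\zeta^{sr'}}{N_i}\,\frac{\phi^+_{i,r+r'}-\phi^-_{i,r+r'}}{q_i-q_i^{-1}};$$ and, with $x_i^\pm(u)=\sum_r x^\pm_{i,r}u^{-r}$, $$\prod_{s=1}^M(u_1-\zeta^sq^{\pm C_{i,\sigma^s(j)}}u_2)\,x_i^\pm(u_1)x_j^\pm(u_2)=\prod_{s=1}^M(u_1q^{\pm C_{i,\sigma^s(j)}}-\zeta^su_2)\,x_j^\pm(u_2)x_i^\pm(u_1);$$ if $C_{i,j}=-1$ and $\sigma(i)\ne j$, $$\mathrm{Sym}_{u_1,u_2}\Big\{P^\pm_{i,j}(u_1,u_2)\big(x_j^\pm(v)x_i^\pm(u_1)x_i^\pm(u_2)-(q^{2Md_{i,j}}+q^{-2Md_{i,j}})x_i^\pm(u_1)x_j^\pm(v)x_i^\pm(u_2)+x_i^\pm(u_1)x_i^\pm(u_2)x_j^\pm(v)\big)\Big\}=0,$$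 where $(d_{i,j},P^\pm_{i,j})$ is $(\frac12,1)$ if $C_{i,\sigma(i)}=2$; $(\frac1{2M},1)$ if $C_{i,\sigma(i)}=0$, $\sigma(j)\ne j$; $\big(\frac12,\frac{u_1^Mq^{\pm2M}-u_2^M}{u_1q^{\pm2}-u_2}\big)$ if $C_{i,\sigma(i)}=0$, $\sigma(j)=j$; and $(\frac14,u_1q^{\pm1}+u_2)$ if $C_{i,\sigma(i)}=-1$; finally, if $C_{i,\sigma(i)}=-1$, for both $\kappa=1$ and $\kappa=-1$, $$\mathrm{Sym}_{u_1,u_2,u_3}\Big\{\big(q^{3\kappa/2}u_1^{\mp\kappa}-(q^{1/2}+q^{-1/2})u_2^{\mp\kappa}+q^{-3\kappa/2}u_3^{\mp\kappa}\big)x_i^\pm(u_1)x_i^\pm(u_2)x_i^\pm(u_3)\Big\}=0.$$ **Category.** For $\omega\in(\mathbb C^*)^{I_0}$ let $V_\omega^+$ (resp. $V^-_\omega$) be the subspace of a module $V$ on which all $\phi^+_{i,0}$ act by $\omega(i)$ (resp. all $\phi^-_{i,\alpha_i(\mu)}$ act by $\omega(i)^{-1}$). Write $\omega'\le\omega$ if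 $\omega\,\omega'^{-1}$ is a product of elements $\overline{\alpha_j}=(q^{b_{ji}})_{i\in I_0}$, $j\in I_0$. The category $\mathcal O_\mu$ consists of the $\mathcal U_q^\mu(\hat{\mathfrak g}^\sigma)$-modules $V$ with $V=\bigoplus_\omega V_\omega^+=\bigoplus_\omega V_\omega^-$, all $V_\omega^\pm$ finite-dimensional, and such that, for some finite set $F$, each $\omega$ with $V^+_\omega\ne0$ or $V_\omega^-\neq0$ satisfies $\omega\le\omega_0$ for some $\omega_0\in F$. Put $\mathcal O^{sh}=\bigoplus_{\mu\in\Lambda}\mathcal O_\mu$. A module $V\in\mathcal O_\mu$ is of highest $\ell$-weight $\Psi=(\Psi_i)_{i\in I_0}$, where the $\Psi_i\in\mathbb C(z)$ are regular and nonzero at $0$ and $\deg\Psi_i=\alpha_i(\mu)$, if it is generated by a nonzero vector $v$ (a highest $\ell$-weight vector) with $x^+_{i,m}v=0$ and $\phi_i^\pm(z)v=\Psi_i^\pm(z)v$, where $\Psi_i^+,\Psi_i^-$ are the expansions of $\Psi_i$ at $0$ and $\infty$. $L(\Psi)$ denotes the simple such module. The prefundamental representations are the $L(\Psi^\pm_{i,a})$,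 $i\in I_0$, $a\in\mathbb C^*$, where $\Psi^+_{i,a}$ has $i$-th component $1-(az)^{N_i}$ and other components $1$, and $\Psi^-_{i,a}=(\Psi^+_{i,a})^{-1}$. The constant representations are the (one-dimensional) $L(\Psi)$ with all $\Psi_i\in\mathbb C^*$ constant. **Fusion product.** For highest $\ell$-weight modules $V_1\in\mathcal O_{\mu_1}$, $V_2\in\mathcal O_{\mu_2}$ with highest $\ell$-weight vectors $v_1,v_2$, the algebra $\mathcal U_q^{\mu_1+\mu_2}(\hat{\mathfrak g}^\sigma)$ acts on $(V_1\otimes V_2)((u))$ by $$x_i^+(z)\mapsto x_i^+(z)\otimes1+\phi_i^-(z^{-1})\otimes x_i^+(zu^{-1}),\quad x_i^-(z)\mapsto1\otimes x_i^-(zu^{-1})+x_i^-(z)\otimes\phi_i^+(z^{-1}u),\quad\phi_i^\pm(z)\mapsto\phi_i^\pm(z)\otimes\phi_i^\pm(zu).$$ Let $\mathcal A\subset\mathbb C(u)$ be the ring of rational functions regular at $u=1$ and $\widetilde V=(\mathcal A\otimes\mathcal U_q^{\mu_1+\mu_2}(\hat{\mathfrak g}^\sigma))(v_1\otimes v_2)$.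 The fusion product is $V_1*V_2=\widetilde V/(u-1)\widetilde V$, with the class of $v_1\otimes v_2$ as its highest $\ell$-weight vector. Fusion products of several modules are obtained by iteration. **Corollary 5.9.** Every simple module $S$ in $\mathcal O^{sh}$, that is, every simple module $S$ in $\mathcal O_\mu$ for some $\mu\in\Lambda$, is a subquotient of a fusion product $(\cdots((K*V_1)*V_2)\cdots)*V_k\in\mathcal O_\mu$, where $k\ge0$, $K$ is a one-dimensional constant representation and $V_1,\dots,V_k$ are prefundamental representations. (In particular, the actions and modules entering this iterated fusion product exist.) -/

import Mathlib

open scoped TensorProduct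

noncomputable section

/-- The pairs (simple Lie algebra, diagram automorphism of order `M > 1`):
`A n` is `(A_n, 2)` with `n ≥ 2`, `n ≠ 3`; `D n` is `(D_{n+1}, 2)` with `n ≥ 2`;
`D4` is `(D_4, 3)`; `E6` is `(E_6, 2)`. -/
inductive TwistedType : Type
  | A (n : ℕ) (h2 : 2 ≤ n) (h3 : n ≠ 3) : TwistedType
  | D (n : ℕ) (h2 : 2 ≤ n) : TwistedType
  | D4 : TwistedType
  | E6 : TwistedType

namespace TwistedType

/-- The number of vertices of the Dynkin diagram of `𝔤`. -/
abbrev numNodes : TwistedType → ℕ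
  | A n _ _ => n
  | D n _ => n + 1
  | D4 => 4
  | E6 => 6

/-- The vertex set `I` of the Dynkin diagram of `𝔤`; the vertex with the usual label `k` is
`k - 1` here. -/
abbrev Node (X : TwistedType) : Type := Fin X.numNodes

/-- The edges of the Dynkin diagram of `𝔤`, each listed in one direction
(vertices numbered from `0`). -/
def Edge : TwistedType → ℕ → ℕ → Prop
  | A _ _ _, a, b => a + 1 = b
  | D n _, a, b => (a + 1 = b ∧ b < n) ∨ (a + 2 = n ∧ b = n)
  | D4, a, b => (a = 0 ∧ b = 1) ∨ (a = 1 ∧ b = 2) ∨ (a = 1 ∧ b = 3)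
  | E6, a, b => (a = 0 ∧ b = 1) ∨ (a = 1 ∧ b = 2) ∨ (a = 2 ∧ b = 3) ∨ (a = 2 ∧ b = 4) ∨
      (a = 4 ∧ b = 5)

open Classical in
/-- The Cartan matrix `C` of `𝔤`. -/
def cartan (X : TwistedType) (i j : X.Node) : ℤ :=
  if i = j then 2 else if X.Edge i j ∨ X.Edge j i then -1 else 0

/-- The diagram automorphism `σ`. -/
def sigma : (X : TwistedType) → Equiv.Perm X.Node
  | A n _ _ => (Fin.revPerm : Equiv.Perm (Fin n))
  | D n _ => Equiv.swap (⟨n - 1, Nat.lt_succ_of_le (Nat.sub_le n 1)⟩ : Fin (n + 1)) (Fin.last n)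
  | D4 => Equiv.swap (0 : Fin 4) 2 * Equiv.swap (2 : Fin 4) 3
  | E6 => Equiv.swap (0 : Fin 6) 5 * Equiv.swap (1 : Fin 6) 4

/-- The order `M` of `σ`. -/
def M : TwistedType → ℕ
  | A _ _ _ => 2
  | D _ _ => 2
  | D4 => 3
  | E6 => 2

/-- The set `I₀` of representatives of the `σ`-orbits: the smallest vertex of each orbit. -/
abbrev I0 (X : TwistedType) : Type := {i : X.Node // ∀ k < X.M, i ≤ (X.sigma ^ k) i}

/-- `C_{i, σ^s(j)}` for `i, j ∈ I₀`. -/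
def c (X : TwistedType) (i : X.I0) (s : ℕ) (j : X.I0) : ℤ := X.cartan i ((X.sigma ^ s) j)

/-- `∑_{s=1}^M C_{i, σ^s(j)}`; this is the symmetrized Cartan matrix `d_i C^σ_{i,j}` of the
finite type Lie algebra `𝔤^σ`. -/
def symCartan (X : TwistedType) (i j : X.I0) : ℤ := ∑ s ∈ Finset.Icc 1 X.M, X.c i s j

/-- `N_i = M` if `σ(i) = i`, and `N_i = 1` otherwise. -/
def N (X : TwistedType) (i : X.I0) : ℕ := if X.sigma i = i then X.M else 1

/-- The root of unity `ζ = exp(2πi/M)`. -/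
def zeta (X : TwistedType) : ℂ := Complex.exp (2 * Real.pi * Complex.I / X.M)

/-- Twice the number `d_i`, where `d_i = N_i` except that `d_i = 1/2` if `C_{i,σ(i)} = -1`. -/
def twoD (X : TwistedType) (i : X.I0) : ℕ := if X.c i 1 i = -1 then 1 else 2 * X.N i

/-- `q_i = q^{d_i}`, where `t` is the chosen square root of `q`. -/
def qi (X : TwistedType) (t : ℂ) (i : X.I0) : ℂ := t ^ X.twoD i

/-- An element `μ` of the lattice `Λ`: an integral coweight of `𝔤^σ`, given by the integers
`μ i = α_i(μ)`, with `M ∣ α_i(μ)` whenever `σ(i) = i`. -/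
def IsShift (X : TwistedType) (μ : X.I0 → ℤ) : Prop :=
  ∀ i : X.I0, X.sigma i = i → (X.M : ℤ) ∣ μ i

end TwistedType

open TwistedType

/-! ### Shifted twisted quantum affine algebras -/

/-- Names of the generators: `x ε i m` is `x_{i,m}^±`, `phi ε i m` is `φ_{i,m}^±` (with `ε = ±1`
the sign), `h i m` is `h_{i,m}` (the spurious `h_{i,0}` is set to `0` below), and `phiInv ε i`
is the inverse of the leading coefficient of `φ_i^±(z)`. -/
inductive Gen (X : TwistedType) : Type
  | x (ε : ℤˣ) (i : X.I0) (m : ℤ) : Gen X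
  | phi (ε : ℤˣ) (i : X.I0) (m : ℤ) : Gen X
  | h (i : X.I0) (m : ℤ) : Gen X
  | phiInv (ε : ℤˣ) (i : X.I0) : Gen X

/-- The coefficient of `z^k` in `exp (∑_{m ≥ 1} a_m z^m)`, in a possibly noncommutative algebra. -/
def expCoeff {R : Type*} [Ring R] [Algebra ℂ R] (a : ℕ → R) (k : ℕ) : R :=
  ∑ n ∈ Finset.range (k + 1), ((n.factorial : ℂ)⁻¹) •
    PowerSeries.coeff k ((PowerSeries.mk fun m => if m = 0 then 0 else a m) ^ n)

/-- The index of the leading coefficient of `φ_i^ε(z)`: it is `-α_i(μ₊)` for `ε = 1`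
and `α_i(μ₋)` for `ε = -1`. -/
def leadIdx {X : TwistedType} (μp μm : X.I0 → ℤ) (ε : ℤˣ) (i : X.I0) : ℤ :=
  if ε = 1 then -μp i else μm i

/-- `∏_{s=1}^M (1 - ζ^s q^{ε C_{i,σ^s(j)}} T)`: its coefficient at `T^k` is the coefficient at
`u₁^{M-k} u₂^k` of `∏_{s=1}^M (u₁ - ζ^s q^{ε C_{i,σ^s(j)}} u₂)`. -/
def quadL (X : TwistedType) (t : ℂ) (ε : ℤˣ) (i j : X.I0) : Polynomial ℂ :=
  ∏ s ∈ Finset.Icc 1 X.M,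
    (1 - Polynomial.C (X.zeta ^ s * (t ^ 2) ^ ((ε : ℤ) * X.c i s j)) * Polynomial.X)

/-- `∏_{s=1}^M (q^{ε C_{i,σ^s(j)}} - ζ^s T)`: its coefficient at `T^k` is the coefficient at
`u₁^{M-k} u₂^k` of `∏_{s=1}^M (u₁ q^{ε C_{i,σ^s(j)}} - ζ^s u₂)`. -/
def quadR (X : TwistedType) (t : ℂ) (ε : ℤˣ) (i j : X.I0) : Polynomial ℂ :=
  ∏ s ∈ Finset.Icc 1 X.M,
    (Polynomial.C ((t ^ 2) ^ ((ε : ℤ) * X.c i s j)) - Polynomial.C (X.zeta ^ s) * Polynomial.X)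

/-- The polynomials of the Serre relations are `P_{i,j}^ε(u₁,u₂) = ∑_{a=0}^d (q^{ε e} u₁)^a u₂^{d-a}`
for the following pair `(d, e)`. So `P = 1` if `C_{i,σ(i)} = 2`, or if `C_{i,σ(i)} = 0` and
`σ(j) ≠ j`; `P = ((q^{2ε} u₁)^M - u₂^M) / (q^{2ε} u₁ - u₂)` if `C_{i,σ(i)} = 0` and `σ(j) = j`;
`P = q^ε u₁ + u₂` if `C_{i,σ(i)} = -1`. -/
def serreDeg (X : TwistedType) (i j : X.I0) : ℕ × ℤ :=
  if X.c i 1 i = 0 ∧ X.sigma j = j then (X.M - 1, 2)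
  else if X.c i 1 i = -1 then (1, 1)
  else (0, 0)

/-- The exponent `2 M d_{i,j}` of `q` in the Serre relations: `d_{i,j} = 1/(2M)` if
`C_{i,σ(i)} = 0` and `σ(j) ≠ j`, `d_{i,j} = 1/4` if `C_{i,σ(i)} = -1` (where `M = 2`), and
`d_{i,j} = 1/2` in the other cases. -/
def serreExp (X : TwistedType) (i j : X.I0) : ℕ :=
  if X.c i 1 i = -1 then 1
  else if X.c i 1 i = 0 ∧ X.sigma j ≠ j then 1
  else X.M

section Relations

variable (X : TwistedType) (t : ℂ) (μp μm : X.I0 → ℤ)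

/-- The element `x_{i,m}^ε` of the free algebra. -/
abbrev fx (ε : ℤˣ) (i : X.I0) (m : ℤ) : FreeAlgebra ℂ (Gen X) := FreeAlgebra.ι ℂ (Gen.x ε i m)

/-- The element `φ_{i,m}^ε` of the free algebra. -/
abbrev fphi (ε : ℤˣ) (i : X.I0) (m : ℤ) : FreeAlgebra ℂ (Gen X) := FreeAlgebra.ι ℂ (Gen.phi ε i m)

/-- The element `h_{i,m}` of the free algebra. -/
abbrev fh (i : X.I0) (m : ℤ) : FreeAlgebra ℂ (Gen X) := FreeAlgebra.ι ℂ (Gen.h i m)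

/-- The inverse of the leading coefficient of `φ_i^ε(z)`, in the free algebra. -/
abbrev fphiInv (ε : ℤˣ) (i : X.I0) : FreeAlgebra ℂ (Gen X) := FreeAlgebra.ι ℂ (Gen.phiInv ε i)

/-- The coefficient at `u₁^{-r₁} u₂^{-r₂} v^{-l}` of
`P_{i,j}^ε(u₁,u₂) (x_j(v) x_i(u₁) x_i(u₂) - (q^{2Md_{ij}} + q^{-2Md_{ij}}) x_i(u₁) x_j(v) x_i(u₂)
  + x_i(u₁) x_i(u₂) x_j(v))`. -/
def serreTerm (ε : ℤˣ) (i j : X.I0) (r₁ r₂ l : ℤ) : FreeAlgebra ℂ (Gen X) :=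
  ∑ a ∈ Finset.range ((serreDeg X i j).1 + 1),
    ((t ^ 2) ^ ((ε : ℤ) * (serreDeg X i j).2 * a)) •
      (fx X ε j l * fx X ε i (r₁ + a) * fx X ε i (r₂ + ((serreDeg X i j).1 - a : ℕ))
        - ((t ^ 2) ^ serreExp X i j + ((t ^ 2) ^ serreExp X i j)⁻¹) •
          (fx X ε i (r₁ + a) * fx X ε j l * fx X ε i (r₂ + ((serreDeg X i j).1 - a : ℕ)))
        + fx X ε i (r₁ + a) * fx X ε i (r₂ + ((serreDeg X i j).1 - a : ℕ)) * fx X ε j l)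

/-- The coefficient at `u₁^{-r₁} u₂^{-r₂} u₃^{-r₃}` of
`(q^{3κ/2} u₁^{-εκ} - (q^{1/2} + q^{-1/2}) u₂^{-εκ} + q^{-3κ/2} u₃^{-εκ}) x_i(u₁) x_i(u₂) x_i(u₃)`;
the two cubic relations are the cases `κ = 1` and `κ = -1`. -/
def cubicTerm (ε κ : ℤˣ) (i : X.I0) (r : Fin 3 → ℤ) : FreeAlgebra ℂ (Gen X) :=
  t ^ (3 * (κ : ℤ)) • (fx X ε i (r 0 - (ε : ℤ) * κ) * fx X ε i (r 1) * fx X ε i (r 2))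
    - (t + t⁻¹) • (fx X ε i (r 0) * fx X ε i (r 1 - (ε : ℤ) * κ) * fx X ε i (r 2))
    + t ^ (-(3 * (κ : ℤ))) • (fx X ε i (r 0) * fx X ε i (r 1) * fx X ε i (r 2 - (ε : ℤ) * κ))

/-- The defining relations of the shifted twisted quantum affine algebra, coefficientwise.
Here `q = t ^ 2`. -/
inductive ShiftedRel : FreeAlgebra ℂ (Gen X) → FreeAlgebra ℂ (Gen X) → Prop
  | x_zero (ε : ℤˣ) (i : X.I0) (r : ℤ) (hr : ¬ (X.N i : ℤ) ∣ r) : ShiftedRel (fx X ε i r) 0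
  | h_zero (i : X.I0) (m : ℤ) (hm : ¬ (X.N i : ℤ) ∣ m) : ShiftedRel (fh X i m) 0
  | h_spurious (i : X.I0) : ShiftedRel (fh X i 0) 0
  | phi_phi (ε ε' : ℤˣ) (i j : X.I0) (r r' : ℤ) :
      ShiftedRel (fphi X ε i r * fphi X ε' j r') (fphi X ε' j r' * fphi X ε i r)
  | phi_h (ε : ℤˣ) (i j : X.I0) (r m : ℤ) :
      ShiftedRel (fphi X ε i r * fh X j m) (fh X j m * fphi X ε i r)
  | h_h (i j : X.I0) (m m' : ℤ) : ShiftedRel (fh X i m * fh X j m') (fh X j m' * fh X i m)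
  | lead_x (ε δ : ℤˣ) (i j : X.I0) (r : ℤ) :
      ShiftedRel (fphi X ε i (leadIdx μp μm ε i) * fx X δ j r)
        (((t ^ 2) ^ ((ε : ℤ) * δ * X.symCartan i j)) •
          (fx X δ j r * fphi X ε i (leadIdx μp μm ε i)))
  /- `[m C_{i,σ^s(j)} / d_i]_{q_i} = (q^{m C} - q^{-m C}) / (q_i - q_i⁻¹)` -/
  | h_x (δ : ℤˣ) (i j : X.I0) (m r : ℤ) (hm : m ≠ 0) :
      ShiftedRel (fh X i m * fx X δ j r - fx X δ j r * fh X i m)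
        ((((δ : ℤ) : ℂ) / (m : ℂ) * ∑ s ∈ Finset.Icc 1 X.M,
            ((t ^ 2) ^ (m * X.c i s j) - (t ^ 2) ^ (-(m * X.c i s j))) /
              (X.qi t i - (X.qi t i)⁻¹) * X.zeta ^ (m * (s : ℤ))) • fx X δ j (m + r))
  | x_x (i j : X.I0) (r r' : ℤ) :
      ShiftedRel (fx X 1 i r * fx X (-1) j r' - fx X (-1) j r' * fx X 1 i r)
        (((∑ s ∈ Finset.Icc 1 X.M,
            if (X.sigma ^ s) i = j then X.zeta ^ ((s : ℤ) * r') else 0) /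
              (X.N i : ℂ) / (X.qi t i - (X.qi t i)⁻¹)) •
          (fphi X 1 i (r + r') - fphi X (-1) i (r + r')))
  /- The two parts of
  `φ_i^±(z) = z^{∓α_i(μ_±)} φ_{i,∓α_i(μ_±)}^± exp(±(q_i - q_i⁻¹) ∑_{m ≥ 1} h_{i,±m} z^{±m})`. -/
  | phi_exp (ε : ℤˣ) (i : X.I0) (k : ℕ) :
      ShiftedRel (fphi X ε i (leadIdx μp μm ε i + (ε : ℤ) * k))
        (fphi X ε i (leadIdx μp μm ε i) *
          expCoeff (fun m : ℕ =>
            (((ε : ℤ) : ℂ) * (X.qi t i - (X.qi t i)⁻¹)) • fh X i ((ε : ℤ) * m)) k)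
  | phi_zero (ε : ℤˣ) (i : X.I0) (k : ℕ) (hk : 0 < k) :
      ShiftedRel (fphi X ε i (leadIdx μp μm ε i - (ε : ℤ) * k)) 0
  | lead_inv (ε : ℤˣ) (i : X.I0) :
      ShiftedRel (fphi X ε i (leadIdx μp μm ε i) * fphiInv X ε i) 1
  | inv_lead (ε : ℤˣ) (i : X.I0) :
      ShiftedRel (fphiInv X ε i * fphi X ε i (leadIdx μp μm ε i)) 1
  | quad (ε : ℤˣ) (i j : X.I0) (r₁ r₂ : ℤ) :
      ShiftedRel
        (∑ k ∈ Finset.range (X.M + 1), (quadL X t ε i j).coeff k •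
          (fx X ε i (r₁ + (X.M - k : ℕ)) * fx X ε j (r₂ + k)))
        (∑ k ∈ Finset.range (X.M + 1), (quadR X t ε i j).coeff k •
          (fx X ε j (r₂ + k) * fx X ε i (r₁ + (X.M - k : ℕ))))
  | serre (ε : ℤˣ) (i j : X.I0) (r₁ r₂ l : ℤ) (hij : X.cartan i j = -1)
      (hσ : X.sigma i ≠ j) :
      ShiftedRel (serreTerm X t ε i j r₁ r₂ l + serreTerm X t ε i j r₂ r₁ l) 0
  | cubic (ε κ : ℤˣ) (i : X.I0) (r : Fin 3 → ℤ) (hi : X.c i 1 i = -1) :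
      ShiftedRel (∑ π : Equiv.Perm (Fin 3), cubicTerm X t ε κ i (r ∘ π)) 0

/-- The shifted twisted quantum affine algebra `U_q^{μ₊,μ₋}`, where `q = t ^ 2`. -/
abbrev ShiftedAlgebra₂ : Type := RingQuot (ShiftedRel X t μp μm)

end Relations

/-- The shifted twisted quantum affine algebra `U_q^μ = U_q^{0,μ}`, where `q = t ^ 2`. -/
abbrev ShiftedAlgebra (X : TwistedType) (t : ℂ) (μ : X.I0 → ℤ) : Type := ShiftedAlgebra₂ X t 0 μ

/-- The generator `x_{i,m}^ε` of `U_q^μ`. -/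
def genX {X : TwistedType} {t : ℂ} (μ : X.I0 → ℤ) (ε : ℤˣ) (i : X.I0) (m : ℤ) :
    ShiftedAlgebra X t μ :=
  RingQuot.mkAlgHom ℂ (ShiftedRel X t 0 μ) (fx X ε i m)

/-- The generator `φ_{i,m}^ε` of `U_q^μ`. -/
def genPhi {X : TwistedType} {t : ℂ} (μ : X.I0 → ℤ) (ε : ℤˣ) (i : X.I0) (m : ℤ) :
    ShiftedAlgebra X t μ :=
  RingQuot.mkAlgHom ℂ (ShiftedRel X t 0 μ) (fphi X ε i m)

/-! ### The category `𝒪_μ` -/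

/-- `t^* = (ℂ^*)^{I₀}`. -/
abbrev Weight (X : TwistedType) : Type := X.I0 → ℂˣ

/-- `WeightLE ω' ω` means `ω' ≤ ω`: the quotient `ω ω'⁻¹` is a product of elements `\bar α_j`,
where `\bar α_j(i) = q^{d_j C^σ_{j,i}}`. -/
def WeightLE {X : TwistedType} (t : ℂ) (ω' ω : Weight X) : Prop :=
  ∃ n : X.I0 → ℕ, ∀ i, (ω i : ℂ) = ω' i * ∏ j, ((t ^ 2) ^ X.symCartan j i) ^ n j

section Modules

variable (X : TwistedType) (t : ℂ) (μ : X.I0 → ℤ)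
variable (V : Type*) [AddCommGroup V] [Module ℂ V] [Module (ShiftedAlgebra X t μ) V]
  [IsScalarTower ℂ (ShiftedAlgebra X t μ) V]

/-- `V_ω^+`, the simultaneous eigenspace of the `φ_{i,0}^+` with eigenvalues `ω(i)`. -/
def weightSpacePlus (ω : Weight X) : Submodule ℂ V :=
  ⨅ i, Module.End.eigenspace
    (Algebra.lsmul ℂ ℂ V (genPhi μ 1 i 0 : ShiftedAlgebra X t μ)) (ω i : ℂ)

/-- `V_ω^-`, the simultaneous eigenspace of the `φ_{i,α_i(μ)}^-` with eigenvalues `ω(i)⁻¹`. -/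
def weightSpaceMinus (ω : Weight X) : Submodule ℂ V :=
  ⨅ i, Module.End.eigenspace
    (Algebra.lsmul ℂ ℂ V (genPhi μ (-1) i (μ i) : ShiftedAlgebra X t μ)) (ω i : ℂ)⁻¹

open Classical in
/-- `V` is an object of the category `𝒪_μ`. -/
structure InCategoryO : Prop where
  decompPlus : DirectSum.IsInternal (weightSpacePlus X t μ V)
  decompMinus : DirectSum.IsInternal (weightSpaceMinus X t μ V)
  finitePlus : ∀ ω, FiniteDimensional ℂ (weightSpacePlus X t μ V ω)
  finiteMinus : ∀ ω, FiniteDimensional ℂ (weightSpaceMinus X t μ V ω)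
  bounded : ∃ F : Finset (Weight X), ∀ ω,
    (weightSpacePlus X t μ V ω ≠ ⊥ ∨ weightSpaceMinus X t μ V ω ≠ ⊥) →
      ∃ ω₀ ∈ F, WeightLE t ω ω₀

end Modules

/-! ### Rational `ℓ`-weights and highest `ℓ`-weight modules -/

/-- The coefficient at `z^m` of the expansion of a rational function at `z = 0`. -/
def expandZero (f : RatFunc ℂ) (m : ℤ) : ℂ := (f : LaurentSeries ℂ).coeff m

/-- The coefficient at `z^m` of the expansion of a rational function at `z = ∞`, that is,
the coefficient at `w^{-m}` of the expansion of `f(1/w)` at `w = 0`. -/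
def expandInfty (f : RatFunc ℂ) (m : ℤ) : ℂ :=
  ((RatFunc.eval (RatFunc.C : ℂ →+* RatFunc ℂ) (RatFunc.X : RatFunc ℂ)⁻¹ f : RatFunc ℂ) :
    LaurentSeries ℂ).coeff (-m)

/-- `Ψ ∈ 𝔯_μ`: each `Ψ_i` is regular and nonzero at `0`, and has degree `α_i(μ)`. -/
def IsRationalWeight {X : TwistedType} (μ : X.I0 → ℤ) (Ψ : X.I0 → RatFunc ℂ) : Prop :=
  ∀ i, (Ψ i).denom.eval 0 ≠ 0 ∧ (Ψ i).num.eval 0 ≠ 0 ∧ (Ψ i).intDegree = μ i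

/-- A `U_q^μ`-module together with a vector. -/
structure PtMod (X : TwistedType) (t : ℂ) (μ : X.I0 → ℤ) where
  carrier : Type
  [addCommGroup : AddCommGroup carrier]
  [moduleC : Module ℂ carrier]
  [moduleU : Module (ShiftedAlgebra X t μ) carrier]
  [tower : IsScalarTower ℂ (ShiftedAlgebra X t μ) carrier]
  vec : carrier

attribute [instance] PtMod.addCommGroup PtMod.moduleC PtMod.moduleU PtMod.tower

section Highest

variable {X : TwistedType} {t : ℂ} {μ : X.I0 → ℤ}

/-- `V` is a highest `ℓ`-weight module of highest `ℓ`-weight `Ψ ∈ 𝔯_μ` in `𝒪_μ`, and its vector is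
a highest `ℓ`-weight vector. -/
structure IsHighest (V : PtMod X t μ) (Ψ : X.I0 → RatFunc ℂ) : Prop where
  inO : InCategoryO X t μ V.carrier
  rational : IsRationalWeight μ Ψ
  ne_zero : V.vec ≠ 0
  generates : Submodule.span (ShiftedAlgebra X t μ) {V.vec} = ⊤
  raise : ∀ i m, (genX μ 1 i m : ShiftedAlgebra X t μ) • V.vec = 0
  phiPlus : ∀ i m, (genPhi μ 1 i m : ShiftedAlgebra X t μ) • V.vec = expandZero (Ψ i) m • V.vec
  phiMinus : ∀ i m,
    (genPhi μ (-1) i m : ShiftedAlgebra X t μ) • V.vec = expandInfty (Ψ i) m • V.vec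

/-- `V` is (isomorphic to) the simple highest `ℓ`-weight module `L(Ψ)`. -/
def IsL (V : PtMod X t μ) (Ψ : X.I0 → RatFunc ℂ) : Prop :=
  IsHighest V Ψ ∧ IsSimpleModule (ShiftedAlgebra X t μ) V.carrier

end Highest

open Classical in
/-- `Ψ_{i,a}^+`: its `i`-th component is `1 - (az)^{N_i}`, the other components are `1`.
The `ℓ`-weight `Ψ_{i,a}^-` is its inverse. -/
def prefWeight (X : TwistedType) (i : X.I0) (a : ℂˣ) : X.I0 → RatFunc ℂ :=
  fun j => if j = i then 1 - (RatFunc.C (a : ℂ) * RatFunc.X) ^ X.N i else 1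

/-- `V` is a positive or negative prefundamental representation. -/
def IsPrefundamental {X : TwistedType} {t : ℂ} {μ : X.I0 → ℤ} (V : PtMod X t μ) : Prop :=
  ∃ (i : X.I0) (a : ℂˣ), IsL V (prefWeight X i a) ∨ IsL V (prefWeight X i a)⁻¹

/-- `V` is a (one-dimensional) constant representation: `V = L(Ψ)` with all `Ψ_i(z)` constant. -/
def IsConstantRep {X : TwistedType} {t : ℂ} {μ : X.I0 → ℤ} (V : PtMod X t μ) : Prop :=
  (∃ γ : X.I0 → ℂˣ, IsL V fun i => RatFunc.C (γ i : ℂ)) ∧ Module.finrank ℂ V.carrier = 1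

/-! ### The deformed Drinfeld coproduct and the fusion product -/

section Coproduct

variable {X : TwistedType} (t : ℂ) (μ₁ μ₂ : X.I0 → ℤ)

/-- The coefficient at `u^k` of `Δ_u(x_{i,m}^+)`, read off from
`Δ_u(x_i^+(z)) = x_i^+(z) ⊗ 1 + φ_i^-(z⁻¹) ⊗ x_i^+(z u⁻¹)`, where
`x_i^±(z) = ∑ x_{i,m}^± z^{-m}` and `φ_i^±(z) = ∑ φ_{i,m}^± z^m`. -/
def deltaXPlus (i : X.I0) (m k : ℤ) : ShiftedAlgebra X t μ₁ ⊗[ℂ] ShiftedAlgebra X t μ₂ :=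
  (if k = 0 then genX μ₁ 1 i m ⊗ₜ 1 else 0) + genPhi μ₁ (-1) i (m - k) ⊗ₜ genX μ₂ 1 i k

/-- The coefficient at `u^k` of `Δ_u(x_{i,m}^-)`, read off from
`Δ_u(x_i^-(z)) = 1 ⊗ x_i^-(z u⁻¹) + x_i^-(z) ⊗ φ_i^+(z⁻¹ u)`. -/
def deltaXMinus (i : X.I0) (m k : ℤ) : ShiftedAlgebra X t μ₁ ⊗[ℂ] ShiftedAlgebra X t μ₂ :=
  (if k = m then 1 ⊗ₜ genX μ₂ (-1) i m else 0) + genX μ₁ (-1) i (m - k) ⊗ₜ genPhi μ₂ 1 i k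

/-- The coefficient at `u^k` of `Δ_u(φ_{i,m}^ε)`, read off from
`Δ_u(φ_i^±(z)) = φ_i^±(z) ⊗ φ_i^±(z u)`. -/
def deltaPhi (ε : ℤˣ) (i : X.I0) (m k : ℤ) :
    ShiftedAlgebra X t μ₁ ⊗[ℂ] ShiftedAlgebra X t μ₂ :=
  genPhi μ₁ ε i (m - k) ⊗ₜ genPhi μ₂ ε i k

end Coproduct

section Fusion

variable {X : TwistedType} {t : ℂ} {μ₁ μ₂ : X.I0 → ℤ} (V₁ : PtMod X t μ₁) (V₂ : PtMod X t μ₂)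

/-- The action of `U_q^{μ₁} ⊗ U_q^{μ₂}` on `V₁ ⊗ V₂`. -/
def tensorAct : ShiftedAlgebra X t μ₁ ⊗[ℂ] ShiftedAlgebra X t μ₂ →ₐ[ℂ]
    Module.End ℂ (V₁.carrier ⊗[ℂ] V₂.carrier) :=
  (Module.endTensorEndAlgHom (R := ℂ) (S := ℂ) (A := ℂ)).comp
    (Algebra.TensorProduct.map (Algebra.lsmul ℂ ℂ V₁.carrier) (Algebra.lsmul ℂ ℂ V₂.carrier))

/-- `(V₁ ⊗ V₂)((u))`, as a module over `ℂ((u))`. -/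
abbrev TensorLaurent : Type := HahnModule ℤ ℂ (V₁.carrier ⊗[ℂ] V₂.carrier)

variable {V₁ V₂}

/-- The coefficient at `u^n` of an element of `(V₁ ⊗ V₂)((u))`. -/
def lcoeff (f : TensorLaurent V₁ V₂) (n : ℤ) : V₁.carrier ⊗[ℂ] V₂.carrier :=
  ((HahnModule.of ℂ).symm f).coeff n

variable (V₁ V₂)

/-- `g = T f` in `(V₁ ⊗ V₂)((u))`, where `T = ∑_k T_k u^k` is a Laurent series with coefficients
in `U_q^{μ₁} ⊗ U_q^{μ₂}`. In every use the sum is finite, since `T_k` acts by `0` for `k ≪ 0`. -/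
def IsLaurentImage (T : ℤ → ShiftedAlgebra X t μ₁ ⊗[ℂ] ShiftedAlgebra X t μ₂)
    (f g : TensorLaurent V₁ V₂) : Prop :=
  ∀ n, {k | tensorAct V₁ V₂ (T k) (lcoeff f (n - k)) ≠ 0}.Finite ∧
    lcoeff g n = ∑ᶠ k, tensorAct V₁ V₂ (T k) (lcoeff f (n - k))

/-- `ρ` is the `U_q^{μ}`-module structure on `(V₁ ⊗ V₂)((u))` defined by `Δ_u`, `μ = μ₁ + μ₂`. -/
structure IsDeformedAction (μ : X.I0 → ℤ)
    (ρ : ShiftedAlgebra X t μ →ₐ[ℂ] Module.End ℂ (TensorLaurent V₁ V₂)) : Prop where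
  xPlus : ∀ i m f, IsLaurentImage V₁ V₂ (deltaXPlus t μ₁ μ₂ i m) f (ρ (genX μ 1 i m) f)
  xMinus : ∀ i m f, IsLaurentImage V₁ V₂ (deltaXMinus t μ₁ μ₂ i m) f (ρ (genX μ (-1) i m) f)
  phi : ∀ ε i m f, IsLaurentImage V₁ V₂ (deltaPhi t μ₁ μ₂ ε i m) f (ρ (genPhi μ ε i m) f)

/-- The element `v₁ ⊗ v₂` of `(V₁ ⊗ V₂)((u))`. -/
def topVec : TensorLaurent V₁ V₂ := HahnModule.of ℂ (HahnSeries.single 0 (V₁.vec ⊗ₜ[ℂ] V₂.vec))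

/-- `(𝒜 ⊗ U_q^{μ})(v₁ ⊗ v₂)`, where `𝒜 ⊆ ℂ(u)` is the ring of rational functions
regular at `u = 1`, embedded into `ℂ((u))` by expansion at `u = 0`. -/
def fusionLattice {μ : X.I0 → ℤ}
    (ρ : ShiftedAlgebra X t μ →ₐ[ℂ] Module.End ℂ (TensorLaurent V₁ V₂)) :
    Submodule ℂ (TensorLaurent V₁ V₂) :=
  Submodule.span ℂ {w | ∃ (f : RatFunc ℂ) (a : ShiftedAlgebra X t μ), f.denom.eval 1 ≠ 0 ∧
    w = (f : LaurentSeries ℂ) • ρ a (topVec V₁ V₂)}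

/-- `W` is the fusion product `V₁ * V₂` of the highest `ℓ`-weight modules `V₁`, `V₂` (with highest
`ℓ`-weight vectors `v₁`, `v₂`): it is the quotient of `Ṽ = (𝒜 ⊗ U_q^{μ₁+μ₂})(v₁ ⊗ v₂)` by
`(u - 1) Ṽ`, with the class of `v₁ ⊗ v₂` as its distinguished vector. The quotient map is `p`. -/
def IsFusionProduct {μ : X.I0 → ℤ} (W : PtMod X t μ) : Prop :=
  (∃ Ψ, IsHighest V₁ Ψ) ∧ (∃ Ψ, IsHighest V₂ Ψ) ∧ μ = μ₁ + μ₂ ∧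
  ∃ ρ : ShiftedAlgebra X t μ →ₐ[ℂ] Module.End ℂ (TensorLaurent V₁ V₂),
    IsDeformedAction V₁ V₂ μ ρ ∧
    ∃ p : fusionLattice V₁ V₂ ρ →ₗ[ℂ] W.carrier,
      Function.Surjective p ∧
      (∀ w, p w = 0 ↔ ∃ w' : fusionLattice V₁ V₂ ρ,
        (w : TensorLaurent V₁ V₂) =
          ((RatFunc.X - 1 : RatFunc ℂ) : LaurentSeries ℂ) • (w' : TensorLaurent V₁ V₂)) ∧
      (∀ (a : ShiftedAlgebra X t μ) (w w' : fusionLattice V₁ V₂ ρ),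
        (w' : TensorLaurent V₁ V₂) = ρ a w → p w' = a • p w) ∧
      (∀ w : fusionLattice V₁ V₂ ρ, (w : TensorLaurent V₁ V₂) = topVec V₁ V₂ → p w = W.vec)

end Fusion

/-- `W` is the iterated fusion product `(⋯((K * V₁) * V₂) ⋯) * V_k` for the list `[V₁, …, V_k]`. -/
inductive IsIteratedFusion {X : TwistedType} {t : ℂ} {κ : X.I0 → ℤ} (K : PtMod X t κ) :
    List (Σ ν : X.I0 → ℤ, PtMod X t ν) → ∀ {μ : X.I0 → ℤ}, PtMod X t μ → Prop
  | nil : IsIteratedFusion K [] K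
  | snoc {L : List (Σ ν : X.I0 → ℤ, PtMod X t ν)} {μ ν μ' : X.I0 → ℤ}
      {W : PtMod X t μ} {V : PtMod X t ν} {W' : PtMod X t μ'} :
      IsIteratedFusion K L W → IsFusionProduct W V W' → IsIteratedFusion K (L ++ [⟨ν, V⟩]) W'

/-- `S` is isomorphic to a subquotient `N / N'` of the module `W`. -/
def IsSubquotientOf (R S W : Type*) [Ring R] [AddCommGroup S] [Module R S] [AddCommGroup W]
    [Module R W] : Prop :=
  ∃ N' N : Submodule R W, N' ≤ N ∧ Nonempty (S ≃ₗ[R] N ⧸ N'.submoduleOf N)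

end

open scoped TensorProduct AddMonoidAlgebra
noncomputable section

open AddMonoidAlgebra (mapDomainAlgHom single_pow mapDomain_single induction_linear mapDomainAlgHom_apply)
open AddMonoidHom (snd fst coe_snd coe_fst)
open Algebra (lsmul smul_def)
open Algebra.TensorProduct (one_def tmul_mul_tmul)
open DistribSMul (toLinearMap)
open Equiv (Perm)
open Equiv.Perm (coe_one coe_mul)
open Fin (val_rev le_def revPerm_apply)
open Finset (sum_congr Icc range mem_Icc sum_eq_zero mem_range smul_sum sum_insert univ mul_sum prod_congr
  prod_insert sum_add_distrib sum_singleton prod_mul_distrib sum_nbij' mem_univ sum_empty uIcc sum_eq_single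
  sum_comm mem_filter sum_mul sum_sigma' mem_singleton add_sum_erase sum_range_succ sum_sub_distrib sum_smul
  sum_image prod_pair mem_vaddAntidiagonal sum_pair mem_image mem_insert mem_map)
open Finset.HasAntidiagonal (antidiagonal mem_antidiagonal)
open Finset.Nat (antidiagonal_zero)
open Finsupp (linearCombination_single lsingle_apply linearCombination)
open FreeAlgebra (lift_ι_apply)
open HahnSeries (coeff_single_of_ne coeff_single_mul coeff_add coeff_smul coeff_sum coeff_sub coeff_mul_single
  single_mul_single coeff_single_same C_apply coeff_one coeff_single coeff_order_eq_zero order_mul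
  coeff_eq_zero_of_lt_order single)
open Ideal.Quotient (mkₐ)
open Int (units_eq_one_or units_mul_self natCast_dvd_natCast)
open LinearEquiv (ofInjective)
open LinearMap (mem_ker ker comp_apply mulLeft mulRight restrict_apply compRight inr lcomp coe_mk applyₗ eqLocus
  ker_eq_bot mem_eqLocus mulLeft_apply)
open LinearMap renaming sum_apply -> sumL, zero_apply -> zeroL, smul_apply -> smulL, add_apply -> addL,
  sub_apply -> subL, congr_fun -> congrL, ext -> extL
open List (map_map)
open Matrix (cons_val)
open Module (finrank compHom End)
open Module.End (mul_apply eigenspace mem_eigenspace_iff)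
open Module.Finite (iff_fg)
open Nat (strong_induction_on)
open Polynomial (expand aeval sum_def eval_mul eval_eq_zero_of_dvd_of_eval_eq_zero sum_over_range monic_one
  sum_over_range' aeval_algHom_apply eval₂_X eval₂_C monic_prod_of_monic revAt_le expand_X expand_C eval_sub
  eval_one leadingCoeff_ne_zero eval_zero aeval_def coeff_C_mul eval₂RingHom coeff_reverse dvd_iff_isRoot
  natDegree_mul_X eval)
open PowerSeries (coeff_mk coeff_mul coeff_C coeff_map coeff_succ_mul_X coe_C coeff C)
open RatFunc (algebraMap_X algebraMap_C denom_ne_zero num_div_denom X_ne_zero coe_X algebraMap_eq_C num_zero)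
open RingQuot (mkAlgHom)
open Set (mem_ofPred_eq)
open SetLike (mem_coe)
open Submodule (smul_mem mem_span_singleton mem_comap mem_iSup_of_mem mem_top mem_iInf mem_span_singleton_self
  mem_sup_right span_le subset_span map₂ span_singleton_le_iff_mem mem_sup_left linearMap_qext ne_bot_iff
  smul_mem_iff span_induction mkQ_surjective map₂_le apply_mem_map₂ mem_sup mkQ_apply finiteDimensional_of_le span)
open Submodule.FG (sup)
open Submodule.Quotient (mk_eq_zero mk_sub)
open TensorProduct (map_tmul tmul_zero zero_tmul tmul_smul smul_tmul' equivFinsuppOfBasisLeft ext' tmul_sum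
  tmul_sub sum_tmul sub_tmul map_comp)
open Units (val_one val_mul val_neg mk0 val_mk0)

local notation "mdC" => mapDomainAlgHom ℂ ℂ
local notation "LS" => LaurentSeries ℂ
local notation "SA" => ShiftedAlgebra
local notation "HM" => HahnModule ℤ ℂ
local notation "hof" => HahnModule.of ℂ
local notation "RF" => RatFunc ℂ
local notation "Rx" => RatFunc.X
local notation "RC" => RatFunc.C
local notation "pmk" => PowerSeries.mk
local notation "PX" => PowerSeries.X
local notation "ACG" => AddCommGroup
local notation "aM" => algebraMap
local notation "pC" => Polynomial.C
local notation "pX" => Polynomial.X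
local notation "tmap" => TensorProduct.map

variable {X : TwistedType} {t : ℂ} {O O1 O2 : X.I0 → ℤ}

local notation "ℓ" => leadIdx 0

section

abbrev Generic (t : ℂ) : Prop := ∀ n, 0 < n -> (t ^ 2) ^ n ≠ 1

namespace TwistedType

variable (X)

lemma M_cases : X.M = 2 ∨ X.M = 3 := by cases X <;> simp [M]

lemma M_pos : 0 < X.M := by rcases X.M_cases with h | h <;> omega

lemma zeta_primitive : IsPrimitiveRoot X.zeta X.M := Complex.isPrimitiveRoot_exp _ X.M_pos.ne'

lemma zeta_pow_M : X.zeta ^ X.M = 1 := X.zeta_primitive.pow_eq_one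

lemma zeta_ne : X.zeta ≠ 0 := X.zeta_primitive.ne_zero X.M_pos.ne'

lemma sigpow_M : X.sigma ^ X.M = 1 := by
  cases X with
  | A n h2 h3 =>
    ext i; simp [sigma, M, pow_two]
  | D n h2 => simp [sigma, M, pow_two]
  | D4 => simp only [sigma, M]; decide
  | E6 => simp only [sigma, M]; decide

def Adj (i j : X.Node) : Prop := X.Edge i j ∨ X.Edge j i

lemma adj_symm {i j : X.Node} (h : X.Adj i j) : X.Adj j i := Or.symm h

lemma adj_ne {i j : X.Node} (h : X.Adj i j) : i ≠ j := by rintro rfl; rcases i with ⟨i, hi⟩; cases X <;> simp [Adj, Edge] at h <;> omega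

lemma adj_sigma_aux {i j : X.Node} (h : X.Edge i j) : X.Adj (X.sigma i) (X.sigma j) := by
  cases X with
  | A n h2 h3 =>
    simp only [Adj, Edge, sigma, revPerm_apply, val_rev] at h ⊢; omega
  | D n h2 =>
    rcases i with ⟨i, hi⟩; rcases j with ⟨j, hj⟩; simp only [numNodes] at hi hj
    simp only [Adj, Edge, sigma, Equiv.swap_apply_def, Fin.last, Fin.mk.injEq] at h ⊢; split_ifs <;> simp <;> omega
  | D4 =>
    revert h; simp only [Adj, Edge, sigma]; revert i j; decide
  | E6 =>
    revert h; simp only [Adj, Edge, sigma]; revert i j; decide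

lemma adj_sigma {i j : X.Node} (h : X.Adj i j) : X.Adj (X.sigma i) (X.sigma j) := by
  rcases h with h | h
  . exact X.adj_sigma_aux h
  . exact X.adj_symm (X.adj_sigma_aux h)

lemma adj_sigpow {i j : X.Node} (h : X.Adj i j) (k) :
    X.Adj ((X.sigma ^ k) i) ((X.sigma ^ k) j) := by
  induction k with
  | zero => simpa using h
  | succ k ih => simpa [pow_succ', Equiv.Perm.mul_apply] using X.adj_sigma ih

lemma sigpow_M_sub {s} (hs : s ≤ X.M) (i : X.Node) :
    (X.sigma ^ (X.M - s)) ((X.sigma ^ s) i) = i := by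
  rw [<-Equiv.Perm.mul_apply, <-pow_add, Nat.sub_add_cancel hs, sigpow_M]; rfl

lemma sigpow_sub_M {s} (hs : s ≤ X.M) (i : X.Node) :
    (X.sigma ^ s) ((X.sigma ^ (X.M - s)) i) = i := by
  rw [<-Equiv.Perm.mul_apply, <-pow_add, Nat.add_sub_cancel' hs, sigpow_M]; rfl

lemma adj_sigma_iff {i j : X.Node} : X.Adj (X.sigma i) (X.sigma j) ↔ X.Adj i j := by
  refine ⟨fun h => ?_, X.adj_sigma⟩; have h' := X.adj_sigpow h (X.M - 1)
  have e : ∀ k, (X.sigma ^ (X.M - 1)) (X.sigma k) = k := fun k => by simpa using X.sigpow_M_sub (s := 1) X.M_pos k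
  rwa [e, e] at h'

open Classical in
lemma cartan_eq (i j : X.Node) :
    X.cartan i j = if i = j then 2 else if X.Adj i j then -1 else 0 := by
  unfold cartan Adj; split_ifs <;> rfl

lemma car_symm (i j : X.Node) : X.cartan i j = X.cartan j i := by
  classical
  have : X.Adj i j ↔ X.Adj j i := ⟨X.adj_symm, X.adj_symm⟩; simp only [cartan_eq, this, eq_comm]

lemma car_sigma (i j : X.Node) : X.cartan (X.sigma i) (X.sigma j) = X.cartan i j := by
  classical
  simp only [cartan_eq, X.adj_sigma_iff, EmbeddingLike.apply_eq_iff_eq]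

lemma car_sigpow (k) (i j : X.Node) :
    X.cartan ((X.sigma ^ k) i) ((X.sigma ^ k) j) = X.cartan i j := by
  induction k with
  | zero => simp
  | succ k ih => rw [pow_succ', Equiv.Perm.mul_apply, Equiv.Perm.mul_apply, car_sigma, ih]

lemma car_self (i : X.Node) : X.cartan i i = 2 := by simp [cartan]

lemma car_eq_n_one {i j : X.Node} : X.cartan i j = -1 ↔ X.Adj i j := by
  classical
  rw [cartan_eq]; split_ifs with h1 h2
  . subst h1; simpa using fun h => X.adj_ne h rfl
  . simpa using h2
  . simpa using h2

lemma c_reflect {s} (hs : s ≤ X.M) (i j) : X.c i (X.M - s) j = X.c j s i := by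
  unfold c; rw [X.car_symm j.1, <-X.car_sigpow s i.1, X.sigpow_sub_M hs]

lemma c_M (i j) : X.c i X.M j = X.cartan i j := by simp [c, sigpow_M]

lemma symCartan_symm (i j) : X.symCartan i j = X.symCartan j i := by
  unfold symCartan; have h1 := X.c_M i j; have h2 := X.c_M j i; have h3 := X.car_symm i j; rcases X.M_cases with h | h
  . have := X.c_reflect (s := 1) (by omega) i j; simp only [h] at *; simp [Finset.sum_Icc_succ_top, this, h1, h2, h3]
  . have e1 := X.c_reflect (s := 1) (by omega) i j; have e2 := X.c_reflect (s := 2) (by omega) i j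
    simp only [h] at *; norm_num at e1 e2; simp [Finset.sum_Icc_succ_top, e1, e2, h1, h2, h3]; ring

lemma sigpow_fixed {i : X.Node} (hi : X.sigma i = i) (s) : (X.sigma ^ s) i = i := by
  induction s with
  | zero => simp
  | succ s ih => rw [pow_succ', Equiv.Perm.mul_apply, ih, hi]

lemma c_of_fixed_r {i j : X.I0} (hj : X.sigma j = j) (s : ℕ) : X.c i s j = X.cartan i j := by unfold c; rw [X.sigpow_fixed hj]

lemma c_of_fixed_l {i j : X.I0} (hi : X.sigma i = i) (s : ℕ) : X.c i s j = X.cartan i j := by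
  unfold c; conv_lhs => rw [<-X.sigpow_fixed hi s]
  rw [car_sigpow]

lemma car_nondegenerate (y : X.Node -> ℤ) (h : ∀ i, ∑ k, X.cartan i k * y k = 0) : y = 0 := by
  classical
  let Y : ℕ -> ℤ := fun k => if hk : k < X.numNodes then y ⟨k, hk⟩ else 0
  have hY : ∀ k, X.numNodes ≤ k -> Y k = 0 := fun k hk => dif_neg (by omega)
  have hy : ∀ k : X.Node, y k = Y k := fun k => by simp [Y]
  have row : ∀ i hi (u : Finset ℕ), (∀ k hk, X.Adj ⟨i, hi⟩ ⟨k, hk⟩ ↔ k ∈ u) -> ∑ k ∈ u, Y k = 2 * Y i := by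
    intro i hi u hu
    have e : ∀ k : X.Node, X.cartan ⟨i, hi⟩ k * y k = (if ⟨i, hi⟩ = k then 2 * Y k else 0) - if (k : ℕ) ∈ u then Y k else 0 := fun k => by
      rw [cartan_eq, hu, hy]; split_ifs with h1 h2
      . exact (X.adj_ne ((hu _ _).mpr h2) h1).elim
      all_goals ring
    have h := h ⟨i, hi⟩
    rw [sum_congr rfl fun k _ => e k, sum_sub_distrib, Finset.sum_ite_eq, if_pos (mem_univ _),
      Fin.sum_univ_eq_sum_range fun k => if k ∈ u then Y k else 0, Finset.sum_ite_mem,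
      Finset.sum_subset Finset.inter_subset_right fun k hk hk' => hY k (by simp_all)] at h
    linarith
  suffices H : ∀ k, k < X.numNodes -> Y k = 0 by ext k; rw [hy, H k k.2]; rfl
  clear_value Y; clear hy h
  have chain : ∀ m, m < X.numNodes -> (∀ i hi, i < m -> ∀ k hk, X.Adj ⟨i, hi⟩ ⟨k, hk⟩ ↔ k = i + 1 ∨ k + 1 = i) ->
      ∀ k ≤ m, Y k = (k + 1) * Y 0 := by
    intro m hm H k; induction k using Nat.strong_induction_on with
    | _ k ih =>
      intro hk; rcases k with _ | _ | k
      . simp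
      . have := row 0 (by omega) {1} fun k hk => by rw [H 0 _ (by omega)]; simp
        simp at this; push_cast; linarith
      . have := row (k + 1) (by omega) {k, k + 2} fun j hj => by rw [H _ _ (by omega)]; simp; omega
        rw [sum_pair (by omega), ih _ (by omega) (by omega), ih (k + 1) (by omega) (by omega)] at this; push_cast at this ⊢; linarith
  cases X with
  | A n h2 h3 =>
    simp only [numNodes, Adj, Edge] at *; have c := chain (n - 1) (by omega) fun i hi him k hk => by omega
    have e := row (n - 1) (by omega) {n - 2} fun k hk => by simp; omega
    rw [sum_singleton, c _ (by omega), c _ le_rfl] at e; obtain ⟨m, rfl⟩ : ∃ m, n = m + 2 := ⟨n - 2, by omega⟩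
    have : Y 0 = 0 := by
      have : (m + 3 : ℤ) * Y 0 = 0 := by simp at e; linarith
      exact (mul_eq_zero.mp this).resolve_left (by omega)
    exact fun k hk => by rw [c k (by omega), this, mul_zero]
  | D n h2 =>
    simp only [numNodes, Adj, Edge] at *; obtain ⟨m, rfl⟩ : ∃ m, n = m + 2 := ⟨n - 2, by omega⟩
    have c := chain m (by omega) fun i hi him k hk => by omega
    have e1 := row (m + 1) (by omega) {m} fun k hk => by simp; omega
    have e2 := row (m + 2) (by omega) {m} fun k hk => by simp; omega
    rw [sum_singleton] at e1 e2
    have : Y 0 = 0 := by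
      rcases m with _ | m
      . have := row 0 (by omega) {1, 2} fun k hk => by simp; omega
        simp at this e1 e2; omega
      . have := row (m + 1) (by omega) {m, m + 2, m + 3} fun k hk => by simp; omega
        rw [sum_insert (by simp), sum_pair (by omega), c m (by omega)] at this
        rw [c (m + 1) le_rfl] at this e1 e2; push_cast at this e1 e2; linarith
    rw [c m le_rfl, this, mul_zero] at e1 e2; intro k hk; by_cases hm : k ≤ m
    . rw [c k hm, this, mul_zero]
    . obtain rfl | rfl : k = m + 1 ∨ k = m + 2 := by omega
      all_goals omega
  | D4 =>
    simp only [numNodes, Adj, Edge] at *; have h0 := row 0 (by omega) {1} fun k hk => by simp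
    have h1 := row 1 (by omega) {0, 2, 3} fun k hk => by simp; omega
    have h2 := row 2 (by omega) {1} fun k hk => by simp
    have h3 := row 3 (by omega) {1} fun k hk => by simp
    simp at h0 h1 h2 h3; intro k hk; interval_cases k <;> omega
  | E6 =>
    simp only [numNodes, Adj, Edge] at *; have h0 := row 0 (by omega) {1} fun k hk => by simp
    have h1 := row 1 (by omega) {0, 2} fun k hk => by simp; omega
    have h2 := row 2 (by omega) {1, 3, 4} fun k hk => by simp; omega
    have h3 := row 3 (by omega) {2} fun k hk => by simp
    have h4 := row 4 (by omega) {2, 5} fun k hk => by simp; omega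
    have h5 := row 5 (by omega) {4} fun k hk => by simp
    simp at h0 h1 h2 h3 h4 h5; intro k hk; interval_cases k <;> omega

lemma ex_pow_in_I0 (k : X.Node) : ∃ (i : X.I0) (r : ℕ), r < X.M ∧ (X.sigma ^ r) i.1 = k := by
  classical
  obtain ⟨r, hr, hmin⟩ := Finset.exists_min_image (range X.M) (fun r => (X.sigma ^ r) k)
    ⟨0, Finset.mem_range.mpr X.M_pos⟩
  rw [mem_range] at hr; refine ⟨⟨(X.sigma ^ r) k, fun s hs => ?_⟩, if r = 0 then 0 else X.M - r, ?_, ?_⟩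
  . rw [<-Equiv.Perm.mul_apply, <-pow_add]; by_cases h : s + r < X.M
    . exact hmin _ (Finset.mem_range.mpr h)
    . have e : s + r = (s + r - X.M) + X.M := by omega
      rw [e, pow_add, sigpow_M, mul_one]; exact hmin _ (Finset.mem_range.mpr (by omega))
  . have := X.M_pos; split_ifs <;> omega
  . split_ifs with h
    . subst h; simp
    . exact X.sigpow_M_sub hr.le k

lemma I0_eq_of_pow {i j : X.I0} {s : ℕ} (hs : s ≤ X.M) (h : (X.sigma ^ s) i.1 = j.1) : i = j := by
  have hM := X.M_pos
  have key : ∀ (i j : X.I0) s, s ≤ X.M -> (X.sigma ^ s) i.1 = j.1 -> i.1 ≤ j.1 := by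
    intro i j s hs h; rcases hs.lt_or_eq with h1 | h1
    . rw [<-h]; exact i.2 s h1
    . rw [h1, sigpow_M] at h; exact le_of_eq h
  refine Subtype.ext (le_antisymm (key i j s hs h) (key j i (X.M - s) (Nat.sub_le _ _) ?_)); rw [<-h, X.sigpow_M_sub hs]

lemma symCartan_nondegenerate (n : X.I0 -> ℤ) (h : ∀ i, ∑ j, X.symCartan j i * n j = 0) :
    n = 0 := by
  classical
  let y : X.Node -> ℤ := fun k => ∑ j : X.I0, ∑ s ∈ Icc 1 X.M,
    if (X.sigma ^ s) j.1 = k then n j else 0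
  have hy0 : ∀ i : X.I0, ∑ k, X.cartan i k * y k = 0 := by
    intro i; rw [<-h i]; simp only [y, mul_sum]; rw [sum_comm]; refine sum_congr rfl fun j _ => ?_
    rw [sum_comm, X.symCartan_symm, symCartan, sum_mul]; refine sum_congr rfl fun s _ => ?_
    simp [c]
  have hyσ : ∀ k, y (X.sigma k) = y k := by
    intro k; simp only [y]; refine sum_congr rfl fun j _ => ?_
    have hM := X.M_pos
    have e : ∀ f : ℕ -> ℤ, f 0 = f X.M -> ∑ s ∈ Icc 1 X.M, f s = ∑ s ∈ range X.M, f s := by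
      intro f hf
      rcases X.M_cases with h | h <;> rw [h] at hf ⊢ <;>
        simp [Finset.sum_Icc_succ_top, sum_range_succ, hf] <;> ring
    have e2 : Icc 1 X.M = (range X.M).image (· + 1) := by
      ext s; simp only [mem_Icc, mem_image, mem_range]; constructor
      . rintro ⟨h1, h2⟩; exact ⟨s - 1, by omega, by omega⟩
      . rintro ⟨a, h1, rfl⟩; omega
    rw [e (fun s => if (X.sigma ^ s) j.1 = k then n j else 0) (by simp [sigpow_M]), e2, sum_image (by intro a _ b _ h; simpa using h)]
    refine sum_congr rfl fun s _ => ?_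
    rw [pow_succ', Equiv.Perm.mul_apply]; simp
  have hyσp : ∀ r k, y ((X.sigma ^ r) k) = y k := by
    intro r; induction r with
    | zero => simp
    | succ r ih => intro k; rw [pow_succ', Equiv.Perm.mul_apply, hyσ, ih]
  have hy : y = 0 := by
    refine X.car_nondegenerate y fun k => ?_
    obtain ⟨i, r, -, rfl⟩ := X.ex_pow_in_I0 k; rw [<-hy0 i, <-Equiv.sum_comp (X.sigma ^ r)]; refine sum_congr rfl fun k _ => ?_
    rw [car_sigpow, hyσp]
  ext j
  have hj : y j.1 = (((Icc 1 X.M).filter fun s => (X.sigma ^ s) j.1 = j.1).card : ℤ) * n j := by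
    simp only [y]; rw [sum_eq_single j]
    . rw [<-Finset.sum_filter, Finset.sum_const, nsmul_eq_mul]
    . intro i _ hij; refine sum_eq_zero fun s hs => if_neg fun h => hij ?_
      exact X.I0_eq_of_pow (Finset.mem_Icc.mp hs).2 h
    . simp
  rw [hy] at hj
  have hcard : 0 < ((Icc 1 X.M).filter fun s => (X.sigma ^ s) j.1 = j.1).card :=
    Finset.card_pos.mpr ⟨X.M, by simp [sigpow_M, Nat.succ_le_of_lt X.M_pos]⟩
  have := mul_eq_zero.mp hj.symm; simpa [hcard.ne'] using this

end TwistedType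

end

section

namespace TwistedType

variable (X)

lemma car_in (i j : X.Node) (h : i ≠ j) : X.cartan i j = -1 ∨ X.cartan i j = 0 := by
  classical
  rw [cartan_eq, if_neg h]; split_ifs <;> simp

lemma car_zero {i j : X.Node} (h : i ≠ j) (h' : ¬ X.Adj i j) : X.cartan i j = 0 := by
  classical
  rw [cartan_eq, if_neg h, if_neg h']

lemma I0_le (i : X.I0) : i.1 ≤ X.sigma i.1 := by simpa using i.2 1 (by rcases X.M_cases with h | h <;> omega)

set_option synthInstance.maxSize 1000 in
lemma car_sigpow_of_adj {i j : X.Node} (hi0 : ∀ k < X.M, i ≤ (X.sigma ^ k) i)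
    (hj0 : ∀ k < X.M, j ≤ (X.sigma ^ k) j) (hi : X.sigma i ≠ i) (hj : X.sigma j ≠ j)
    (hij : X.Adj i j) {s : ℕ} (h1 : 1 ≤ s) (h2 : s < X.M) : X.cartan i ((X.sigma ^ s) j) = 0 := by
  have hi' : i ≤ X.sigma i := X.I0_le ⟨i, hi0⟩; have hj' : j ≤ X.sigma j := X.I0_le ⟨j, hj0⟩; cases X with
  | A n _ _ =>
    obtain rfl : s = 1 := by simp only [M] at h2; omega
    clear hi0 hj0; obtain ⟨i, hiN⟩ := i; obtain ⟨j, hjN⟩ := j; simp only [numNodes] at hiN hjN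
    simp only [numNodes, sigma, Adj, Edge, le_def, Fin.ext_iff, val_rev, revPerm_apply, ne_eq]
      at hi hj hij hi' hj'
    refine car_zero _ ?_ ?_
    . simp only [numNodes, sigma, pow_one, revPerm_apply, Fin.ext_iff, val_rev, ne_eq]; omega
    . simp only [numNodes, Adj, Edge, sigma, pow_one, revPerm_apply, val_rev]; omega
  | D n _ =>
    exfalso; clear hi0 hj0; obtain ⟨i, hiN⟩ := i; obtain ⟨j, hjN⟩ := j; simp only [numNodes] at hiN hjN
    simp only [sigma, Adj, Edge, Equiv.swap_apply_def, Fin.last, Fin.mk.injEq, le_def]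
      at hi hj hij hi' hj'
    split_ifs at hi hj hi' hj' <;> simp at hi hj hi' hj' <;> omega
  | D4 =>
    exfalso; have h := hi0 2 (by simp [M]); have h' := hj0 2 (by simp [M]); clear hi0 hj0 h1 h2
    simp only [sigma, Adj, Edge] at hi hj hij hi' hj' h h'; revert i j; decide
  | E6 =>
    obtain rfl : s = 1 := by simp only [M] at h2; omega
    clear hi0 hj0 h1 h2; simp only [pow_one]; refine car_zero _ ?_ ?_ <;> simp only [sigma, Adj, Edge] at hi hj hij hi' hj' ⊢ <;>
    revert i j <;> decide

lemma c_of_not_fixed {i j : X.I0} (hi : X.sigma i ≠ i) (hj : X.sigma j ≠ j)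
    (hij : X.cartan i j = -1) {s : ℕ} (h1 : 1 ≤ s) (h2 : s < X.M) : X.c i s j = 0 :=
  X.car_sigpow_of_adj i.2 j.2 hi hj (X.car_eq_n_one.mp hij) h1 h2

lemma not_adj_sigma_of_M_eq_three {i : X.Node} (hM : X.M = 3)
    (hi0 : ∀ k < X.M, i ≤ (X.sigma ^ k) i) (hi : X.sigma i ≠ i) :
    X.cartan i (X.sigma i) = 0 := by
  cases X with
  | A n _ _ => simp [M] at hM
  | D n _ => simp [M] at hM
  | E6 => simp [M] at hM
  | D4 =>
    clear hi0 hM; refine car_zero _ ?_ ?_ <;> simp only [sigma, Adj, Edge] at hi ⊢ <;>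
    revert i <;> decide

lemma c_self_of_not_fixed {i : X.I0} (hi : X.sigma i ≠ i) :
    (X.c i 1 i = 0 ∨ (X.c i 1 i = -1 ∧ X.M = 2)) ∧ ∀ s, 1 ≤ s -> s < X.M -> X.c i s i = X.c i 1 i := by
  have h0 : X.c i 1 i = -1 ∨ X.c i 1 i = 0 := by unfold c; exact X.car_in _ _ (by simpa using fun h => hi h.symm)
  rcases X.M_cases with hM | hM
  . refine ⟨?_, fun s h1 h2 => ?_⟩
    . tauto
    . obtain rfl : s = 1 := by omega
      rfl
  . have h3 : X.c i 1 i = 0 := X.not_adj_sigma_of_M_eq_three hM i.2 hi; refine ⟨Or.inl h3, fun s h1 h2 => ?_⟩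
    have := X.c_reflect (s := 1) (by omega) i i; rw [hM] at this; obtain rfl | rfl : s = 1 ∨ s = 2 := by omega
    . rfl
    . exact this

lemma c_one_of_fixed {i : X.I0} (hi : X.sigma i = i) : X.c i 1 i = 2 := by rw [X.c_of_fixed_l hi, car_self]

lemma sigma_ne_of_adj_loop {i j : X.Node} (hi' : i ≤ X.sigma i) (hi : X.Adj i (X.sigma i))
    (hij : X.Adj i j) : X.sigma j ≠ j := by
  cases X with
  | A n _ _ =>
    obtain ⟨i, hiN⟩ := i; obtain ⟨j, hjN⟩ := j; simp only [numNodes] at hiN hjN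
    simp only [numNodes, sigma, Adj, Edge, le_def, Fin.ext_iff, val_rev, revPerm_apply, ne_eq]
      at hi hij hi' ⊢
    omega
  | D n _ =>
    exfalso; obtain ⟨i, hiN⟩ := i; obtain ⟨j, hjN⟩ := j; simp only [numNodes] at hiN hjN
    simp only [sigma, Adj, Edge, Equiv.swap_apply_def, Fin.last, Fin.mk.injEq, le_def]
      at hi hi' hij
    split_ifs at hi hi' <;> simp at hi hi' <;> omega
  | D4 =>
    exfalso; clear hij; simp only [sigma, Adj, Edge] at hi hi'; revert i; decide
  | E6 =>
    exfalso; clear hij; simp only [sigma, Adj, Edge] at hi hi'; revert i; decide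

lemma not_fixed_of_adj_loop {i j : X.I0} (hi : X.c i 1 i = -1) (hij : X.cartan i j = -1) :
    X.sigma j ≠ j :=
  X.sigma_ne_of_adj_loop (X.I0_le i) (by simpa [c, car_eq_n_one] using hi)
    (X.car_eq_n_one.mp hij)

lemma c_M_self (i) : X.c i X.M i = 2 := by rw [c_M, car_self]

end TwistedType

section Families

variable {G : Type*} [AddCommMonoid G] {B : Type*} [ACG B] [Module ℂ B]

def shiftFam (g : G) : (G -> B) →ₗ[ℂ] (G -> B) where
  toFun F r := F (r + g)
  map_add' _ _ := rfl
  map_smul' _ _ := rfl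

/-- The action of Laurent polynomials on families by shifts. -/
def act : ℂ[G] →ₐ[ℂ] End ℂ (G -> B) := AddMonoidAlgebra.lift ℂ _ G
    { toFun := fun g => shiftFam g.toAdd
      map_one' := by ext F r; simp [shiftFam]
      map_mul' := by
        intro a b; ext F r; simp only [shiftFam, toAdd_mul, coe_mk, AddHom.coe_mk, mul_apply]; congr 1
        ac_rfl }

lemma act_sgl (g : G) (c) (F : G -> B) (r : G) :
    act (AddMonoidAlgebra.single g c) F r = c • F (r + g) := by
  rw [act, AddMonoidAlgebra.lift_single]; rfl

lemma act_mul (p p' : ℂ[G]) (F : G -> B) :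
    act (p * p') F = act p (act p' F) := by
  rw [map_mul]; rfl

lemma act_add (p p' : ℂ[G]) (F : G -> B) :
    act (p + p') F = act p F + act p' F := by
  rw [map_add]; rfl

lemma act_sub (p p' : ℂ[G]) (F : G -> B) :
    act (p - p') F = act p F - act p' F := by
  rw [map_sub]; rfl

lemma act_neg (p : ℂ[G]) (F : G -> B) :
    act (-p) F = - act p F := by
  rw [map_neg]; rfl

lemma act_aM (c) (F : G -> B) :
    act (aM ℂ (ℂ[G]) c) F = c • F := by
  rw [AlgHom.commutes]; rfl

lemma act_map {G' B' : Type*} [AddCommMonoid G'] [ACG B'] [Module ℂ B'] (f : G →+ G')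
    (L : B →ₗ[ℂ] B') (p : ℂ[G]) (F : G -> B) (F' : G' -> B') (r : G) (r' : G')
    (h : ∀ a, F' (r' + f a) = L (F (r + a))) :
    act (mdC f p) F' r' = L (act p F r) := by
  induction p using induction_linear with
  | zero => simp
  | add p p' hp hp' => simp only [map_add, addL, Pi.add_apply, hp, hp']
  | single g c =>
    rw [mapDomainAlgHom_apply, mapDomain_single, act_sgl, act_sgl, h, map_smul]

lemma act_comp {B' : Type*} [ACG B'] [Module ℂ B']
    (L : B →ₗ[ℂ] B') (p : ℂ[G]) (F : G -> B) (r : G) :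
    act p (fun a => L (F a)) r = L (act p F r) := by
  induction p using induction_linear with
  | zero => simp
  | add p p' hp hp' => simp only [map_add, addL, Pi.add_apply, hp, hp']
  | single g c => rw [act_sgl, act_sgl, map_smul]

lemma act_shift (p : ℂ[G]) (F : G -> B) (s r : G) :
    act p (fun a => F (a + s)) r = act p F (r + s) := by
  induction p using induction_linear with
  | zero => simp
  | add p p' hp hp' => simp only [map_add, addL, Pi.add_apply, hp, hp']
  | single g c => rw [act_sgl, act_sgl]; congr 2; ac_rfl

end Families

end

section

open PowerSeries in
def twist {B : Type*} [ACG B] [Module ℂ B] (e : ℤ) (g : PowerSeries ℂ) (F : ℕ -> ℤ -> B)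
    (k : ℕ) (m : ℤ) : B :=
  ∑ p ∈ antidiagonal k, coeff p.1 g • F p.2 (m + e * p.1)

section Star

variable {B : Type*} [ACG B] [Module ℂ B] (e : ℤ)

lemma tw_mul (g h : PowerSeries ℂ) (F : ℕ -> ℤ -> B) : twist e (g * h) F = twist e g (twist e h F) := by
  funext k m; simp only [twist, coeff_mul, sum_smul, smul_sum, sum_sigma']
  refine sum_nbij' (fun ⟨⟨_i, j⟩, ⟨k, l⟩⟩ ↦ ⟨(k, l + j), (l, j)⟩)
    (fun ⟨⟨i, _j⟩, ⟨k, l⟩⟩ ↦ ⟨(i + k, l), (i, k)⟩) ?_ ?_ ?_ ?_ ?_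
  . rintro ⟨⟨i, j⟩, ⟨a, b⟩⟩ h; simp at h ⊢; omega
  . rintro ⟨⟨i, j⟩, ⟨a, b⟩⟩ h; simp at h ⊢; omega
  . rintro ⟨⟨i, j⟩, ⟨a, b⟩⟩ h; simp at h ⊢; omega
  . rintro ⟨⟨i, j⟩, ⟨a, b⟩⟩ h; simp at h ⊢; omega
  . rintro ⟨⟨i, j⟩, ⟨a, b⟩⟩ h; simp at h ⊢; rw [smul_smul, <-h.2]; congr 2; push_cast; ring

lemma tw_one (F : ℕ -> ℤ -> B) : twist e 1 F = F := by
  funext k m; rw [twist, sum_eq_single (0, k)]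
  . simp
  . rintro ⟨a, b⟩ h1 h2; have : a ≠ 0 := by rintro rfl; simp at h1; simp [h1] at h2
    simp [PowerSeries.coeff_one, this]
  . simp

lemma tw_comp {B' : Type*} [ACG B'] [Module ℂ B'] (g : PowerSeries ℂ) (F : ℕ -> ℤ -> B)
    (L : B →ₗ[ℂ] B') (k : ℕ) (m : ℤ) : L (twist e g F k m) = twist e g (fun k m => L (F k m)) k m := by
  simp [twist, map_sum]

lemma tw_zero (g : PowerSeries ℂ) : twist e g (fun _ _ => (0 : B)) = fun _ _ => 0 := by funext k m; simp [twist]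

def extFam (e : ℤˣ) (a : ℤ) (F : ℕ -> ℤ -> B) (r : ℤ × ℤ) : B :=
  if 0 ≤ e * (r.1 - a) then F (e * (r.1 - a)).toNat r.2 else 0

/-- The variables of two-variable Laurent polynomials. -/
def U0 : ℂ[ℤ × ℤ] := AddMonoidAlgebra.single (1, 0) 1
def U1 : ℂ[ℤ × ℤ] := AddMonoidAlgebra.single (0, 1) 1

lemma act_U0 (F : ℤ × ℤ -> B) (r m) : act U0 F (r, m) = F (r + 1, m) := by simp [U0, act_sgl]

lemma act_U1 (F : ℤ × ℤ -> B) (r m) : act U1 F (r, m) = F (r, m + 1) := by simp [U1, act_sgl]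

lemma act_lin (a b) (F : ℤ × ℤ -> B) (r m) :
    act (aM ℂ _ a * U0 - aM ℂ _ b * U1) F (r, m) = a • F (r + 1, m) - b • F (r, m + 1) := by
  simp only [act_sub, act_mul, act_aM, Pi.sub_apply, Pi.smul_apply, act_U0, act_U1]

lemma tw_lin_zero (a b : ℂ) (F : ℕ -> ℤ -> B) (m : ℤ) :
    twist e (C a - C b * PX) F 0 m = a • F 0 m := by
  simp [twist]

lemma tw_lin_succ (u d : ℂ) (F : ℕ -> ℤ -> B) (k : ℕ) (m : ℤ) :
    twist e (C u - C d * PX) F (k + 1) m = u • F (k + 1) m - d • F k (m + e) := by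
  rw [twist, <-add_sum_erase _ _ (show (0, k + 1) ∈ antidiagonal (k + 1) by simp), sum_eq_single (1, k)]
  . simp [coeff_C]; abel
  . rintro ⟨a, b⟩ h1 h2; simp at h1 h2; have : a ≠ 0 := by rintro rfl; exact h1.1 rfl (by omega)
    have h3 : a ≠ 1 := by rintro rfl; exact h2 rfl (by omega)
    obtain ⟨a, rfl⟩ : ∃ c, a = c + 1 := ⟨a - 1, by omega⟩; have h4 : a ≠ 0 := by omega
    simp [coeff_C, h4]
  . intro h; exact absurd (by simp; omega) h

lemma act_lin_ext_pos (a : ℤ) (d b : ℂ) (F : ℕ -> ℤ -> B) :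
    act (aM ℂ _ d * U0 - aM ℂ _ b * U1) (extFam 1 a F) = act U0 (extFam 1 a (twist 1 (C d - C b * PX) F)) := by
  funext ⟨r, m⟩; rw [act_lin, act_U0]; simp only [extFam, val_one, one_mul]; rcases lt_trichotomy (r + 1) a with h | h | h
  . rw [if_neg (by omega), if_neg (by omega), if_neg (by omega)]; simp
  . rw [if_pos (by omega), if_neg (by omega), if_pos (by omega)]; have : (r + 1 - a).toNat = 0 := by omega
    rw [this, tw_lin_zero]; simp
  . rw [if_pos (by omega), if_pos (by omega), if_pos (by omega)]
    have : (r + 1 - a).toNat = (r - a).toNat + 1 := by omega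
    rw [this, tw_lin_succ]

lemma act_lin_ext_neg (a : ℤ) (d b : ℂ) (F : ℕ -> ℤ -> B) :
    act (aM ℂ _ d * U0 - aM ℂ _ b * U1) (extFam (-1) a F) = act U1 (extFam (-1) a
        (twist (-1) (-(C b - C d * PX)) F)) := by
  funext ⟨r, m⟩; rw [act_lin, act_U1]
  have hneg : ∀ k m, twist (-1) (-(C b - C d * PX)) F k m = - twist (-1) (C b - C d * PX) F k m := by
    intro k m; simp only [twist, map_neg, neg_smul, Finset.sum_neg_distrib]
  simp only [extFam, val_neg, val_one]; rcases lt_trichotomy a r with h | h | h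
  . rw [if_neg (by omega), if_neg (by omega), if_neg (by omega)]; simp
  . rw [if_neg (by omega), if_pos (by omega), if_pos (by omega)]; have : (-1 * (r - a)).toNat = 0 := by omega
    rw [this, hneg, tw_lin_zero]; simp
  . rw [if_pos (by omega), if_pos (by omega), if_pos (by omega)]
    have : (-1 * (r - a)).toNat = (-1 * (r + 1 - a)).toNat + 1 := by omega
    rw [this, hneg, tw_lin_succ]; simp

end Star

namespace TwistedType

variable (X) (t)

def sqSet (i j : X.I0) : Finset ℕ := (Icc 1 X.M).filter fun s => X.c i s j ≠ 0

def sqL {S : Type*} [CommRing S] [Algebra ℂ S] (d : ℤˣ) (i j : X.I0) (a b : S) : S := ∏ s ∈ X.sqSet i j,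
    (aM ℂ S 1 * a - aM ℂ S (X.zeta ^ s * (t ^ 2) ^ (d * X.c i s j)) * b)

def sqR {S : Type*} [CommRing S] [Algebra ℂ S] (d : ℤˣ) (i j : X.I0) (a b : S) : S := ∏ s ∈ X.sqSet i j,
    (aM ℂ S ((t ^ 2) ^ (d * X.c i s j)) * a - aM ℂ S (X.zeta ^ s) * b)

lemma map_sqL {S S' : Type*} [CommRing S] [Algebra ℂ S] [CommRing S'] [Algebra ℂ S']
    (f : S →ₐ[ℂ] S') (d i j) (a b : S) :
    f (X.sqL t d i j a b) = X.sqL t d i j (f a) (f b) := by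
  simp [sqL, map_prod]

lemma map_sqR {S S' : Type*} [CommRing S] [Algebra ℂ S] [CommRing S'] [Algebra ℂ S']
    (f : S →ₐ[ℂ] S') (d i j) (a b : S) :
    f (X.sqR t d i j a b) = X.sqR t d i j (f a) (f b) := by
  simp [sqR, map_prod]

def gamNum (J d : ℤˣ) (i j : X.I0) (s : ℕ) : PowerSeries ℂ := C ((t ^ 2) ^ ((J : ℤ) * d * X.c i s j)) - C (X.zeta ^ ((J : ℤ) * s)) * PX

def gamDen (J d : ℤˣ) (i j : X.I0) (s : ℕ) : PowerSeries ℂ := C 1 - C ((t ^ 2) ^ ((J : ℤ) * d * X.c i s j) * X.zeta ^ ((J : ℤ) * s)) * PX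

def gam (J d : ℤˣ) (i j : X.I0) : PowerSeries ℂ := ∏ s ∈ Icc 1 X.M, X.gamNum t J d i j s * (X.gamDen t J d i j s)⁻¹

lemma gamDen_inv (J d i j s) :
    X.gamDen t J d i j s * (X.gamDen t J d i j s)⁻¹ = 1 :=
  PowerSeries.mul_inv_cancel _ (by simp [gamDen])

lemma gam_eq_sqSet (J d i j) :
    X.gam t J d i j = ∏ s ∈ X.sqSet i j, X.gamNum t J d i j s * (X.gamDen t J d i j s)⁻¹ := by
  rw [gam, sqSet, Finset.prod_filter]; refine prod_congr rfl fun s _ => ?_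
  split_ifs with h
  . rfl
  . have h : X.c i s j = 0 := by simpa using h
    have : X.gamNum t J d i j s = X.gamDen t J d i j s := by simp [gamNum, gamDen, h]
    rw [this, gamDen_inv]

variable {t} {B : Type*} [ACG B] [Module ℂ B]

lemma act_sqL_ext (ht : t ≠ 0) (J d : ℤˣ) (a : ℤ) (i j) (F : ℕ -> ℤ -> B) :
    act (X.sqL t d i j U0 U1) (extFam J a (twist J (X.gam t J d i j) F)) = act (X.sqR t d i j U0 U1) (extFam J a F) := by
  have key : ∀ {U : ℂ[ℤ × ℤ]} {L R : ℕ -> ℂ[ℤ × ℤ]} (p p' : ℕ -> PowerSeries ℂ),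
      (∀ s F, act (L s) (extFam J a F) = act U (extFam J a (twist J (p s) F : ℕ -> ℤ -> B))) ->
      (∀ s F, act (R s) (extFam J a F) = act U (extFam J a (twist J (p' s) F : ℕ -> ℤ -> B))) ->
      (∀ s, p s * (X.gamNum t J d i j s * (X.gamDen t J d i j s)⁻¹) = p' s) -> ∀ (T : Finset ℕ) (F : ℕ -> ℤ -> B),
      act (∏ s ∈ T, L s) (extFam J a (twist J (∏ s ∈ T, X.gamNum t J d i j s * (X.gamDen t J d i j s)⁻¹) F)) =
        act (∏ s ∈ T, R s) (extFam J a F) := by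
    intro U L R p p' hL hR h T; induction T using Finset.induction_on with
    | empty => intro F; simp [tw_one]
    | insert s T hs ih =>
      intro F
      rw [prod_insert hs, prod_insert hs, prod_insert hs, mul_comm (L s), mul_comm (R s), act_mul, act_mul, hL, hR,
        <-act_mul, <-act_mul, mul_comm _ U, mul_comm _ U, act_mul, act_mul, <-ih, <-tw_mul, <-tw_mul,
        <-mul_assoc, h, mul_comm (p' s)]
  rw [gam_eq_sqSet]; rcases units_eq_one_or J with rfl | rfl
  . refine key _ _ (fun s => act_lin_ext_pos a _ _) (fun s => act_lin_ext_pos a _ _) (fun s => ?_) _ F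
    have := X.gamDen_inv t 1 d i j s; simp only [gamDen, gamNum, val_one, one_mul, zpow_natCast, mul_comm _ (X.zeta ^ s)] at *
    rw [mul_left_comm, this, mul_one]
  . refine key _ _ (fun s => act_lin_ext_neg a _ _) (fun s => act_lin_ext_neg a _ _) (fun s => ?_) _ F
    have h := X.gamDen_inv t (-1) d i j s
    have hz := pow_ne_zero s X.zeta_ne; have hq := zpow_ne_zero (d * X.c i s j) (pow_ne_zero 2 ht)
    simp only [gamDen, gamNum, show ((-1 : ℤˣ) : ℤ) * d * X.c i s j = -(d * X.c i s j) by simp, zpow_neg,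
      show ((-1 : ℤˣ) : ℤ) * s = -s by simp, zpow_natCast] at h ⊢
    generalize X.zeta ^ s = z at *; generalize (t ^ 2) ^ (d * X.c i s j) = w at *
    rw [show -(C (z * w) - C 1 * PX) = -C (z * w) * (C 1 - C (w⁻¹ * z⁻¹) * PX) by
        rw [mul_sub, <-mul_assoc, neg_mul (C _) (C (w⁻¹ * z⁻¹)), <-map_mul, show z * w * (w⁻¹ * z⁻¹) = 1 by field_simp]; simp; ring,
      mul_mul_mul_comm, h, mul_one, neg_mul, mul_sub, <-mul_assoc, <-map_mul, <-map_mul,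
      show z * w * w⁻¹ = z by field_simp, show z * w * z⁻¹ = w by field_simp]

end TwistedType

end

section

section Identities

variable {S : Type*} [CommRing S]

lemma ser_out_of_fixed (c c' a b v : S) (h : c * c' = 1) : ∃ H : S, (c ^ 2 * a - b) * (c' * a - v) + (a - c ^ 2 * b) * (c' * a - v)
        + -(c + c') * ((a - c ^ 2 * b) * (a - c' * v)) = H * (b - c' * v) ∧
    -(c + c') * ((c ^ 2 * a - b) * (c' * a - v)) + (a - c' * v) * (c ^ 2 * a - b)
        + (a - c ^ 2 * b) * (a - c' * v) = -H * (c' * b - v) :=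
  ⟨(c ^ 2 - c' ^ 2) * c * a, by grind, by grind⟩

lemma ser_inn_of_fixed (c c' a b v : S) (h : c * c' = 1) : ∃ H : S,
    (c' * v - a) * (c' * v - b) + -(c + c') * ((v - c' * a) * (c' * v - b))
        + (v - c' * a) * (v - c' * b) = H * (a - c ^ 2 * b) ∧
    (c' * v - a) * (c' * v - b) + -(c + c') * ((v - c' * b) * (c' * v - a))
        + (v - c' * a) * (v - c' * b) = -H * (c ^ 2 * a - b) :=
  ⟨-(c - c') * c' ^ 2 * v, by grind, by grind⟩

lemma ser_out_of_loop (c c' a b v : S) (h : c * c' = 1) : ∃ H : S, (c * a + b) * (((c ^ 2 * a - b) * (c' * a + b)) * (c' * a - v))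
        + (c * b + a) * (((a - c ^ 2 * b) * (a + c' * b)) * (c' * a - v))
        + -(c + c') * (c * b + a) * (((a - c ^ 2 * b) * (a + c' * b)) * (a - c' * v))
      = H * (b - c' * v) ∧
    -(c + c') * (c * a + b) * (((c ^ 2 * a - b) * (c' * a + b)) * (c' * a - v))
        + (c * a + b) * ((a - c' * v) * ((c ^ 2 * a - b) * (c' * a + b)))
        + (c * b + a) * (((a - c ^ 2 * b) * (a + c' * b)) * (a - c' * v))
      = -H * (c' * b - v) :=
  ⟨(c ^ 2 - c' ^ 2) * c * a * (a + c * b) * (a + c' * b), by grind, by grind⟩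

lemma ser_inn_of_loop (c c' a b v : S) (h : c * c' = 1) : ∃ H : S, (c * a + b) * ((c' * v - a) * (c' * v - b))
        + -(c + c') * (c * a + b) * ((v - c' * a) * (c' * v - b))
        + (c * a + b) * ((v - c' * a) * (v - c' * b))
      = H * ((a - c ^ 2 * b) * (a + c' * b)) ∧
    (c * b + a) * ((c' * v - a) * (c' * v - b))
        + -(c + c') * (c * b + a) * ((v - c' * b) * (c' * v - a))
        + (c * b + a) * ((v - c' * a) * (v - c' * b))
      = -H * ((c ^ 2 * a - b) * (c' * a + b)) :=
  ⟨-(c - c') * c' ^ 2 * v * c, by grind, by grind⟩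

lemma cubic_slot_l (t t' a b c : S) (h : t * t' = 1) : ∃ H : S, (a - (t ^ 4 + t ^ 2) * b + t ^ 6 * c) *
          (((t ^ 4 * a - b) * (t' ^ 2 * a + b)) * ((t ^ 4 * a - c) * (t' ^ 2 * a + c)))
        + (b - (t ^ 4 + t ^ 2) * a + t ^ 6 * c) * (((a - t ^ 4 * b) * (a + t' ^ 2 * b)) * ((t ^ 4 * a - c) * (t' ^ 2 * a + c)))
        + (b - (t ^ 4 + t ^ 2) * c + t ^ 6 * a) * (((a - t ^ 4 * b) * (a + t' ^ 2 * b)) * ((a - t ^ 4 * c) * (a + t' ^ 2 * c)))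
      = H * ((b - t ^ 4 * c) * (b + t' ^ 2 * c)) ∧
    (a - (t ^ 4 + t ^ 2) * c + t ^ 6 * b) * (((t ^ 4 * a - b) * (t' ^ 2 * a + b)) * ((t ^ 4 * a - c) * (t' ^ 2 * a + c)))
        + (c - (t ^ 4 + t ^ 2) * a + t ^ 6 * b) * (((a - t ^ 4 * c) * (a + t' ^ 2 * c)) * ((t ^ 4 * a - b) * (t' ^ 2 * a + b)))
        + (c - (t ^ 4 + t ^ 2) * b + t ^ 6 * a) * (((a - t ^ 4 * b) * (a + t' ^ 2 * b)) * ((a - t ^ 4 * c) * (a + t' ^ 2 * c)))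
      = -H * ((t ^ 4 * b - c) * (t' ^ 2 * b + c)) :=
  ⟨t' ^ 2 * (-(a ^ 3 * t ^ 12) - a ^ 3 * t ^ 10 + a ^ 3 * t ^ 2 + a ^ 3
      + (t ^ 8 - t ^ 4) * a ^ 2 * (b + c) + a * b * c * (t ^ 10 + t ^ 8 - t ^ 4 - t ^ 2)),
    by grind, by grind⟩

lemma cubic_slot_r (t t' a b c : S) (h : t * t' = 1) : ∃ H : S, (t ^ 6 * b * c - (t ^ 4 + t ^ 2) * a * c + a * b) *
          (((t ^ 4 * a - b) * (t' ^ 2 * a + b)) * ((t ^ 4 * a - c) * (t' ^ 2 * a + c)))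
        + (t ^ 6 * a * c - (t ^ 4 + t ^ 2) * b * c + b * a) * (((a - t ^ 4 * b) * (a + t' ^ 2 * b)) * ((t ^ 4 * a - c) * (t' ^ 2 * a + c)))
        + (t ^ 6 * c * a - (t ^ 4 + t ^ 2) * b * a + b * c) * (((a - t ^ 4 * b) * (a + t' ^ 2 * b)) * ((a - t ^ 4 * c) * (a + t' ^ 2 * c)))
      = H * ((b - t ^ 4 * c) * (b + t' ^ 2 * c)) ∧
    (t ^ 6 * c * b - (t ^ 4 + t ^ 2) * a * b + a * c) * (((t ^ 4 * a - b) * (t' ^ 2 * a + b)) * ((t ^ 4 * a - c) * (t' ^ 2 * a + c)))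
        + (t ^ 6 * a * b - (t ^ 4 + t ^ 2) * c * b + c * a) * (((a - t ^ 4 * c) * (a + t' ^ 2 * c)) * ((t ^ 4 * a - b) * (t' ^ 2 * a + b)))
        + (t ^ 6 * b * a - (t ^ 4 + t ^ 2) * c * a + c * b) * (((a - t ^ 4 * b) * (a + t' ^ 2 * b)) * ((a - t ^ 4 * c) * (a + t' ^ 2 * c)))
      = -H * ((t ^ 4 * b - c) * (t' ^ 2 * b + c)) :=
  ⟨t' ^ 2 * (a ^ 4 * (t ^ 10 + t ^ 8 - t ^ 4 - t ^ 2) + a ^ 3 * (b + c) * (t ^ 8 - t ^ 4)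
      + a ^ 2 * b * c * (-t ^ 12 - t ^ 10 + t ^ 2 + 1)),
    by grind, by grind⟩

end Identities

namespace TwistedType

variable (X) (t) {S : Type*} [CommRing S] [Algebra ℂ S]

lemma zeta_of_two (h : X.M = 2) : X.zeta = -1 := by have := X.zeta_primitive; rw [h] at this; exact this.eq_neg_one_of_two_right

lemma zeta_of_three (h : X.M = 3) : 1 + X.zeta + X.zeta ^ 2 = 0 := by
  have := X.zeta_primitive; rw [h] at this; have := this.geom_sum_eq_zero (by norm_num); simpa [sum_range_succ] using this

lemma prod_lin (a b : S) :
    ∏ s ∈ Icc 1 X.M, (a - aM ℂ S (X.zeta ^ s) * b) = a ^ X.M - b ^ X.M := by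
  rcases X.M_cases with h | h
  . rw [h, show Icc 1 2 = ({1, 2} : Finset ℕ) by decide, prod_pair (by decide), X.zeta_of_two h]; simp; ring
  . have h1 := X.zeta_of_three h
    rw [h, show Icc 1 3 = ({1, 2, 3} : Finset ℕ) by decide, prod_insert (by decide), prod_pair (by decide)]
    have h2 : 1 + aM ℂ S X.zeta + aM ℂ S X.zeta ^ 2 = 0 := by simpa using congrArg (aM ℂ S) h1
    simp only [map_pow]; generalize aM ℂ S X.zeta = z at h2; grind

variable (δ : ℤˣ)

/-- `q^{δ k}` as an element of a commutative algebra. -/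
def qpow (S : Type*) [CommRing S] [Algebra ℂ S] (t : ℂ) (δ : ℤˣ) (k : ℤ) : S := aM ℂ S ((t ^ 2) ^ (δ * k))

lemma sqL_of_const {i j} {k : ℤ} (hk : k ≠ 0) (h : ∀ s, X.c i s j = k) (a b : S) :
    X.sqL t δ i j a b = a ^ X.M - qpow S t δ k ^ X.M * b ^ X.M := by
  rw [<-mul_pow, <-prod_lin, sqL, sqSet, Finset.filter_true_of_mem (by simp [h, hk])]; refine prod_congr rfl fun s _ => ?_
  rw [h, map_mul, qpow]; simp; ring

lemma sqR_of_const {i j} {k : ℤ} (hk : k ≠ 0) (h : ∀ s, X.c i s j = k) (a b : S) :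
    X.sqR t δ i j a b = qpow S t δ k ^ X.M * a ^ X.M - b ^ X.M := by
  rw [<-mul_pow, <-prod_lin, sqR, sqSet, Finset.filter_true_of_mem (by simp [h, hk])]; refine prod_congr rfl fun s _ => ?_
  rw [h, qpow]

lemma sqSet_of_sgl {i j} (hk : X.c i X.M j ≠ 0)
    (h : ∀ s, 1 ≤ s -> s < X.M -> X.c i s j = 0) : X.sqSet i j = {X.M} := by
  ext s; have := X.M_pos; simp only [sqSet, mem_filter, mem_Icc, mem_singleton]; constructor
  . rintro ⟨⟨h1, h2⟩, h3⟩; by_contra h4; exact h3 (h s h1 (by omega))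
  . rintro rfl; exact ⟨⟨this, le_rfl⟩, hk⟩

lemma sqL_of_sgl {i j} {k : ℤ} (hk : k ≠ 0) (h0 : X.c i X.M j = k)
    (h : ∀ s, 1 ≤ s -> s < X.M -> X.c i s j = 0) (a b : S) :
    X.sqL t δ i j a b = a - qpow S t δ k * b := by
  rw [sqL, X.sqSet_of_sgl (h0 ▸ hk) h, Finset.prod_singleton, h0, zeta_pow_M]; simp [qpow]

lemma sqR_of_sgl {i j} {k : ℤ} (hk : k ≠ 0) (h0 : X.c i X.M j = k)
    (h : ∀ s, 1 ≤ s -> s < X.M -> X.c i s j = 0) (a b : S) :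
    X.sqR t δ i j a b = qpow S t δ k * a - b := by
  rw [sqR, X.sqSet_of_sgl (h0 ▸ hk) h, Finset.prod_singleton, h0, zeta_pow_M]; simp [qpow]

lemma loop_not_fixed {i} (h : X.c i 1 i = -1) : X.sigma i ≠ i := fun h' => by rw [X.c_one_of_fixed h'] at h; omega

lemma loop_M {i} (h : X.c i 1 i = -1) : X.M = 2 := by
  rcases (X.c_self_of_not_fixed (X.loop_not_fixed h)).1 with h' | h'
  . omega
  . exact h'.2

lemma sqSet_of_loop {i} (h : X.c i 1 i = -1) : X.sqSet i i = {1, 2} := by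
  have hM := X.loop_M h; have h2 := X.c_M_self i; rw [hM] at h2; rw [sqSet, hM, show Icc 1 2 = ({1, 2} : Finset ℕ) by decide]
  exact Finset.filter_true_of_mem (by simp [h, h2])

lemma sqL_of_loop {i : X.I0} (h : X.c i 1 i = -1) (a b : S) :
    X.sqL t δ i i a b = (a - qpow S t δ 2 * b) * (a + qpow S t δ (-1) * b) := by
  have hM := X.loop_M h; have h2 := X.c_M_self i; rw [hM] at h2
  rw [sqL, X.sqSet_of_loop h, prod_pair (by decide), h, h2, X.zeta_of_two hM]; simp [qpow]; ring

lemma sqR_of_loop {i : X.I0} (h : X.c i 1 i = -1) (a b : S) :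
    X.sqR t δ i i a b = (qpow S t δ 2 * a - b) * (qpow S t δ (-1) * a + b) := by
  have hM := X.loop_M h; have h2 := X.c_M_self i; rw [hM] at h2
  rw [sqR, X.sqSet_of_loop h, prod_pair (by decide), h, h2, X.zeta_of_two hM]; simp [qpow]; ring

variable {t} in
lemma qpow_add (ht : t ≠ 0) (k l : ℤ) : qpow S t δ (k + l) = qpow S t δ k * qpow S t δ l := by
  rw [qpow, qpow, qpow, <-map_mul, mul_add, zpow_add₀ (pow_ne_zero 2 ht)]

lemma qpow_zero : qpow S t δ 0 = 1 := by simp [qpow]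

lemma qpow_nat_mul (k : ℤ) (n : ℕ) : qpow S t δ (k * n) = qpow S t δ k ^ n := by
  rw [qpow, qpow, <-map_pow, <-mul_assoc, zpow_mul, zpow_natCast]

/-- The polynomial `P_{i,j}^δ` of the Serre relations. -/
def serreP (i j : X.I0) (a b : S) : S := ∑ k ∈ range ((serreDeg X i j).1 + 1),
    aM ℂ S ((t ^ 2) ^ (δ * (serreDeg X i j).2 * k)) * (a ^ k * b ^ ((serreDeg X i j).1 - k))

variable (S) in
def serTwo (i j : X.I0) : S := aM ℂ S ((t ^ 2) ^ serreExp X i j + ((t ^ 2) ^ serreExp X i j)⁻¹)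

variable {t} in
lemma serTwo_eq (ht : t ≠ 0) (i j : X.I0) {n : ℕ} (hn : serreExp X i j = n) :
    X.serTwo t S i j = qpow S t δ n + qpow S t δ (-n) := by
  have hq : (t ^ 2) ≠ 0 := pow_ne_zero 2 ht; rw [serTwo, qpow, qpow, hn, <-map_add]; congr 1; rcases units_eq_one_or δ with rfl | rfl
  . simp
  . simp [add_comm]

variable {t} in
lemma ser_identities (ht : t ≠ 0) {i j : X.I0} (hij : X.cartan i j = -1)
    (a b v : S) :
    (∃ H : S, X.serreP t δ i j a b * (X.sqR t δ i i a b * X.sqR t δ i j a v)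
        + X.serreP t δ i j b a * (X.sqL t δ i i a b * X.sqR t δ i j a v)
        + -(X.serTwo t S i j) * X.serreP t δ i j b a * (X.sqL t δ i i a b * X.sqL t δ i j a v)
        = H * X.sqL t δ i j b v ∧
      -(X.serTwo t S i j) * X.serreP t δ i j a b * (X.sqR t δ i i a b * X.sqR t δ i j a v)
        + X.serreP t δ i j a b * (X.sqL t δ i j a v * X.sqR t δ i i a b)
        + X.serreP t δ i j b a * (X.sqL t δ i i a b * X.sqL t δ i j a v)
        = -H * X.sqR t δ i j b v) ∧
    ∃ H : S, X.serreP t δ i j a b * (X.sqR t δ j i v a * X.sqR t δ j i v b)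
        + -(X.serTwo t S i j) * X.serreP t δ i j a b * (X.sqL t δ j i v a * X.sqR t δ j i v b)
        + X.serreP t δ i j a b * (X.sqL t δ j i v a * X.sqL t δ j i v b)
        = H * X.sqL t δ i i a b ∧
      X.serreP t δ i j b a * (X.sqR t δ j i v a * X.sqR t δ j i v b)
        + -(X.serTwo t S i j) * X.serreP t δ i j b a * (X.sqL t δ j i v b * X.sqR t δ j i v a)
        + X.serreP t δ i j b a * (X.sqL t δ j i v a * X.sqL t δ j i v b)
        = -H * X.sqR t δ i i a b := by
  have hji : X.cartan j i = -1 := by rw [car_symm, hij]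
  have hne : i ≠ j := fun h => by rw [h, car_self] at hij; omega
  have h1 : ((-1 : ℤ)) ≠ 0 := by norm_num
  have h2 : ((2 : ℤ)) ≠ 0 := by norm_num
  have hcc : ∀ k : ℤ, (qpow S t δ k * qpow S t δ (-k)) = 1 := fun k => by rw [<-qpow_add δ ht, add_neg_cancel, qpow_zero]
  have e2 : qpow S t δ 2 = qpow S t δ 1 ^ 2 := by rw [<-qpow_nat_mul]; norm_num
  have eM : qpow S t δ X.M = qpow S t δ 1 ^ X.M := by rw [<-qpow_nat_mul]; norm_num
  have eM' : qpow S t δ (-X.M) = qpow S t δ (-1) ^ X.M := by rw [<-qpow_nat_mul]; norm_num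
  by_cases hi : X.sigma i = i
  . have c1 : X.c i 1 i = 2 := X.c_one_of_fixed hi; have hE : serreExp X i j = X.M := by simp [serreExp, c1]
    have hD : serreDeg X i j = (0, 0) := by simp [serreDeg, c1]
    have hP : ∀ a b : S, X.serreP t δ i j a b = 1 := fun a b => by simp [serreP, hD]
    have hc1 : ∀ s, X.c i s i = 2 := fun s => by rw [X.c_of_fixed_l hi, car_self]
    have hc2 : ∀ s, X.c i s j = -1 := fun s => by rw [X.c_of_fixed_l hi, hij]
    have hc3 : ∀ s, X.c j s i = -1 := fun s => by rw [X.c_of_fixed_r hi, hji]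
    simp only [hP, X.serTwo_eq δ ht i j hE, X.sqL_of_const t δ h2 hc1, X.sqR_of_const t δ h2 hc1,
      X.sqL_of_const t δ h1 hc2, X.sqR_of_const t δ h1 hc2,
      X.sqL_of_const t δ h1 hc3, X.sqR_of_const t δ h1 hc3, e2, eM, eM', one_mul, mul_one]
    have h := congrArg (· ^ X.M) (hcc 1); simp only [mul_pow, one_pow] at h
    have o := ser_out_of_fixed _ _ (a ^ X.M) (b ^ X.M) (v ^ X.M) h; have i' := ser_inn_of_fixed _ _ (a ^ X.M) (b ^ X.M) (v ^ X.M) h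
    rw [<-pow_mul, mul_comm X.M 2, pow_mul] at o i'; exact ⟨o, i'⟩
  . obtain ⟨hci, hci'⟩ := X.c_self_of_not_fixed hi; rcases hci with hci | ⟨hci, hM⟩
    . have hc1 : ∀ s, 1 ≤ s -> s < X.M -> X.c i s i = 0 := fun s h1 h2 => by rw [hci' s h1 h2, hci]
      by_cases hj : X.sigma j = j
      . have hE : serreExp X i j = X.M := by simp [serreExp, hci, hj]
        have hD : serreDeg X i j = (X.M - 1, 2) := by simp [serreDeg, hci, hj]
        have hP : ∀ a b : S, X.serreP t δ i j a b * (qpow S t δ 1 ^ 2 * a - b) =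
            (qpow S t δ 1 ^ X.M) ^ 2 * a ^ X.M - b ^ X.M := fun a b => by
          have : ∀ k : ℕ, aM ℂ S ((t ^ 2) ^ ((δ : ℤ) * 2 * k)) = (qpow S t δ 1 ^ 2) ^ k := by
            intro k; rw [<-e2, <-qpow_nat_mul, qpow]; congr 2; ring
          simp only [serreP, hD, this]; rcases X.M_cases with h | h <;> rw [h] <;> simp [sum_range_succ] <;> ring
        have hc2 : ∀ s, X.c i s j = -1 := fun s => by rw [X.c_of_fixed_r hj, hij]
        have hc3 : ∀ s, X.c j s i = -1 := fun s => by rw [X.c_of_fixed_l hj, hji]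
        have hP1 := hP a b; have hP2 := hP b a; have h := congrArg (· ^ X.M) (hcc 1); simp only [mul_pow, one_pow] at h
        obtain ⟨H, o1, o2⟩ := ser_out_of_fixed _ _ (a ^ X.M) (b ^ X.M) (v ^ X.M) h
        obtain ⟨H', i1, i2⟩ := ser_inn_of_fixed _ _ (a ^ X.M) (b ^ X.M) (v ^ X.M) h
        simp only [X.serTwo_eq δ ht i j hE, X.sqL_of_sgl t δ h2 (X.c_M_self i) hc1, X.sqR_of_sgl t δ h2 (X.c_M_self i) hc1,
          X.sqL_of_const t δ h1 hc2, X.sqR_of_const t δ h1 hc2,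
          X.sqL_of_const t δ h1 hc3, X.sqR_of_const t δ h1 hc3, e2, eM, eM']
        refine ⟨⟨H, ?_, ?_⟩, X.serreP t δ i j a b * X.serreP t δ i j b a * H', ?_, ?_⟩
        . linear_combination o1 + (qpow S t δ (-1) ^ X.M * a ^ X.M - v ^ X.M) * hP1 -
            ((qpow S t δ (-1) ^ X.M * a ^ X.M - v ^ X.M) - (qpow S t δ 1 ^ X.M + qpow S t δ (-1) ^ X.M) *
                (a ^ X.M - qpow S t δ (-1) ^ X.M * v ^ X.M)) * hP2
        . linear_combination o2 + (-(qpow S t δ 1 ^ X.M + qpow S t δ (-1) ^ X.M) * (qpow S t δ (-1) ^ X.M * a ^ X.M - v ^ X.M) +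
                (a ^ X.M - qpow S t δ (-1) ^ X.M * v ^ X.M)) * hP1 -
            (a ^ X.M - qpow S t δ (-1) ^ X.M * v ^ X.M) * hP2
        . linear_combination X.serreP t δ i j a b * i1 + X.serreP t δ i j a b * H' * hP2
        . linear_combination X.serreP t δ i j b a * i2 + X.serreP t δ i j b a * H' * hP1
      . have hE : serreExp X i j = 1 := by simp [serreExp, hci, hj]
        have hD : serreDeg X i j = (0, 0) := by simp [serreDeg, hci, hj]
        have hP : ∀ a b : S, X.serreP t δ i j a b = 1 := fun a b => by simp [serreP, hD]
        have hc2 : ∀ s, 1 ≤ s -> s < X.M -> X.c i s j = 0 := fun s => X.c_of_not_fixed hi hj hij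
        have hc3 : ∀ s, 1 ≤ s -> s < X.M -> X.c j s i = 0 := fun s => X.c_of_not_fixed hj hi hji
        have hcM : X.c i X.M j = -1 := by rw [c_M, hij]
        have hcM' : X.c j X.M i = -1 := by rw [c_M, hji]
        simp only [hP, X.serTwo_eq δ ht i j hE, X.sqL_of_sgl t δ h2 (X.c_M_self i) hc1,
          X.sqR_of_sgl t δ h2 (X.c_M_self i) hc1, X.sqL_of_sgl t δ h1 hcM hc2,
          X.sqR_of_sgl t δ h1 hcM hc2, X.sqL_of_sgl t δ h1 hcM' hc3,
          X.sqR_of_sgl t δ h1 hcM' hc3, e2, one_mul, mul_one, Nat.cast_one]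
        exact ⟨ser_out_of_fixed _ _ a b v (hcc 1), ser_inn_of_fixed _ _ a b v (hcc 1)⟩
    . have hj := X.not_fixed_of_adj_loop hci hij; have hE : serreExp X i j = 1 := by simp [serreExp, hci]
      have hD : serreDeg X i j = (1, 1) := by simp [serreDeg, hci]
      have hP : ∀ a b : S, X.serreP t δ i j a b = qpow S t δ 1 * a + b := fun a b => by simp [serreP, hD, qpow, sum_range_succ, add_comm]
      have hc2 : ∀ s, 1 ≤ s -> s < X.M -> X.c i s j = 0 := fun s => X.c_of_not_fixed hi hj hij
      have hc3 : ∀ s, 1 ≤ s -> s < X.M -> X.c j s i = 0 := fun s => X.c_of_not_fixed hj hi hji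
      have hcM : X.c i X.M j = -1 := by rw [c_M, hij]
      have hcM' : X.c j X.M i = -1 := by rw [c_M, hji]
      simp only [hP, X.serTwo_eq δ ht i j hE, X.sqL_of_loop t δ hci, X.sqR_of_loop t δ hci, X.sqL_of_sgl t δ h1 hcM hc2,
        X.sqR_of_sgl t δ h1 hcM hc2, X.sqL_of_sgl t δ h1 hcM' hc3,
        X.sqR_of_sgl t δ h1 hcM' hc3, e2, Nat.cast_one]
      exact ⟨ser_out_of_loop _ _ a b v (hcc 1), ser_inn_of_loop _ _ a b v (hcc 1)⟩

end TwistedType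
namespace TwistedType

variable (X) (t) {S : Type*} [CommRing S] [Algebra ℂ S] (δ : ℤˣ)

def cubicP (k : ℤˣ) (a b c : S) : S :=
  if k = 1 then aM ℂ S (t ^ (3 * (δ : ℤ))) * (b * c) - aM ℂ S (t + t⁻¹) * (a * c) + aM ℂ S (t ^ (-(3 * (δ : ℤ)))) * (a * b)
  else aM ℂ S (t ^ (-(3 * (δ : ℤ)))) * a - aM ℂ S (t + t⁻¹) * b + aM ℂ S (t ^ (3 * (δ : ℤ))) * c

variable {t} in
lemma cubic_identities (ht : t ≠ 0) (κ : ℤˣ) {i : X.I0} (hi : X.c i 1 i = -1) (a b c : S) :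
    ∃ H : S, cubicP t δ κ a b c * (X.sqR t δ i i a b * X.sqR t δ i i a c)
        + cubicP t δ κ b a c * (X.sqL t δ i i a b * X.sqR t δ i i a c)
        + cubicP t δ κ b c a * (X.sqL t δ i i a b * X.sqL t δ i i a c)
        = H * X.sqL t δ i i b c ∧
      cubicP t δ κ a c b * (X.sqR t δ i i a b * X.sqR t δ i i a c)
        + cubicP t δ κ c a b * (X.sqL t δ i i a c * X.sqR t δ i i a b)
        + cubicP t δ κ c b a * (X.sqL t δ i i a b * X.sqL t δ i i a c)
        = -H * X.sqR t δ i i b c := by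
  set T : S := aM ℂ S (t ^ (δ : ℤ)) with hT; set T' : S := aM ℂ S (t ^ (-(δ : ℤ))) with hT'
  have h : T * T' = 1 := by rw [hT, hT', <-map_mul, <-zpow_add₀ ht, add_neg_cancel, zpow_zero, map_one]
  have e1 : aM ℂ S (t ^ (3 * (δ : ℤ))) = T ^ 3 := by rw [hT, <-map_pow, mul_comm, zpow_mul]; norm_cast
  have e2 : aM ℂ S (t ^ (-(3 * (δ : ℤ)))) = T' ^ 3 := by rw [hT', <-map_pow, mul_comm, <-neg_mul, zpow_mul]; norm_cast
  have e3 : aM ℂ S (t + t⁻¹) = T + T' := by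
    rw [hT, hT', <-map_add]; congr 1; rcases units_eq_one_or δ with rfl | rfl
    . simp
    . simp [add_comm]
  have e4 : qpow S t δ 2 = T ^ 4 := by
    rw [hT, qpow, <-map_pow, <-zpow_natCast t 2, <-zpow_mul, <-zpow_natCast (t ^ (δ : ℤ)) 4, <-zpow_mul]; congr 2; push_cast; ring
  have e5 : qpow S t δ (-1) = T' ^ 2 := by
    rw [hT', qpow, <-map_pow, <-zpow_natCast t 2, <-zpow_mul, <-zpow_natCast (t ^ (-(δ : ℤ))) 2, <-zpow_mul]; congr 2; push_cast; ring
  simp only [X.sqL_of_loop t δ hi, X.sqR_of_loop t δ hi, e4, e5]; have h3 : T' ^ 3 * T ^ 3 = 1 := by rw [<-mul_pow, mul_comm, h, one_pow]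
  rcases units_eq_one_or κ with rfl | rfl
  . obtain ⟨H, h1, h2⟩ := cubic_slot_r T T' a b c h
    have hp : ∀ a b c : S, cubicP t δ 1 a b c = T' ^ 3 * (T ^ 6 * b * c - (T ^ 4 + T ^ 2) * a * c + a * b) := fun a b c => by
      simp only [cubicP, if_true, e1, e2, e3]; clear h1 h2; grind
    simp only [hp]; exact ⟨T' ^ 3 * H, by linear_combination T' ^ 3 * h1, by linear_combination T' ^ 3 * h2⟩
  . obtain ⟨H, h1, h2⟩ := cubic_slot_l T T' a b c h
    have hp : ∀ a b c : S, cubicP t δ (-1) a b c = T' ^ 3 * (a - (T ^ 4 + T ^ 2) * b + T ^ 6 * c) := fun a b c => by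
      simp only [cubicP, show ((-1 : ℤˣ) = 1) = False by simp, if_false, e1, e2, e3]; clear h1 h2; grind
    simp only [hp]; exact ⟨T' ^ 3 * H, by linear_combination T' ^ 3 * h1, by linear_combination T' ^ 3 * h2⟩

variable (i j : X.I0)

/-- The involution `s ↦ -s` of the indices modulo `M`. -/
def reflIdx (s : ℕ) : ℕ := if s = X.M then X.M else X.M - s

lemma prod_sqSet_refl (i j) (f : ℕ -> S) :
    ∏ s ∈ X.sqSet i j, f s = ∏ s ∈ X.sqSet j i, f (X.reflIdx s) := by
  have hc : ∀ (i j : X.I0) s, s ∈ X.sqSet i j -> X.reflIdx s ∈ X.sqSet j i := by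
    intro i j s hs; simp only [sqSet, mem_filter, mem_Icc, reflIdx] at hs ⊢; have := X.M_pos; split_ifs with h
    . subst h; refine ⟨by omega, ?_⟩; rw [c_M, car_symm, <-c_M]; exact hs.2
    . refine ⟨by omega, ?_⟩; rw [X.c_reflect (by omega)]; exact hs.2
  have hr : ∀ (i j : X.I0) s, s ∈ X.sqSet i j -> X.reflIdx (X.reflIdx s) = s := by
    intro i j s hs; simp only [sqSet, mem_filter, mem_Icc] at hs; simp only [reflIdx]; split_ifs <;> omega
  exact Finset.prod_nbij' X.reflIdx X.reflIdx (hc i j) (hc j i) (hr i j) (hr j i)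
    (fun s hs => by rw [hr i j s hs])

lemma reflIdx_spec {s} (hs : s ∈ X.sqSet j i) :
    X.c i (X.reflIdx s) j = X.c j s i ∧ X.zeta ^ X.reflIdx s * X.zeta ^ s = 1 := by
  simp only [sqSet, mem_filter, mem_Icc] at hs; simp only [reflIdx]; split_ifs with h
  . subst h; refine ⟨by rw [c_M, c_M, car_symm], by rw [zeta_pow_M, one_mul]⟩
  . exact ⟨X.c_reflect (by omega) i j, by rw [<-pow_add, Nat.sub_add_cancel hs.1.2, zeta_pow_M]⟩

def reflUnit : ℂ := ∏ s ∈ X.sqSet j i, (-X.zeta ^ X.reflIdx s)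

lemma sqL_swap (a b : S) :
    X.sqL t δ i j a b = aM ℂ S (X.reflUnit i j) * X.sqR t δ j i b a := by
  rw [sqL, prod_sqSet_refl, reflUnit, map_prod, sqR, <-prod_mul_distrib]; refine prod_congr rfl fun s hs => ?_
  obtain ⟨h1, h2⟩ := X.reflIdx_spec i j hs; have h3 := congrArg (aM ℂ S) h2
  simp only [map_mul, map_one, map_neg, h1] at h3 ⊢; linear_combination -a * h3

lemma sqR_swap (a b : S) :
    X.sqR t δ i j a b = aM ℂ S (X.reflUnit i j) * X.sqL t δ j i b a := by
  rw [sqR, prod_sqSet_refl, reflUnit, map_prod, sqL, <-prod_mul_distrib]; refine prod_congr rfl fun s hs => ?_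
  obtain ⟨h1, h2⟩ := X.reflIdx_spec i j hs; have h3 := congrArg (aM ℂ S) h2; simp only [map_mul, map_one, map_neg, h1] at h3 ⊢
  linear_combination -a * aM ℂ S ((t ^ 2) ^ (δ * X.c j s i)) * h3

end TwistedType

end

section

section Slots

variable {G : Type*} [ACG G] {B : Type*} [ACG B] [Module ℂ B]

/-- `F` vanishes where `e * l` is sufficiently negative. -/
def BddFam (l : G →+ ℤ) (e : ℤˣ) (F : G -> B) : Prop := ∃ c, ∀ r, F r ≠ 0 -> c ≤ e * l r

variable {l : G →+ ℤ} {e : ℤˣ}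

omit [Module ℂ B] in
lemma BddFam.add {F F' : G -> B} (h : BddFam l e F) (h' : BddFam l e F') : BddFam l e (F + F') := by
  obtain ⟨c, hc⟩ := h; obtain ⟨c', hc'⟩ := h'; refine ⟨min c c', fun r hr => ?_⟩; by_cases h0 : F r = 0
  . have : F' r ≠ 0 := fun h1 => hr (by simp [h0, h1])
    exact (min_le_right _ _).trans (hc' r this)
  . exact (min_le_left _ _).trans (hc r h0)

lemma BddFam.act {F : G -> B} (h : BddFam l e F) (p : ℂ[G]) :
    BddFam l e (act p F) := by
  induction p using induction_linear with
  | zero => exact ⟨0, fun r hr => absurd (by simp) hr⟩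
  | add p p' hp hp' => rw [map_add]; exact hp.add hp'
  | single g c =>
    obtain ⟨b, hb⟩ := h; refine ⟨b - e * l g, fun r hr => ?_⟩; rw [act_sgl] at hr
    have := hb (r + g) (fun h0 => hr (by rw [h0, smul_zero])); rw [map_add, mul_add] at this; linarith

lemma BddFam.act_lin_inj {F : G -> B} (h : BddFam l e F) {a d} (hα : a ≠ 0) (hβ : d ≠ 0)
    {s b : G} (hs : l s = 1) (hb : l b = 0)
    (h0 : _root_.act (aM ℂ _ a * AddMonoidAlgebra.single s 1 - aM ℂ _ d * AddMonoidAlgebra.single b 1) F = 0) : F = 0 := by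
  have h1 : ∀ r, a • F (r + s) = d • F (r + b) := by
    intro r; have := congrFun h0 r
    simp only [act_sub, act_mul, act_aM, Pi.sub_apply, Pi.smul_apply, act_sgl, one_smul, Pi.zero_apply] at this
    exact sub_eq_zero.mp this
  obtain ⟨c, hc⟩ := h; funext r; by_contra hr; change F r ≠ 0 at hr; rcases units_eq_one_or e with rfl | rfl
  . have key : ∀ n : ℕ, F (r + n • (b - s)) ≠ 0 := by
      intro n; induction n with
      | zero => simpa using hr
      | succ n ih =>
        intro h2; have := h1 (r + (n + 1) • (b - s) - b); rw [sub_add_cancel, h2, smul_zero] at this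
        rw [show r + (n + 1) • (b - s) - b + s = r + n • (b - s) by
          rw [add_smul, one_smul]; abel] at this
        exact ih ((smul_eq_zero.mp this).resolve_left hα)
    have := hc _ (key (1 * l r - c + 1).toNat); simp only [map_add, map_nsmul, map_sub, hs, hb] at this; simp at this; omega
  . have key : ∀ n : ℕ, F (r + n • (s - b)) ≠ 0 := by
      intro n; induction n with
      | zero => simpa using hr
      | succ n ih =>
        intro h2; have := h1 (r + (n + 1) • (s - b) - s); rw [sub_add_cancel, h2, smul_zero] at this
        rw [show r + (n + 1) • (s - b) - s + b = r + n • (s - b) by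
          rw [add_smul, one_smul]; abel] at this
        exact ih ((smul_eq_zero.mp this.symm).resolve_left hβ)
    have := hc _ (key (-1 * l r - c + 1).toNat); simp only [map_add, map_nsmul, map_sub, hs, hb] at this; simp at this; omega

end Slots

section Words

variable {B : Type*} [Ring B] [Algebra ℂ B]

def wordSum (p : Fin 6 -> ℂ[ℤ × ℤ × ℤ]) (A C D : ℤ -> B) : ℤ × ℤ × ℤ -> B :=
  act (p 0) (fun r => A r.1 * C r.2.1 * D r.2.2) + act (p 1) (fun r => A r.1 * D r.2.2 * C r.2.1) +
  act (p 2) (fun r => C r.2.1 * A r.1 * D r.2.2) + act (p 3) (fun r => C r.2.1 * D r.2.2 * A r.1) +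
  act (p 4) (fun r => D r.2.2 * A r.1 * C r.2.1) + act (p 5) (fun r => D r.2.2 * C r.2.1 * A r.1)

/-- The exchange relation `P A(a) C(b) = Q C(b) A(a)`. -/
def Exch (P Q : ℂ[ℤ × ℤ]) (A C : ℤ -> B) : Prop := act P (fun r => A r.1 * C r.2) = act Q (fun r => C r.2 * A r.1)

lemma Exch.lift {P Q : ℂ[ℤ × ℤ]} {A C : ℤ -> B} (h : Exch P Q A C)
    {G : Type*} [AddCommMonoid G] (f : ℤ × ℤ →+ G) (W W' : G -> B)
    (hW : ∀ s, ∃ (x y : B) (o : ℤ × ℤ), ∀ p, W (s + f p) = x * (A (o + p).1 * C (o + p).2) * y ∧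
      W' (s + f p) = x * (C (o + p).2 * A (o + p).1) * y) :
    act (mdC f P) W = act (mdC f Q) W' := by
  funext s; obtain ⟨x, y, o, hp⟩ := hW s
  rw [act_map f ((mulLeft ℂ x).comp (mulRight ℂ y)) P
      (fun r => A r.1 * C r.2) W o s (fun a => by rw [(hp a).1]; simp [mul_assoc]),
    act_map f ((mulLeft ℂ x).comp (mulRight ℂ y)) Q
      (fun r => C r.2 * A r.1) W' o s (fun a => by rw [(hp a).2]; simp [mul_assoc]), h]

def ins12 : ℤ × ℤ →+ ℤ × ℤ × ℤ where
  toFun p := (p.1, p.2, 0)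
  map_zero' := rfl
  map_add' _ _ := by ext <;> simp
def ins13 : ℤ × ℤ →+ ℤ × ℤ × ℤ where
  toFun p := (p.1, 0, p.2)
  map_zero' := rfl
  map_add' _ _ := by ext <;> simp
def ins23 : ℤ × ℤ →+ ℤ × ℤ × ℤ where
  toFun p := (0, p.1, p.2)
  map_zero' := rfl
  map_add' _ _ := by ext <;> simp
def insSwap : ℤ × ℤ →+ ℤ × ℤ where
  toFun p := (p.2, p.1)
  map_zero' := rfl
  map_add' _ _ := rfl

/-- The variables of three-variable Laurent polynomials. -/
def V0 : ℂ[ℤ × ℤ × ℤ] := AddMonoidAlgebra.single (1, 0, 0) 1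
def V1 : ℂ[ℤ × ℤ × ℤ] := AddMonoidAlgebra.single (0, 1, 0) 1
def V2 : ℂ[ℤ × ℤ × ℤ] := AddMonoidAlgebra.single (0, 0, 1) 1

variable {A C D : ℤ -> B}

lemma Exch.lift_word {P Q : ℂ[ℤ × ℤ]} (h : Exch P Q A C) (D : ℤ -> B) {f : ℤ × ℤ →+ ℤ × ℤ × ℤ}
    {a b d : ℤ × ℤ × ℤ →+ ℤ} (hf : ∀ p, a (f p) = p.1 ∧ b (f p) = p.2 ∧ d (f p) = 0) :
    act (mdC f P) (fun r => A (a r) * C (b r) * D (d r)) = act (mdC f Q) (fun r => C (b r) * A (a r) * D (d r)) ∧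
    act (mdC f P) (fun r => D (d r) * A (a r) * C (b r)) = act (mdC f Q) (fun r => D (d r) * C (b r) * A (a r)) :=
  ⟨h.lift _ _ _ fun s => ⟨1, D (d s), (a s, b s), fun p => by simp [hf]⟩,
   h.lift _ _ _ fun s => ⟨D (d s), 1, (a s, b s), fun p => by simp [hf, mul_assoc]⟩⟩

lemma ins_zero {q0 q1 q2 q3 q4 q5 : ℂ[ℤ × ℤ × ℤ]} {L R L' R' L'' R'' : ℂ[ℤ × ℤ]} {Y A C : ℤ -> B}
    {e : ℤˣ} {a b d : ℤ × ℤ × ℤ →+ ℤ} {f g h : ℤ × ℤ →+ ℤ × ℤ × ℤ}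
    (hf : ∀ p, a (f p) = p.1 ∧ b (f p) = p.2 ∧ d (f p) = 0) (hg : ∀ p, a (g p) = p.1 ∧ d (g p) = p.2 ∧ b (g p) = 0)
    (hh : ∀ p, b (h p) = p.1 ∧ d (h p) = p.2 ∧ a (h p) = 0) (hY : ∃ c, ∀ r, Y r ≠ 0 -> c ≤ (e : ℤ) * r)
    (h1 : Exch L R Y A) (h2 : Exch L' R' Y C) (h3 : Exch L'' R'' A C)
    (i1 : ∀ F : ℤ × ℤ × ℤ -> B, BddFam a e F -> act (mdC f L) F = 0 -> F = 0)
    (i2 : ∀ F : ℤ × ℤ × ℤ -> B, BddFam a e F -> act (mdC g L') F = 0 -> F = 0)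
    (ids : ∃ H, q0 * (mdC f R * mdC g R')
        + q2 * (mdC f L * mdC g R')
        + q3 * (mdC f L * mdC g L') = H * mdC h L'' ∧
      q1 * (mdC f R * mdC g R')
        + q4 * (mdC g L' * mdC f R)
        + q5 * (mdC f L * mdC g L') = -H * mdC h R'') :
    act q0 (fun r => Y (a r) * A (b r) * C (d r)) + act q1 (fun r => Y (a r) * C (d r) * A (b r)) +
      act q2 (fun r => A (b r) * Y (a r) * C (d r)) + act q3 (fun r => A (b r) * C (d r) * Y (a r)) +
      act q4 (fun r => C (d r) * Y (a r) * A (b r)) + act q5 (fun r => C (d r) * A (b r) * Y (a r)) = 0 := by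
  obtain ⟨H, id1, id2⟩ := ids; obtain ⟨c, hY⟩ := hY
  have bdd : ∀ {W : ℤ × ℤ × ℤ -> B} (p : ℂ[ℤ × ℤ × ℤ]), (∀ r, Y (a r) = 0 -> W r = 0) -> BddFam a e (act p W) :=
    fun p hW => BddFam.act ⟨c, fun r hr => hY _ fun h0 => hr (hW r h0)⟩ p
  have hb := (((((bdd q0 (W := fun r => Y (a r) * A (b r) * C (d r)) fun r hr => by simp [hr]).add
    (bdd q1 (W := fun r => Y (a r) * C (d r) * A (b r)) fun r hr => by simp [hr])).add
    (bdd q2 (W := fun r => A (b r) * Y (a r) * C (d r)) fun r hr => by simp [hr])).add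
    (bdd q3 (W := fun r => A (b r) * C (d r) * Y (a r)) fun r hr => by simp [hr])).add
    (bdd q4 (W := fun r => C (d r) * Y (a r) * A (b r)) fun r hr => by simp [hr])).add
    (bdd q5 (W := fun r => C (d r) * A (b r) * Y (a r)) fun r hr => by simp [hr])
  refine i2 _ hb (i1 _ (hb.act _) ?_)
  obtain ⟨e1, e4⟩ := h1.lift_word C hf; obtain ⟨e3, e2⟩ := h2.lift_word A hg; have e5 := (h3.lift_word Y hh).1
  generalize mdC f L = LU at *; generalize mdC f R = RU at *; generalize mdC g L' = LV at *; generalize mdC g R' = RV at *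
  have via : ∀ (q : ℂ[ℤ × ℤ × ℤ]) {p p' : ℂ[ℤ × ℤ × ℤ]} {F F' : ℤ × ℤ × ℤ -> B}, act p F = act p' F' ->
      act (q * p) F = act (q * p') F' := fun q _ _ _ _ h => by rw [act_mul, h, <-act_mul]
  rw [<-act_mul]; simp only [map_add, <-act_mul]
  rw [show LU * LV * q0 = q0 * LV * LU by ring, via _ e1, show q0 * LV * RU = q0 * RU * LV by ring, via _ e2,
    show LU * LV * q1 = q1 * LU * LV by ring, via _ e3, show q1 * LU * RV = q1 * RV * LU by ring, via _ e4,
    show LU * LV * q2 = q2 * LU * LV by ring, via _ e2, show LU * LV * q4 = q4 * LV * LU by ring, via _ e4]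
  have := congrArg₂ (fun p p' => act p (fun r => A (b r) * C (d r) * Y (a r)) + act p' fun r => C (d r) * A (b r) * Y (a r)) id1 id2
  simp only [act_add, neg_mul, act_neg, via H e5, add_neg_cancel] at this; rw [<-this]; simp only [mul_comm, mul_left_comm]; abel

lemma ins_U : mdC ins12 U0 = V0 ∧ mdC ins12 U1 = V1 ∧ mdC ins13 U0 = V0 ∧ mdC ins13 U1 = V2 ∧ mdC ins23 U0 = V1 ∧ mdC ins23 U1 = V2 ∧
    mdC (ins12.comp insSwap) U0 = V1 ∧
    mdC (ins12.comp insSwap) U1 = V0 ∧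
    mdC (ins13.comp insSwap) U0 = V2 ∧
    mdC (ins13.comp insSwap) U1 = V0 ∧
    mdC (ins23.comp insSwap) U0 = V2 ∧
    mdC (ins23.comp insSwap) U1 = V1 := by
  simp only [mapDomainAlgHom_apply, U0, U1, V0, V1, V2, mapDomain_single]; simp [ins12, ins13, ins23, insSwap]

lemma commtr_wordSum {A' C' D' : ℤ -> B} (z : B) (hA : ∀ m, z * A m - A m * z = A' m)
    (hC : ∀ m, z * C m - C m * z = C' m) (hD : ∀ m, z * D m - D m * z = D' m)
    (p : Fin 6 -> ℂ[ℤ × ℤ × ℤ]) (r : ℤ × ℤ × ℤ) :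
    z * wordSum p A C D r - wordSum p A C D r * z = wordSum p A' C D r + wordSum p A C' D r + wordSum p A C D' r := by
  have key : ∀ (q : ℂ[ℤ × ℤ × ℤ]) (W W1 W2 W3 : ℤ × ℤ × ℤ -> B), (∀ s, z * W s - W s * z = W1 s + W2 s + W3 s) ->
      z * act q W r - act q W r * z = act q W1 r + act q W2 r + act q W3 r := by
    intro q W W1 W2 W3 h; have := act_comp (mulLeft ℂ z - mulRight ℂ z) q W r
    simp only [subL, mulLeft_apply, LinearMap.mulRight_apply, h] at this
    rw [<-this, show (fun a => W1 a + W2 a + W3 a) = W1 + W2 + W3 from rfl, map_add, map_add]; rfl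
  have word : ∀ a b c a' b' c' : B, z * a - a * z = a' -> z * b - b * z = b' -> z * c - c * z = c' ->
      z * (a * b * c) - a * b * c * z = a' * b * c + a * b' * c + a * b * c' := by
    rintro a b c _ _ _ rfl rfl rfl; noncomm_ring
  simp only [wordSum, Pi.add_apply, mul_add, add_mul]
  have k0 := key (p 0) _ _ _ _ (fun s => word _ _ _ _ _ _ (hA s.1) (hC s.2.1) (hD s.2.2))
  have k1 := key (p 1) _ _ _ _ (fun s => word _ _ _ _ _ _ (hA s.1) (hD s.2.2) (hC s.2.1))
  have k2 := key (p 2) _ _ _ _ (fun s => word _ _ _ _ _ _ (hC s.2.1) (hA s.1) (hD s.2.2))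
  have k3 := key (p 3) _ _ _ _ (fun s => word _ _ _ _ _ _ (hC s.2.1) (hD s.2.2) (hA s.1))
  have k4 := key (p 4) _ _ _ _ (fun s => word _ _ _ _ _ _ (hD s.2.2) (hA s.1) (hC s.2.1))
  have k5 := key (p 5) _ _ _ _ (fun s => word _ _ _ _ _ _ (hD s.2.2) (hC s.2.1) (hA s.1))
  rw [sub_eq_iff_eq_add.mp k0, sub_eq_iff_eq_add.mp k1, sub_eq_iff_eq_add.mp k2,
    sub_eq_iff_eq_add.mp k3, sub_eq_iff_eq_add.mp k4, sub_eq_iff_eq_add.mp k5]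
  abel

lemma wordSum_lin (p : Fin 6 -> ℂ[ℤ × ℤ × ℤ]) (A C D E : ℤ -> B) :
    wordSum p (A - E) C D = wordSum p A C D - wordSum p E C D ∧
    wordSum p C (A - E) D = wordSum p C A D - wordSum p C E D ∧
    wordSum p C D (A - E) = wordSum p C D A - wordSum p C D E := by
  have e : ∀ f g : ℤ × ℤ × ℤ -> B, (fun r => f r - g r) = f - g := fun _ _ => rfl
  refine ⟨?_, ?_, ?_⟩ <;>
  . simp only [wordSum, Pi.sub_apply, sub_mul, mul_sub, e, map_sub]; abel

end Words

section Quad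

variable {B : Type*} [Ring B] [Algebra ℂ B]

def exchDefect (P Q : ℂ[ℤ × ℤ]) (A C : ℤ -> B) : ℤ × ℤ -> B := act P (fun r => A r.1 * C r.2) - act Q (fun r => C r.2 * A r.1)

lemma exch_zero {P Q : ℂ[ℤ × ℤ]} {A C : ℤ -> B} :
    exchDefect P Q A C = 0 ↔ Exch P Q A C := sub_eq_zero

lemma commtr_exch {A C A' C' : ℤ -> B} (z : B) (hA : ∀ m, z * A m - A m * z = A' m)
    (hC : ∀ m, z * C m - C m * z = C' m) (P Q : ℂ[ℤ × ℤ]) (r) :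
    z * exchDefect P Q A C r - exchDefect P Q A C r * z = exchDefect P Q A' C r + exchDefect P Q A C' r := by
  have key : ∀ (q : ℂ[ℤ × ℤ]) (W W1 W2 : ℤ × ℤ -> B), (∀ s, z * W s - W s * z = W1 s + W2 s) ->
      z * act q W r - act q W r * z = act q W1 r + act q W2 r := by
    intro q W W1 W2 h; have := act_comp (mulLeft ℂ z - mulRight ℂ z) q W r
    simp only [subL, mulLeft_apply, LinearMap.mulRight_apply, h] at this
    rw [<-this, show (fun a => W1 a + W2 a) = W1 + W2 from rfl, map_add]; rfl
  have word : ∀ a b a' b' : B, z * a - a * z = a' -> z * b - b * z = b' ->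
      z * (a * b) - a * b * z = a' * b + a * b' := by
    rintro a b _ _ rfl rfl; noncomm_ring
  have k0 := key P _ _ _ (fun s => word _ _ _ _ (hA s.1) (hC s.2)); have k1 := key Q _ _ _ (fun s => word _ _ _ _ (hC s.2) (hA s.1))
  simp only [exchDefect, Pi.sub_apply, mul_sub, sub_mul]; rw [sub_eq_iff_eq_add.mp k0, sub_eq_iff_eq_add.mp k1]; abel

lemma Exch.shift {P Q : ℂ[ℤ × ℤ]} {A C : ℤ -> B} (h : Exch P Q A C) (c : ℂ)
    (s : ℤ) : Exch P Q (fun m => c • A (s + m)) C := by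
  have e : ∀ (p : ℂ[ℤ × ℤ]) (F : ℤ × ℤ -> B), act p (fun r => c • F (r + (s, 0))) = fun r => c • act p F (r + (s, 0)) := by
    intro p F; funext r; have h1 := act_comp (LinearMap.lsmul ℂ B c) p (fun r => F (r + (s, 0))) r; rw [act_shift] at h1; exact h1
  have e1 := e P (fun r => A r.1 * C r.2); have e2 := e Q (fun r => C r.2 * A r.1); rw [h] at e1
  have := e1.trans e2.symm; unfold Exch; simpa [add_comm s] using this

end Quad

end

section

structure PreRep (X : TwistedType) (t : ℂ) (O : X.I0 -> ℤ) (B : Type*) [Ring B] [Algebra ℂ B] where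
  x : ℤˣ -> X.I0 -> ℤ -> B
  phi : ℤˣ -> X.I0 -> ℤ -> B
  inv : ℤˣ -> X.I0 -> B
  x_zero : ∀ J i r, ¬ (X.N i : ℤ) ∣ r -> x J i r = 0
  phi_dvd : ∀ J i r, ¬ (X.N i : ℤ) ∣ r -> phi J i r = 0
  phi_van : ∀ (J : ℤˣ) i r, (J : ℤ) * (r - ℓ O J i) < 0 -> phi J i r = 0
  phi_comm : ∀ J ε' i j r r', phi J i r * phi ε' j r' = phi ε' j r' * phi J i r
  lead_inv : ∀ J i, phi J i (ℓ O J i) * inv J i = 1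
  inv_lead : ∀ J i, inv J i * phi J i (ℓ O J i) = 1
  phi_x : ∀ (J δ : ℤˣ) i j (k : ℕ) m, phi J i (ℓ O J i + (J : ℤ) * k) * x δ j m =
    twist J (X.gam t J δ i j) (fun k m => x δ j m * phi J i (ℓ O J i + (J : ℤ) * k)) k m
  x_x : ∀ i j r s, x 1 i r * x (-1) j s - x (-1) j s * x 1 i r =
    if i = j ∧ (X.N i : ℤ) ∣ s then
      (X.qi t i - (X.qi t i)⁻¹)⁻¹ • (phi 1 i (r + s) - phi (-1) i (r + s)) else 0

namespace TwistedType

variable (X) 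

lemma sqL_inj {B : Type*} [ACG B] [Module ℂ B] {l : ℤ × ℤ × ℤ →+ ℤ} {e : ℤˣ} (ht : t ≠ 0) (δ : ℤˣ)
    (i j : X.I0) {f : ℤ × ℤ →+ ℤ × ℤ × ℤ} (hl : ∀ p, l (f p) = p.1) (F : ℤ × ℤ × ℤ -> B) (hF : BddFam l e F)
    (h0 : act (mdC f (X.sqL t δ i j U0 U1)) F = 0) : F = 0 := by
  rw [X.map_sqL, sqL] at h0; generalize X.sqSet i j = T at h0; induction T using Finset.induction_on with
  | empty => simpa using h0
  | insert a T ha ih =>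
    simp only [mapDomainAlgHom_apply, U0, U1, mapDomain_single] at h0 ih; rw [prod_insert ha, act_mul] at h0
    refine ih ((hF.act _).act_lin_inj (l := l) one_ne_zero ?_ (hl _) (hl _) h0)
    exact mul_ne_zero (pow_ne_zero _ X.zeta_ne) (zpow_ne_zero _ (pow_ne_zero 2 ht))

/-- The quadratic relations with the common factors removed. -/
def _root_.StrongQuad {B : Type*} [Ring B] [Algebra ℂ B] (X : TwistedType) (t : ℂ) (δ : ℤˣ)
    (x : X.I0 -> ℤ -> B) : Prop :=
  ∀ i j, Exch (X.sqL t δ i j U0 U1) (X.sqR t δ i j U0 U1) (x i) (x j)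

lemma mapDomain_sqL {G : Type*} [ACG G] (f : ℤ × ℤ →+ G) (δ : ℤˣ) (i j : X.I0) :
    mdC f (X.sqL t δ i j U0 U1) = X.sqL t δ i j
      (mdC f U0) (mdC f U1) :=
  X.map_sqL t _ _ _ _ _ _

lemma mapDomain_sqR {G : Type*} [ACG G] (f : ℤ × ℤ →+ G) (δ : ℤˣ) (i j : X.I0) :
    mdC f (X.sqR t δ i j U0 U1) = X.sqR t δ i j
      (mdC f U0) (mdC f U1) :=
  X.map_sqR t _ _ _ _ _ _

section Insert

variable {B : Type*} [Ring B] [Algebra ℂ B] {δ : ℤˣ} {Y A C : ℤ -> B} {i j k : X.I0}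

def OneSided (Y : ℤ -> B) : Prop := ∃ (e : ℤˣ) (c : ℤ), ∀ r, Y r ≠ 0 -> c ≤ (e : ℤ) * r

def co0 : ℤ × ℤ × ℤ →+ ℤ := fst _ _
def co1 : ℤ × ℤ × ℤ →+ ℤ := (fst _ _).comp (snd _ _)
def co2 : ℤ × ℤ × ℤ →+ ℤ := (snd _ _).comp (snd _ _)

variable (p : Fin 6 -> ℂ[ℤ × ℤ × ℤ]) (ht : t ≠ 0) (hY : OneSided Y)
include ht hY

lemma wordSum_insert₀ (h1 : Exch (X.sqL t δ i j U0 U1) (X.sqR t δ i j U0 U1) Y A)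
    (h2 : Exch (X.sqL t δ i k U0 U1) (X.sqR t δ i k U0 U1) Y C)
    (h3 : Exch (X.sqL t δ j k U0 U1) (X.sqR t δ j k U0 U1) A C)
    (ids : ∃ H, p 0 * (X.sqR t δ i j V0 V1 * X.sqR t δ i k V0 V2)
        + p 2 * (X.sqL t δ i j V0 V1 * X.sqR t δ i k V0 V2)
        + p 3 * (X.sqL t δ i j V0 V1 * X.sqL t δ i k V0 V2) = H * X.sqL t δ j k V1 V2 ∧
      p 1 * (X.sqR t δ i j V0 V1 * X.sqR t δ i k V0 V2)
        + p 4 * (X.sqL t δ i k V0 V2 * X.sqR t δ i j V0 V1)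
        + p 5 * (X.sqL t δ i j V0 V1 * X.sqL t δ i k V0 V2) = -H * X.sqR t δ j k V1 V2) :
    wordSum p Y A C = 0 := by
  obtain ⟨e, hY⟩ := hY; rw [<-ins_zero (a := co0) (b := co1) (d := co2) (f := ins12) (g := ins13) (h := ins23)
    (fun _ => ⟨rfl, rfl, rfl⟩) (fun _ => ⟨rfl, rfl, rfl⟩) (fun _ => ⟨rfl, rfl, rfl⟩) hY h1 h2 h3
    (X.sqL_inj ht δ _ _ fun _ => rfl) (X.sqL_inj ht δ _ _ fun _ => rfl)
    (by simpa only [mapDomain_sqL, mapDomain_sqR, ins_U] using ids), wordSum]; rfl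

lemma wordSum_insert₁ (h1 : Exch (X.sqL t δ j i U0 U1) (X.sqR t δ j i U0 U1) Y A)
    (h2 : Exch (X.sqL t δ j k U0 U1) (X.sqR t δ j k U0 U1) Y C)
    (h3 : Exch (X.sqL t δ i k U0 U1) (X.sqR t δ i k U0 U1) A C)
    (ids : ∃ H, p 2 * (X.sqR t δ j i V1 V0 * X.sqR t δ j k V1 V2)
        + p 0 * (X.sqL t δ j i V1 V0 * X.sqR t δ j k V1 V2)
        + p 1 * (X.sqL t δ j i V1 V0 * X.sqL t δ j k V1 V2) = H * X.sqL t δ i k V0 V2 ∧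
      p 3 * (X.sqR t δ j i V1 V0 * X.sqR t δ j k V1 V2)
        + p 5 * (X.sqL t δ j k V1 V2 * X.sqR t δ j i V1 V0)
        + p 4 * (X.sqL t δ j i V1 V0 * X.sqL t δ j k V1 V2) = -H * X.sqR t δ i k V0 V2) :
    wordSum p A Y C = 0 := by
  obtain ⟨e, hY⟩ := hY; rw [<-ins_zero (a := co1) (b := co0) (d := co2) (f := (ins12.comp insSwap)) (g := ins23) (h := ins13)
    (fun _ => ⟨rfl, rfl, rfl⟩) (fun _ => ⟨rfl, rfl, rfl⟩) (fun _ => ⟨rfl, rfl, rfl⟩) hY h1 h2 h3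
    (X.sqL_inj ht δ _ _ fun _ => rfl) (X.sqL_inj ht δ _ _ fun _ => rfl)
    (by simpa only [mapDomain_sqL, mapDomain_sqR, ins_U] using ids), wordSum]; simp only [co0, co1, co2, AddMonoidHom.comp_apply, coe_fst, coe_snd]; abel

lemma wordSum_insert₂ (h1 : Exch (X.sqL t δ k i U0 U1) (X.sqR t δ k i U0 U1) Y A)
    (h2 : Exch (X.sqL t δ k j U0 U1) (X.sqR t δ k j U0 U1) Y C)
    (h3 : Exch (X.sqL t δ i j U0 U1) (X.sqR t δ i j U0 U1) A C)
    (ids : ∃ H, p 4 * (X.sqR t δ k i V2 V0 * X.sqR t δ k j V2 V1)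
        + p 1 * (X.sqL t δ k i V2 V0 * X.sqR t δ k j V2 V1)
        + p 0 * (X.sqL t δ k i V2 V0 * X.sqL t δ k j V2 V1) = H * X.sqL t δ i j V0 V1 ∧
      p 5 * (X.sqR t δ k i V2 V0 * X.sqR t δ k j V2 V1)
        + p 3 * (X.sqL t δ k j V2 V1 * X.sqR t δ k i V2 V0)
        + p 2 * (X.sqL t δ k i V2 V0 * X.sqL t δ k j V2 V1) = -H * X.sqR t δ i j V0 V1) :
    wordSum p A C Y = 0 := by
  obtain ⟨e, hY⟩ := hY; rw [<-ins_zero (a := co2) (b := co0) (d := co1) (f := (ins13.comp insSwap)) (g := (ins23.comp insSwap)) (h := ins12)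
    (fun _ => ⟨rfl, rfl, rfl⟩) (fun _ => ⟨rfl, rfl, rfl⟩) (fun _ => ⟨rfl, rfl, rfl⟩) hY h1 h2 h3
    (X.sqL_inj ht δ _ _ fun _ => rfl) (X.sqL_inj ht δ _ _ fun _ => rfl)
    (by simpa only [mapDomain_sqL, mapDomain_sqR, ins_U] using ids), wordSum]; simp only [co0, co1, co2, AddMonoidHom.comp_apply, coe_fst, coe_snd]; abel

end Insert

end TwistedType

end

section

namespace TwistedType

variable (X) (t)

/-- The coefficients of the six words in a Serre relation. -/
def serWords (d : ℤˣ) (i j : X.I0) : Fin 6 -> ℂ[ℤ × ℤ × ℤ] := ![X.serreP t d i j V0 V1, -(X.serTwo t _ i j) * X.serreP t d i j V0 V1,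
    X.serreP t d i j V1 V0, -(X.serTwo t _ i j) * X.serreP t d i j V1 V0,
    X.serreP t d i j V0 V1, X.serreP t d i j V1 V0]

/-- The coefficients of the six words in a cubic relation. -/
def cubicWords (d k : ℤˣ) : Fin 6 -> ℂ[ℤ × ℤ × ℤ] := ![cubicP t d k V0 V1 V2, cubicP t d k V0 V2 V1, cubicP t d k V1 V0 V2,
    cubicP t d k V1 V2 V0, cubicP t d k V2 V0 V1, cubicP t d k V2 V1 V0]

end TwistedType

namespace PreRep

variable {B : Type*} [Ring B] [Algebra ℂ B]
  (P : PreRep X t O B)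

lemma oneSided_phi (J : ℤˣ) (i) (c : ℂ) (s : ℤ) :
    TwistedType.OneSided (fun m => c • P.phi J i (s + m)) := by
  refine ⟨J, J * (ℓ O J i - s), fun r hr => ?_⟩; by_contra h; refine hr ?_; change c • P.phi J i (s + r) = 0
  rw [P.phi_van J i _ (by linear_combination (exp := 1) not_le.mp h), smul_zero]

lemma exch_phi (ht : t ≠ 0) (J d i j) :
    Exch (X.sqL t d i j U0 U1) (X.sqR t d i j U0 U1) (P.phi J i) (P.x d j) := by
  have e : ∀ r, 0 ≤ J * (r - ℓ O J i) -> ℓ O J i + J * (J * (r - ℓ O J i)).toNat = r := by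
    intro r hr; rw [Int.toNat_of_nonneg hr, <-mul_assoc, <-val_mul, units_mul_self]; simp
  have := X.act_sqL_ext ht J d (ℓ O J i) i j
    (fun k m => P.x d j m * P.phi J i (ℓ O J i + J * k))
  unfold Exch; convert this using 2
  . funext ⟨r, m⟩; simp only [extFam]; split_ifs with h
    . rw [<-P.phi_x, e r h]
    . rw [P.phi_van J i r (not_le.mp h), zero_mul]
  . funext ⟨r, m⟩; simp only [extFam]; split_ifs with h
    . rw [e r h]
    . rw [P.phi_van J i r (not_le.mp h), mul_zero]

lemma comm_x (d k i r) : ∃ c : ℂ, ∀ m, P.x d k r * P.x (-d) i m - P.x (-d) i m * P.x d k r =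
      c • P.phi 1 i (r + m) - c • P.phi (-1) i (r + m) := by
  by_cases hr : (X.N k : ℤ) ∣ r
  . by_cases hk : k = i
    . subst hk; refine ⟨(d : ℤ) • (X.qi t k - (X.qi t k)⁻¹)⁻¹, fun m => ?_⟩; by_cases hm : (X.N k : ℤ) ∣ m
      . rcases units_eq_one_or d with rfl | rfl
        . rw [P.x_x, if_pos ⟨rfl, hm⟩]; simp [smul_sub]
        . have := P.x_x k k m r; rw [if_pos ⟨rfl, hr⟩] at this; rw [neg_neg, <-neg_sub, this, add_comm m]
          simp [smul_sub]; abel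
      . have h : ¬ (X.N k : ℤ) ∣ r + m := fun h => hm ((Int.dvd_add_right hr).mp h)
        rw [P.x_zero _ _ _ hm, P.phi_dvd _ _ _ h, P.phi_dvd _ _ _ h]; simp
    . refine ⟨0, fun m => ?_⟩; rcases units_eq_one_or d with rfl | rfl
      . rw [P.x_x, if_neg (by tauto)]; simp
      . have := P.x_x i k m r; rw [if_neg (by tauto)] at this; rw [neg_neg, <-neg_sub, this]; simp
  . exact ⟨0, fun m => by rw [P.x_zero _ _ _ hr]; simp⟩

lemma comm_quad (ht : t ≠ 0) (u k i j r s) :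
    Commute (P.x u k r)
      (exchDefect (X.sqL t (-u) i j U0 U1) (X.sqR t (-u) i j U0 U1) (P.x (-u) i) (P.x (-u) j) s) := by
  obtain ⟨c, hc⟩ := P.comm_x u k i r; obtain ⟨d, hd⟩ := P.comm_x u k j r
  have h := commtr_exch (P.x u k r) hc hd (X.sqL t (-u) i j U0 U1)
    (X.sqR t (-u) i j U0 U1) s
  have e1 : ∀ (J : ℤˣ) (c : ℂ), exchDefect (X.sqL t (-u) i j U0 U1) (X.sqR t (-u) i j U0 U1)
        (fun m => c • P.phi J i (r + m)) (P.x (-u) j) = 0 := fun J c =>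
    exch_zero.mpr ((P.exch_phi ht J (-u) i j).shift c r)
  have e2 : ∀ (J : ℤˣ) (c : ℂ), exchDefect (X.sqL t (-u) i j U0 U1) (X.sqR t (-u) i j U0 U1) (P.x (-u) i)
        (fun m => c • P.phi J j (r + m)) = 0 := fun J c => by
    have h1 := ((P.exch_phi ht J (-u) j i).shift c r).lift insSwap
      (fun r' => c • P.phi J j (r + r'.2) * P.x (-u) i r'.1)
      (fun r' => P.x (-u) i r'.1 * c • P.phi J j (r + r'.2))
      (fun s => ⟨1, 1, (s.2, s.1), fun p => by simp [insSwap, add_comm]⟩)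
    rw [X.mapDomain_sqL, X.mapDomain_sqR] at h1; have u0 : mdC insSwap U0 = U1 := by simp [U0, U1, insSwap, mapDomain_single]
    have u1 : mdC insSwap U1 = U0 := by simp [U0, U1, insSwap, mapDomain_single]
    rw [u0, u1] at h1; rw [exchDefect, X.sqL_swap t (-u) i j, X.sqR_swap t (-u) i j, act_mul, act_mul, h1, sub_self]
  have lin : ∀ (p q : ℂ[ℤ × ℤ]) (A C E : ℤ -> B), exchDefect p q (A - E) C = exchDefect p q A C - exchDefect p q E C ∧
      exchDefect p q C (A - E) = exchDefect p q C A - exchDefect p q C E := by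
    intro p q A C E; have e : ∀ f g : ℤ × ℤ -> B, (fun r => f r - g r) = f - g := fun _ _ => rfl
    constructor <;>
    . simp only [exchDefect, Pi.sub_apply, sub_mul, mul_sub, e, map_sub]; abel
  have e : ∀ f g : ℤ -> B, (fun r => f r - g r) = f - g := fun _ _ => rfl
  rw [e, e, (lin _ _ _ _ _).1, (lin _ _ _ _ _).2, e1, e1, e2, e2] at h; refine sub_eq_zero.mp (h.trans ?_); simp

lemma comm_wordSum (u : ℤˣ) (k i j l) (r : ℤ) (s : ℤ × ℤ × ℤ)
    (p : Fin 6 -> ℂ[ℤ × ℤ × ℤ])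
    (h0 : ∀ (J : ℤˣ) (c : ℂ), wordSum p (fun m => c • P.phi J i (r + m)) (P.x (-u) j) (P.x (-u) l) = 0)
    (h1 : ∀ (J : ℤˣ) (c : ℂ), wordSum p (P.x (-u) i) (fun m => c • P.phi J j (r + m)) (P.x (-u) l) = 0)
    (h2 : ∀ (J : ℤˣ) (c : ℂ), wordSum p (P.x (-u) i) (P.x (-u) j) (fun m => c • P.phi J l (r + m)) = 0) :
    Commute (P.x u k r) (wordSum p (P.x (-u) i) (P.x (-u) j) (P.x (-u) l) s) := by
  obtain ⟨c, hc⟩ := P.comm_x u k i r; obtain ⟨d, hd⟩ := P.comm_x u k j r; obtain ⟨d', hd'⟩ := P.comm_x u k l r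
  have h := commtr_wordSum (P.x u k r) hc hd hd' p s; have e : ∀ f g : ℤ -> B, (fun r => f r - g r) = f - g := fun _ _ => rfl
  rw [e, e, e, (wordSum_lin _ _ _ _ _).1, (wordSum_lin _ _ _ _ _).2.1, (wordSum_lin _ _ _ _ _).2.2, h0, h0, h1, h1, h2, h2] at h
  refine sub_eq_zero.mp (h.trans ?_); simp

variable (ht : t ≠ 0)
include ht

lemma comm_ser {d : ℤˣ} (hq : StrongQuad X t (-d) (P.x (-d))) (k : X.I0) {i j : X.I0}
    (hij : X.cartan i j = -1) (r : ℤ) (s : ℤ × ℤ × ℤ) :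
    Commute (P.x d k r)
      (wordSum (X.serWords t (-d) i j) (P.x (-d) i) (P.x (-d) i) (P.x (-d) j) s) := by
  have ex := fun (i j : X.I0) J c => (P.exch_phi ht J (-d) i j).shift c r
  refine P.comm_wordSum d k i i j r s _ (fun J c => ?_) (fun J c => ?_) (fun J c => ?_)
  . refine X.wordSum_insert₀ _ ht (P.oneSided_phi J i c r) (ex i i J c) (ex i j J c) (hq i j) ?_
    exact (X.ser_identities (-d) ht hij V0 V1 V2).1
  . refine X.wordSum_insert₁ _ ht (P.oneSided_phi J i c r) (ex i i J c) (ex i j J c) (hq i j) ?_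
    exact (X.ser_identities (-d) ht hij V1 V0 V2).1
  . refine X.wordSum_insert₂ _ ht (P.oneSided_phi J j c r) (ex j i J c) (ex j i J c) (hq i i) ?_
    exact (X.ser_identities (-d) ht hij V0 V1 V2).2

lemma comm_cubic {d : ℤˣ} (hq : StrongQuad X t (-d) (P.x (-d))) (k) {i}
    (hi : X.c i 1 i = -1) (e : ℤˣ) (r : ℤ) (s : ℤ × ℤ × ℤ) :
    Commute (P.x d k r)
      (wordSum (TwistedType.cubicWords t (-d) e) (P.x (-d) i) (P.x (-d) i) (P.x (-d) i) s) := by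
  have ex := fun (i j : X.I0) J c => (P.exch_phi ht J (-d) i j).shift c r
  refine P.comm_wordSum d k i i i r s _ (fun J c => ?_) (fun J c => ?_) (fun J c => ?_)
  . refine X.wordSum_insert₀ _ ht (P.oneSided_phi J i c r) (ex i i J c) (ex i i J c) (hq i i) ?_
    exact X.cubic_identities (-d) ht e hi V0 V1 V2
  . refine X.wordSum_insert₁ _ ht (P.oneSided_phi J i c r) (ex i i J c) (ex i i J c) (hq i i) ?_
    exact X.cubic_identities (-d) ht e hi V1 V0 V2
  . refine X.wordSum_insert₂ _ ht (P.oneSided_phi J i c r) (ex i i J c) (ex i i J c) (hq i i) ?_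
    exact X.cubic_identities (-d) ht e hi V2 V0 V1

end PreRep

end

section

section LogDeriv

variable {R : Type*} [Ring R] [Algebra ℂ R]

def eulerOp (u : PowerSeries R) : PowerSeries R := pmk fun k => (k : ℂ) • coeff k u

lemma cf_euler (u : PowerSeries R) (k : ℕ) :
    coeff k (eulerOp u) = (k : ℂ) • coeff k u := by simp [eulerOp]

lemma euler_mul (u v : PowerSeries R) : eulerOp (u * v) = eulerOp u * v + u * eulerOp v := by
  ext k; simp only [map_add, cf_euler, coeff_mul, smul_sum]; rw [<-sum_add_distrib]; refine sum_congr rfl fun p hp => ?_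
  rw [smul_mul_assoc, mul_smul_comm, <-add_smul, <-Finset.HasAntidiagonal.mem_antidiagonal.mp hp]; push_cast; rfl

lemma euler_one : eulerOp (1 : PowerSeries R) = 0 := by ext k; rcases k with _ | k <;> simp [cf_euler, PowerSeries.coeff_one]

omit [Algebra ℂ R] in
lemma ser_comm {u v : PowerSeries R}
    (h : ∀ k l, Commute (coeff k u) (coeff l v)) : u * v = v * u := by
  ext k; rw [coeff_mul, coeff_mul, <-Finset.Nat.sum_antidiagonal_swap]; exact sum_congr rfl fun p _ => h _ _

lemma euler_pow {u : PowerSeries R} (h : u * eulerOp u = eulerOp u * u) (n : ℕ) :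
    eulerOp (u ^ (n + 1)) = ((n + 1 : ℕ) : ℂ) • (eulerOp u * u ^ n) := by
  induction n with
  | zero => simp
  | succ n ih =>
    have hc : Commute (eulerOp u) u := h.symm
    rw [pow_succ, euler_mul, ih, smul_mul_assoc, mul_assoc, <-pow_succ, <-(hc.pow_right (n + 1)).eq]
    push_cast; rw [add_smul (n + 1 : ℂ), one_smul]

lemma expCoeff_rec {a : ℕ -> R} (ha : ∀ k l, Commute (a k) (a l)) (k : ℕ) :
    (k : ℂ) • expCoeff a k = ∑ p ∈ antidiagonal k, (p.1 : ℂ) • (a p.1 * expCoeff a p.2) := by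
  set f : PowerSeries R := pmk fun m => if m = 0 then 0 else a m with hf
  have hcoe : ∀ k, coeff k f = if k = 0 then 0 else a k := fun k => by simp [hf]
  have hcomm : f * eulerOp f = eulerOp f * f := ser_comm fun k l => by
    rw [cf_euler, hcoe, hcoe]; refine Commute.smul_right ?_ _; split_ifs <;> simp [ha]
  have hvan : ∀ n k, k < n -> coeff k (f ^ n) = 0 := by
    intro n; induction n with
    | zero => intro k hk; omega
    | succ n ih =>
      intro k hk; rw [pow_succ, coeff_mul]; refine sum_eq_zero fun p hp => ?_
      rw [mem_antidiagonal] at hp; by_cases h0 : p.2 = 0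
      . rw [hcoe, if_pos h0, mul_zero]
      . rw [ih _ (by omega), zero_mul]
  have hE : ∀ n k, k ≤ n -> expCoeff a k = ∑ m ∈ range (n + 1), ((m.factorial : ℂ)⁻¹) • coeff k (f ^ m) := by
    intro n k hk; rw [expCoeff]; refine Finset.sum_subset (Finset.range_mono (by omega)) fun m _ hm => ?_
    rw [mem_range, not_lt] at hm; rw [hvan m k (by omega), smul_zero]
  rcases k with _ | k
  . simp
  . rw [hE (k + 1) (k + 1) le_rfl, Finset.sum_range_succ', smul_add, smul_sum]
    have h1 : ∀ m ∈ range (k + 1), ((k + 1 : ℕ) : ℂ) • (((m + 1).factorial : ℂ)⁻¹ • coeff (k + 1) (f ^ (m + 1))) =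
        ∑ p ∈ antidiagonal (k + 1), (m.factorial : ℂ)⁻¹ • (coeff p.1 (eulerOp f) * coeff p.2 (f ^ m)) := by
      intro m _
      rw [smul_comm, <-cf_euler, euler_pow hcomm, PowerSeries.coeff_smul, smul_smul, coeff_mul, smul_sum]
      refine sum_congr rfl fun p _ => ?_
      congr 1; rw [Nat.factorial_succ]; push_cast; have : (m : ℂ) + 1 ≠ 0 := by exact_mod_cast Nat.succ_ne_zero m
      field_simp
    rw [sum_congr rfl h1, sum_comm]; have h2 : coeff (k + 1) (f ^ 0) = 0 := by simp [PowerSeries.coeff_one]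
    rw [h2, smul_zero, smul_zero, add_zero]; refine sum_congr rfl fun p hp => ?_
    rw [mem_antidiagonal] at hp; by_cases h0 : p.1 = 0
    . simp [h0, cf_euler]
    . rw [cf_euler, hcoe, if_neg h0, hE k p.2 (by omega), mul_sum, smul_sum]
      refine sum_congr rfl fun m _ => ?_
      rw [smul_mul_assoc, mul_smul_comm, smul_comm]

lemma expCf_zero (a : ℕ -> R) : expCoeff a 0 = 1 := by simp [expCoeff]

lemma eq_expCf {a e : ℕ -> R} (ha : ∀ k l, Commute (a k) (a l)) (h0 : e 0 = 1)
    (h : ∀ k : ℕ, (k : ℂ) • e k = ∑ p ∈ antidiagonal k, (p.1 : ℂ) • (a p.1 * e p.2)) (k : ℕ) :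
    e k = expCoeff a k := by
  induction k using strong_induction_on with
  | _ k ih =>
    rcases Nat.eq_zero_or_pos k with rfl | hk
    . rw [h0, expCf_zero]
    . have hk' : (k : ℂ) ≠ 0 := by exact_mod_cast hk.ne'
      refine smul_right_injective R hk' ?_; change (k : ℂ) • e k = (k : ℂ) • expCoeff a k
      rw [h, expCoeff_rec ha]; refine sum_congr rfl fun p hp => ?_
      rw [mem_antidiagonal] at hp; by_cases h0 : p.1 = 0
      . simp [h0]
      . rw [ih p.2 (by omega)]

lemma map_expCf {S : Type*} [Ring S] [Algebra ℂ S] (f : R →ₐ[ℂ] S) (a : ℕ -> R) (k : ℕ) :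
    f (expCoeff a k) = expCoeff (fun m => f (a m)) k := by
  simp only [expCoeff, map_sum, map_smul]; refine sum_congr rfl fun n _ => ?_
  congr 1
  have : PowerSeries.map (f : R →+* S) (pmk fun m => if m = 0 then 0 else a m) = pmk fun m => if m = 0 then 0 else f (a m) := by
    ext m; rw [coeff_map, coeff_mk, coeff_mk]; split_ifs <;> simp
  rw [<-this, <-map_pow, coeff_map]; rfl

def logCf (p : ℕ -> R) : ℕ -> R
  | k => p k - (k : ℂ)⁻¹ • ∑ m : Fin k, (m : ℂ) • (logCf p m * p (k - m))

lemma logCf_rec {d : ℕ -> R} (h0 : d 0 = 1) (k : ℕ) :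
    (k : ℂ) • d k = ∑ p ∈ antidiagonal k, (p.1 : ℂ) • (logCf d p.1 * d p.2) := by
  rw [Finset.Nat.sum_antidiagonal_eq_sum_range_succ
    (fun a b => (a : ℂ) • (logCf d a * d b)) k, sum_range_succ, Nat.sub_self, h0, mul_one]
  have e : logCf d k = d k - (k : ℂ)⁻¹ • ∑ m : Fin k, (m : ℂ) • (logCf d m * d (k - m)) := by rw [logCf]
  rw [e, smul_sub, smul_smul]; rcases Nat.eq_zero_or_pos k with rfl | hk
  . simp
  . rw [mul_inv_cancel₀ (by exact_mod_cast hk.ne'), one_smul, Finset.sum_range]; abel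

lemma logCf_comm {p : ℕ -> R} {b : R} (h : ∀ k, Commute b (p k)) (k : ℕ) :
    Commute b (logCf p k) := by
  induction k using strong_induction_on with
  | _ k ih =>
    rw [logCf]; refine (h k).sub_right (Commute.smul_right (Commute.sum_right _ _ _ fun m _ => ?_) _)
    exact ((ih m m.2).mul_right (h _)).smul_right _

lemma logCf_zero {p : ℕ -> R} {n : ℕ} (h : ∀ k, ¬ n ∣ k -> p k = 0) (k : ℕ) (hk : ¬ n ∣ k) :
    logCf p k = 0 := by
  induction k using strong_induction_on with
  | _ k ih =>
    rw [logCf, h k hk, sum_eq_zero, smul_zero, sub_zero]; intro m _; by_cases hm : n ∣ (m : ℕ)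
    . rw [h (k - m), mul_zero, smul_zero]
      exact fun h' => hk ((Nat.dvd_sub_iff_left (Nat.le_of_lt m.2) hm).mp h')
    . rw [ih m m.2 hm, zero_mul, smul_zero]

end LogDeriv

section Compare

variable {F : Type*} [ACG F] [Module ℂ F]

def annSer (x : F) (u : PowerSeries (End ℂ F)) : Prop := ∀ k, coeff k u x = 0

variable {x : F} {L R G A A' C u v : PowerSeries (End ℂ F)}

lemma annSer.mul (h : annSer x u) (v : PowerSeries (End ℂ F)) :
    annSer x (v * u) := fun k => by
  rw [coeff_mul, sumL]; exact sum_eq_zero fun p _ => by rw [mul_apply, h, map_zero]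

lemma annSer.sub (h : annSer x u) (h' : annSer x v) : annSer x (u - v) := fun k => by rw [map_sub, subL, h, h', sub_zero]

lemma annSer.euler (h : annSer x u) : annSer x (eulerOp u) := fun k => by rw [cf_euler, smulL, h, smul_zero]

lemma annSer.of_mul {b : End ℂ F} (hb : b * coeff 0 v = 1)
    (h : annSer x (v * u)) : annSer x u := by
  intro k; induction k using strong_induction_on with
  | _ k ih =>
    have := h k
    rw [coeff_mul, <-add_sum_erase _ _
      (show (0, k) ∈ antidiagonal k by simp), addL, sumL,
      sum_eq_zero, add_zero] at this
    . have h2 := congrArg b this; rwa [<-mul_apply, <-mul_assoc, hb, one_mul, map_zero] at h2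
    . rintro p hp; simp only [Finset.mem_erase, mem_antidiagonal, ne_eq] at hp
      have : p.1 ≠ 0 := fun h => hp.1 (by ext <;> simp <;> omega)
      rw [mul_apply, ih _ (by omega), map_zero]

lemma ann_log_of_ann {b : End ℂ F} (hb : b * coeff 0 L = 1)
    (hL : eulerOp L = A * L) (hR : eulerOp R = A' * R) (hG : eulerOp G = C * G)
    (c1 : A * L = L * A) (c2 : A' * L = L * A') (c3 : C * L = L * C) (c4 : R * C = C * R)
    (h : annSer x (L - R * G)) : annSer x (A - A' - C) := by
  refine annSer.of_mul hb ?_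
  have h1 : eulerOp (L - R * G) = A * L - (A' + C) * (R * G) := by
    have : eulerOp (L - R * G) = eulerOp L - eulerOp (R * G) := by ext k : 1; simp [cf_euler, smul_sub]
    rw [this, euler_mul, hL, hR, hG, add_mul, <-mul_assoc, <-mul_assoc, <-mul_assoc, c4]
  have h2 := h.euler.sub (h.mul (A' + C)); rw [h1] at h2; convert h2 using 1; rw [mul_sub, mul_sub, <-c1, <-c2, <-c3]; noncomm_ring

lemma ann_of_ann_log (hL : eulerOp L = A * L) (hR : eulerOp R = A' * R) (hG : eulerOp G = C * G)
    (c1 : A * L = L * A) (c2 : A' * L = L * A') (c3 : C * L = L * C) (c4 : R * C = C * R)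
    (z1 : coeff 0 A' = 0) (z2 : coeff 0 C = 0)
    (h0 : coeff 0 (L - R * G) x = 0)
    (h : annSer x (A - A' - C)) : annSer x (L - R * G) := by
  have h1 : eulerOp (L - R * G) = L * (A - A' - C) + (A' + C) * (L - R * G) := by
    have : eulerOp (L - R * G) = eulerOp L - eulerOp (R * G) := by ext k : 1; simp [cf_euler, smul_sub]
    rw [this, euler_mul, hL, hR, hG, mul_sub, mul_sub, <-c1, <-c2, <-c3, <-mul_assoc R, c4]; noncomm_ring
  intro k; induction k using strong_induction_on with
  | _ k ih =>
    rcases Nat.eq_zero_or_pos k with rfl | hk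
    . exact h0
    . have h2 := congrArg (fun u : PowerSeries (End ℂ F) => coeff k u x) h1
      simp only [cf_euler, smulL, map_add (coeff k), addL, h.mul L k, zero_add] at h2; rw [coeff_mul, sumL, sum_eq_zero] at h2
      . exact (smul_eq_zero.mp h2).resolve_left (by exact_mod_cast hk.ne')
      . intro p hp; rw [mem_antidiagonal] at hp; rw [mul_apply]; by_cases h3 : p.1 = 0
        . rw [h3, map_add, z1, z2, add_zero, zeroL]
        . rw [ih _ (by omega), map_zero]

end Compare

end

section

section CompareAlgebra

variable {B : Type*} [Ring B] [Algebra ℂ B]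

def lmulFam (b : B) : End ℂ (ℤ -> B) := (mulLeft ℂ b).compLeft ℤ

def rmulFam (b : B) : End ℂ (ℤ -> B) := (mulRight ℂ b).compLeft ℤ

lemma lmulFam_mul (a b : B) : lmulFam a * lmulFam b = lmulFam (a * b) := by ext f r; simp [lmulFam]

lemma rmulFam_mul (a b : B) : rmulFam a * rmulFam b = rmulFam (b * a) := by ext f r; simp [rmulFam, mul_assoc]

lemma lmulFam_rmulFam (a b : B) : lmulFam a * rmulFam b = rmulFam b * lmulFam a := by ext f r; simp [lmulFam, rmulFam, mul_assoc]

lemma lmulFam_shift (a : B) (s) : lmulFam a * shiftFam s = shiftFam s * lmulFam a := by ext f r; simp [lmulFam, shiftFam]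

lemma rmulFam_shift (a : B) (s) : rmulFam a * shiftFam s = shiftFam s * rmulFam a := by ext f r; simp [rmulFam, shiftFam]

lemma shiftFam_mul (s s') :
    (shiftFam s * shiftFam s' : End ℂ (ℤ -> B)) = shiftFam (s + s') := by
  ext f r; simp only [shiftFam, mul_apply, coe_mk, AddHom.coe_mk]; congr 1; ring

lemma euler_mk {S : Type*} [Ring S] [Algebra ℂ S] (f : B →ₗ[ℂ] S) {a φ : ℕ -> B}
    (hf : ∀ k l, f (a k * φ l) = f (a k) * f (φ l))
    (h : ∀ k : ℕ, (k : ℂ) • φ k = ∑ p ∈ antidiagonal k, (p.1 : ℂ) • (a p.1 * φ p.2)) :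
    eulerOp (pmk fun k => f (φ k)) = pmk (fun k => (k : ℂ) • f (a k)) * pmk fun k => f (φ k) := by
  ext k : 1; rw [cf_euler, coeff_mk, <-map_smul, h, map_sum, coeff_mul]; refine sum_congr rfl fun p _ => ?_
  rw [map_smul, hf, coeff_mk, coeff_mk, smul_mul_assoc]

variable (e : ℤ) {x : ℤ -> B} {φ a : ℕ -> B} {g c : PowerSeries ℂ}
  (hφ : ∀ k : ℕ, (k : ℂ) • φ k = ∑ p ∈ antidiagonal k, (p.1 : ℂ) • (a p.1 * φ p.2))
  (haφ : ∀ k l, Commute (a k) (φ l)) (haa : ∀ k l, Commute (a k) (a l))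
  (hg : eulerOp g = c * g)

/-- The operator-valued series of a scalar series in the shift. -/
def shift' (e : ℤ) (g : PowerSeries ℂ) : PowerSeries (End ℂ (ℤ -> B)) := pmk fun k => coeff k g • shiftFam (e * k)

include hg in
lemma euler_shift : eulerOp (shift' e g : PowerSeries (End ℂ (ℤ -> B))) = shift' e c * shift' e g := by
  ext k : 1; have := congrArg (coeff k) hg; rw [cf_euler, coeff_mul] at this
  rw [cf_euler, shift', coeff_mk, smul_smul, <-smul_eq_mul, this, sum_smul, coeff_mul]; refine sum_congr rfl fun p hp => ?_
  rw [mem_antidiagonal] at hp; rw [shift', coeff_mk, coeff_mk, smul_mul_smul_comm, shiftFam_mul, <-hp]; push_cast; ring_nf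

lemma annSer_iff : annSer x ((pmk fun k => lmulFam (φ k)) - (pmk fun k => rmulFam (φ k)) * shift' e g) ↔
    ∀ k r, φ k * x r = twist e g (fun k r => x r * φ k) k r := by
  have key : ∀ k r, (coeff k ((pmk fun k => lmulFam (φ k)) - (pmk fun k => rmulFam (φ k)) * shift' e g) : End ℂ (ℤ -> B)) x r =
      φ k * x r - twist e g (fun k r => x r * φ k) k r := by
    intro k r
    rw [map_sub, coeff_mul, <-Finset.Nat.sum_antidiagonal_swap, subL, sumL, Pi.sub_apply, Finset.sum_apply, twist, coeff_mk]
    congr 1; refine sum_congr rfl fun p _ => ?_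
    simp [shift', rmulFam, shiftFam]
  refine ⟨fun h k r => ?_, fun h k => ?_⟩
  . have := congrFun (h k) r; rw [key] at this; exact sub_eq_zero.mp this
  . funext r; rw [key, h, sub_self]; rfl

lemma annSer_log_iff : annSer x ((pmk fun k : ℕ => (k : ℂ) • lmulFam (a k)) -
      (pmk fun k : ℕ => (k : ℂ) • rmulFam (a k)) - shift' e c) ↔
    ∀ (k : ℕ) r, (k : ℂ) • (a k * x r - x r * a k) = coeff k c • x (r + e * k) := by
  have key : ∀ (k : ℕ) r, (coeff k ((pmk fun k : ℕ => (k : ℂ) • lmulFam (a k)) -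
      (pmk fun k : ℕ => (k : ℂ) • rmulFam (a k)) - shift' e c) :
        End ℂ (ℤ -> B)) x r =
      (k : ℂ) • (a k * x r - x r * a k) - coeff k c • x (r + e * k) := by
    intro k r; simp [shift', rmulFam, lmulFam, shiftFam, smul_sub]
  refine ⟨fun h k r => ?_, fun h k => ?_⟩
  . have := congrFun (h k) r; rw [key] at this; exact sub_eq_zero.mp this
  . funext r; rw [key, h, sub_self]; rfl

def lmulFamₗ : B →ₗ[ℂ] End ℂ (ℤ -> B) where
  toFun := lmulFam
  map_add' a b := by ext f r; simp [lmulFam, add_mul]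
  map_smul' a b := by ext f r; simp [lmulFam]

def rmulFamₗ : B →ₗ[ℂ] End ℂ (ℤ -> B) where
  toFun := rmulFam
  map_add' a b := by ext f r; simp [rmulFam, mul_add]
  map_smul' a b := by ext f r; simp [rmulFam]

include hφ in
lemma euler_lmulFam : eulerOp (pmk fun k => lmulFam (φ k)) = pmk (fun k => (k : ℂ) • lmulFam (a k)) * pmk fun k => lmulFam (φ k) :=
  euler_mk lmulFamₗ (fun _ _ => (lmulFam_mul _ _).symm) hφ

include hφ haφ in
lemma euler_rmulFam : eulerOp (pmk fun k => rmulFam (φ k)) = pmk (fun k => (k : ℂ) • rmulFam (a k)) * pmk fun k => rmulFam (φ k) :=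
  euler_mk rmulFamₗ (fun k l => by rw [haφ]; exact (rmulFam_mul _ _).symm) hφ

lemma ser_comms (haφ : ∀ k l, Commute (a k) (φ l)) :
    (pmk fun k : ℕ => (k : ℂ) • lmulFam (a k)) * (pmk fun k => lmulFam (φ k)) =
      (pmk fun k => lmulFam (φ k)) * (pmk fun k : ℕ => (k : ℂ) • lmulFam (a k)) ∧
    (pmk fun k : ℕ => (k : ℂ) • rmulFam (a k)) * (pmk fun k => lmulFam (φ k)) =
      (pmk fun k => lmulFam (φ k)) * (pmk fun k : ℕ => (k : ℂ) • rmulFam (a k)) ∧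
    shift' e c * (pmk fun k => lmulFam (φ k)) = (pmk fun k => lmulFam (φ k)) * shift' e c ∧
    (pmk fun k => rmulFam (φ k)) * shift' e c = shift' e c * (pmk fun k => rmulFam (φ k)) := by
  refine ⟨ser_comm fun k l => ?_, ser_comm fun k l => ?_,
    ser_comm fun k l => ?_, ser_comm fun k l => ?_⟩ <;>
  simp only [coeff_mk, shift']
  . refine Commute.smul_left ?_ _; rw [Commute, SemiconjBy, lmulFam_mul, lmulFam_mul, (haφ k l).eq]
  . exact (show Commute _ _ from (lmulFam_rmulFam _ _).symm).smul_left _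
  . exact (Commute.symm (lmulFam_shift _ _)).smul_left _
  . exact (show Commute _ _ from rmulFam_shift _ _).smul_right _

include hφ haφ hg in
lemma log_commtr_of_ser {b : B} (hb : b * φ 0 = 1)
    (h : ∀ k r, φ k * x r = twist e g (fun k r => x r * φ k) k r) (k : ℕ) (r : ℤ) :
    (k : ℂ) • (a k * x r - x r * a k) = coeff k c • x (r + e * k) := by
  obtain ⟨c1, c2, c3, c4⟩ := ser_comms e (c := c) haφ
  refine (annSer_log_iff e).mp (ann_log_of_ann (b := lmulFam b) ?_ (euler_lmulFam hφ)
    (euler_rmulFam hφ haφ) (euler_shift e hg) c1 c2 c3 c4 ((annSer_iff e).mpr h)) k r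
  rw [coeff_mk, lmulFam_mul, hb]; ext f r; simp [lmulFam]

include hφ haφ hg in
lemma ser_of_log_commtr (hc : coeff 0 c = 0)
    (h0 : ∀ r, φ 0 * x r = coeff 0 g • (x r * φ 0))
    (h : ∀ (k : ℕ) r, (k : ℂ) • (a k * x r - x r * a k) = coeff k c • x (r + e * k))
    (k : ℕ) (r : ℤ) : φ k * x r = twist e g (fun k r => x r * φ k) k r := by
  obtain ⟨c1, c2, c3, c4⟩ := ser_comms e (c := c) haφ
  refine (annSer_iff e).mp (ann_of_ann_log (euler_lmulFam hφ)
    (euler_rmulFam hφ haφ) (euler_shift e hg) c1 c2 c3 c4 ?_ ?_ ?_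
    ((annSer_log_iff e).mpr h)) k r
  . simp
  . rw [shift', coeff_mk, hc, zero_smul]
  . funext r; rw [map_sub, coeff_mul]; have := h0 r; simp [shift', rmulFam, lmulFam, shiftFam, this]

end CompareAlgebra

namespace TwistedType

variable (X) (t)

def gamLog (J d : ℤˣ) (i j : X.I0) : PowerSeries ℂ := pmk fun m => if m = 0 then 0 else ∑ s ∈ Icc 1 X.M,
    (((t ^ 2) ^ ((J : ℤ) * d * X.c i s j) * X.zeta ^ ((J : ℤ) * s)) ^ m -
      (((t ^ 2) ^ ((J : ℤ) * d * X.c i s j))⁻¹ * X.zeta ^ ((J : ℤ) * s)) ^ m)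

lemma euler_lin {Q : ℂ} (hQ : Q ≠ 0) (Z : ℂ) :
    eulerOp (C Q - C Z * PX) = (pmk fun m => if m = 0 then 0 else -(Q⁻¹ * Z) ^ m) * (C Q - C Z * PX) := by
  ext k; rw [cf_euler, mul_sub, mul_comm (C Z), <-mul_assoc]; rcases k with _ | _ | k
  . simp
  . simp [coeff_succ_mul_X]; field_simp
  . have hw : Q * Q⁻¹ = 1 := mul_inv_cancel₀ hQ; simp [coeff_succ_mul_X, PowerSeries.coeff_X]
    generalize Q⁻¹ = w at hw; linear_combination Z ^ 2 * Z ^ k * w * w ^ k * hw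

omit X t in
lemma euler_quot {Q} (hQ : Q ≠ 0) (Z) :
    eulerOp ((C Q - C Z * PX) * (C (1 : ℂ) - C (Q * Z) * PX)⁻¹) = (pmk fun m => if m = 0 then 0 else (Q * Z) ^ m - (Q⁻¹ * Z) ^ m) *
        ((C Q - C Z * PX) * (C (1 : ℂ) - C (Q * Z) * PX)⁻¹) := by
  have hd := PowerSeries.mul_inv_cancel (C (1 : ℂ) - C (Q * Z) * PX) (by simp)
  have h := congrArg eulerOp hd; rw [euler_mul, euler_one, euler_lin one_ne_zero] at h
  rw [show (pmk fun m => if m = 0 then 0 else (Q * Z) ^ m - (Q⁻¹ * Z) ^ m) = (pmk fun m => if m = 0 then 0 else -(Q⁻¹ * Z) ^ m) -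
      pmk fun m => if m = 0 then 0 else -((1 : ℂ)⁻¹ * (Q * Z)) ^ m by
    ext m; simp only [map_sub, coeff_mk]; split_ifs <;> simp; ring, euler_mul, euler_lin hQ]
  generalize (C (1 : ℂ) - C (Q * Z) * PX)⁻¹ = D' at *; generalize C (1 : ℂ) - C (Q * Z) * PX = D at *
  generalize (pmk fun m => if m = 0 then 0 else -((1 : ℂ)⁻¹ * (Q * Z)) ^ m) = b at *
  linear_combination (C Q - C Z * PX) * (D' * h - (eulerOp D' + b * D') * hd)

lemma euler_gam (ht : t ≠ 0) (J d : ℤˣ) (i j : X.I0) :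
    eulerOp (X.gam t J d i j) = X.gamLog t J d i j * X.gam t J d i j := by
  rw [gam, gamLog]; induction Icc 1 X.M using Finset.induction_on with
  | empty => simp [euler_one, show (pmk fun m => (0 : ℂ)) = 0 from rfl]
  | insert s T hs ih =>
    rw [prod_insert hs, euler_mul, ih, gamNum, gamDen, euler_quot (zpow_ne_zero _ (pow_ne_zero 2 ht)), mul_assoc,
      mul_left_comm, <-mul_add, <-add_mul, mul_left_comm]; congr 1; ext m; simp only [map_add, coeff_mk, sum_insert hs]; split_ifs <;> simp

lemma cf_zero_gam (ht : t ≠ 0) (J d i j) :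
    coeff 0 (X.gam t J d i j) = (t ^ 2) ^ (J * d * X.symCartan i j) := by
  have hq : (t ^ 2) ≠ 0 := pow_ne_zero 2 ht
  have : ∀ T : Finset ℕ, ∏ s ∈ T, (t ^ 2) ^ (J * d * X.c i s j) = (t ^ 2) ^ (J * d * ∑ s ∈ T, X.c i s j) := by
    intro T; induction T using Finset.induction_on with
    | empty => simp
    | insert s T hs ih => rw [prod_insert hs, sum_insert hs, ih, mul_add, zpow_add₀ hq]
  rw [symCartan, <-this, gam, PowerSeries.coeff_zero_eq_constantCoeff, map_prod]; refine prod_congr rfl fun s _ => ?_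
  simp [gamNum, gamDen]

lemma sum_zeta_pow (J : ℤˣ) {m : ℕ} (hm : ¬ X.M ∣ m) :
    ∑ s ∈ Icc 1 X.M, (X.zeta ^ ((J : ℤ) * s)) ^ m = 0 := by
  have h : X.zeta ^ ((J : ℤ) * m) ≠ 1 := by
    intro h; rw [X.zeta_primitive.zpow_eq_one_iff_dvd] at h; rcases units_eq_one_or J with rfl | rfl
    . simp at h; exact hm (Int.natCast_dvd_natCast.mp h)
    . simp at h; exact hm (Int.natCast_dvd_natCast.mp h)
  have e : ∀ s : ℕ, (X.zeta ^ ((J : ℤ) * s)) ^ m = (X.zeta ^ ((J : ℤ) * m)) ^ s := by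
    intro s; rw [<-zpow_natCast, <-zpow_mul, <-zpow_natCast, <-zpow_mul]; congr 1; ring
  simp only [e]; set w := X.zeta ^ ((J : ℤ) * m) with hw
  have hwM : w ^ X.M = 1 := by rw [hw, <-zpow_natCast, zpow_comm, zpow_natCast, zeta_pow_M, one_zpow]
  have h1 : Icc 1 X.M = (range X.M).image (· + 1) := by rw [Finset.range_eq_Ico, Finset.image_add_right_Ico]; rfl
  rw [h1, sum_image (by simp)]; simp only [pow_succ]
  rw [<-sum_mul, (mul_eq_zero.mp (show (∑ k ∈ range X.M, w ^ k) * (w - 1) = 0 by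
    rw [geom_sum_mul, hwM, sub_self])).resolve_right (sub_ne_zero.mpr h), zero_mul]

lemma cf_gam_zero (ht : t ≠ 0) (J d : ℤˣ) {i j} {l : ℕ}
    (h : ¬ ((X.N i ∣ l) ∧ (X.N j ∣ l))) : coeff l (X.gam t J d i j) = 0 := by
  have hfix : (X.sigma i = i ∨ X.sigma j = j) ∧ ¬ X.M ∣ l := by simp only [N] at h; split_ifs at h <;> simp_all
  have hc : ∀ s, X.c i s j = X.cartan i j := by
    rcases hfix.1 with h | h
    . exact X.c_of_fixed_l h
    . exact X.c_of_fixed_r h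
  have hlog : ∀ m, ¬ X.M ∣ m -> coeff m (X.gamLog t J d i j) = 0 := by
    intro m hm; rw [gamLog, coeff_mk]; simp only [hc, mul_pow, <-sub_mul, <-mul_sum, X.sum_zeta_pow J hm]; simp
  have hl := hfix.2; clear h; induction l using strong_induction_on with
  | _ l ih =>
    have h1 := congrArg (coeff l) (X.euler_gam t ht J d i j); rw [cf_euler, coeff_mul, sum_eq_zero] at h1
    . refine (smul_eq_zero.mp h1).resolve_left ?_; rintro h0; rw [Nat.cast_eq_zero] at h0
      exact hl (h0 ▸ dvd_zero _)
    . intro p hp; rw [mem_antidiagonal] at hp; by_cases h2 : X.M ∣ p.1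
      . have h3 : ¬ X.M ∣ p.2 := fun h3 => hl (hp ▸ dvd_add h2 h3)
        by_cases h4 : p.1 = 0
        . simp [h4, gamLog]
        . rw [ih p.2 (by omega) ⟨hfix.1, h3⟩ h3, mul_zero]
      . rw [hlog _ h2, zero_mul]

end TwistedType

end

section

namespace TwistedType

variable (X) 

lemma twoD_pos (i : X.I0) : 0 < X.twoD i := by have := X.M_pos; simp only [twoD, N]; split_ifs <;> omega

lemma qi_sub_ne (ht : t ≠ 0) (hq : Generic t) (i : X.I0) :
    X.qi t i - (X.qi t i)⁻¹ ≠ 0 := by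
  have h0 : X.qi t i ≠ 0 := pow_ne_zero _ ht; intro h
  have h1 : X.qi t i * X.qi t i = 1 := by
    rw [sub_eq_zero] at h
    nth_rw 2 [h]
    exact mul_inv_cancel₀ h0
  refine hq (X.twoD i) (X.twoD_pos i) ?_; rw [<-h1, qi, <-pow_add, <-pow_mul]; congr 1; ring

lemma N_pos (i : X.I0) : 0 < X.N i := by have := X.M_pos; simp only [N]; split_ifs <;> omega

lemma sigpow_eq_self {i : X.I0} (hi : X.sigma i ≠ i) {s : ℕ} (h1 : 1 ≤ s) (h2 : s < X.M) :
    (X.sigma ^ s) i.1 ≠ i.1 := by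
  intro h; have hc := (X.c_self_of_not_fixed hi).2 s h1 h2; have h3 := (X.c_self_of_not_fixed hi).1; rw [c, h, car_self] at hc; omega

lemma coef_x_x (i j : X.I0) (r : ℤ) :
    (∑ s ∈ Icc 1 X.M, if (X.sigma ^ s) i = j then X.zeta ^ ((s : ℤ) * r) else 0) / (X.N i : ℂ) =
      if i = j ∧ (X.N i : ℤ) ∣ r then 1 else 0 := by
  by_cases hij : i = j
  . subst hij; by_cases hi : X.sigma i = i
    . have hN : X.N i = X.M := if_pos hi; have hM : (X.M : ℂ) ≠ 0 := by exact_mod_cast X.M_pos.ne'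
      simp only [X.sigpow_fixed hi, if_true, hN, true_and]
      have e : ∀ s : ℕ, X.zeta ^ ((s : ℤ) * r) = (X.zeta ^ r) ^ s := by intro s; rw [<-zpow_natCast, <-zpow_mul, mul_comm]
      split_ifs with h
      . have h1 : X.zeta ^ r = 1 := (X.zeta_primitive.zpow_eq_one_iff_dvd r).mpr h; simp only [e, h1]
        simp [hM]
      . have hr : ∃ (J : ℤˣ) (m : ℕ), r = J * m := by
          rcases Int.natAbs_eq r with h | h
          . exact ⟨1, r.natAbs, by simpa using h⟩
          . exact ⟨-1, r.natAbs, by simpa using h⟩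
        obtain ⟨J, m, rfl⟩ := hr; have hm : ¬ X.M ∣ m := fun hm => h (dvd_mul_of_dvd_right (Int.natCast_dvd_natCast.mpr hm) _)
        have := X.sum_zeta_pow J hm; rw [sum_congr rfl (g := fun s : ℕ => (X.zeta ^ ((J : ℤ) * s)) ^ m), this, zero_div]; intro s _
        rw [<-zpow_natCast, <-zpow_mul]; congr 1; ring
    . have hN : X.N i = 1 := if_neg hi; have hM := X.M_pos; rw [hN, sum_eq_single X.M]
      . simp [sigpow_M, zpow_mul, X.zeta_pow_M]
      . intro s hs hs'; rw [mem_Icc] at hs; exact if_neg (X.sigpow_eq_self hi hs.1 (by omega))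
      . intro h; exact absurd (Finset.mem_Icc.mpr ⟨hM, le_rfl⟩) h
  . rw [if_neg (by tauto), sum_eq_zero, zero_div]; intro s hs
    exact if_neg fun h => hij (X.I0_eq_of_pow (Finset.mem_Icc.mp hs).2 h)

end TwistedType

lemma TwistedType.cf_gamLog (X : TwistedType) {t : ℂ} (ht : t ≠ 0)
    (hq : Generic t) (J d : ℤˣ) (i j : X.I0) {k : ℕ} (hk : k ≠ 0) :
    coeff k (X.gamLog t J d i j) = (((d : ℤ) : ℂ) * (X.qi t i - (X.qi t i)⁻¹)) * ∑ s ∈ Icc 1 X.M,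
        ((t ^ 2) ^ ((J : ℤ) * k * X.c i s j) - (t ^ 2) ^ (-((J : ℤ) * k * X.c i s j))) /
              (X.qi t i - (X.qi t i)⁻¹) * X.zeta ^ ((J : ℤ) * k * (s : ℤ)) := by
  have hq' := X.qi_sub_ne ht hq i; rw [TwistedType.gamLog, coeff_mk, if_neg hk]
  have : ∀ s ∈ Icc 1 X.M, ((t ^ 2) ^ ((J : ℤ) * d * X.c i s j) * X.zeta ^ ((J : ℤ) * s)) ^ k -
      (((t ^ 2) ^ ((J : ℤ) * d * X.c i s j))⁻¹ * X.zeta ^ ((J : ℤ) * s)) ^ k =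
      (((d : ℤ) : ℂ) * (X.qi t i - (X.qi t i)⁻¹)) *
      (((t ^ 2) ^ ((J : ℤ) * k * X.c i s j) - (t ^ 2) ^ (-((J : ℤ) * k * X.c i s j))) /
            (X.qi t i - (X.qi t i)⁻¹) * X.zeta ^ ((J : ℤ) * k * (s : ℤ))) := by
    intro s _
    have e1 : ((t ^ 2) ^ ((J : ℤ) * d * X.c i s j)) ^ k = (t ^ 2) ^ ((J : ℤ) * k * X.c i s j * d) := by
      rw [<-zpow_natCast ((t ^ 2) ^ ((J : ℤ) * d * X.c i s j)), <-zpow_mul]; congr 1; ring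
    have e2 : (((t ^ 2) ^ ((J : ℤ) * d * X.c i s j))⁻¹) ^ k = (t ^ 2) ^ (-((J : ℤ) * k * X.c i s j) * d) := by
      rw [inv_pow, e1, <-zpow_neg]; congr 1; ring
    have e3 : (X.zeta ^ ((J : ℤ) * s)) ^ k = X.zeta ^ ((J : ℤ) * k * (s : ℤ)) := by rw [<-zpow_natCast, <-zpow_mul]; congr 1; ring
    rw [mul_pow, mul_pow, e1, e2, e3]; clear e1 e2 e3; generalize X.zeta ^ ((J : ℤ) * k * (s : ℤ)) = z
    generalize X.qi t i - (X.qi t i)⁻¹ = D at hq' ⊢; rcases units_eq_one_or d with rfl | rfl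
    . simp only [val_one, mul_one, Int.cast_one, one_mul]; field_simp
    . simp only [val_neg, val_one, mul_neg, mul_one, neg_neg, Int.cast_neg, Int.cast_one, neg_mul, one_mul]
      field_simp
      try ring
  rw [sum_congr rfl this, <-mul_sum]

section Generators

def genH (O : X.I0 -> ℤ) (i : X.I0) (m : ℤ) : SA X t O := mkAlgHom ℂ (ShiftedRel X t 0 O) (fh X i m)

/-- The inverse of the leading coefficient of `φ_i^J`. -/
def genInv (O : X.I0 -> ℤ) (J : ℤˣ) (i : X.I0) : SA X t O := mkAlgHom ℂ (ShiftedRel X t 0 O) (fphiInv X J i)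

variable (O)

lemma rel_eq {a b : FreeAlgebra ℂ (Gen X)} (h : ShiftedRel X t 0 O a b) :
    mkAlgHom ℂ (ShiftedRel X t 0 O) a = mkAlgHom ℂ (ShiftedRel X t 0 O) b :=
  RingQuot.mkAlgHom_rel ℂ h

/-- The coefficients of the exponent in the definition of `φ_i^J`. -/
def logGen (t : ℂ) (O : X.I0 -> ℤ) (J : ℤˣ) (i : X.I0) (m : ℕ) : SA X t O :=
  (((J : ℤ) : ℂ) * (X.qi t i - (X.qi t i)⁻¹)) • genH O i ((J : ℤ) * m)

lemma genH_comm (i j : X.I0) (m m' : ℤ) :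
    Commute (genH O i m : SA X t O) (genH O j m') := by
  have := rel_eq O (ShiftedRel.h_h (t := t) (μp := 0) (μm := O) i j m m'); rw [map_mul, map_mul] at this; exact this

lemma gPhi_genH_comm (J : ℤˣ) (i j : X.I0) (m m' : ℤ) :
    Commute (genPhi O J i m : SA X t O) (genH O j m') := by
  have := rel_eq O (ShiftedRel.phi_h (t := t) (μp := 0) (μm := O) J i j m m'); rw [map_mul, map_mul] at this; exact this

lemma gPhi_comm (J ε' : ℤˣ) (i j : X.I0) (m m' : ℤ) :
    Commute (genPhi O J i m : SA X t O) (genPhi O ε' j m') := by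
  have := rel_eq O (ShiftedRel.phi_phi (t := t) (μp := 0) (μm := O) J ε' i j m m'); rw [map_mul, map_mul] at this; exact this

lemma logGen_comm (J : ℤˣ) (i : X.I0) (k l : ℕ) :
    Commute (logGen t O J i k) (logGen t O J i l) :=
  ((genH_comm O _ _ _ _).smul_left _).smul_right _

lemma logGen_gPhi_comm (J ε' : ℤˣ) (i j : X.I0) (k : ℕ) (m : ℤ) :
    Commute (logGen t O J i k) (genPhi O ε' j m) :=
  (gPhi_genH_comm O _ _ _ _ _).symm.smul_left _

lemma gPhi_ld_inv (J : ℤˣ) (i : X.I0) :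
    (genPhi O J i (ℓ O J i) : SA X t O) * genInv O J i = 1 := by
  have := rel_eq O (ShiftedRel.lead_inv (t := t) (μp := 0) (μm := O) J i); rw [map_mul, map_one] at this; exact this

lemma gPhi_inv_ld (J : ℤˣ) (i : X.I0) :
    genInv O J i * (genPhi O J i (ℓ O J i) : SA X t O) = 1 := by
  have := rel_eq O (ShiftedRel.inv_lead (t := t) (μp := 0) (μm := O) J i); rw [map_mul, map_one] at this; exact this

lemma gPhi_exp (J : ℤˣ) (i : X.I0) (k : ℕ) :
    (genPhi O J i (ℓ O J i + (J : ℤ) * k) : SA X t O) = genPhi O J i (ℓ O J i) * expCoeff (logGen t O J i) k := by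
  have := rel_eq O (ShiftedRel.phi_exp (t := t) (μp := 0) (μm := O) J i k); rw [map_mul, map_expCf] at this
  simp only [map_smul] at this; exact this

lemma gPhi_rec (J : ℤˣ) (i : X.I0) (k : ℕ) :
    (k : ℂ) • (genPhi O J i (ℓ O J i + (J : ℤ) * k) : SA X t O) =
      ∑ p ∈ antidiagonal k, (p.1 : ℂ) • (logGen t O J i p.1 * genPhi O J i (ℓ O J i + (J : ℤ) * p.2)) := by
  rw [gPhi_exp, <-mul_smul_comm, expCoeff_rec (logGen_comm O J i), mul_sum]; refine sum_congr rfl fun p _ => ?_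
  rw [mul_smul_comm, gPhi_exp, <-mul_assoc, <-mul_assoc, (logGen_gPhi_comm O J J i i _ _).eq]

variable (ht : t ≠ 0) (hq : Generic t) (hμ : X.IsShift O)

include ht hq in
lemma logGen_genX (J d : ℤˣ) (i j : X.I0) (k : ℕ) (r : ℤ) :
    (k : ℂ) • (logGen t O J i k * genX O d j r - genX O d j r * logGen t O J i k) =
      coeff k (X.gamLog t J d i j) • genX O d j (r + (J : ℤ) * k) := by
  have hq' := X.qi_sub_ne ht hq i; by_cases hk : k = 0
  . subst hk; simp [TwistedType.gamLog]
  . have hk' : (k : ℂ) ≠ 0 := by exact_mod_cast hk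
    have hε : ((J : ℤ) : ℂ) ≠ 0 := by exact_mod_cast J.ne_zero
    have h1 := rel_eq O (ShiftedRel.h_x (t := t) (μp := 0) (μm := O) d i j ((J : ℤ) * k) r
      (mul_ne_zero J.ne_zero (by exact_mod_cast hk)))
    simp only [map_sub, map_mul, map_smul] at h1
    have gen : ∀ {R : Type} [Ring R] [Algebra ℂ R] (c : ℂ) (a b : R), c • a * b - b * c • a = c • (a * b - b * a) := by
      intro R _ _ c a b; rw [smul_mul_assoc, mul_smul_comm, smul_sub]
    refine (congrArg ((k : ℂ) • ·) (gen (((J : ℤ) : ℂ) * (X.qi t i - (X.qi t i)⁻¹))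
      (genH O i ((J : ℤ) * k)) (genX O d j r))).trans ?_
    change genH O i ((J : ℤ) * k) * genX O d j r - genX O d j r * genH O i ((J : ℤ) * k) = _ • genX O d j ((J : ℤ) * k + r) at h1
    rw [h1, smul_smul, smul_smul, add_comm r]; congr 1; rw [X.cf_gamLog ht hq J d i j hk]; push_cast; field_simp

lemma genX_zero (J : ℤˣ) (i : X.I0) (r : ℤ) (hr : ¬ (X.N i : ℤ) ∣ r) :
    (genX O J i r : SA X t O) = 0 := by
  simpa [genX] using rel_eq O (ShiftedRel.x_zero (t := t) (μp := 0) (μm := O) J i r hr)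

include hμ in
lemma dvd_ld (J : ℤˣ) (i : X.I0) : (X.N i : ℤ) ∣ ℓ O J i := by
  simp only [leadIdx, TwistedType.N]; split_ifs with h1 h2 h2
  . simp
  . exact hμ i h1
  . simp
  . simp

lemma gPhi_van (J : ℤˣ) (i : X.I0) (r : ℤ) (hr : (J : ℤ) * (r - ℓ O J i) < 0) :
    (genPhi O J i r : SA X t O) = 0 := by
  have := rel_eq O (ShiftedRel.phi_zero (t := t) (μp := 0) (μm := O) J i
    (-((J : ℤ) * (r - ℓ O J i))).toNat (by omega))
  rw [Int.toNat_of_nonneg (by omega), mul_neg, <-mul_assoc, <-val_mul, units_mul_self,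
    val_one, one_mul, sub_neg_eq_add, add_sub_cancel, map_zero] at this
  exact this

lemma exists_index (J : ℤˣ) (a r : ℤ) (h : 0 ≤ (J : ℤ) * (r - a)) :
    ∃ k : ℕ, r = a + (J : ℤ) * k := by
  refine ⟨((J : ℤ) * (r - a)).toNat, ?_⟩; rw [Int.toNat_of_nonneg h, <-mul_assoc, <-val_mul, units_mul_self]; simp

include hμ in
lemma gPhi_dvd (J : ℤˣ) (i : X.I0) (r : ℤ) (hr : ¬ (X.N i : ℤ) ∣ r) :
    (genPhi O J i r : SA X t O) = 0 := by
  by_cases h : (J : ℤ) * (r - ℓ O J i) < 0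
  . exact gPhi_van O J i r h
  . obtain ⟨k, rfl⟩ := exists_index J _ r (not_lt.mp h)
    have hk : ¬ X.N i ∣ k := fun hk => hr
      (dvd_add (dvd_ld O hμ J i) (dvd_mul_of_dvd_right (Int.natCast_dvd_natCast.mpr hk) _))
    clear hr h; induction k using strong_induction_on with
    | _ k ih =>
      have h1 := gPhi_rec (t := t) O J i k; rw [sum_eq_zero] at h1
      . refine (smul_eq_zero.mp h1).resolve_left ?_; rintro h0; rw [Nat.cast_eq_zero] at h0
        exact hk (h0 ▸ dvd_zero _)
      . intro p hp; rw [mem_antidiagonal] at hp; by_cases h2 : X.N i ∣ p.1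
        . have h3 : ¬ X.N i ∣ p.2 := fun h3 => hk (hp ▸ dvd_add h2 h3)
          by_cases h4 : p.1 = 0
          . simp [h4]
          . rw [ih p.2 (by omega) h3, mul_zero, smul_zero]
        . have : (genH O i ((J : ℤ) * p.1) : SA X t O) = 0 := by
            have := rel_eq O (ShiftedRel.h_zero (t := t) (μp := 0) (μm := O) i ((J : ℤ) * p.1)
              (fun h => h2 (Int.natCast_dvd_natCast.mp (by
                rcases units_eq_one_or J with rfl | rfl <;> simpa using h))))
            simpa [genH] using this
          rw [logGen, this]; simp

end Generators

end

section

def PreRep.ofAlgebra (ht : t ≠ 0) (hq : Generic t) (hμ : X.IsShift O) :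
    PreRep X t O (SA X t O) where
  x := genX O
  phi := genPhi O
  inv := genInv O
  x_zero := genX_zero O
  phi_dvd := gPhi_dvd O hμ
  phi_van := gPhi_van O
  phi_comm J ε' i j r r' := gPhi_comm O J ε' i j r r'
  lead_inv := gPhi_ld_inv O
  inv_lead := gPhi_inv_ld O
  phi_x J δ i j k m := by
    refine ser_of_log_commtr J (gPhi_rec O J i)
      (fun k l => logGen_gPhi_comm O J J i i _ _) (X.euler_gam t ht J δ i j) ?_ ?_
      (logGen_genX O ht hq J δ i j) k m
    . aesop
    . intro r; have := rel_eq O (ShiftedRel.lead_x (t := t) (μp := 0) (μm := O) J δ i j r)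
      rw [map_mul, map_smul, map_mul] at this; simp only [Nat.cast_zero, mul_zero, add_zero]; rw [X.cf_zero_gam t ht]; exact this
  x_x i j r s := by
    have := rel_eq O (ShiftedRel.x_x (t := t) (μp := 0) (μm := O) i j r s)
    rw [map_sub, map_mul, map_mul, map_smul, map_sub, X.coef_x_x] at this; refine this.trans ?_; split_ifs with h
    . rw [one_div]; rfl
    simp

/-- The image of a `PreRep` under an algebra homomorphism. -/
def PreRep.map {B B' : Type*} [Ring B] [Algebra ℂ B] [Ring B'] [Algebra ℂ B']
    (P : PreRep X t O B) (f : B →ₐ[ℂ] B') : PreRep X t O B' where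
  x J i r := f (P.x J i r)
  phi J i r := f (P.phi J i r)
  inv J i := f (P.inv J i)
  x_zero J i r h := by rw [P.x_zero J i r h, map_zero]
  phi_dvd J i r h := by rw [P.phi_dvd J i r h, map_zero]
  phi_van J i r h := by rw [P.phi_van J i r h, map_zero]
  phi_comm J ε' i j r r' := by rw [<-map_mul, P.phi_comm, map_mul]
  lead_inv J i := by rw [<-map_mul, P.lead_inv, map_one]
  inv_lead J i := by rw [<-map_mul, P.inv_lead, map_one]
  phi_x J δ i j k m := by rw [<-map_mul, P.phi_x, <-AlgHom.toLinearMap_apply, tw_comp]; simp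
  x_x i j r s := by rw [<-map_mul, <-map_mul, <-map_sub, P.x_x]; split_ifs <;> simp

/-- The quadratic, Serre and cubic relations of one sign. -/
structure RelFam {B : Type*} [Ring B] [Algebra ℂ B] (X : TwistedType) (t : ℂ) (δ : ℤˣ)
    (x : X.I0 -> ℤ -> B) : Prop where
  quad : StrongQuad X t δ x
  serre : ∀ i j : X.I0, X.cartan i j = -1 -> wordSum (X.serWords t δ i j) (x i) (x i) (x j) = 0
  cubic : ∀ (κ : ℤˣ) (i : X.I0), X.c i 1 i = -1 -> wordSum (TwistedType.cubicWords t δ κ) (x i) (x i) (x i) = 0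

/-- The relations among the generators of one sign. -/
abbrev PreRep.Complete {B : Type*} [Ring B] [Algebra ℂ B] (P : PreRep X t O B) (δ : ℤˣ) : Prop := RelFam X t δ (P.x δ)

section Homogenize

variable {S : Type*} [CommRing S] [Algebra ℂ S]

lemma prod_homogenize (T : Finset ℕ) (d e : ℕ -> ℂ) (a b : S) :
    (∏ s ∈ T, (pC (d s) - pC (e s) * pX)).natDegree ≤ T.card ∧
    ∑ k ∈ range (T.card + 1), aM ℂ S ((∏ s ∈ T, (pC (d s) - pC (e s) * pX)).coeff k) * (a ^ (T.card - k) * b ^ k) =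
      ∏ s ∈ T, (aM ℂ S (d s) * a - aM ℂ S (e s) * b) := by
  induction T using Finset.induction_on with
  | empty => simp
  | insert s T hs ih =>
    rw [prod_insert hs, prod_insert hs, Finset.card_insert_of_notMem hs, <-ih.2]
    set p := ∏ s ∈ T, (pC (d s) - pC (e s) * pX) with hp; refine ⟨?_, ?_⟩
    . refine (Polynomial.natDegree_mul_le).trans ?_
      have : (pC (d s) - pC (e s) * pX).natDegree ≤ 1 := by
        compute_degree
      omega
    . have h1 : p.coeff (T.card + 1) = 0 := Polynomial.coeff_eq_zero_of_natDegree_lt (by omega)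
      have e1 : ∑ k ∈ range (T.card + 1 + 1), aM ℂ S (p.coeff k) * (a ^ (T.card + 1 - k) * b ^ k) = a * ∑ k ∈ range (T.card + 1),
            aM ℂ S (p.coeff k) * (a ^ (T.card - k) * b ^ k) := by
        rw [sum_range_succ, h1, map_zero, zero_mul, add_zero, mul_sum]; refine sum_congr rfl fun k hk => ?_
        rw [mem_range] at hk; rw [show T.card + 1 - k = (T.card - k) + 1 by omega, pow_succ]; ring
      have e2 : ∑ k ∈ range (T.card + 1 + 1), aM ℂ S ((p * pX).coeff k) * (a ^ (T.card + 1 - k) * b ^ k) = b * ∑ k ∈ range (T.card + 1),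
            aM ℂ S (p.coeff k) * (a ^ (T.card - k) * b ^ k) := by
        rw [Finset.sum_range_succ', mul_sum]; simp only [Polynomial.coeff_mul_X, Polynomial.coeff_mul_X_zero, map_zero, zero_mul, add_zero]
        grind
      rw [sub_mul, sub_mul, mul_assoc, mul_assoc, mul_assoc, <-e1, <-e2, mul_sum, mul_sum, <-sum_sub_distrib]
      refine sum_congr rfl fun k _ => ?_
      rw [Polynomial.coeff_sub, coeff_C_mul, coeff_C_mul, Polynomial.X_mul]; grind

end Homogenize

lemma act_mono {B : Type*} [ACG B] [Module ℂ B] (c : ℂ) (a b : ℕ) (F : ℤ × ℤ -> B)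
    (r s : ℤ) : act (aM ℂ _ c * (U0 ^ a * U1 ^ b)) F (r, s) = c • F (r + a, s + b) := by
  have : (U0 ^ a * U1 ^ b : ℂ[ℤ × ℤ]) = AddMonoidAlgebra.single ((a : ℤ), (b : ℤ)) 1 := by
    simp [U0, U1, single_pow, AddMonoidAlgebra.single_mul_single]
  rw [act_mul, act_aM, this, Pi.smul_apply, act_sgl, one_smul]; rfl

lemma act_monomial₃ {B : Type*} [ACG B] [Module ℂ B] (c : ℂ) (a b d : ℕ)
    (F : ℤ × ℤ × ℤ -> B) (r s u : ℤ) :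
    act (aM ℂ _ c * (V0 ^ a * V1 ^ b * V2 ^ d)) F (r, s, u) = c • F (r + a, s + b, u + d) := by
  have : (V0 ^ a * V1 ^ b * V2 ^ d : ℂ[ℤ × ℤ × ℤ]) = AddMonoidAlgebra.single ((a : ℤ), (b : ℤ), (d : ℤ)) 1 := by
    simp [V0, V1, V2, single_pow, AddMonoidAlgebra.single_mul_single]
  rw [act_mul, act_aM, this, Pi.smul_apply, act_sgl, one_smul]; rfl

namespace StrongQuad

variable {B : Type*} [Ring B] [Algebra ℂ B] {δ : ℤˣ} {x : X.I0 -> ℤ -> B}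

lemma quad (h : StrongQuad X t δ x) (i j) (r1 r2 : ℤ) :
    ∑ k ∈ range (X.M + 1), (quadL X t δ i j).coeff k • (x i (r1 + (X.M - k : ℕ)) * x j (r2 + k)) =
      ∑ k ∈ range (X.M + 1), (quadR X t δ i j).coeff k • (x j (r2 + k) * x i (r1 + (X.M - k : ℕ))) := by
  have hcard : (Icc 1 X.M).card = X.M := by simp
  have hL := (prod_homogenize (S := ℂ[ℤ × ℤ]) (Icc 1 X.M) (fun _ => 1)
    (fun s => X.zeta ^ s * (t ^ 2) ^ (δ * X.c i s j)) U0 U1).2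
  have hR := (prod_homogenize (S := ℂ[ℤ × ℤ]) (Icc 1 X.M)
    (fun s => (t ^ 2) ^ (δ * X.c i s j)) (fun s => X.zeta ^ s) U0 U1).2
  have hsplit : ∀ f : ℕ -> ℂ[ℤ × ℤ], ∏ s ∈ Icc 1 X.M, f s = (∏ s ∈ Icc 1 X.M with ¬ X.c i s j ≠ 0, f s) * ∏ s ∈ X.sqSet i j, f s := by
    intro f; rw [mul_comm, TwistedType.sqSet, Finset.prod_filter_mul_prod_filter_not]
  rw [hsplit] at hL hR
  have e0 : ∏ s ∈ Icc 1 X.M with ¬ X.c i s j ≠ 0, (aM ℂ (ℂ[ℤ × ℤ]) 1 * U0 - aM ℂ _ (X.zeta ^ s * (t ^ 2) ^ (δ * X.c i s j)) * U1) =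
      ∏ s ∈ Icc 1 X.M with ¬ X.c i s j ≠ 0, (aM ℂ (ℂ[ℤ × ℤ]) ((t ^ 2) ^ (δ * X.c i s j)) * U0 - aM ℂ _ (X.zeta ^ s) * U1) := by
    refine prod_congr rfl fun s hs => ?_
    have : X.c i s j = 0 := by simp_all
    simp [this]
  rw [e0] at hL
  have h1 := congrArg (act (∏ s ∈ Icc 1 X.M with ¬ X.c i s j ≠ 0, (aM ℂ (ℂ[ℤ × ℤ]) ((t ^ 2) ^ (δ * X.c i s j)) * U0 -
          aM ℂ _ (X.zeta ^ s) * U1))) (h i j)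
  rw [<-act_mul, <-act_mul, TwistedType.sqL, TwistedType.sqR, <-hL, <-hR, hcard] at h1; have h2 := congrFun h1 (r1, r2)
  simp only [map_sum, sumL, Finset.sum_apply, act_mono] at h2; simpa only [quadL, quadR, map_one] using h2

end StrongQuad

section Serre

variable {B : Type*} [Ring B] [Algebra ℂ B]

lemma act_serP (δ : ℤˣ) (i j) (F : ℤ × ℤ × ℤ -> B) (r s u : ℤ) :
    act (X.serreP t δ i j V0 V1) F (r, s, u) = ∑ a ∈ range ((serreDeg X i j).1 + 1),
      ((t ^ 2) ^ (δ * (serreDeg X i j).2 * a)) • F (r + a, s + ((serreDeg X i j).1 - a : ℕ), u) ∧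
    act (X.serreP t δ i j V1 V0) F (r, s, u) = ∑ a ∈ range ((serreDeg X i j).1 + 1),
      ((t ^ 2) ^ (δ * (serreDeg X i j).2 * a)) • F (r + ((serreDeg X i j).1 - a : ℕ), s + a, u) := by
  constructor
  . simp only [TwistedType.serreP, map_sum, sumL, Finset.sum_apply]
    refine sum_congr rfl fun a _ => ?_
    have := act_monomial₃ ((t ^ 2) ^ (δ * (serreDeg X i j).2 * a)) a ((serreDeg X i j).1 - a) 0 F r s u
    simp_all
  . simp only [TwistedType.serreP, map_sum, sumL, Finset.sum_apply]
    refine sum_congr rfl fun a _ => ?_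
    have := act_monomial₃ ((t ^ 2) ^ (δ * (serreDeg X i j).2 * a)) ((serreDeg X i j).1 - a) a 0 F r s u; rw [mul_comm (V1 ^ a)]; simp_all

lemma map_serTerm (f : FreeAlgebra ℂ (Gen X) →ₐ[ℂ] B) (x : X.I0 -> ℤ -> B) (δ)
    (hf : ∀ i r, f (fx X δ i r) = x i r) (i j r1 r2 l) :
    f (serreTerm X t δ i j r1 r2 l + serreTerm X t δ i j r2 r1 l) = wordSum (X.serWords t δ i j) (x i) (x i) (x j) (r1, r2, l) := by
  have e : ∀ (p : ℂ[ℤ × ℤ × ℤ]) (F : ℤ × ℤ × ℤ -> B), act (-(X.serTwo t _ i j) * p) F =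
        -(((t ^ 2) ^ serreExp X i j + ((t ^ 2) ^ serreExp X i j)⁻¹) • act p F) := by
    intro p F; rw [TwistedType.serTwo, neg_mul, act_neg, act_mul, act_aM]
  simp only [wordSum, TwistedType.serWords, cons_val, Pi.add_apply, e, Pi.neg_apply, Pi.smul_apply]
  simp only [(act_serP _ _ _ _ _ _ _).1, (act_serP _ _ _ _ _ _ _).2, serreTerm, map_add,
    map_sum, map_smul, map_sub, map_mul, hf, smul_add, smul_sub, sum_add_distrib,
    sum_sub_distrib, smul_sum]
  simp only [smul_comm ((t ^ 2) ^ ((δ : ℤ) * _ * _))]; abel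

lemma map_cubicTerm (f : FreeAlgebra ℂ (Gen X) →ₐ[ℂ] B) (x : X.I0 -> ℤ -> B) (δ k : ℤˣ)
    (hf : ∀ i r, f (fx X δ i r) = x i r) (i) (r : Fin 3 -> ℤ) : ∃ s : ℤ × ℤ × ℤ,
    f (∑ π : Perm (Fin 3), cubicTerm X t δ k i (r ∘ π)) = wordSum (TwistedType.cubicWords t δ (δ * k)) (x i) (x i) (x i) s := by
  have huniv : (univ : Finset (Perm (Fin 3))) = {1, Equiv.swap 1 2, Equiv.swap 0 1, Equiv.swap 0 1 * Equiv.swap 1 2,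
        Equiv.swap 1 2 * Equiv.swap 0 1, Equiv.swap 0 2} := by decide
  have m1 := fun (F : ℤ × ℤ × ℤ -> B) c r s u => act_monomial₃ c 1 0 0 F r s u
  have m2 := fun (F : ℤ × ℤ × ℤ -> B) c r s u => act_monomial₃ c 0 1 0 F r s u
  have m3 := fun (F : ℤ × ℤ × ℤ -> B) c r s u => act_monomial₃ c 0 0 1 F r s u
  have m4 := fun (F : ℤ × ℤ × ℤ -> B) c r s u => act_monomial₃ c 1 1 0 F r s u
  have m5 := fun (F : ℤ × ℤ × ℤ -> B) c r s u => act_monomial₃ c 1 0 1 F r s u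
  have m6 := fun (F : ℤ × ℤ × ℤ -> B) c r s u => act_monomial₃ c 0 1 1 F r s u
  simp only [pow_one, pow_zero, mul_one, one_mul, Nat.cast_one, Nat.cast_zero, add_zero] at m1 m2 m3 m4 m5 m6
  have c1 : (V1 * V0 : ℂ[ℤ × ℤ × ℤ]) = V0 * V1 := mul_comm _ _; have c2 : (V2 * V0 : ℂ[ℤ × ℤ × ℤ]) = V0 * V2 := mul_comm _ _
  have c3 : (V2 * V1 : ℂ[ℤ × ℤ × ℤ]) = V1 * V2 := mul_comm _ _; have s1 : ∀ s : ℤ, s - 1 + 1 = s := fun s => sub_add_cancel s 1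
  have d1 : (Equiv.swap (1 : Fin 3) 2 : Fin 3 -> Fin 3) = ![0, 2, 1] := by decide
  have d2 : (Equiv.swap (0 : Fin 3) 1 : Fin 3 -> Fin 3) = ![1, 0, 2] := by decide
  have d3 : (Equiv.swap (0 : Fin 3) 2 : Fin 3 -> Fin 3) = ![2, 1, 0] := by decide
  have hsum : ∀ F : Perm (Fin 3) -> FreeAlgebra ℂ (Gen X), ∑ π, F π = F 1 + F (Equiv.swap 1 2) +
      F (Equiv.swap 0 1) + F (Equiv.swap 0 1 * Equiv.swap 1 2) + F (Equiv.swap 1 2 * Equiv.swap 0 1) +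
      F (Equiv.swap 0 2) := by
    intro F
    rw [huniv, sum_insert (by decide), sum_insert (by decide), sum_insert (by decide), sum_insert (by decide), sum_insert (by decide),
      sum_singleton]
    abel
  rw [hsum]; have key : δ * k = 1 ∨ δ * k = -1 := units_eq_one_or _; have hk : ((δ : ℤ) * k) = ((δ * k : ℤˣ) : ℤ) := by push_cast; rfl
  have e3 : t ^ (3 * (k : ℤ)) = t ^ (3 * (δ : ℤ) * ((δ * k : ℤˣ) : ℤ)) := by
    rw [<-hk, mul_assoc, <-mul_assoc (δ : ℤ), <-val_mul, units_mul_self]; simp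
  have e4 : t ^ (-(3 * (k : ℤ))) = t ^ (-(3 * (δ : ℤ) * ((δ * k : ℤˣ) : ℤ))) := by simp [zpow_neg, e3]
  rcases key with h | h
  . refine ⟨(r 0 - 1, r 1 - 1, r 2 - 1), ?_⟩
    simp only [cubicTerm, hk, e3, e4, h, Function.comp_apply, map_add, map_sub, map_smul, map_mul, hf,
      coe_mul, coe_one, d1, d2, d3, cons_val, id, val_one]
    simp only [wordSum, TwistedType.cubicWords, cons_val, Pi.add_apply, TwistedType.cubicP,
      if_true, act_add, act_sub, Pi.sub_apply, c1, c2, c3, m4, m5, m6, s1, mul_one]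
  . refine ⟨(r 0, r 1, r 2), ?_⟩
    simp only [cubicTerm, hk, e3, e4, h, Function.comp_apply, map_add, map_sub, map_smul, map_mul, hf,
      coe_mul, coe_one, d1, d2, d3, cons_val, id, val_one,
      val_neg, sub_neg_eq_add]
    simp only [wordSum, TwistedType.cubicWords, cons_val, Pi.add_apply, TwistedType.cubicP,
      if_neg (show ¬ ((-1 : ℤˣ) = 1) by decide), act_add, act_sub, Pi.sub_apply, c1, c2, c3,
      m1, m2, m3, mul_one, mul_neg, neg_neg]

end Serre

section Lift

variable {B : Type*} [Ring B] [Algebra ℂ B] (P : PreRep X t O B)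

namespace PreRep

def psi (J : ℤˣ) (i : X.I0) (k : ℕ) : B := P.inv J i * P.phi J i (ℓ O J i + J * k)

lemma inv_comm {b : B} (J i) (h : Commute b (P.phi J i (ℓ O J i))) :
    Commute b (P.inv J i) := by
  have h1 : P.inv J i * (b * P.phi J i (ℓ O J i)) * P.inv J i = P.inv J i * (P.phi J i (ℓ O J i) * b) * P.inv J i := by rw [h.eq]
  rw [mul_assoc, mul_assoc b, P.lead_inv, mul_one, <-mul_assoc, P.inv_lead, one_mul] at h1; exact h1.symm

lemma psi_zero (J i) : P.psi J i 0 = 1 := by simp [psi, P.inv_lead]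

lemma psi_comm {b : B} (h : ∀ J i r, Commute b (P.phi J i r)) (J i k) :
    Commute b (P.psi J i k) :=
  (P.inv_comm J i (h _ _ _)).mul_right (h _ _ _)

def h (i : X.I0) (m : ℤ) : B :=
  if m = 0 then 0 else if 0 < m then
    (X.qi t i - (X.qi t i)⁻¹)⁻¹ • logCf (P.psi 1 i) m.natAbs
  else -(X.qi t i - (X.qi t i)⁻¹)⁻¹ • logCf (P.psi (-1) i) m.natAbs

lemma h_eq (J : ℤˣ) (i) {k : ℕ} (hk : k ≠ 0) : P.h i (J * k) = ((J : ℂ) * (X.qi t i - (X.qi t i)⁻¹)⁻¹) • logCf (P.psi J i) k := by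
  rcases units_eq_one_or J with rfl | rfl
  . simp_all [h]
  simp_all [h]

lemma ex_sign {m} (hm : m ≠ 0) : ∃ (J : ℤˣ) (k : ℕ), k ≠ 0 ∧ m = (J : ℤ) * k := by
  rcases Int.natAbs_eq m with h | h
  . exact ⟨1, m.natAbs, by omega, by simpa using h⟩
  . exact ⟨-1, m.natAbs, by omega, by simpa using h⟩

lemma h_comm'' {b : B} (hb : ∀ J i r, Commute b (P.phi J i r)) (i : X.I0) (m : ℤ) :
    Commute b (P.h i m) := by
  by_cases hm : m = 0
  . simp [h, if_pos hm]
  . obtain ⟨J, k, hk, rfl⟩ := ex_sign hm; rw [P.h_eq J i hk]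
    exact (logCf_comm (P.psi_comm hb J i) k).smul_right _

lemma phi_h_comm (J : ℤˣ) (i j : X.I0) (r m : ℤ) : Commute (P.phi J i r) (P.h j m) :=
  P.h_comm'' (fun _ _ _ => P.phi_comm _ _ _ _ _ _) j m

lemma h_h_comm (i j : X.I0) (m m' : ℤ) : Commute (P.h i m) (P.h j m') := P.h_comm'' (fun _ _ _ => (P.phi_h_comm _ _ _ _ _).symm) j m'

lemma phi_log_comm (J ε' : ℤˣ) (i j : X.I0) (r : ℤ) (k : ℕ) :
    Commute (P.phi J i r) (logCf (P.psi ε' j) k) :=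
  logCf_comm (P.psi_comm (fun _ _ _ => P.phi_comm _ _ _ _ _ _) ε' j) k

lemma phi_eq_ld_psi (J : ℤˣ) (i) (k : ℕ) :
    P.phi J i (ℓ O J i + J * k) = P.phi J i (ℓ O J i) * P.psi J i k := by
  rw [psi, <-mul_assoc, P.lead_inv, one_mul]

variable (ht : t ≠ 0) (hq : Generic t) (hμ : X.IsShift O)

include ht in
lemma log_x (J δ : ℤˣ) (i j) (k : ℕ) (r : ℤ) :
    (k : ℂ) • (logCf (P.psi J i) k * P.x δ j r - P.x δ j r * logCf (P.psi J i) k) =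
      coeff k (X.gamLog t J δ i j) • P.x δ j (r + (J : ℤ) * k) := by
  refine log_commtr_of_ser (b := P.inv J i) (a := logCf (P.psi J i)) (x := P.x δ j) (J : ℤ)
    (φ := fun k => P.phi J i (ℓ O J i + (J : ℤ) * k))
    ?_ (fun k l => (P.phi_log_comm _ _ _ _ _ _).symm) (X.euler_gam t ht J δ i j) ?_
    (P.phi_x J δ i j) k r
  . intro k; simp only [P.phi_eq_ld_psi]; rw [<-mul_smul_comm, logCf_rec (P.psi_zero J i), mul_sum]
    refine sum_congr rfl fun p _ => ?_
    rw [mul_smul_comm, <-mul_assoc, <-mul_assoc, (P.phi_log_comm J J i i _ p.1).eq]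
  . simp [P.inv_lead]

include hμ in
lemma log_eq_zero (J : ℤˣ) (i : X.I0) (k : ℕ) (hk : ¬ X.N i ∣ k) : logCf (P.psi J i) k = 0 := by
  refine logCf_zero (fun k hk => ?_) k hk; rw [psi, P.phi_dvd, mul_zero]; intro h
  have h1 := (Int.dvd_add_right (dvd_ld O hμ J i)).mp h; refine hk (Int.natCast_dvd_natCast.mp ?_)
  simp_all

end PreRep

end Lift

end

section

variable {B : Type*} [Ring B] [Algebra ℂ B]

namespace PreRep

variable (P : PreRep X t O B)

def genVal : Gen X -> B
  | .x J i m => P.x J i m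
  | .phi J i m => P.phi J i m
  | .h i m => P.h i m
  | .phiInv J i => P.inv J i

variable (ht : t ≠ 0) (hq : Generic t) (hμ : X.IsShift O)

include ht hq hμ in
lemma lift_rel (hc : ∀ e, P.Complete e) {a b : FreeAlgebra ℂ (Gen X)} (h : ShiftedRel X t 0 O a b) :
    FreeAlgebra.lift ℂ P.genVal a = FreeAlgebra.lift ℂ P.genVal b := by
  have hx : ∀ J i m, FreeAlgebra.lift ℂ P.genVal (fx X J i m) = P.x J i m := fun _ _ _ => by rw [lift_ι_apply]; rfl
  have hphi : ∀ J i m, FreeAlgebra.lift ℂ P.genVal (fphi X J i m) = P.phi J i m := fun _ _ _ => by rw [lift_ι_apply]; rfl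
  have hh : ∀ i m, FreeAlgebra.lift ℂ P.genVal (fh X i m) = P.h i m := fun _ _ => by rw [lift_ι_apply]; rfl
  have hinv : ∀ J i, FreeAlgebra.lift ℂ P.genVal (fphiInv X J i) = P.inv J i := fun _ _ => by rw [lift_ι_apply]; rfl
  cases h with
  | x_zero J i r hr => rw [hx, P.x_zero _ _ _ hr, map_zero]
  | h_zero i m hm =>
    rw [hh, map_zero]; by_cases h0 : m = 0
    . exact if_pos h0
    . obtain ⟨J, k, hk, rfl⟩ := ex_sign h0; rw [P.h_eq J i hk, P.log_eq_zero hμ J i k, smul_zero]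
      exact fun h' => hm (dvd_mul_of_dvd_right (Int.natCast_dvd_natCast.mpr h') _)
  | h_spurious i => rw [hh, map_zero]; exact if_pos rfl
  | phi_phi J ε' i j r r' => rw [map_mul, map_mul, hphi, hphi, P.phi_comm]
  | phi_h J i j r m => rw [map_mul, map_mul, hphi, hh, (P.phi_h_comm _ _ _ _ _).eq]
  | h_h i j m m' => rw [map_mul, map_mul, hh, hh, (P.h_h_comm _ _ _ _).eq]
  | lead_x J e i j r =>
    rw [map_smul, map_mul, map_mul, hphi, hx]; have := P.phi_x J e i j 0 r
    simp only [twist, antidiagonal_zero, sum_singleton, Nat.cast_zero, mul_zero, add_zero] at this; rw [this, X.cf_zero_gam t ht]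
  | h_x e i j m r hm =>
    rw [map_smul, map_sub, map_mul, map_mul, hh, hx, hx]; obtain ⟨J, k, hk, rfl⟩ := ex_sign hm
    have hk' : (k : ℂ) ≠ 0 := by exact_mod_cast hk
    have hq' := X.qi_sub_ne ht hq i; have hε : ((J : ℤ) : ℂ) ≠ 0 := by exact_mod_cast J.ne_zero
    have h1 := P.log_x ht J e i j k r
    rw [P.h_eq J i hk, smul_mul_assoc, mul_smul_comm, <-smul_sub,
      <-inv_smul_smul₀ hk' (logCf (P.psi J i) k * P.x e j r - P.x e j r * logCf (P.psi J i) k),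
      h1, smul_smul, smul_smul, add_comm r]
    congr 1; rw [X.cf_gamLog ht hq J e i j hk]
    have hε2 : ((J : ℤ) : ℂ) * ((J : ℤ) : ℂ) = 1 := by rw [<-Int.cast_mul, <-val_mul, units_mul_self]; simp
    have key : ∀ a d Q S l : ℂ, a * a = 1 -> Q ≠ 0 -> l ≠ 0 ->
        a * Q⁻¹ * l⁻¹ * (d * Q * S) = d / (a * l) * S := by
      intro a d Q S l ha hQ hl; have ha0 : a ≠ 0 := fun h => by simp [h] at ha
      field_simp; linear_combination S * d * ha
    rw [Int.cast_mul, Int.cast_natCast]; exact key _ _ _ _ _ hε2 hq' hk'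
  | x_x i j r r' =>
    rw [map_smul, map_sub, map_sub, map_mul, map_mul, hx, hx, hphi, hphi, P.x_x, X.coef_x_x]; split_ifs
    . rw [one_div]
    . rw [zero_div, zero_smul]
  | phi_exp J i k =>
    rw [map_mul, hphi, hphi, map_expCf, P.phi_eq_ld_psi]; congr 1; refine eq_expCf ?_ (P.psi_zero J i) ?_ k
    . intro k l; simp only [map_smul, hh]; exact ((P.h_h_comm _ _ _ _).smul_left _).smul_right _
    . intro k; rw [logCf_rec (P.psi_zero J i)]; refine sum_congr rfl fun p _ => ?_
      by_cases hp : p.1 = 0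
      . simp [hp]
      . have hq' := X.qi_sub_ne ht hq i
        have hε2 : ((J : ℤ) : ℂ) * ((J : ℤ) : ℂ) = 1 := by rw [<-Int.cast_mul, <-val_mul, units_mul_self]; simp
        rw [map_smul, hh, P.h_eq J i hp, smul_smul, mul_assoc, mul_left_comm _ (((J : ℤ) : ℂ)), mul_inv_cancel₀ hq', mul_one, hε2, one_smul]
  | phi_zero J i k hk =>
    rw [hphi, map_zero]; refine P.phi_van J i _ ?_
    rw [sub_sub_cancel_left, mul_neg, <-mul_assoc, <-val_mul, units_mul_self]; simpa using hk
  | lead_inv J i => rw [map_mul, hphi, hinv, P.lead_inv, map_one]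
  | inv_lead J i => rw [map_mul, hphi, hinv, P.inv_lead, map_one]
  | quad J i j r1 r2 =>
    simp only [map_sum, map_smul, map_mul, hx]; exact (hc J).quad.quad i j r1 r2
  | serre J i j r1 r2 l hij hσ =>
    rw [map_serTerm _ (P.x J) J (hx J), (hc J).serre i j hij, map_zero]; rfl
  | cubic J u i r hi =>
    obtain ⟨s, hs⟩ := map_cubicTerm (t := t) (FreeAlgebra.lift ℂ P.genVal) (P.x J) J u (hx J) i r
    rw [hs, (hc J).cubic _ i hi, map_zero]; rfl

/-- A representation of the shifted algebra, from its generators. -/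
def lift (hc : ∀ d, P.Complete d) : SA X t O →ₐ[ℂ] B :=
  RingQuot.liftAlgHom ℂ ⟨FreeAlgebra.lift ℂ P.genVal, fun _ _ h => P.lift_rel ht hq hμ hc h⟩

lemma lift_genX (hc : ∀ d, P.Complete d) (J i m) :
    P.lift ht hq hμ hc (genX O J i m) = P.x J i m := by
  rw [lift, genX, RingQuot.liftAlgHom_mkAlgHom_apply, lift_ι_apply]; rfl

lemma lift_gPhi (hc : ∀ d, P.Complete d) (J i m) :
    P.lift ht hq hμ hc (genPhi O J i m) = P.phi J i m := by
  rw [lift, genPhi, RingQuot.liftAlgHom_mkAlgHom_apply, lift_ι_apply]; rfl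

lemma lift_genInv (hc : ∀ d, P.Complete d) (J i) :
    P.lift ht hq hμ hc (genInv O J i) = P.inv J i := by
  rw [lift, genInv, RingQuot.liftAlgHom_mkAlgHom_apply, lift_ι_apply]; rfl

end PreRep

section Adjoin

variable (ht : t ≠ 0) (hq : Generic t)

lemma logGen_in {A : Subalgebra ℂ (SA X t O)} (J i)
    (hphi : ∀ m, genPhi O J i m ∈ A) (hinv : genInv O J i ∈ A) {k} (hk : k ≠ 0) :
    logGen t O J i k ∈ A := by
  induction k using strong_induction_on with
  | _ k ih =>
    have hk' : (k : ℂ) ≠ 0 := by exact_mod_cast hk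
    have hE : ∀ k, expCoeff (logGen t O J i) k = genInv O J i * genPhi O J i (ℓ O J i + (J : ℤ) * k) := fun k => by
      rw [gPhi_exp, <-mul_assoc, gPhi_inv_ld, one_mul]
    have hEA : ∀ k, expCoeff (logGen t O J i) k ∈ A := fun k => by rw [hE]; exact A.mul_mem hinv (hphi _)
    have h1 := expCoeff_rec (logGen_comm (t := t) O J i) k
    rw [<-add_sum_erase _ _ (show (k, 0) ∈ antidiagonal k by simp), expCf_zero, mul_one, <-sub_eq_iff_eq_add] at h1
    have h2 : (k : ℂ) • logGen t O J i k ∈ A := by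
      rw [<-h1]; refine A.sub_mem (A.smul_mem (hEA _) _) (A.sum_mem fun p hp => ?_)
      simp only [Finset.mem_erase, mem_antidiagonal, ne_eq] at hp; by_cases h0 : p.1 = 0
      . rw [h0, Nat.cast_zero, zero_smul]; exact A.zero_mem
      . have : p.1 ≠ k := fun h => hp.1 (by ext <;> simp <;> omega)
        exact A.smul_mem (A.mul_mem (ih _ (by omega) h0) (hEA _)) _
    have := A.smul_mem h2 (k : ℂ)⁻¹; rwa [inv_smul_smul₀ hk'] at this

include ht hq in
lemma subalgebra_eq_top (A : Subalgebra ℂ (SA X t O))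
    (hx : ∀ J i m, genX O J i m ∈ A) (hphi : ∀ J i m, genPhi O J i m ∈ A)
    (hinv : ∀ J i, genInv O J i ∈ A) : A = ⊤ := by
  have hh : ∀ i m, genH O i m ∈ A := by
    intro i m; by_cases hm : m = 0
    . subst hm
      have : (genH O i 0 : SA X t O) = 0 := by
        have := rel_eq O (ShiftedRel.h_spurious (t := t) (μp := 0) (μm := O) i); rwa [map_zero] at this
      rw [this]; exact A.zero_mem
    . obtain ⟨J, k, hk, rfl⟩ := PreRep.ex_sign hm; have h1 := logGen_in J i (hphi J i) (hinv J i) hk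
      have h2 : (J : ℂ) * (X.qi t i - (X.qi t i)⁻¹) ≠ 0 := mul_ne_zero (by exact_mod_cast J.ne_zero) (X.qi_sub_ne ht hq i)
      have h3 := A.smul_mem h1 ((J : ℂ) * (X.qi t i - (X.qi t i)⁻¹))⁻¹; rwa [logGen, inv_smul_smul₀ h2] at h3
  rw [eq_top_iff]; rintro a -; obtain ⟨a, rfl⟩ := RingQuot.mkAlgHom_surjective ℂ (ShiftedRel X t 0 O) a
  induction a using FreeAlgebra.induction with
  | grade0 r => rw [AlgHom.commutes]; exact A.algebraMap_mem r
  | grade1 g =>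
    cases g with
    | x J i m => exact hx J i m
    | phi J i m => exact hphi J i m
    | h i m => exact hh i m
    | phiInv J i => exact hinv J i
  | mul a b ha hb => rw [map_mul]; exact A.mul_mem ha hb
  | add a b ha hb => rw [map_add]; exact A.add_mem ha hb

include ht hq in
lemma smul_in_of_gens {V : Type*} [ACG V] [Module ℂ V] [Module (SA X t O) V]
    [IsScalarTower ℂ (SA X t O) V] (Z : Submodule ℂ V)
    (hx : ∀ J i m, ∀ z ∈ Z, (genX O J i m : SA X t O) • z ∈ Z)
    (hphi : ∀ J i m, ∀ z ∈ Z, (genPhi O J i m : SA X t O) • z ∈ Z)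
    (hinv : ∀ J i, ∀ z ∈ Z, (genInv O J i : SA X t O) • z ∈ Z)
    (a : SA X t O) {z : V} (hz : z ∈ Z) : a • z ∈ Z := by
  let A : Subalgebra ℂ (SA X t O) := {
      carrier := {a | ∀ z ∈ Z, a • z ∈ Z}
      mul_mem' := fun {a b} ha hb z hz => by rw [mul_smul]; exact ha _ (hb _ hz)
      add_mem' := fun {a b} ha hb z hz => by rw [add_smul]; exact Z.add_mem (ha _ hz) (hb _ hz)
      algebraMap_mem' := fun r z hz => by rw [algebraMap_smul]; exact Z.smul_mem _ hz }
  have : A = ⊤ := subalgebra_eq_top ht hq A hx hphi hinv; have h1 : a ∈ A := this ▸ Algebra.mem_top; exact h1 z hz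

end Adjoin

end

section

namespace TwistedType

variable (X) (t)

lemma gam_mul_gam_neg (ht : t ≠ 0) (J d : ℤˣ) (i j : X.I0) :
    X.gam t J d i j * X.gam t J (-d) i j = 1 := by
  have hq : (t ^ 2) ≠ 0 := pow_ne_zero 2 ht; rw [gam, gam, <-prod_mul_distrib]; refine Finset.prod_eq_one fun s _ => ?_
  have h0 : (t ^ 2) ^ ((J : ℤ) * d * X.c i s j) ≠ 0 := zpow_ne_zero _ hq
  have h2 : (t ^ 2) ^ ((J : ℤ) * ((-d : ℤˣ) : ℤ) * X.c i s j) = ((t ^ 2) ^ ((J : ℤ) * d * X.c i s j))⁻¹ := by simp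
  have h1 : X.gamNum t J d i j s * X.gamNum t J (-d) i j s = X.gamDen t J d i j s * X.gamDen t J (-d) i j s := by
    simp only [gamNum, gamDen, h2, map_mul, map_one]
    have : C ((t ^ 2) ^ ((J : ℤ) * d * X.c i s j)) *
      C ((t ^ 2) ^ ((J : ℤ) * d * X.c i s j))⁻¹ = 1 := by
      rw [<-map_mul, mul_inv_cancel₀ h0, map_one]
    grind
  calc _ = (X.gamNum t J d i j s * X.gamNum t J (-d) i j s) * ((X.gamDen t J d i j s)⁻¹ * (X.gamDen t J (-d) i j s)⁻¹) := by ring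
    _ = (X.gamDen t J d i j s * (X.gamDen t J d i j s)⁻¹) * (X.gamDen t J (-d) i j s * (X.gamDen t J (-d) i j s)⁻¹) := by rw [h1]; ring
    _ = 1 := by simp [gamDen_inv, one_mul]

end TwistedType

/-- The eigenvalues of the `φ`'s on a highest `ℓ`-weight vector. -/
structure LWeight (X : TwistedType) (O : X.I0 -> ℤ) where
  psi : ℤˣ -> X.I0 -> ℤ -> ℂ
  dvd : ∀ J i r, ¬ (X.N i : ℤ) ∣ r -> psi J i r = 0
  van : ∀ (J : ℤˣ) i r, (J : ℤ) * (r - ℓ O J i) < 0 -> psi J i r = 0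
  lead_ne : ∀ J i, psi J i (ℓ O J i) ≠ 0

abbrev Letter (X : TwistedType) : Type := {p : X.I0 × ℤ // (X.N p.1 : ℤ) ∣ p.2}

abbrev Verma (X : TwistedType) : Type := List (Letter X) →₀ ℂ

namespace Verma

def vac : Verma X := Finsupp.single [] 1

def low (j : X.I0) (m : ℤ) : End ℂ (Verma X) :=
  if h : (X.N j : ℤ) ∣ m then Finsupp.lmapDomain ℂ ℂ (List.cons ⟨(j, m), h⟩) else 0

lemma low_sgl {j : X.I0} {m : ℤ} (h : (X.N j : ℤ) ∣ m) (w : List (Letter X)) :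
    low j m (Finsupp.single w 1) = Finsupp.single (⟨(j, m), h⟩ :: w) 1 := by
  rw [low, dif_pos h, Finsupp.lmapDomain_apply, Finsupp.mapDomain_single]

lemma low_zero {j : X.I0} {m : ℤ} (h : ¬ (X.N j : ℤ) ∣ m) : (low j m : End ℂ (Verma X)) = 0 := dif_neg h

lemma eq_top_of_stable (Z : Submodule ℂ (Verma X)) (h0 : vac ∈ Z)
    (hs : ∀ j m, ∀ y ∈ Z, low j m y ∈ Z) : Z = ⊤ := by
  have h1 : ∀ w : List (Letter X), (Finsupp.single w 1 : Verma X) ∈ Z := by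
    intro w; induction w with
    | nil => exact h0
    | cons a w ih =>
      have := hs a.1.1 a.1.2 _ ih; rwa [low_sgl a.2] at this
  rw [eq_top_iff]; rintro y -; induction y using Finsupp.induction_linear with
  | zero => simp
  | add f g hf hg => exact Z.add_mem hf hg
  | single w c =>
    rw [<-mul_one c, <-smul_eq_mul, <-Finsupp.smul_single]; exact Z.smul_mem _ (h1 w)

lemma hom_ext {M : Type*} [ACG M] [Module ℂ M] {I : Type*} {f g : I -> Verma X →ₗ[ℂ] M}
    (h0 : ∀ a, f a vac = g a vac)
    (hs : ∀ y, (∀ a, f a y = g a y) -> ∀ j m a, f a (low j m y) = g a (low j m y)) (a : I) :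
    f a = g a := by
  have := eq_top_of_stable (⨅ a, eqLocus (f a) (g a))
    (by simp_all)
    (fun j m y hy => by
      simp_all)
  simp_all

variable (t) (Ψ : LWeight X O)

/-- The action of the coefficients of `f` on words. -/
def phiWord : List (Letter X) -> ℤˣ -> X.I0 -> ℕ -> Verma X
  | [] => fun J i k => Ψ.psi J i (ℓ O J i + (J : ℤ) * k) • vac
  | a :: w => fun J i k => ∑ p ∈ antidiagonal k, coeff p.1 (X.gam t J (-1) i a.1.1) • low a.1.1 (a.1.2 + (J : ℤ) * p.1) (phiWord w J i p.2)

/-- The coefficients of `f`, counted from the leading one. -/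
def phiN (J : ℤˣ) (i : X.I0) (k : ℕ) : End ℂ (Verma X) := linearCombination ℂ fun w => phiWord t Ψ w J i k

lemma phiN_vac (J : ℤˣ) (i : X.I0) (k : ℕ) :
    phiN t Ψ J i k vac = Ψ.psi J i (ℓ O J i + (J : ℤ) * k) • vac := by
  rw [phiN, vac, linearCombination_single, one_smul]; rfl

variable {t}

lemma tw_congr_dvd (ht : t ≠ 0) {B : Type*} [ACG B] [Module ℂ B] (J d : ℤˣ) (i j : X.I0)
    {F F' : ℕ -> ℤ -> B} {k : ℕ} {m : ℤ}
    (h : ∀ p ∈ antidiagonal k, X.N i ∣ p.1 -> X.N j ∣ p.1 ->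
      F p.2 (m + (J : ℤ) * p.1) = F' p.2 (m + (J : ℤ) * p.1)) :
    twist J (X.gam t J d i j) F k m = twist J (X.gam t J d i j) F' k m := by
  refine sum_congr rfl fun p hp => ?_
  by_cases h0 : X.N i ∣ p.1 ∧ X.N j ∣ p.1
  . simp_all
  simp [X.cf_gam_zero t ht J d h0, zero_smul]

lemma dvd_shift (J : ℤˣ) {n l : ℕ} (h : n ∣ l) (m : ℤ) : (n : ℤ) ∣ m + J * l ↔ (n : ℤ) ∣ m :=
  Int.dvd_add_left (dvd_mul_of_dvd_right (Int.natCast_dvd_natCast.mpr h) _)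

lemma phiN_low (ht : t ≠ 0) (J : ℤˣ) (i j : X.I0) (k : ℕ) (m : ℤ) (y : Verma X) :
    phiN t Ψ J i k (low j m y) = twist J (X.gam t J (-1) i j) (fun k m => low j m (phiN t Ψ J i k y)) k m := by
  by_cases h : (X.N j : ℤ) ∣ m
  . have : ∀ a : Unit, phiN t Ψ J i k ∘ₗ low j m = ∑ p ∈ antidiagonal k,
        coeff p.1 (X.gam t J (-1) i j) • low j (m + (J : ℤ) * p.1) ∘ₗ phiN t Ψ J i p.2 := by
      intro _; ext1 w; ext1; simp [low_sgl h, phiN, linearCombination_single, one_smul, phiWord, comp_apply, lsingle_apply, sumL, smulL]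
    have := congrL (this ()) y; simpa [twist, sumL] using this
  . rw [low_zero h, zeroL, map_zero, tw_congr_dvd ht (F' := fun _ _ => 0), tw_zero]
    intro p _ _ h2; rw [low_zero ((dvd_shift J h2 m).not.mpr h), zeroL]

lemma sum_antidiagonal_swap {B : Type*} [AddCommMonoid B] (k : ℕ) (f : ℕ -> ℕ -> ℕ -> B) :
    ∑ p ∈ antidiagonal k, ∑ p' ∈ antidiagonal p.2, f p.1 p'.1 p'.2 = ∑ p ∈ antidiagonal k, ∑ p' ∈ antidiagonal p.2, f p'.1 p.1 p'.2 := by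
  rw [sum_sigma', sum_sigma']
  refine sum_nbij' (fun ⟨⟨i, _j⟩, ⟨k, l⟩⟩ ↦ ⟨(k, i + l), (i, l)⟩)
    (fun ⟨⟨i, _j⟩, ⟨k, l⟩⟩ ↦ ⟨(k, i + l), (i, l)⟩) ?_ ?_ ?_ ?_ ?_
  . rintro ⟨⟨i, j⟩, ⟨a, b⟩⟩ h; simp at h ⊢; omega
  . rintro ⟨⟨i, j⟩, ⟨a, b⟩⟩ h; simp at h ⊢; omega
  . simp_all
  . simp_all
  simp

lemma phiN_comm (ht : t ≠ 0) (J ε' : ℤˣ) (i i' : X.I0) (k k' : ℕ) :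
    phiN t Ψ J i k * phiN t Ψ ε' i' k' = phiN t Ψ ε' i' k' * phiN t Ψ J i k := by
  refine hom_ext (I := ℕ × ℕ) (f := fun a => phiN t Ψ J i a.1 * phiN t Ψ ε' i' a.2)
    (g := fun a => phiN t Ψ ε' i' a.2 * phiN t Ψ J i a.1) ?_ ?_ (k, k')
  . intro a; simp only [mul_apply, phiN_vac, map_smul]; rw [smul_comm]
  . intro y hy j m ⟨k, k'⟩
    have hy : ∀ k k', phiN t Ψ J i k (phiN t Ψ ε' i' k' y) = phiN t Ψ ε' i' k' (phiN t Ψ J i k y) := fun k k' => hy (k, k')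
    simp only [mul_apply]; rw [phiN_low Ψ ht, phiN_low Ψ ht]
    simp only [twist, map_sum, map_smul, phiN_low Ψ ht, smul_sum, hy]; rw [sum_comm]
    refine sum_congr rfl fun p _ => sum_congr rfl fun p' _ => ?_
    rw [smul_comm, add_right_comm]

/-- The eigenvalue of the leading coefficient of `f` on a word. -/
def ldScal (t : ℂ) (Ψ : LWeight X O) (J : ℤˣ) (i : X.I0) : List (Letter X) -> ℂ
  | [] => Ψ.psi J i (ℓ O J i)
  | a :: w => (t ^ 2) ^ ((J : ℤ) * ((-1 : ℤˣ) : ℤ) * X.symCartan i a.1.1) * ldScal t Ψ J i w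

lemma ldScal_ne (ht : t ≠ 0) (J : ℤˣ) (i : X.I0) (w : List (Letter X)) :
    ldScal t Ψ J i w ≠ 0 := by
  induction w with
  | nil => exact Ψ.lead_ne J i
  | cons a w ih => exact mul_ne_zero (zpow_ne_zero _ (pow_ne_zero 2 ht)) ih

lemma phiN_zero_sgl (ht : t ≠ 0) (J : ℤˣ) (i : X.I0) (w : List (Letter X)) :
    phiN t Ψ J i 0 (Finsupp.single w 1) = ldScal t Ψ J i w • Finsupp.single w 1 := by
  induction w with
  | nil =>
    have := phiN_vac t Ψ J i 0; simp_all [ldScal, vac]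
  | cons a w ih =>
    have e := low_sgl (X := X) a.2 w
    rw [show (Finsupp.single (a :: w) 1 : Verma X) = low a.1.1 a.1.2 (Finsupp.single w 1) from e.symm, phiN_low Ψ ht]
    simp only [twist, antidiagonal_zero, sum_singleton, Nat.cast_zero, mul_zero,
      add_zero, ih, X.cf_zero_gam t ht, ldScal, map_smul, smul_smul]

/-- The inverse of the leading coefficient of `f`. -/
def phiInv (t : ℂ) (Ψ : LWeight X O) (J : ℤˣ) (i : X.I0) : End ℂ (Verma X) :=
  linearCombination ℂ fun w => (ldScal t Ψ J i w)⁻¹ • Finsupp.single w 1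

lemma phiInv_sgl (J : ℤˣ) (i : X.I0) (w : List (Letter X)) :
    phiInv t Ψ J i (Finsupp.single w 1) = (ldScal t Ψ J i w)⁻¹ • Finsupp.single w 1 := by
  rw [phiInv, linearCombination_single, one_smul]

lemma phiN_phiInv (ht : t ≠ 0) (J : ℤˣ) (i : X.I0) : phiN t Ψ J i 0 * phiInv t Ψ J i = 1 := by
  ext1 w; ext1
  rw [comp_apply, lsingle_apply, mul_apply, phiInv_sgl, map_smul,
    phiN_zero_sgl Ψ ht, smul_smul, inv_mul_cancel₀ (ldScal_ne Ψ ht _ _ _), one_smul]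
  rfl

lemma phiInv_phiN (ht : t ≠ 0) (J : ℤˣ) (i : X.I0) : phiInv t Ψ J i * phiN t Ψ J i 0 = 1 := by
  ext1 w; ext1
  rw [comp_apply, lsingle_apply, mul_apply, phiN_zero_sgl Ψ ht, map_smul,
    phiInv_sgl, smul_smul, mul_inv_cancel₀ (ldScal_ne Ψ ht _ _ _), one_smul]
  rfl

def phi (t : ℂ) (Ψ : LWeight X O) (J : ℤˣ) (i : X.I0) (r : ℤ) : End ℂ (Verma X) :=
  if 0 ≤ (J : ℤ) * (r - ℓ O J i) then
    phiN t Ψ J i ((J : ℤ) * (r - ℓ O J i)).toNat else 0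

lemma phi_ld (J : ℤˣ) (i : X.I0) (k : ℕ) :
    phi t Ψ J i (ℓ O J i + (J : ℤ) * k) = phiN t Ψ J i k := by
  have : (J : ℤ) * (ℓ O J i + (J : ℤ) * k - ℓ O J i) = k := by rw [add_sub_cancel_left, <-mul_assoc, <-val_mul, units_mul_self]; simp
  simp_all [phi, this, Int.toNat_natCast]

lemma phi_cases (J : ℤˣ) (i : X.I0) (r : ℤ) :
    (∃ k : ℕ, r = ℓ O J i + (J : ℤ) * k) ∨ (J : ℤ) * (r - ℓ O J i) < 0 := by
  rcases le_or_gt 0 ((J : ℤ) * (r - ℓ O J i)) with h | h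
  . refine Or.inl ⟨((J : ℤ) * (r - ℓ O J i)).toNat, ?_⟩
    rw [Int.toNat_of_nonneg h, <-mul_assoc, <-val_mul, units_mul_self]; simp
  omega

lemma phi_van {J : ℤˣ} {i : X.I0} {r : ℤ} (h : (J : ℤ) * (r - ℓ O J i) < 0) :
    phi t Ψ J i r = 0 := if_neg (not_le.mpr h)

lemma phi_comm (ht : t ≠ 0) (J ε' : ℤˣ) (i i' : X.I0) (r r' : ℤ) :
    phi t Ψ J i r * phi t Ψ ε' i' r' = phi t Ψ ε' i' r' * phi t Ψ J i r := by
  unfold phi; split_ifs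
  . exact phiN_comm Ψ ht _ _ _ _ _ _
  all_goals simp

lemma phiN_dvd (ht : t ≠ 0) (J : ℤˣ) (i : X.I0) :
    ∀ k : ℕ, ¬ (X.N i : ℤ) ∣ ℓ O J i + (J : ℤ) * k -> phiN t Ψ J i k = 0 := by
  intro k hk
  refine hom_ext (I := {k : ℕ // ¬ (X.N i : ℤ) ∣ ℓ O J i + (J : ℤ) * k})
    (f := fun a => phiN t Ψ J i a) (g := fun a => 0) ?_ ?_ ⟨k, hk⟩
  . rintro ⟨k, hk⟩; rw [phiN_vac, Ψ.dvd _ _ _ hk, zero_smul, zeroL]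
  . rintro y hy j m ⟨k, hk⟩; simp only [zeroL] at hy ⊢
    rw [phiN_low Ψ ht, tw_congr_dvd ht (F' := fun _ _ => 0), tw_zero]; intro p hp h1 _
    simp only [mem_antidiagonal] at hp; rw [hy ⟨p.2, ?_⟩, map_zero]; rw [<-hp, Nat.cast_add, mul_add, add_left_comm] at hk
    exact fun h => hk ((Int.dvd_add_right
      (dvd_mul_of_dvd_right (Int.natCast_dvd_natCast.mpr h1) _)).mpr h)

lemma phi_dvd (ht : t ≠ 0) (J : ℤˣ) (i : X.I0) (r : ℤ) (h : ¬ (X.N i : ℤ) ∣ r) :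
    phi t Ψ J i r = 0 := by
  rcases phi_cases (O := O) J i r with ⟨k, rfl⟩ | h1
  . rw [phi_ld, phiN_dvd Ψ ht J i k h]
  . exact phi_van Ψ h1

end Verma

end

section

namespace Verma

variable (Ψ : LWeight X O)

/-- The commutator of the raising and lowering operators. -/
def chi (t : ℂ) (Ψ : LWeight X O) (i : X.I0) (r : ℤ) : End ℂ (Verma X) := (X.qi t i - (X.qi t i)⁻¹)⁻¹ • (phi t Ψ 1 i r - phi t Ψ (-1) i r)

open Classical in
/-- The action of the raising operators on words. -/
def raiseWord (t : ℂ) (Ψ : LWeight X O) : List (Letter X) -> X.I0 -> ℤ -> Verma X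
  | [] => fun _ _ => 0
  | a :: w => fun i r => low a.1.1 a.1.2 (raiseWord t Ψ w i r) +
      if i = a.1.1 then chi t Ψ i (r + a.1.2) (Finsupp.single w 1) else 0

def raise (t : ℂ) (Ψ : LWeight X O) (i : X.I0) (r : ℤ) : End ℂ (Verma X) := linearCombination ℂ fun w => raiseWord t Ψ w i r

lemma raise_vac (i) (r : ℤ) : raise t Ψ i r vac = 0 := by rw [raise, vac, linearCombination_single, one_smul]; rfl

open Classical in
lemma raise_low (i j) (r s : ℤ) (y : Verma X) : raise t Ψ i r (low j s y) =
    low j s (raise t Ψ i r y) + if i = j ∧ (X.N i : ℤ) ∣ s then chi t Ψ i (r + s) y else 0 := by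
  by_cases h : (X.N j : ℤ) ∣ s
  . have : raise t Ψ i r ∘ₗ low j s = low j s ∘ₗ raise t Ψ i r + if i = j then chi t Ψ i (r + s) else 0 := by
      ext1 w; ext1; simp only [comp_apply, lsingle_apply, addL]
      rw [low_sgl h, raise, linearCombination_single, one_smul, raiseWord, linearCombination_single, one_smul]
      by_cases hij : i = j <;> simp [hij]
    have := congrL this y; simp only [comp_apply, addL] at this; rw [this]; congr 1; by_cases hij : i = j
    . simp_all
    . simp [hij]
  . have h' : ¬ (i = j ∧ (X.N i : ℤ) ∣ s) := by simp_all
    rw [low_zero h, if_neg h']; simp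

lemma chi_dvd (ht : t ≠ 0) (i) (r : ℤ) (h : ¬ (X.N i : ℤ) ∣ r) : chi t Ψ i r = 0 := by
  refine extL fun y => ?_
  simp [chi, smulL, subL, phi_dvd Ψ ht _ _ _ h, sub_self, smul_zero, zeroL]

lemma raise_dvd (ht : t ≠ 0) (i) (r : ℤ) (h : ¬ (X.N i : ℤ) ∣ r) : raise t Ψ i r = 0 := by
  refine hom_ext (I := Unit) (f := fun _ => raise t Ψ i r) (g := fun _ => 0) ?_ ?_ ()
  . intro _; rw [raise_vac, zeroL]
  . intro y hy j m _; rw [raise_low, hy ()]; split_ifs with h1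
    . rw [chi_dvd Ψ ht i _ ((dvd_add_left h1.2).not.mpr h)]; simp
    . simp

lemma phiN_chi (ht : t ≠ 0) (J i j k r) (y : Verma X) :
    phiN t Ψ J i k (chi t Ψ j r y) = chi t Ψ j r (phiN t Ψ J i k y) := by
  have h := fun ε' => congrL (phi_comm Ψ ht J ε' i j (ℓ O J i + (J : ℤ) * k) r) y
  simp_all [phi_ld, mul_apply, chi, smulL, subL, map_smul, map_sub, h]

lemma phiN_raise (ht : t ≠ 0) (J i j k r) (y : Verma X) :
    phiN t Ψ J i k (raise t Ψ j r y) = twist J (X.gam t J 1 i j) (fun k r => raise t Ψ j r (phiN t Ψ J i k y)) k r := by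
  classical
  have key := hom_ext (I := ℕ × ℤ) (f := fun a => phiN t Ψ J i a.1 ∘ₗ raise t Ψ j a.2)
    (g := fun a => ∑ p ∈ antidiagonal a.1, coeff p.1 (X.gam t J 1 i j) • raise t Ψ j (a.2 + (J : ℤ) * p.1) ∘ₗ phiN t Ψ J i p.2) ?_ ?_ (k, r)
  . have := congrL key y; simpa [twist, sumL] using this
  . simp [sumL, raise_vac, phiN_vac]
  . rintro y hy j' s ⟨k, r⟩
    have hy : ∀ k r, phiN t Ψ J i k (raise t Ψ j r y) = twist J (X.gam t J 1 i j) (fun k r => raise t Ψ j r (phiN t Ψ J i k y)) k r := by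
      simp_all [twist, sumL]
    suffices h : phiN t Ψ J i k (raise t Ψ j r (low j' s y)) =
        twist J (X.gam t J 1 i j) (fun k r => raise t Ψ j r (phiN t Ψ J i k (low j' s y))) k r by
      simpa [twist, sumL] using h
    have e1 : phiN t Ψ J i k (low j' s (raise t Ψ j r y)) = ∑ p ∈ antidiagonal k, ∑ p' ∈ antidiagonal p.2,
          (coeff p.1 (X.gam t J (-1) i j') * coeff p'.1 (X.gam t J 1 i j)) •
            low j' (s + J * p.1) (raise t Ψ j (r + J * p'.1) (phiN t Ψ J i p'.2 y)) := by
      simp [phiN_low Ψ ht, twist, hy, map_sum, map_smul, smul_sum, smul_smul]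
    have e2 : twist J (X.gam t J 1 i j) (fun k r => raise t Ψ j r (phiN t Ψ J i k (low j' s y))) k r =
        ∑ p ∈ antidiagonal k, ∑ p' ∈ antidiagonal p.2, (coeff p'.1 (X.gam t J (-1) i j') * coeff p.1 (X.gam t J 1 i j)) •
            low j' (s + J * p'.1) (raise t Ψ j (r + J * p.1) (phiN t Ψ J i p'.2 y)) +
        ∑ p ∈ antidiagonal k, ∑ p' ∈ antidiagonal p.2,
          (coeff p'.1 (X.gam t J (-1) i j') * coeff p.1 (X.gam t J 1 i j)) • (if j = j' ∧ (X.N j : ℤ) ∣ s then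
              chi t Ψ j (r + s + J * (p.1 + p'.1 : ℕ)) (phiN t Ψ J i p'.2 y) else 0) := by
      rw [<-sum_add_distrib]; refine sum_congr rfl fun p _ => ?_
      beta_reduce
      rw [phiN_low Ψ ht, <-sum_add_distrib, twist, map_sum, smul_sum]; refine sum_congr rfl fun p' _ => ?_
      rw [map_smul, raise_low, smul_smul, mul_comm, <-smul_add]; by_cases hd : X.N i ∣ p'.1 ∧ X.N j' ∣ p'.1
      . congr 2
        have : (j = j' ∧ (X.N j : ℤ) ∣ s + J * p'.1) ↔ (j = j' ∧ (X.N j : ℤ) ∣ s) := and_congr_right fun h => dvd_shift J (h ▸ hd.2) s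
        grind
      . rw [X.cf_gam_zero t ht J (-1) hd, zero_mul, zero_smul, zero_smul]
    rw [raise_low, map_add, e1, e2, sum_antidiagonal_swap k fun a b c =>
      (coeff a (X.gam t J (-1) i j') * coeff b (X.gam t J 1 i j)) • low j' (s + J * a) (raise t Ψ j (r + J * b) (phiN t Ψ J i c y))]
    congr 1; by_cases hj : j = j' ∧ (X.N j : ℤ) ∣ s
    . simp only [if_pos hj]
      have e3 := congrFun (congrFun (tw_mul (J : ℤ) (X.gam t J 1 i j) (X.gam t J (-1) i j')
        (fun k r => chi t Ψ j r (phiN t Ψ J i k y))) k) (r + s)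
      rw [<-hj.1, X.gam_mul_gam_neg t ht J 1, tw_one, <-phiN_chi Ψ ht] at e3; rw [e3, <-hj.1]
      simp only [twist, smul_sum, smul_smul]; refine sum_congr rfl fun p _ => sum_congr rfl fun p' _ => ?_
      rw [mul_comm]; grind
    simp [if_neg hj]

/-- The Cartan part of the action on the free module. -/
def preRep (ht : t ≠ 0) (Ψ : LWeight X O) : PreRep X t O (End ℂ (Verma X)) where
  x J i r := if J = 1 then raise t Ψ i r else low i r
  phi := phi t Ψ
  inv := phiInv t Ψ
  x_zero J i r h := by
    split_ifs
    . exact raise_dvd Ψ ht i r h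
    . exact low_zero h
  phi_dvd := phi_dvd Ψ ht
  phi_van _ _ _ h := phi_van Ψ h
  phi_comm := phi_comm Ψ ht
  lead_inv J i := by have := phi_ld (t := t) Ψ J i 0; simp_all [Nat.cast_zero, mul_zero, add_zero, this, phiN_phiInv Ψ ht]
  inv_lead J i := by have := phi_ld (t := t) Ψ J i 0; simp_all [Nat.cast_zero, mul_zero, add_zero, this, phiInv_phiN Ψ ht]
  phi_x J d i j k m := by
    refine extL fun y => ?_
    simp only [phi_ld]; rcases units_eq_one_or d with rfl | rfl
    . simpa [twist, sumL] using phiN_raise Ψ ht J i j k m y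
    . simpa [twist, sumL] using phiN_low Ψ ht J i j k m y
  x_x i j r s := by
    refine extL fun y => ?_
    have := raise_low (t := t) Ψ i j r s y
    rw [if_pos rfl, if_neg (by decide), subL, mul_apply, mul_apply, this, add_sub_cancel_left]; split_ifs <;> rfl

/-- The coefficient of the highest weight vector. -/
def top : Verma X →ₗ[ℂ] ℂ := Finsupp.lapply []

lemma top_vac : top (vac : Verma X) = 1 := by simp [top, vac]

lemma top_low (j m) (y : Verma X) : top (low j m y) = 0 := by
  unfold low; split_ifs with h
  . rw [top, Finsupp.lmapDomain_apply, Finsupp.lapply_apply, Finsupp.mapDomain_of_notMem_range]; simp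
  . simp

lemma top_phiN (ht : t ≠ 0) (J i k) (y : Verma X) :
    top (phiN t Ψ J i k y) = Ψ.psi J i (ℓ O J i + J * k) * top y := by
  refine congrL (hom_ext (I := Unit) (f := fun _ => top ∘ₗ phiN t Ψ J i k)
    (g := fun _ => Ψ.psi J i (ℓ O J i + J * k) • top) ?_ ?_ ()) y
  . simp [phiN_vac]
  simp [phiN_low Ψ ht, twist, map_sum, top_low]

lemma phi_vac (J i r) : phi t Ψ J i r vac = Ψ.psi J i r • vac := by
  rcases phi_cases (O := O) J i r with ⟨k, rfl⟩ | h1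
  . rw [phi_ld, phiN_vac]
  . rw [phi_van Ψ h1, Ψ.van _ _ _ h1]; simp

def rad (t : ℂ) (Ψ : LWeight X O) : Submodule ℂ (Verma X) := sSup {Z | Z ≤ ker top ∧ ∀ i r, ∀ y ∈ Z, raise t Ψ i r y ∈ Z}

lemma le_rad {Z : Submodule ℂ (Verma X)} (h1 : Z ≤ ker top)
    (h2 : ∀ i r, ∀ y ∈ Z, raise t Ψ i r y ∈ Z) : Z ≤ rad t Ψ :=
  le_sSup ⟨h1, h2⟩

lemma rad_le : rad t Ψ ≤ ker top := sSup_le fun _ h => h.1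

lemma raise_in_rad {i} {r : ℤ} {y : Verma X} (hy : y ∈ rad t Ψ) :
    raise t Ψ i r y ∈ rad t Ψ := by
  have : rad t Ψ ≤ (rad t Ψ).comap (raise t Ψ i r) := sSup_le fun Z hZ z hz => le_rad Ψ hZ.1 hZ.2 (hZ.2 i r z hz)
  exact this hy

lemma low_in_rad {i} {r : ℤ} {y : Verma X} (hphi : ∀ J i r, ∀ y ∈ rad t Ψ, phi t Ψ J i r y ∈ rad t Ψ)
    (hy : y ∈ rad t Ψ) : low i r y ∈ rad t Ψ := by
  classical
  have h : rad t Ψ ⊔ ⨆ a : X.I0 × ℤ, (rad t Ψ).map (low a.1 a.2) ≤ rad t Ψ := by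
    refine le_rad Ψ (sup_le (rad_le Ψ) (iSup_le fun a => ?_)) fun i r => ?_
    . rintro _ ⟨y, _, rfl⟩; exact top_low _ _ _
    . suffices h : rad t Ψ ⊔ ⨆ a : X.I0 × ℤ, (rad t Ψ).map (low a.1 a.2) ≤
          (rad t Ψ ⊔ ⨆ a : X.I0 × ℤ, (rad t Ψ).map (low a.1 a.2)).comap (raise t Ψ i r) from h
      refine sup_le (fun y hy => mem_sup_left (raise_in_rad Ψ hy)) (iSup_le fun a => ?_); rintro _ ⟨y, hy, rfl⟩; rw [mem_comap, raise_low]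
      refine add_mem (mem_sup_right (mem_iSup_of_mem a
        ⟨_, raise_in_rad Ψ hy, rfl⟩)) (mem_sup_left ?_)
      split_ifs
      . exact smul_mem _ _ (sub_mem (hphi _ _ _ _ hy) (hphi _ _ _ _ hy))
      simp
  exact h (mem_sup_right (mem_iSup_of_mem (i, r) ⟨y, hy, rfl⟩))

lemma raise_phiN (ht : t ≠ 0) (J : ℤˣ) (i j) (k : ℕ) (r : ℤ) (y : Verma X) :
    raise t Ψ j r (phiN t Ψ J i k y) = twist J (X.gam t J (-1) i j) (fun k r => phiN t Ψ J i k (raise t Ψ j r y)) k r := by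
  have : (fun k r => phiN t Ψ J i k (raise t Ψ j r y)) = twist J (X.gam t J 1 i j) (fun k r => raise t Ψ j r (phiN t Ψ J i k y)) := by
    funext k r; exact phiN_raise Ψ ht J i j k r y
  rw [this, <-tw_mul, mul_comm, X.gam_mul_gam_neg t ht J 1, tw_one]

lemma phi_in_rad (ht : t ≠ 0) {J : ℤˣ} {i} {r : ℤ} {y : Verma X} (hy : y ∈ rad t Ψ) :
    phi t Ψ J i r y ∈ rad t Ψ := by
  rcases phi_cases (O := O) J i r with ⟨k, rfl⟩ | h1
  swap
  . simp [phi_van Ψ h1]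
  rw [phi_ld]
  have h : ⨆ k : ℕ, (rad t Ψ).map (phiN t Ψ J i k) ≤ rad t Ψ := by
    refine le_rad Ψ (iSup_le fun a => ?_) fun j r => ?_
    . rintro _ ⟨y, hy, rfl⟩; rw [mem_ker, top_phiN Ψ ht, LinearMap.mem_ker.mp (rad_le Ψ hy), mul_zero]
    . suffices h : ⨆ k : ℕ, (rad t Ψ).map (phiN t Ψ J i k) ≤
          (⨆ k : ℕ, (rad t Ψ).map (phiN t Ψ J i k)).comap (raise t Ψ j r) from h
      refine iSup_le fun k => ?_
      rintro _ ⟨y, hy, rfl⟩; rw [mem_comap, raise_phiN Ψ ht]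
      exact Submodule.sum_mem _ fun p _ => smul_mem _ _
        (mem_iSup_of_mem p.2 ⟨_, raise_in_rad Ψ hy, rfl⟩)
  exact h (mem_iSup_of_mem k ⟨y, hy, rfl⟩)

lemma phiInv_in_rad (ht : t ≠ 0) {J : ℤˣ} {i} {y : Verma X} (hy : y ∈ rad t Ψ) :
    phiInv t Ψ J i y ∈ rad t Ψ := by
  have hc : ∀ z, phiN t Ψ J i 0 (phiInv t Ψ J i z) = z := fun z =>
    congrL (phiN_phiInv Ψ ht J i) z
  have hc' : ∀ z, phiInv t Ψ J i (phiN t Ψ J i 0 z) = z := fun z =>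
    congrL (phiInv_phiN Ψ ht J i) z
  have h : (rad t Ψ).map (phiInv t Ψ J i) ≤ rad t Ψ := by
    refine le_rad Ψ ?_ fun j r => ?_
    . rintro _ ⟨y, hy, rfl⟩; have := top_phiN Ψ ht J i 0 (phiInv t Ψ J i y)
      rw [hc, LinearMap.mem_ker.mp (rad_le Ψ hy), Nat.cast_zero, mul_zero, add_zero] at this
      exact (mul_eq_zero.mp this.symm).resolve_left (Ψ.lead_ne J i)
    . rintro _ ⟨y, hy, rfl⟩
      refine ⟨(coeff 0 (X.gam t J 1 i j)) • raise t Ψ j r y, smul_mem _ _ (raise_in_rad Ψ hy), ?_⟩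
      have := phiN_raise Ψ ht J i j 0 r (phiInv t Ψ J i y)
      simp only [twist, antidiagonal_zero, sum_singleton, Nat.cast_zero, mul_zero, add_zero, hc] at this; grind
  exact h ⟨y, hy, rfl⟩

end Verma

/-- Transport of the Cartan relations to a quotient. -/
def PreRep.ofSurjective {X : TwistedType} {t O} {V L : Type*} [ACG V] [Module ℂ V]
    [ACG L] [Module ℂ L] (P : PreRep X t O (End ℂ V)) (π : V →ₗ[ℂ] L)
    (hπ : Function.Surjective π) (x phi : ℤˣ -> X.I0 -> ℤ -> End ℂ L) (inv : ℤˣ -> X.I0 -> End ℂ L)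
    (hx : ∀ J i r y, x J i r (π y) = π (P.x J i r y))
    (hphi : ∀ J i r y, phi J i r (π y) = π (P.phi J i r y))
    (hinv : ∀ J i y, inv J i (π y) = π (P.inv J i y)) : PreRep X t O (End ℂ L) where
  x := x
  phi := phi
  inv := inv
  x_zero J i r h := by refine extL (hπ.forall.mpr fun y => ?_); rw [hx, P.x_zero J i r h]; simp
  phi_dvd J i r h := by refine extL (hπ.forall.mpr fun y => ?_); rw [hphi, P.phi_dvd J i r h]; simp
  phi_van J i r h := by refine extL (hπ.forall.mpr fun y => ?_); rw [hphi, P.phi_van J i r h]; simp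
  phi_comm J ε' i j r r' := by
    refine extL (hπ.forall.mpr fun y => ?_); simp only [mul_apply, hphi]; exact congrArg π (congrL (P.phi_comm J ε' i j r r') y)
  lead_inv J i := by
    refine extL (hπ.forall.mpr fun y => ?_); simp only [mul_apply, hphi, hinv]; exact congrArg π (congrL (P.lead_inv J i) y)
  inv_lead J i := by
    refine extL (hπ.forall.mpr fun y => ?_); simp only [mul_apply, hphi, hinv]; exact congrArg π (congrL (P.inv_lead J i) y)
  phi_x J δ i j k m := by
    refine extL (hπ.forall.mpr fun y => ?_); have := congrArg π (congrL (P.phi_x J δ i j k m) y); simpa [twist, sumL, hphi, hx] using this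
  x_x i j r s := by
    refine extL (hπ.forall.mpr fun y => ?_); have := congrArg π (congrL (P.x_x i j r s) y)
    split_ifs at this ⊢ <;> simpa [hphi, hx] using this

end

section

section Kills

variable {B B' : Type*} [ACG B] [Module ℂ B] [ACG B'] [Module ℂ B']

def Kills (p : Polynomial ℂ) (f : ℤ -> B) : Prop := ∀ m, (p.sum fun k a => a • f (m + k)) = 0

lemma act_aeval_sgl {G : Type*} [ACG G] (g : G) (p : Polynomial ℂ) (f : G -> B) (m : G) :
    act (aeval (AddMonoidAlgebra.single g 1) p) f m = p.sum fun k a => a • f (m + k • g) := by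
  rw [Polynomial.aeval_eq_sum_range, sum_over_range _ (by simp), map_sum, sumL, Finset.sum_apply]; refine sum_congr rfl fun k _ => ?_
  rw [single_pow, one_pow, map_smul, smulL, Pi.smul_apply, act_sgl]; simp

lemma kills_iff {p : Polynomial ℂ} {f : ℤ -> B} :
    Kills p f ↔ act (aeval (AddMonoidAlgebra.single 1 1) p) f = 0 := by
  rw [funext_iff]; refine forall_congr' fun m => ?_
  rw [act_aeval_sgl]; simp

lemma Kills.mul {p : Polynomial ℂ} {f : ℤ -> B} (h : Kills p f) (q : Polynomial ℂ) :
    Kills (q * p) f := by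
  rw [kills_iff] at h ⊢; rw [map_mul, act_mul, h, map_zero]

lemma Kills.of_dvd {p q : Polynomial ℂ} {f : ℤ -> B} (h : Kills p f) (hq : p ∣ q) : Kills q f := by
  obtain ⟨r, rfl⟩ := hq; rw [mul_comm]; exact h.mul r

lemma Kills.add {p : Polynomial ℂ} {f g : ℤ -> B} (h : Kills p f) (h' : Kills p g) :
    Kills p (fun m => f m + g m) := by
  rw [kills_iff] at h h' ⊢; exact (map_add (act _) f g).trans (by rw [h, h', add_zero])

lemma Kills.map {p : Polynomial ℂ} {f : ℤ -> B} (h : Kills p f) (L : B →ₗ[ℂ] B') :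
    Kills p (fun m => L (f m)) := by
  intro m; have := congrArg L (h m); simpa [Polynomial.sum, map_sum] using this

lemma Kills.shift {p : Polynomial ℂ} {f : ℤ -> B} (h : Kills p f) (s) :
    Kills p (fun m => f (s + m)) := by
  intro m; have := h (s + m); simpa [add_assoc] using this

lemma kills_zero (p : Polynomial ℂ) : Kills p (fun _ => (0 : B)) := by intro m; simp [Polynomial.sum]

/-- The subspace on which a family of operators satisfies a recurrence. -/
def killSpace (p : Polynomial ℂ) (u : ℤ -> End ℂ B) : Submodule ℂ B where
  carrier := {y | Kills p fun m => u m y}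
  zero_mem' := by simpa using kills_zero p
  add_mem' {a b} ha hb := by simp only [mem_ofPred_eq] at ha hb ⊢; simpa using Kills.add ha hb
  smul_mem' c y hy := by simp only [mem_ofPred_eq] at hy ⊢; have := Kills.map hy (LinearMap.lsmul ℂ B c); simpa using this

lemma in_kill {p : Polynomial ℂ} {u : ℤ -> End ℂ B} {y : B} :
    y ∈ killSpace p u ↔ Kills p fun m => u m y := Iff.rfl

lemma kill_mono {p q : Polynomial ℂ} (h : p ∣ q) (u : ℤ -> End ℂ B) :
    killSpace p u ≤ killSpace q u := fun _ hy => Kills.of_dvd (in_kill.mp hy) h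

/-- The operators satisfy a recurrence on the subspace. -/
def RecOn (F : Submodule ℂ B) (u : ℤ -> End ℂ B) : Prop := ∃ p : Polynomial ℂ, p.Monic ∧ F ≤ killSpace p u

lemma kills_elim {f : ℤ × ℤ -> B} {p p' : Polynomial ℂ} (hp : p.Monic) (hp' : p'.Monic)
    (T : Finset ℕ) (d : ℕ -> ℂ) (h1 : act (aeval U1 p) f = 0)
    (h0 : act (aeval U0 p' * ∏ s ∈ T, (aM ℂ _ 1 * U0 - aM ℂ _ (d s) * U1)) f = 0) :
    ∃ q : Polynomial ℂ, q.Monic ∧ act (aeval U0 q) f = 0 := by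
  let I : Ideal (ℂ[ℤ × ℤ]) := {
      carrier := {a | act a f = 0}
      zero_mem' := by simp
      add_mem' := fun {a b} ha hb => by simp only [mem_ofPred_eq] at ha hb ⊢; rw [map_add, addL, ha, hb, add_zero]
      smul_mem' := fun c a ha => by
        simp only [mem_ofPred_eq] at ha ⊢; rw [smul_eq_mul, act_mul, ha, map_zero] }
  have hI : ∀ a, a ∈ I ↔ act a f = 0 := fun _ => Iff.rfl
  let e := mkₐ ℂ I; have hφ : ∀ a, e a = 0 ↔ act a f = 0 := fun a => by rw [<-hI]; exact Ideal.Quotient.eq_zero_iff_mem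
  have i1 : IsIntegral ℂ (e U1) := ⟨p, hp, by
    have := (hφ _).mpr h1; rwa [<-aeval_algHom_apply] at this⟩
  let A := integralClosure ℂ (ℂ[ℤ × ℤ] ⧸ I); let u : A := ⟨e U1, i1⟩
  have i0 : IsIntegral A (e U0) := by
    refine ⟨p'.map (aM ℂ A) * ∏ s ∈ T, (pX - pC (d s • u)),
      (hp'.map _).mul (monic_prod_of_monic _ _ fun s _ => Polynomial.monic_X_sub_C _), ?_⟩
    have := (hφ _).mpr h0; rw [map_mul, <-aeval_algHom_apply, map_prod] at this
    rw [Polynomial.eval₂_mul, Polynomial.eval₂_finsetProd, Polynomial.eval₂_map, <-IsScalarTower.algebraMap_eq, <-aeval_def, <-this]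
    congr 1; refine prod_congr rfl fun s _ => ?_
    rw [Polynomial.eval₂_sub, eval₂_X, eval₂_C, map_sub, map_mul, map_mul, map_one, map_one, one_mul, AlgHom.commutes, <-smul_def]; rfl
  obtain ⟨q, hq, h⟩ := isIntegral_trans (R := ℂ) (A := A) _ i0; refine ⟨q, hq, (hφ _).mp ?_⟩; rw [<-aeval_algHom_apply]; exact h

end Kills

namespace PreRep

variable {V : Type*} [ACG V] [Module ℂ V]
  (P : PreRep X t O (End ℂ V)) (v : V)

def filt : ℕ -> Submodule ℂ V
  | 0 => span ℂ {v}
  | d + 1 => filt d ⊔ ⨆ a : X.I0 × ℤ, (filt d).map (P.x (-1) a.1 a.2)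

/-- The span of the images of the lowering operators. -/
def lowSpan : Submodule ℂ V := ⨆ a : X.I0 × ℤ, LinearMap.range (P.x (-1) a.1 a.2)

lemma low_in_lowSpan (i m) (y : V) : P.x (-1) i m y ∈ P.lowSpan := mem_iSup_of_mem (i, m) ⟨y, rfl⟩

lemma filt_le_succ (d) : P.filt v d ≤ P.filt v (d + 1) := le_sup_left

lemma filt_mono : Monotone (P.filt v) := monotone_nat_of_le_succ (P.filt_le_succ v)

lemma self_in_filt (d) : v ∈ P.filt v d := P.filt_mono v (Nat.zero_le d) (mem_span_singleton_self v)

variable {v}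

lemma low_in_filt {d} {y : V} (hy : y ∈ P.filt v d) (i m) :
    P.x (-1) i m y ∈ P.filt v (d + 1) :=
  mem_sup_right (mem_iSup_of_mem (i, m) ⟨y, hy, rfl⟩)

lemma filt_succ_le {d} {Z : Submodule ℂ V} (h0 : P.filt v d ≤ Z)
    (h1 : ∀ i m, ∀ y ∈ P.filt v d, P.x (-1) i m y ∈ Z) : P.filt v (d + 1) ≤ Z := by
  refine sup_le h0 (iSup_le fun a => ?_); rintro _ ⟨y, hy, rfl⟩; exact h1 _ _ y hy

lemma iSup_filt_le {Z : Submodule ℂ V} (h0 : v ∈ Z)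
    (h1 : ∀ i m, ∀ y ∈ Z, P.x (-1) i m y ∈ Z) : ⨆ d, P.filt v d ≤ Z := by
  refine iSup_le fun d => ?_
  induction d with
  | zero => exact (span_singleton_le_iff_mem _ _).mpr h0
  | succ d ih => exact P.filt_succ_le ih fun i m y hy => h1 i m y (ih hy)

lemma in_iSup_filt {y : V} : y ∈ ⨆ d, P.filt v d ↔ ∃ d, y ∈ P.filt v d := Submodule.mem_iSup_of_directed _ (P.filt_mono v).directed_le

lemma phi_cases (J i r) :
    (∃ k : ℕ, r = ℓ O J i + (J : ℤ) * k) ∨ P.phi J i r = 0 :=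
  (Verma.phi_cases (O := O) J i r).imp id fun h => P.phi_van J i r h

lemma phi_x' (J d : ℤˣ) (i j) (k : ℕ) (m : ℤ) (y : V) :
    P.phi J i (ℓ O J i + J * k) (P.x d j m y) = ∑ p ∈ antidiagonal k, coeff p.1 (X.gam t J d i j) •
        P.x d j (m + J * p.1) (P.phi J i (ℓ O J i + J * p.2) y) := by
  have := congrL (P.phi_x J d i j k m) y; simpa [twist, sumL] using this

lemma phi_in_filt (hv : ∀ J i r, P.phi J i r v ∈ span ℂ {v}) {d} {y : V}
    (hy : y ∈ P.filt v d) (J i r) : P.phi J i r y ∈ P.filt v d := by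
  induction d generalizing y r with
  | zero =>
    obtain ⟨c, rfl⟩ := Submodule.mem_span_singleton.mp hy; rw [map_smul]; exact smul_mem _ _ (hv J i r)
  | succ d ih =>
    suffices h : P.filt v (d + 1) ≤ (P.filt v (d + 1)).comap (P.phi J i r) from h hy
    refine P.filt_succ_le (fun y hy => P.filt_le_succ v d (ih hy r)) fun j m y hy => ?_
    rw [mem_comap]; rcases P.phi_cases J i r with ⟨k, rfl⟩ | h
    . rw [phi_x']; exact Submodule.sum_mem _ fun p _ => smul_mem _ _ (P.low_in_filt (ih hy _) _ _)
    . rw [h]; exact zero_mem _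

lemma x_x_apply (i j r s) (y : V) : ∃ c : ℂ, P.x 1 i r (P.x (-1) j s y) =
    P.x (-1) j s (P.x 1 i r y) + c • (P.phi 1 i (r + s) y - P.phi (-1) i (r + s) y) := by
  have h := congrL (P.x_x i j r s) y; rw [subL, mul_apply, mul_apply, sub_eq_iff_eq_add'] at h; rw [h]; split_ifs
  . exact ⟨_, rfl⟩
  . exact ⟨0, by simp⟩

lemma raise_in_filt (hr : ∀ i m, P.x 1 i m v = 0) (hv : ∀ J i r, P.phi J i r v ∈ span ℂ {v})
    {d : ℕ} {y : V} (hy : y ∈ P.filt v (d + 1)) (i) (m : ℤ) : P.x 1 i m y ∈ P.filt v d := by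
  have h0 : ∀ y ∈ P.filt v 0, P.x 1 i m y = 0 := by
    intro y hy; obtain ⟨c, rfl⟩ := Submodule.mem_span_singleton.mp hy; rw [map_smul, hr, smul_zero]
  induction d generalizing y with
  | zero =>
    suffices h : P.filt v 1 ≤ (P.filt v 0).comap (P.x 1 i m) from h hy
    refine P.filt_succ_le (fun y hy => ?_) fun j s y hy => ?_
    . rw [mem_comap, h0 y hy]; exact zero_mem _
    . obtain ⟨c, hc⟩ := P.x_x_apply i j m s y; rw [mem_comap, hc, h0 y hy, map_zero, zero_add]
      exact smul_mem _ _ (sub_mem (P.phi_in_filt hv hy _ _ _)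
        (P.phi_in_filt hv hy _ _ _))
  | succ d ih =>
    suffices h : P.filt v (d + 2) ≤ (P.filt v (d + 1)).comap (P.x 1 i m) from h hy
    refine P.filt_succ_le (fun y hy => P.filt_le_succ v d (ih hy)) fun j s y hy => ?_
    obtain ⟨c, hc⟩ := P.x_x_apply i j m s y; rw [mem_comap, hc]
    exact add_mem (P.low_in_filt (ih hy) _ _) (smul_mem _ _
      (sub_mem (P.phi_in_filt hv hy _ _ _) (P.phi_in_filt hv hy _ _ _)))

end PreRep

end

section

section Words

variable {B B' C : Type*} [Ring B] [Algebra ℂ B] [Ring B'] [Algebra ℂ B']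
  [ACG C] [Module ℂ C] (L : B →ₗ[ℂ] C) (L' : B' →ₗ[ℂ] C)

lemma map_exch {A D : ℤ -> B} {A' D' : ℤ -> B'}
    (h : ∀ r s, L (A r * D s) = L' (A' r * D' s)) (h' : ∀ r s, L (D s * A r) = L' (D' s * A' r))
    (P Q : ℂ[ℤ × ℤ]) (s) :
    L (exchDefect P Q A D s) = L' (exchDefect P Q A' D' s) := by
  simp only [exchDefect, Pi.sub_apply, map_sub, <-act_comp, h, h']

lemma map_wordSum {x : X.I0 -> ℤ -> B} {x' : X.I0 -> ℤ -> B'}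
    (h : ∀ i j k r s u, L (x i r * x j s * x k u) = L' (x' i r * x' j s * x' k u))
    (p : Fin 6 -> ℂ[ℤ × ℤ × ℤ]) (i j k) (s : ℤ × ℤ × ℤ) :
    L (wordSum p (x i) (x j) (x k) s) = L' (wordSum p (x' i) (x' j) (x' k) s) := by
  simp only [wordSum, Pi.add_apply, map_add, <-act_comp, h]

lemma RelFam.of_words {d} {x : X.I0 -> ℤ -> B} {x' : X.I0 -> ℤ -> B'} (hx : RelFam X t d x')
    (hL : ∀ b, L b = 0 -> b = 0) (h2 : ∀ i j r s, L (x i r * x j s) = L' (x' i r * x' j s))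
    (h3 : ∀ i j k r s u, L (x i r * x j s * x k u) = L' (x' i r * x' j s * x' k u)) :
    RelFam X t d x where
  quad i j := by
    rw [<-exch_zero]; funext s; refine hL _ ?_
    rw [map_exch L L' (h2 i j) (fun r s => h2 j i s r), exch_zero.mpr (hx.quad i j)]; simp
  serre i j hij := by funext s; refine hL _ ?_; simp [map_wordSum L L' h3, hx.serre i j hij]
  cubic e i hi := by funext s; refine hL _ ?_; simp [map_wordSum L L' h3, hx.cubic e i hi]

lemma RelFam.map {d} {x : X.I0 -> ℤ -> B'} (hx : RelFam X t d x) (f : B' →ₐ[ℂ] B) :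
    RelFam X t d (fun i m => f (x i m)) :=
  hx.of_words LinearMap.id f.toLinearMap (fun _ h => h) (fun _ _ _ _ => (map_mul f _ _).symm)
    (fun _ _ _ _ _ _ => by simp [map_mul])

lemma RelFam.zero (d) : RelFam X t d (fun _ _ => (0 : B)) where
  quad i j := by simp only [Exch, mul_zero]; exact (map_zero (act _)).trans (map_zero (act _)).symm
  serre i j _ := by
    simp only [wordSum, mul_zero]; simp only [show (fun _ : ℤ × ℤ × ℤ => (0 : B)) = 0 from rfl, map_zero, add_zero]
  cubic k i _ := by
    simp only [wordSum, mul_zero]; simp only [show (fun _ : ℤ × ℤ × ℤ => (0 : B)) = 0 from rfl, map_zero, add_zero]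

lemma PreRep.compl_of {O} (P : PreRep X t O B) (ht : t ≠ 0) (d)
    {x' : X.I0 -> ℤ -> B'} (hx : RelFam X t d x')
    (h2 : ∀ i j r s, L (P.x d i r * P.x d j s) = L' (x' i r * x' j s))
    (h3 : ∀ i j k r s u, L (P.x d i r * P.x d j s * P.x d k u) = L' (x' i r * x' j s * x' k u))
    (rigid : ∀ R, L R = 0 -> (∀ k r, Commute (P.x (-d) k r) R) -> R = 0) : P.Complete d := by
  have hq : StrongQuad X t d (P.x d) := by
    intro i j; rw [<-exch_zero]; funext s; refine rigid _ ?_ fun k r => ?_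
    . rw [map_exch L L' (h2 i j) (fun r s => h2 j i s r), exch_zero.mpr (hx.quad i j)]
      simp
    . have := P.comm_quad ht (-d) k i j r s; rwa [neg_neg] at this
  have hq' : StrongQuad X t (-(-d)) (P.x (-(-d))) := by rwa [neg_neg]
  refine ⟨hq, fun i j hij => ?_, fun e i hi => ?_⟩
  . funext s; refine rigid _ ?_ fun k r => ?_
    . simp [map_wordSum L L' h3, hx.serre i j hij]
    . have := P.comm_ser ht hq' k hij r s; rwa [neg_neg] at this
  . funext s; refine rigid _ ?_ fun k r => ?_
    . simp [map_wordSum L L' h3, hx.cubic e i hi]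
    . have := P.comm_cubic ht hq' k hi e r s; rwa [neg_neg] at this

end Words

namespace PreRep

variable {V : Type*} [ACG V] [Module ℂ V]

structure Highest (P : PreRep X t O (End ℂ V)) (v : V) (Ψ : LWeight X O) : Prop where
  raise : ∀ i m, P.x 1 i m v = 0
  phi : ∀ J i r, P.phi J i r v = Ψ.psi J i r • v
  gen : ⨆ d, P.filt v d = ⊤
  notMem : v ∉ P.lowSpan

structure Core (P : PreRep X t O (End ℂ V)) (v : V) (Ψ : LWeight X O) : Prop extends
    P.Highest v Ψ where
  nonsing : ∀ y, (∀ i m, P.x 1 i m y = 0) -> y ∈ span ℂ {v}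

variable {P : PreRep X t O (End ℂ V)} {v : V} {Ψ : LWeight X O}

namespace Highest

variable (h : P.Highest v Ψ)
include h

lemma phi_mem (J i r) : P.phi J i r v ∈ span ℂ {v} := by rw [h.phi]; aesop

lemma ex_in_filt (y : V) : ∃ d, y ∈ P.filt v d := P.in_iSup_filt.mp (h.gen ▸ mem_top)

lemma ne_zero : v ≠ 0 := fun h0 => h.notMem (h0 ▸ zero_mem _)

lemma span_inf {y : V} (h1 : y ∈ span ℂ {v}) (h2 : y ∈ P.lowSpan) : y = 0 := by
  obtain ⟨c, rfl⟩ := Submodule.mem_span_singleton.mp h1; by_cases hc : c = 0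
  . simp_all
  . exact absurd ((smul_mem_iff _ hc).mp h2) h.notMem

lemma raise_filt_zero {y : V} (hy : y ∈ P.filt v 0) (i m) : P.x 1 i m y = 0 := by
  obtain ⟨c, rfl⟩ := Submodule.mem_span_singleton.mp hy; rw [map_smul, h.raise, smul_zero]

lemma span_sup : span ℂ {v} ⊔ P.lowSpan = ⊤ := by
  rw [eq_top_iff, <-h.gen]
  exact P.iSup_filt_le (mem_sup_left (mem_span_singleton_self v))
    fun i m y _ => mem_sup_right (P.low_in_lowSpan i m y)

lemma exists_top : ∃ s : V →ₗ[ℂ] ℂ, s v = 1 ∧ (∀ i m y, s (P.x (-1) i m y) = 0) ∧ ∀ J i r y, s (P.phi J i r y) = Ψ.psi J i r * s y := by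
  obtain ⟨f, hf, hl⟩ := Submodule.exists_le_ker_of_notMem h.notMem
  have hτ : ∀ i m y, ((f v)⁻¹ • f) (P.x (-1) i m y) = 0 := fun i m y => by
    rw [smulL, LinearMap.mem_ker.mp (hl (P.low_in_lowSpan i m y)), smul_zero]
  refine ⟨(f v)⁻¹ • f, by simp [hf], hτ, fun J i r y => ?_⟩; generalize (f v)⁻¹ • f = s at hτ
  suffices hs : (⊤ : Submodule ℂ V) ≤ ker (s ∘ₗ P.phi J i r - Ψ.psi J i r • s) by
    have := LinearMap.mem_ker.mp (hs (mem_top (x := y))); simpa [sub_eq_zero] using this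
  rw [<-h.span_sup]; refine sup_le ((span_singleton_le_iff_mem _ _).mpr ?_) (iSup_le fun a => ?_)
  . simp [h.phi]
  . rintro _ ⟨y, rfl⟩
    rw [mem_ker, subL, smulL, hτ, smul_zero, sub_zero, comp_apply]; rcases P.phi_cases J i r with ⟨k, rfl⟩ | h
    . simp [phi_x', hτ]
    . simp [h]

end Highest

namespace Core

variable (h : P.Core v Ψ)
include h

lemma zero_of_comm_raise {R : End ℂ V} (hR : ∀ y, R y ∈ P.lowSpan)
    (hc : ∀ k r, Commute (P.x 1 k r) R) : R = 0 := by
  have hc' : ∀ k r y, P.x 1 k r (R y) = R (P.x 1 k r y) := fun k r y => congrL (hc k r).eq y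
  refine extL fun y => ?_
  obtain ⟨d, hd⟩ := h.ex_in_filt y; induction d generalizing y with
  | zero =>
    exact h.span_inf (h.nonsing _ fun i m => by rw [hc', h.raise_filt_zero hd, map_zero]) (hR y)
  | succ d ih =>
    refine h.span_inf (h.nonsing _ fun i m => ?_) (hR y); rw [hc', ih _ (P.raise_in_filt h.raise h.phi_mem hd i m), zeroL]

end Core

lemma Highest.zero_of_comm_low (h : P.Highest v Ψ) {R : End ℂ V} (hR : R v = 0)
    (hc : ∀ k r, Commute (P.x (-1) k r) R) : R = 0 := by
  have : (⊤ : Submodule ℂ V) ≤ ker R := by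
    rw [<-h.gen]; refine P.iSup_filt_le hR fun i m y hy => ?_
    have := congrL (hc i m).eq y; simp_all
  simp_all

lemma Core.complete (h : P.Core v Ψ) (ht : t ≠ 0) (d) : P.Complete d := by
  rcases units_eq_one_or d with rfl | rfl
  . have h1 : ∀ i m, P.x 1 i m v = 0 := h.raise
    exact P.compl_of (applyₗ v) (0 : ℂ →ₗ[ℂ] V) ht 1 (RelFam.zero (B := ℂ) 1)
      (fun _ _ _ _ => by simp [h1]) (fun _ _ _ _ _ _ => by simp [h1])
      fun R hR hc => h.zero_of_comm_low hR hc
  . have h1 : ∀ i m y, P.lowSpan.mkQ (P.x (-1) i m y) = 0 := fun i m y =>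
      (mk_eq_zero _).mpr (P.low_in_lowSpan i m y)
    refine P.compl_of (compRight ℂ P.lowSpan.mkQ) (0 : ℂ →ₗ[ℂ] _) ht (-1)
      (RelFam.zero (B := ℂ) (-1)) (fun _ _ _ _ => ?_) (fun _ _ _ _ _ _ => ?_) fun R hR hc => ?_
    . ext y; simp_all
    . ext y; simp_all
    . refine h.zero_of_comm_raise (fun y => ?_) (by simpa using hc)
      exact (mk_eq_zero _).mp (congrL hR y)

def _root_.LWeight.Rational (Ψ : LWeight X O) : Prop := ∀ i, ∃ p : Polynomial ℂ, p.Monic ∧ Kills p fun m => Ψ.psi 1 i m - Ψ.psi (-1) i m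

section Rec

lemma Core.rec_low_of (h : P.Core v Ψ) {d}
    (hC : ∀ i, RecOn (P.filt v d) fun r => P.phi 1 i r - P.phi (-1) i r)
    (hX : ∀ e, e + 1 = d -> ∀ i, RecOn (P.filt v e) (P.x (-1) i)) (i) :
    RecOn (P.filt v d) (P.x (-1) i) := by
  obtain ⟨p, hp, hpC⟩ := hC i
  obtain ⟨p', hp', hX⟩ : ∃ p' : Polynomial ℂ, p'.Monic ∧ ∀ y ∈ P.filt v d, ∀ j s, Kills p' fun m => P.x (-1) i m (P.x 1 j s y) := by
    cases d with
    | zero =>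
      refine ⟨1, monic_one, fun y hy j s => ?_⟩; simp only [h.raise_filt_zero hy, map_zero]; exact kills_zero _
    | succ d =>
      obtain ⟨p', hp', hX⟩ := hX d rfl i; exact ⟨p', hp', fun y hy j s => hX (P.raise_in_filt h.raise h.phi_mem hy j s)⟩
  refine ⟨p * p', hp.mul hp', fun y hy => ?_⟩; rw [in_kill]; intro m; refine h.span_inf (h.nonsing _ fun j s => ?_) ?_
  . have h1 : Kills (p * p') fun m => P.x 1 j s (P.x (-1) i m y) := by
      obtain ⟨c, hc⟩ := P.comm_x 1 j i s
      have hc' : ∀ m, P.x 1 j s (P.x (-1) i m y) = P.x (-1) i m (P.x 1 j s y) +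
          c • (P.phi 1 i (s + m) y - P.phi (-1) i (s + m) y) := fun m => by
        have := congrL (hc m) y; simp only [subL, smulL, mul_apply] at this; rw [smul_sub, <-this, add_sub_cancel]
      simp only [hc']; have hk := in_kill.mp (hpC hy)
      exact ((hX y hy j s).mul p).add
        (((hk.shift s).map (LinearMap.lsmul ℂ V c)).of_dvd (Dvd.intro _ rfl))
    have := h1 m; simpa [Polynomial.sum, map_sum] using this
  . exact Submodule.sum_mem _ fun k _ => smul_mem _ _ (P.low_in_lowSpan _ _ _)

lemma rec_phi_succ {d} (ht : t ≠ 0) (hC : ∀ i, RecOn (P.filt v d) fun r => P.phi 1 i r - P.phi (-1) i r)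
    (hX : ∀ i, RecOn (P.filt v d) (P.x (-1) i)) (i) :
    RecOn (P.filt v (d + 1)) fun r => P.phi 1 i r - P.phi (-1) i r := by
  have key : ∀ j, ∃ q : Polynomial ℂ, q.Monic ∧ ∀ y ∈ P.filt v d, ∀ s,
      Kills q fun r => (P.phi 1 i r - P.phi (-1) i r) (P.x (-1) j s y) := by
    intro j; obtain ⟨p, hp, hX⟩ := hX j; obtain ⟨p', hp', hC⟩ := hC i
    let f : ℤ × ℤ -> (P.filt v d -> V) := fun r y =>
      (P.phi 1 i r.1 - P.phi (-1) i r.1) (P.x (-1) j r.2 y)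
    let g : ℤ × ℤ -> (P.filt v d -> V) := fun r y =>
      P.x (-1) j r.2 ((P.phi 1 i r.1 - P.phi (-1) i r.1) y)
    have ev : ∀ (y : P.filt v d) (p : ℂ[ℤ × ℤ]) (F : ℤ × ℤ -> (P.filt v d -> V)) r, act p F r y = act p (fun a => F a y) r := fun y p F r =>
      (act_comp (LinearMap.proj y) p F r).symm
    have hfg : act (X.sqL t (-1) i j U0 U1) f = act (X.sqR t (-1) i j U0 U1) g := by
      funext r y; rw [ev, ev]; have e := fun J => congrFun (P.exch_phi ht J (-1) i j) r
      have e' : ∀ J, act (X.sqL t (-1) i j U0 U1) (fun r => P.phi J i r.1 (P.x (-1) j r.2 y)) r =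
          act (X.sqR t (-1) i j U0 U1) (fun r => P.x (-1) j r.2 (P.phi J i r.1 y)) r := fun J => by
        have := congrArg (applyₗ (y : V)) (e J); rw [<-act_comp, <-act_comp] at this; exact this
      have lin : ∀ (p : ℂ[ℤ × ℤ]) (F F' : ℤ × ℤ -> V), act p (fun a => F a - F' a) r = act p F r - act p F' r := fun p F F' =>
        congrFun (map_sub (act p) F F') r
      simp [lin, e', f, g, subL, map_sub]
    have h1 : act (aeval U1 p) f = 0 := by
      funext r y; have := (in_kill.mp (hX y.2)).map (P.phi 1 i r.1 - P.phi (-1) i r.1) r.2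
      rw [U1, act_aeval_sgl]; simpa [Polynomial.sum, f] using this
    have h0 : act (aeval U0 p') g = 0 := by
      funext r y; have := (in_kill.mp (hC y.2)).map (P.x (-1) j r.2) r.1; rw [U0, act_aeval_sgl]
      simpa [Polynomial.sum, g] using this
    obtain ⟨q, hq, hqf⟩ := kills_elim hp hp' (X.sqSet i j)
      (fun s => X.zeta ^ s * (t ^ 2) ^ (((-1 : ℤˣ) : ℤ) * X.c i s j)) h1 (by
        change act (aeval U0 p' * X.sqL t (-1) i j U0 U1) f = 0; rw [act_mul, hfg, <-act_mul, mul_comm, act_mul, h0, map_zero])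
    refine ⟨q, hq, fun y hy s r => ?_⟩; have := congrFun (congrFun hqf (r, s)) ⟨y, hy⟩
    rw [U0, act_aeval_sgl] at this; simpa [Polynomial.sum, f] using this
  choose q hq hk using key; obtain ⟨p', hp', hC⟩ := hC i
  refine ⟨p' * ∏ j, q j, hp'.mul (monic_prod_of_monic _ _ fun j _ => hq j),
    P.filt_succ_le (hC.trans (kill_mono (Dvd.intro _ rfl) _)) fun j s y hy => ?_⟩
  rw [in_kill]; exact (hk j y hy s).of_dvd (dvd_mul_of_dvd_right (Finset.dvd_prod_of_mem q (mem_univ j)) _)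

lemma rec_raise_succ {d} (hC : ∀ i, RecOn (P.filt v d) fun r => P.phi 1 i r - P.phi (-1) i r)
    (i) (hX : RecOn (P.filt v d) (P.x 1 i)) : RecOn (P.filt v (d + 1)) (P.x 1 i) := by
  obtain ⟨p, hp, hX⟩ := hX; obtain ⟨p', hp', hC⟩ := hC i
  refine ⟨p * p', hp.mul hp', P.filt_succ_le (hX.trans (kill_mono (Dvd.intro _ rfl) _))
    fun j s y hy => ?_⟩
  obtain ⟨c, hc⟩ := P.comm_x (-1) j i s
  have hc' : ∀ m, P.x 1 i m (P.x (-1) j s y) = P.x (-1) j s (P.x 1 i m y) +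
      (-c) • (P.phi 1 i (s + m) y - P.phi (-1) i (s + m) y) := fun m => by
    have := congrL (hc m) y; simp only [subL, smulL, mul_apply, neg_neg] at this; rw [neg_smul, smul_sub, <-this, neg_sub, add_sub_cancel]
  rw [in_kill]; simp only [hc']; have hk := in_kill.mp (hC hy)
  exact (((in_kill.mp (hX hy)).map (P.x (-1) j s)).of_dvd (Dvd.intro _ rfl)).add
    (((hk.shift s).map (LinearMap.lsmul ℂ V (-c))).mul p)

lemma Core.recurrence (h : P.Core v Ψ) (ht : t ≠ 0) (hΨ : Ψ.Rational) (d : ℕ) (i) (J : ℤˣ) :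
    RecOn (P.filt v d) (P.x J i) := by
  have key : ∀ d, (∀ i, RecOn (P.filt v d) fun r => P.phi 1 i r - P.phi (-1) i r) ∧
      (∀ i, RecOn (P.filt v d) (P.x (-1) i)) ∧ ∀ i, RecOn (P.filt v d) (P.x 1 i) := by
    intro d; induction d with
    | zero =>
      have hC : ∀ i, RecOn (P.filt v 0) fun r => P.phi 1 i r - P.phi (-1) i r := fun i => by
        obtain ⟨p, hp, hk⟩ := hΨ i; refine ⟨p, hp, (span_singleton_le_iff_mem _ _).mpr ?_⟩; rw [in_kill]
        have := hk.map (LinearMap.toSpanSingleton ℂ V v); simp_all [h.phi, sub_smul]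
      refine ⟨hC, fun i => h.rec_low_of hC (fun e he => absurd he (by omega)) i, fun i =>
        ⟨1, monic_one, fun y hy => ?_⟩⟩
      rw [in_kill]; simp only [h.raise_filt_zero hy]; exact kills_zero _
    | succ d ih =>
      have hC := rec_phi_succ ht ih.1 ih.2.1
      refine ⟨hC, fun i => h.rec_low_of hC (fun e he => ?_) i, fun i => rec_raise_succ ih.1 i (ih.2.2 i)⟩; simp_all
  rcases units_eq_one_or J with rfl | rfl
  . simp_all
  simp_all

end Rec

end PreRep

namespace Verma

variable (Ψ : LWeight X O)

abbrev Simple (t : ℂ) (Ψ : LWeight X O) : Type := Verma X ⧸ rad t Ψ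

/-- The Cartan part of the action on the simple quotient. -/
def simplePreRp (ht : t ≠ 0) (Ψ : LWeight X O) : PreRep X t O (End ℂ (Simple t Ψ)) :=
  (preRep ht Ψ).ofSurjective (rad t Ψ).mkQ (mkQ_surjective _)
    (fun J i r => (rad t Ψ).mapQ (rad t Ψ) ((preRep ht Ψ).x J i r) fun y hy => by
      rcases units_eq_one_or J with rfl | rfl
      . exact raise_in_rad Ψ hy
      . exact low_in_rad Ψ (fun _ _ _ _ hy => phi_in_rad Ψ ht hy) hy)
    (fun J i r => (rad t Ψ).mapQ (rad t Ψ) ((preRep ht Ψ).phi J i r) fun y hy => phi_in_rad Ψ ht hy)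
    (fun J i => (rad t Ψ).mapQ (rad t Ψ) ((preRep ht Ψ).inv J i) fun y hy => phiInv_in_rad Ψ ht hy)
    (fun _ _ _ _ => rfl) (fun _ _ _ _ => rfl) (fun _ _ _ => rfl)

/-- The highest weight vector of the simple quotient. -/
def simpleVec (t : ℂ) (Ψ : LWeight X O) : Simple t Ψ := (rad t Ψ).mkQ vac

lemma simple_core (ht : t ≠ 0) : (simplePreRp ht Ψ).Core (simpleVec t Ψ) Ψ where
  raise i m := by change (rad t Ψ).mkQ (raise t Ψ i m vac) = 0; rw [raise_vac, map_zero]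
  phi J i r := by change (rad t Ψ).mkQ (phi t Ψ J i r vac) = _; rw [phi_vac, map_smul]; rfl
  gen := by
    rw [eq_top_iff]
    have h := eq_top_of_stable ((⨆ d, (simplePreRp ht Ψ).filt (simpleVec t Ψ) d).comap (rad t Ψ).mkQ)
      (PreRep.in_iSup_filt _ |>.mpr ⟨0, mem_span_singleton_self _⟩) (fun j m y hy => by
        obtain ⟨d, hd⟩ := (PreRep.in_iSup_filt _).mp hy; exact (PreRep.in_iSup_filt _).mpr ⟨d + 1, PreRep.low_in_filt _ hd j m⟩)
    rintro y -; obtain ⟨y, rfl⟩ := mkQ_surjective _ y; exact h.ge (mem_top (x := y))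
  notMem hmem := by
    have h : (simplePreRp ht Ψ).lowSpan ≤ ker ((rad t Ψ).liftQ top (rad_le Ψ)) := by
      refine iSup_le fun a => ?_
      rintro _ ⟨y, rfl⟩; obtain ⟨y, rfl⟩ := mkQ_surjective _ y; change top (low a.1 a.2 y) = 0; exact top_low _ _ _
    have h1 : top (vac : Verma X) = 0 := h hmem; simp_all [top_vac]
  nonsing y hy := by
    obtain ⟨y, rfl⟩ := mkQ_surjective _ y
    have hy : ∀ i m, raise t Ψ i m y ∈ rad t Ψ := fun i m =>
      (mk_eq_zero _).mp (hy i m)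
    have h : rad t Ψ ⊔ span ℂ {y - top y • vac} ≤ rad t Ψ := by
      refine le_rad Ψ (sup_le (rad_le Ψ) ((span_singleton_le_iff_mem _ _).mpr ?_)) fun i r => ?_
      . rw [mem_ker, map_sub, map_smul, top_vac, smul_eq_mul, mul_one, sub_self]
      . suffices h : rad t Ψ ⊔ span ℂ {y - top y • vac} ≤
            (rad t Ψ ⊔ span ℂ {y - top y • vac}).comap (raise t Ψ i r) from h
        refine sup_le (fun z hz => mem_sup_left (raise_in_rad Ψ hz))
          ((span_singleton_le_iff_mem _ _).mpr ?_)
        rw [mem_comap, map_sub, map_smul, raise_vac, smul_zero, sub_zero]; exact mem_sup_left (hy i r)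
    have h1 := h (mem_sup_right (mem_span_singleton_self _))
    refine Submodule.mem_span_singleton.mpr ⟨top y, ?_⟩; have := (mk_eq_zero _).mpr h1; rw [mk_sub, sub_eq_zero] at this; exact this.symm

end Verma

end

section

section LinearAlgebra

variable {V : Type*} [ACG V] [Module ℂ V]

lemma le_iSup_of_iSupIndep {I e : Type*} {W : e -> Submodule ℂ V} (hW : iSupIndep W)
    {U : I -> Submodule ℂ V} {c : I -> e} (hU : ∀ n, U n ≤ W (c n)) (htop : ⨆ n, U n = ⊤) (k : e) :
    W k ≤ ⨆ n, ⨆ _ : c n = k, U n := by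
  intro y hy
  have h1 : (⨆ n, ⨆ _ : c n = k, U n) ⊔ (⨆ n, ⨆ _ : c n ≠ k, U n) = ⊤ := by
    rw [eq_top_iff, <-htop]; refine iSup_le fun n => ?_
    by_cases h : c n = k
    . exact le_sup_of_le_left (le_iSup₂_of_le n h le_rfl)
    . exact le_sup_of_le_right (le_iSup₂_of_le n h le_rfl)
  obtain ⟨a, ha, b, hb, rfl⟩ := Submodule.mem_sup.mp (h1.ge (mem_top (x := y)))
  have ha' : a ∈ W k := by refine (iSup₂_le (f := fun n (_ : c n = k) => U n) (a := W k) fun n h => ?_) ha; grind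
  have hb' : b ∈ ⨆ k', ⨆ _ : k' ≠ k, W k' := by
    refine (iSup₂_le (f := fun n (_ : c n ≠ k) => U n) fun n h => ?_) hb; exact le_iSup₂_of_le (c n) h (hU n)
  have hb0 : b = 0 := by have := (hW k).le_bot ⟨(Submodule.add_mem_iff_right _ ha').mp hy, hb'⟩; simp_all
  simp_all

lemma iSupIndep_eig {I k : Type*} (T : I -> End ℂ V) (hT : ∀ i j, Commute (T i) (T j))
    (f : k -> I -> ℂ) (hf : Function.Injective f) :
    iSupIndep fun w : k => ⨅ i, eigenspace (T i) (f w i) := by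
  have h1 := Module.End.independent_iInf_maxGenEigenspace_of_forall_mapsTo T
    (fun i j e => Module.End.mapsTo_maxGenEigenspace_of_comm (hT j i) e)
  have h2 : iSupIndep fun c : I -> ℂ => ⨅ i, eigenspace (T i) (c i) := h1.mono
    (fun c => iInf_mono fun i => Module.End.eigenspace_le_maxGenEigenspace)
  exact h2.comp hf

lemma in_of_kills {p : Polynomial ℂ} {f : ℤ -> V} (h : Kills p f) (S : Submodule ℂ V) (m) {j}
    (hj : p.coeff j ≠ 0) (hS : ∀ k, k ≠ j -> k < p.natDegree + 1 -> f (m + k) ∈ S) : f (m + j) ∈ S := by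
  have h1 := h m
  have hj' : j ∈ range (p.natDegree + 1) := Finset.mem_range.mpr (Nat.lt_succ_of_le (Polynomial.le_natDegree_of_ne_zero hj))
  rw [sum_over_range _ (by simp), <-add_sum_erase _ _ hj', add_eq_zero_iff_eq_neg] at h1
  refine (smul_mem_iff S hj).mp (h1 ▸ S.neg_mem (S.sum_mem fun k hk => S.smul_mem _ (hS k ?_ ?_)))
  . simp_all
  simp_all

lemma fg_of_kills {p : Polynomial ℂ} (hp : p ≠ 0) {f : ℤ -> V} (h : Kills p f) :
    (span ℂ (Set.range f)).FG := by
  induction hn : p.natDegree using strong_induction_on generalizing p with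
  | _ n ih =>
    subst hn; by_cases h0 : p.coeff 0 = 0
    . have hX : p.divX * pX = p := by have := Polynomial.divX_mul_X_add p; simp_all
      have hd : p.divX ≠ 0 := fun h => hp (by simp_all)
      refine ih p.divX.natDegree ?_ hd (fun m => ?_) rfl
      . nth_rw 2 [<-hX]
        simp [natDegree_mul_X hd]
      . have h1 := h (m - 1)
        rw [sum_over_range' _ (by simp) (p.divX.natDegree + 1 + 1) (by
          rw [<-hX, natDegree_mul_X hd, hX]; omega), Finset.sum_range_succ', h0, zero_smul,
          add_zero] at h1
        rw [sum_over_range _ (by simp), <-h1]; simp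
    . let S : Submodule ℂ V := span ℂ (f '' Set.Ico 0 (p.natDegree : ℤ))
      have hlead : p.coeff p.natDegree ≠ 0 := Polynomial.leadingCoeff_ne_zero.mpr hp
      have hS : ∀ m : ℤ, ∀ k : ℕ, k < p.natDegree -> f (m + k) ∈ S := by
        intro m; induction m using Int.induction_on with
        | zero =>
          intro k hk; rw [zero_add]; exact subset_span ⟨k, ⟨by omega, by omega⟩, rfl⟩
        | succ m ihm =>
          intro k hk; by_cases hk' : k + 1 < p.natDegree
          . grind
          . have := in_of_kills h S (m : ℤ) (j := p.natDegree) hlead fun l hl hl' => ihm l (by omega)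
            grind
        | pred m ihm =>
          intro k hk; by_cases hk' : k = 0
          . subst hk'; refine in_of_kills h S (-(m : ℤ) - 1) (j := 0) h0 fun l hl hl' => ?_
            have := ihm (l - 1) (by omega); grind
          . have := ihm (k - 1) (by omega); grind
      have hfin : S.FG := Submodule.fg_span ((Set.finite_Ico _ _).image f)
      have hle : span ℂ (Set.range f) ≤ S := by
        rw [span_le]; rintro _ ⟨m, rfl⟩; by_cases hd : p.natDegree = 0
        . have := in_of_kills h S m (j := 0) h0 fun l hl hl' => by omega
          simp_all
        . have := hS m 0 (by omega); simp_all
      have := Module.Finite.iff_fg.mpr hfin; exact Module.Finite.iff_fg.mp (finiteDimensional_of_le hle)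

end LinearAlgebra

namespace PreRep

variable {V : Type*} [ACG V] [Module ℂ V]

lemma filt_fg {P : PreRep X t O (End ℂ V)} {v : V} (h : ∀ d i, RecOn (P.filt v d) (P.x (-1) i)) (d) :
    (P.filt v d).FG := by
  induction d with
  | zero => exact Submodule.fg_span_singleton v
  | succ d ih =>
    obtain ⟨s, hs⟩ := ih
    have e : P.filt v (d + 1) = P.filt v d ⊔ ⨆ a : X.I0 × s, span ℂ (Set.range fun m => P.x (-1) a.1 m (a.2 : V)) := by
      refine le_antisymm (P.filt_succ_le le_sup_left fun i m y hy => ?_) (sup_le (P.filt_le_succ v d)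
        (iSup_le fun a => Submodule.span_le.mpr ?_))
      . suffices hle : P.filt v d ≤ (P.filt v d ⊔ ⨆ a : X.I0 × s,
            span ℂ (Set.range fun m => P.x (-1) a.1 m (a.2 : V))).comap (P.x (-1) i m) from hle hy
        rw [<-hs, span_le]; intro z hz
        exact mem_sup_right (mem_iSup_of_mem (i, ⟨z, hz⟩)
          (subset_span ⟨m, rfl⟩))
      . rintro _ ⟨m, rfl⟩; exact P.low_in_filt (hs ▸ subset_span a.2.2) _ _
    rw [e]; refine sup ⟨s, hs⟩ (Submodule.fg_iSup _ fun a => ?_); obtain ⟨p, hp, hk⟩ := h d a.1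
    exact fg_of_kills hp.ne_zero (in_kill.mp (hk (hs ▸ subset_span a.2.2)))

def wtVal (t : ℂ) (P : LWeight X O) (J : ℤˣ) (n : X.I0 -> ℕ) (i : X.I0) : ℂ :=
  P.psi J i (ℓ O J i) * ∏ j, ((t ^ 2) ^ (-(J * X.symCartan i j))) ^ n j

def gradedPart (P : PreRep X t O (End ℂ V)) (v : V) (e : LWeight X O) (n : X.I0 -> ℕ) : Submodule ℂ V :=
  (⨅ J, ⨅ i, eigenspace (P.phi J i (ℓ O J i)) (wtVal t e J n i)) ⊓
    P.filt v (∑ i, n i)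

lemma lead_x (P : PreRep X t O (End ℂ V)) (ht : t ≠ 0) (J d i j m) (y : V) :
    P.phi J i (ℓ O J i) (P.x d j m y) = (t ^ 2) ^ (J * d * X.symCartan i j) • P.x d j m (P.phi J i (ℓ O J i) y) := by
  have := P.phi_x' J d i j 0 m y; simp_all [X.cf_zero_gam t ht]

lemma low_in_wt (P : PreRep X t O (End ℂ V)) (ht : t ≠ 0) {e : LWeight X O} {n : X.I0 -> ℕ} {y : V}
    (hy : ∀ J i, P.phi J i (ℓ O J i) y = wtVal t e J n i • y) (j) (m : ℤ) (J : ℤˣ) (i) :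
    P.phi J i (ℓ O J i) (P.x (-1) j m y) = wtVal t e J (n + Pi.single j 1) i • P.x (-1) j m y := by
  classical
  rw [P.lead_x ht, hy, map_smul, smul_smul]; congr 1; simp only [wtVal, Pi.add_apply, pow_add, prod_mul_distrib]
  rw [Finset.prod_eq_single_of_mem (f := fun x => ((t ^ 2) ^ (-(J * X.symCartan i x))) ^
    (Pi.single j 1 : X.I0 -> ℕ) x) j (mem_univ j) (fun b _ hb => by simp [hb])]
  simp only [Pi.single_eq_same, pow_one, val_neg, val_one]; rw [show J * -1 * X.symCartan i j = -(J * X.symCartan i j) by ring]; ring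

lemma iSup_gradedPart {P : PreRep X t O (End ℂ V)} {v : V} {e : LWeight X O}
    (hphi : ∀ J i r, P.phi J i r v = e.psi J i r • v) (hgen : ⨆ d, P.filt v d = ⊤) (ht : t ≠ 0) :
    ⨆ n, P.gradedPart v e n = ⊤ := by
  classical
  rw [eq_top_iff, <-hgen]; refine P.iSup_filt_le (mem_iSup_of_mem 0 ⟨?_, P.self_in_filt v _⟩) fun j m y hy => ?_
  . simp [hphi, mem_coe, mem_iInf, mem_eigenspace_iff, wtVal]
  . suffices hle : ⨆ n, P.gradedPart v e n ≤ (⨆ n, P.gradedPart v e n).comap (P.x (-1) j m) from hle hy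
    refine iSup_le fun n y hy => ?_
    refine mem_iSup_of_mem (n + Pi.single j 1) ⟨?_, ?_⟩
    . have h1 := hy.1; simp only [mem_coe, mem_iInf, mem_eigenspace_iff] at h1 ⊢
      exact P.low_in_wt ht h1 j m
    . have := P.low_in_filt hy.2 j m; simp_all [sum_add_distrib]

lemma wtVal_ne (ht : t ≠ 0) (P : LWeight X O) (J : ℤˣ) (n : X.I0 -> ℕ) (i : X.I0) :
    wtVal t P J n i ≠ 0 :=
  mul_ne_zero (P.lead_ne J i) (Finset.prod_ne_zero_iff.mpr fun _ _ =>
    pow_ne_zero _ (zpow_ne_zero _ (pow_ne_zero 2 ht)))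

lemma zpow_eq_one {q : ℂ} (hq : ∀ n : ℕ, 0 < n -> q ^ n ≠ 1) {z : ℤ} (h : q ^ z = 1) : z = 0 := by
  by_contra h0; rcases Int.natAbs_eq z with hz | hz
  . rw [hz, zpow_natCast] at h; grind
  . rw [hz, zpow_neg, zpow_natCast, inv_eq_one] at h; grind

lemma prod_zpow_pow (q : ℂ) (f : X.I0 -> ℤ) (n : X.I0 -> ℕ) (hq : q ≠ 0) :
    ∏ j, (q ^ f j) ^ n j = q ^ ∑ j, f j * n j := by
  rw [<-prod_congr rfl fun j _ => (by rw [zpow_mul, zpow_natCast] :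
    q ^ (f j * n j) = (q ^ f j) ^ n j)]
  induction (univ : Finset X.I0) using Finset.cons_induction with
  | empty => simp
  | cons a s ha ih => rw [Finset.prod_cons, Finset.sum_cons, zpow_add₀ hq, ih]

lemma wt_inj (ht : t ≠ 0) (hq : Generic t) (J : ℤˣ) {n n' : X.I0 -> ℕ}
    (h : ∀ i, ∏ j, ((t ^ 2) ^ ((J : ℤ) * X.symCartan i j)) ^ n j = ∏ j, ((t ^ 2) ^ ((J : ℤ) * X.symCartan i j)) ^ n' j) :
    n = n' := by
  have hq0 : (t ^ 2) ≠ 0 := pow_ne_zero 2 ht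
  have key := X.symCartan_nondegenerate (fun j => (n j : ℤ) - n' j) fun i => by
    have h1 := h i
    rw [prod_zpow_pow _ _ _ hq0, prod_zpow_pow _ _ _ hq0, <-div_eq_one_iff_eq (zpow_ne_zero _ hq0), <-zpow_sub₀ hq0] at h1
    have h2 := zpow_eq_one hq h1; rw [<-sum_sub_distrib] at h2
    have h3 : J * ∑ j, X.symCartan j i * ((n j : ℤ) - n' j) = 0 := by
      rw [mul_sum, <-h2]; refine sum_congr rfl fun j _ => ?_
      rw [X.symCartan_symm j i]; ring
    exact (mul_eq_zero.mp h3).resolve_left J.ne_zero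
  funext j; have := congrFun key j; simp only [Pi.zero_apply] at this; omega

lemma wtVal_inj (ht : t ≠ 0) (hq : Generic t) (P : LWeight X O) (J : ℤˣ) :
    Function.Injective (wtVal t P J) := fun n n' hn =>
  wt_inj ht hq (-J) fun i => by simpa only [val_neg, neg_mul] using mul_left_cancel₀ (P.lead_ne J i) (congrFun hn i)

lemma Highest.of_ne_zero {P : PreRep X t O (End ℂ V)} {v : V} {e : LWeight X O} (ht : t ≠ 0)
    (hq : Generic t) (hv : v ≠ 0) (raise : ∀ i m, P.x 1 i m v = 0)
    (hphi : ∀ J i r, P.phi J i r v = e.psi J i r • v) (hgen : ⨆ d, P.filt v d = ⊤) : P.Highest v e := by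
  classical
  refine ⟨raise, hphi, hgen, fun hmem => hv ?_⟩
  have hi := iSupIndep_eig (fun i => P.phi 1 i (ℓ O 1 i))
    (fun i j => P.phi_comm 1 1 i j _ _) (wtVal t e 1) (wtVal_inj ht hq e 1)
  refine Submodule.disjoint_def.mp (hi 0) v ?_ ?_
  . simp [hphi, mem_iInf, mem_eigenspace_iff, wtVal]
  . suffices hle : P.lowSpan ≤ ⨆ n, ⨆ (_ : n ≠ 0), ⨅ i, eigenspace (P.phi 1 i (ℓ O 1 i))
        (wtVal t e 1 n i) from hle hmem
    refine iSup_le fun a => ?_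
    rw [LinearMap.range_eq_map, <-iSup_gradedPart hphi hgen ht, Submodule.map_iSup]; refine iSup_le fun n => ?_
    rintro _ ⟨y, hy, rfl⟩; have h1 := hy.1; simp only [mem_coe, mem_iInf, mem_eigenspace_iff] at h1
    refine mem_iSup_of_mem (n + Pi.single a.1 1) (mem_iSup_of_mem (fun h => ?_) ?_)
    . simpa using congrFun h a.1
    . simp only [mem_iInf, mem_eigenspace_iff]; exact P.low_in_wt ht h1 a.1 a.2 1

end PreRep

end

section

def modRp (ht : t ≠ 0) (hq : Generic t) (hμ : X.IsShift O)
    (V : Type*) [ACG V] [Module ℂ V] [Module (SA X t O) V]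
    [IsScalarTower ℂ (SA X t O) V] : PreRep X t O (End ℂ V) :=
  (PreRep.ofAlgebra ht hq hμ).map (lsmul ℂ ℂ V)

/-- The rational functions have the given expansions. -/
def IsExpansion (Ψ : LWeight X O) (R : X.I0 -> RF) : Prop := ∀ i m, Ψ.psi 1 i m = expandZero (R i) m ∧ Ψ.psi (-1) i m = expandInfty (R i) m

namespace PreRep

section Weights

variable {V : Type*} [ACG V] [Module ℂ V] {P : PreRep X t O (End ℂ V)} {v : V}
  {Ψ : LWeight X O}

lemma wt_decomp (h : P.Highest v Ψ) (hr : ∀ d i, RecOn (P.filt v d) (P.x (-1) i))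
    (ht : t ≠ 0) (hq : Generic t) (J) (f : Weight X -> X.I0 -> ℂ)
    (hf : Function.Injective f) (c : (X.I0 -> ℕ) -> Weight X) (hχ : ∀ n, f (c n) = wtVal t Ψ J n)
    (W : Weight X -> Submodule ℂ V)
    (hW : ∀ w, W w = ⨅ i, eigenspace (P.phi J i (ℓ O J i)) (f w i)) :
    iSupIndep W ∧ ⨆ w, W w = ⊤ ∧ (∀ w, FiniteDimensional ℂ (W w)) ∧ ∀ w, W w ≠ ⊥ -> ∃ n, c n = w := by
  obtain rfl : W = fun w => ⨅ i, eigenspace (P.phi J i (ℓ O J i)) (f w i) := funext hW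
  have hU : ∀ n, P.gradedPart v Ψ n ≤
      ⨅ i, eigenspace (P.phi J i (ℓ O J i)) (f (c n) i) := fun n => by
    rw [hχ]; exact inf_le_left.trans (iInf_le _ J)
  have hi := iSupIndep_eig (fun i => P.phi J i (ℓ O J i))
    (fun i j => P.phi_comm J J i j _ _) f hf
  have hle := le_iSup_of_iSupIndep hi hU (P.iSup_gradedPart h.phi h.gen ht)
  have hχi : Function.Injective c := fun n n' hn =>
    wtVal_inj ht hq Ψ J (by rw [<-hχ, <-hχ, hn])
  refine ⟨hi, ?_, fun w => ?_, fun w hω => ?_⟩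
  . rw [eq_top_iff, <-P.iSup_gradedPart h.phi h.gen ht]; exact iSup_le fun n => le_iSup_of_le (c n) (hU n)
  . by_cases hn : ∃ n, c n = w
    . obtain ⟨n, rfl⟩ := hn; have h1 := hle (c n)
      have h2 : ⨆ n', ⨆ _ : c n' = c n, P.gradedPart v Ψ n' ≤ P.filt v (∑ i, n i) := iSup₂_le fun n' hn' => hχi hn' ▸ inf_le_right
      have := Module.Finite.iff_fg.mpr (P.filt_fg hr (∑ i, n i)); exact finiteDimensional_of_le (h1.trans h2)
    . have h1 := hle w
      have h2 : ⨆ n', ⨆ _ : c n' = w, P.gradedPart v Ψ n' = ⊥ := by simp only [iSup_eq_bot]; exact fun n' hn' => absurd ⟨n', hn'⟩ hn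
      have h3 := le_bot_iff.mp (h2 ▸ h1)
      beta_reduce
      rw [h3]; infer_instance
  . by_contra hn
    have h2 : ⨆ n', ⨆ _ : c n' = w, P.gradedPart v Ψ n' = ⊥ := by simp only [iSup_eq_bot]; exact fun n' hn' => absurd ⟨n', hn'⟩ hn
    exact hω (le_bot_iff.mp (h2 ▸ hle w))

end Weights

section Category

variable (ht : t ≠ 0) (hq : Generic t) (hμ : X.IsShift O)
  {V : Type*} [ACG V] [Module ℂ V] [Module (SA X t O) V]
  [IsScalarTower ℂ (SA X t O) V] {v : V} {Ψ : LWeight X O}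

lemma Highest.inCategoryO (h : (modRp ht hq hμ V).Highest v Ψ)
    (hr : ∀ d i, RecOn ((modRp ht hq hμ V).filt v d) ((modRp ht hq hμ V).x (-1) i)) :
    InCategoryO X t O V := by
  classical
  let χ1 : (X.I0 -> ℕ) -> Weight X := fun n i => mk0 _ (wtVal_ne ht Ψ 1 n i)
  let χ2 : (X.I0 -> ℕ) -> Weight X := fun n i => (mk0 _ (wtVal_ne ht Ψ (-1) n i))⁻¹
  have e1 : ∀ i, ℓ O 1 i = 0 := fun i => by simp [leadIdx]
  have e2 : ∀ i, ℓ O (-1) i = O i := fun i => by simp [leadIdx]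
  obtain ⟨a1, a2, a3, a4⟩ := wt_decomp h hr ht hq 1 (fun w i => (w i : ℂ))
    (fun w ω' h => funext fun i => Units.ext (congrFun h i)) χ1 (fun n => rfl)
    (weightSpacePlus X t O V) (fun w => by simp only [e1]; rfl)
  obtain ⟨b1, b2, b3, b4⟩ := wt_decomp h hr ht hq (-1) (fun w i => (w i : ℂ)⁻¹)
    (fun w ω' h => funext fun i => Units.ext (inv_injective (congrFun h i))) χ2
    (fun n => by funext i; simp [χ2])
    (weightSpaceMinus X t O V) (fun w => by simp only [e2]; rfl)
  refine ⟨DirectSum.isInternal_submodule_of_iSupIndep_of_iSup_eq_top a1 a2,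
    DirectSum.isInternal_submodule_of_iSupIndep_of_iSup_eq_top b1 b2, a3, b3, {χ1 0, χ2 0}, fun w hω => ?_⟩
  have hq0 : (t ^ 2) ≠ 0 := pow_ne_zero 2 ht
  have hz : ∀ (n : X.I0 -> ℕ) i, (∏ j, ((t ^ 2) ^ (-(X.symCartan i j))) ^ n j) * ∏ j, ((t ^ 2) ^ X.symCartan j i) ^ n j = 1 := fun n i => by
    rw [<-prod_mul_distrib]; refine Finset.prod_eq_one fun j _ => ?_
    rw [<-mul_pow, X.symCartan_symm j i, <-zpow_add₀ hq0, neg_add_cancel, zpow_zero, one_pow]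
  rcases hω with hω | hω
  . obtain ⟨n, rfl⟩ := a4 w hω; refine ⟨χ1 0, by simp, n, fun i => ?_⟩
    simp only [χ1, val_mk0, wtVal, val_one, one_mul, Pi.zero_apply, pow_zero, Finset.prod_const_one, mul_one]
    rw [mul_assoc, hz, mul_one]
  . obtain ⟨n, rfl⟩ := b4 w hω; refine ⟨χ2 0, by simp, n, fun i => ?_⟩
    simp only [χ2, Units.val_inv_eq_inv_val, val_mk0, wtVal, val_neg, val_one, neg_mul,
      one_mul, neg_neg, Pi.zero_apply, pow_zero, Finset.prod_const_one, mul_one, mul_inv]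
    rw [mul_assoc]; conv_lhs => rw [<-mul_one (Ψ.psi (-1) i (ℓ O (-1) i))⁻¹]
    congr 1; rw [eq_comm, inv_mul_eq_one₀ (Finset.prod_ne_zero_iff.mpr fun _ _ => pow_ne_zero _ (zpow_ne_zero _ hq0))]
    exact prod_congr rfl fun j _ => by rw [X.symCartan_symm i j]

lemma Highest.span_eq_top (h : (modRp ht hq hμ V).Highest v Ψ) :
    span (SA X t O) {v} = ⊤ := by
  have h1 : (⊤ : Submodule ℂ V) ≤ (span (SA X t O) {v}).restrictScalars ℂ := by
    rw [<-h.gen]; refine PreRep.iSup_filt_le _ (mem_span_singleton_self v) fun i m y hy => ?_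
    exact smul_mem (span (SA X t O) {v}) (genX O (-1) i m) hy
  exact eq_top_iff.mpr fun y _ => h1 mem_top

lemma Core.isSimpleModule (h : (modRp ht hq hμ V).Core v Ψ) :
    IsSimpleModule (SA X t O) V := by
  have key : ∀ (N : Submodule (SA X t O) V) d, ∀ y ∈ N, y ≠ 0 ->
      y ∈ (modRp ht hq hμ V).filt v d -> v ∈ N := by
    intro N d
    have hspan : ∀ y ∈ N, y ≠ 0 -> y ∈ span ℂ {v} -> v ∈ N := by
      intro y hy h0 hs; obtain ⟨c, rfl⟩ := Submodule.mem_span_singleton.mp hs; have hc : c ≠ 0 := fun hc => h0 (by rw [hc, zero_smul])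
      have := (N.restrictScalars ℂ).smul_mem c⁻¹ hy; rwa [inv_smul_smul₀ hc] at this
    induction d with
    | zero => exact hspan
    | succ d ih =>
      intro y hy h0 hd; by_cases hx : ∀ i m, (modRp ht hq hμ V).x 1 i m y = 0
      . exact hspan y hy h0 (h.nonsing y hx)
      . push Not at hx
        obtain ⟨i, m, hx⟩ := hx; exact ih _ (N.smul_mem (genX O 1 i m) hy) hx (PreRep.raise_in_filt _ h.raise h.phi_mem hd i m)
  have hnt : Nontrivial V := ⟨v, 0, h.ne_zero⟩; rw [isSimpleModule_iff]; exact
  { exists_pair_ne := ⟨⊥, ⊤, bot_ne_top⟩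
    eq_bot_or_eq_top := fun N => by
      by_cases hN : N = ⊥
      . exact Or.inl hN
      . obtain ⟨y, hy, h0⟩ := N.exists_mem_ne_zero_of_ne_bot hN; obtain ⟨d, hd⟩ := h.ex_in_filt y
        refine Or.inr (eq_top_iff.mpr ?_)
        rw [<-Highest.span_eq_top ht hq hμ h.toHighest, span_singleton_le_iff_mem]; exact key N d y hy h0 hd }

end Category

/-- The invariants of the modules that enter iterated fusion products. -/
structure Good {V : Type*} [ACG V] [Module ℂ V] (P : PreRep X t O (End ℂ V)) (v : V)
    (Ψ : LWeight X O) : Prop extends P.Highest v Ψ where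
  rel : ∀ δ, RelFam X t δ (P.x δ)
  recurrence : ∀ d i J, RecOn (P.filt v d) (P.x J i)

lemma Core.good {V : Type*} [ACG V] [Module ℂ V] {P : PreRep X t O (End ℂ V)} {v : V}
    {Ψ} (h : P.Core v Ψ) (ht : t ≠ 0) (hΨ : Ψ.Rational) : P.Good v Ψ where
  toHighest := h.toHighest
  rel := h.complete ht
  recurrence := h.recurrence ht hΨ

end PreRep

namespace PtMod

variable (ht : t ≠ 0) (hq : Generic t) (hμ : X.IsShift O)

/-- The Cartan part of the action on a module with a vector. -/
def rep (V : PtMod X t O) : PreRep X t O (End ℂ V.carrier) := modRp ht hq hμ V.carrier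

lemma isHighest {V : PtMod X t O} {Ψ : LWeight X O} (h : (V.rep ht hq hμ).Highest V.vec Ψ)
    (hr : ∀ d i, RecOn ((V.rep ht hq hμ).filt V.vec d) ((V.rep ht hq hμ).x (-1) i))
    {R : X.I0 -> RF} (hR : IsRationalWeight O R) (hΨ : IsExpansion Ψ R) : IsHighest V R where
  inO := PreRep.Highest.inCategoryO ht hq hμ h hr
  rational := hR
  ne_zero := h.ne_zero
  generates := PreRep.Highest.span_eq_top ht hq hμ h
  raise := h.raise
  phiPlus i m := by rw [<-(hΨ i m).1]; exact h.phi 1 i m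
  phiMinus i m := by rw [<-(hΨ i m).2]; exact h.phi (-1) i m

/-- The module given by operators satisfying the relations. -/
def ofRep {V : Type} [ACG V] [Module ℂ V] (ρ : SA X t O →ₐ[ℂ] End ℂ V)
    (v : V) : PtMod X t O :=
  letI : Module (SA X t O) V := compHom V ρ.toRingHom
  { carrier := V
    tower := ⟨fun c a y => by
      change ρ (c • a) y = c • ρ a y; rw [map_smul, smulL]⟩
    vec := v }

lemma _root_.PreRep.eq_of_fields {B : Type*} [Ring B] [Algebra ℂ B] {P Q : PreRep X t O B} (h1 : P.x = Q.x)
    (h2 : P.phi = Q.phi) (h3 : P.inv = Q.inv) : P = Q := by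
  cases P
  cases Q
  simp only at h1 h2 h3; subst h1 h2 h3; rfl

lemma rep_ofRp {V : Type} [ACG V] [Module ℂ V] {P : PreRep X t O (End ℂ V)}
    (hc : ∀ d, P.Complete d) (v : V) : (ofRep (P.lift ht hq hμ hc) v).rep ht hq hμ = P := by
  refine PreRep.eq_of_fields ?_ ?_ ?_
  . funext J i m; exact P.lift_genX ht hq hμ hc J i m
  . funext J i m; exact P.lift_gPhi ht hq hμ hc J i m
  . funext J i; exact P.lift_genInv ht hq hμ hc J i

/-- The simple module of highest `ℓ`-weight `Ψ`. -/
def simple (Ψ : LWeight X O) : PtMod X t O :=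
  ofRep ((Verma.simplePreRp ht Ψ).lift ht hq hμ ((Verma.simple_core Ψ ht).complete ht)) (Verma.simpleVec t Ψ)

lemma simple_core (Ψ) :
    ((simple ht hq hμ Ψ).rep ht hq hμ).Core (simple ht hq hμ Ψ).vec Ψ := by
  have := rep_ofRp ht hq hμ ((Verma.simple_core Ψ ht).complete ht) (Verma.simpleVec t Ψ)
  have e : (simple ht hq hμ Ψ).rep ht hq hμ = Verma.simplePreRp ht Ψ := this; rw [e]; exact Verma.simple_core Ψ ht

lemma isL_simple {Ψ : LWeight X O} (hΨ : Ψ.Rational) {R : X.I0 -> RF} (hR : IsRationalWeight O R)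
    (hR' : IsExpansion Ψ R) : IsL (simple ht hq hμ Ψ) R :=
  ⟨isHighest ht hq hμ (simple_core ht hq hμ Ψ).toHighest
    (fun d i => (simple_core ht hq hμ Ψ).recurrence ht hΨ d i (-1)) hR hR',
    PreRep.Core.isSimpleModule ht hq hμ (simple_core ht hq hμ Ψ)⟩

end PtMod

end

section

section Hahn

variable {E : Type*} [Ring E]

lemma cf_mul_sum {a b : HahnSeries ℤ E} {n} (S : Finset ℤ)
    (h : ∀ k, k ∉ S -> a.coeff k * b.coeff (n - k) = 0) :
    (a * b).coeff n = ∑ k ∈ S, a.coeff k * b.coeff (n - k) := by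
  rw [HahnSeries.coeff_mul]; have hb : ∀ p : ℤ × ℤ, p.1 + p.2 = n -> p.2 = n - p.1 := fun p hp => by omega
  refine Finset.sum_bij_ne_zero (fun p _ _ => p.1) ?_ ?_ ?_ ?_
  . intro p hp h0; by_contra hS; refine h0 ?_; rw [hb p (by simpa using hp : _ ∧ _ ∧ _).2.2]; exact h _ hS
  . intro p hp _ p' hp' _ h1; have e1 := (by simpa using hp : _ ∧ _ ∧ p.1 + p.2 = n).2.2
    have e2 := (by simpa using hp' : _ ∧ _ ∧ p'.1 + p'.2 = n).2.2; grind
  . intro k _ h0; refine ⟨(k, n - k), ?_, h0, rfl⟩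
    simpa using ⟨left_ne_zero_of_mul h0, right_ne_zero_of_mul h0⟩
  . intro p hp _; rw [<-hb p (by simpa using hp : _ ∧ _ ∧ _).2.2]

def toHahn (F : ℤ -> E) : HahnSeries ℤ E := open Classical in
  if h : BddBelow (Function.support F) then HahnSeries.ofSuppBddBelow F h else 0

lemma cf_toHahn {F : ℤ -> E} (a) (h : ∀ n, n < a -> F n = 0) : (toHahn F).coeff = F := by
  have hb : BddBelow (Function.support F) := ⟨a, fun n hn => not_lt.mp fun hlt => hn (h n hlt)⟩
  rw [toHahn, dif_pos hb, HahnSeries.coeff_ofSuppBddBelow]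

end Hahn

lemma sum_anti_assoc {B : Type*} [AddCommMonoid B] (k) (f : ℕ -> ℕ -> ℕ -> B) :
    ∑ p ∈ antidiagonal k, ∑ p' ∈ antidiagonal p.1, f p'.1 p'.2 p.2 = ∑ p ∈ antidiagonal k, ∑ p' ∈ antidiagonal p.2, f p.1 p'.1 p'.2 := by
  rw [sum_sigma', sum_sigma']
  refine sum_nbij' (fun ⟨⟨_i, j⟩, ⟨k, l⟩⟩ ↦ ⟨(k, l + j), (l, j)⟩)
    (fun ⟨⟨i, _j⟩, ⟨k, l⟩⟩ ↦ ⟨(i + k, l), (i, k)⟩) ?_ ?_ ?_ ?_ ?_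
  . rintro ⟨⟨i, j⟩, ⟨a, b⟩⟩ h; simp at h ⊢; omega
  . rintro ⟨⟨i, j⟩, ⟨a, b⟩⟩ h; simp at h ⊢; omega
  . simp_all
  . simp_all
  simp

namespace TwistedType

variable (X) (t)

lemma gam_n_swap (i j) : X.gam t (-1) (-1) i j = X.gam t 1 1 j i := by
  have hM : X.zeta ^ (X.M : ℤ) = 1 := by rw [zpow_natCast]; exact X.zeta_pow_M
  have hz := X.zeta_ne
  have e : ∀ F : ℕ -> PowerSeries ℂ, ∏ s ∈ Icc 1 X.M, F s = F X.M * ∏ s ∈ Icc 1 (X.M - 1), F s := fun F => by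
    have := X.M_pos; obtain ⟨M', hM'⟩ : ∃ M', X.M = M' + 1 := ⟨X.M - 1, by omega⟩
    rw [hM', Finset.prod_Icc_succ_top (by omega), mul_comm]; rfl
  rw [gam, gam, e, e]; have hc : X.c i X.M j = X.c j X.M i := by rw [c_M, c_M, X.car_symm]
  congr 1
  . have : X.zeta ^ (-(X.M : ℤ)) = 1 := by simp_all
    simp only [gamNum, gamDen, hc, val_neg, val_one, neg_mul, one_mul, neg_neg, mul_neg, hM, this]
  . refine Finset.prod_nbij' (fun s => X.M - s) (fun s => X.M - s) ?_ ?_ ?_ ?_ ?_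
    . grind
    . grind
    . grind
    . grind
    . intro s hs; simp only [mem_Icc] at hs; have hs' : s ≤ X.M := by omega
      have h1 : X.c i s j = X.c j (X.M - s) i := by rw [X.c_reflect hs']
      have h2 : X.zeta ^ (-(s : ℤ)) = X.zeta ^ ((X.M - s : ℕ) : ℤ) := by rw [Nat.cast_sub hs', zpow_sub₀ hz, hM, zpow_neg, one_div]
      simp only [gamNum, gamDen, h1, val_neg, val_one, mul_neg, neg_mul, mul_one, neg_neg, one_mul, h2]

end TwistedType

namespace PreRep

variable {B1 B2 E : Type*} [Ring B1] [Algebra ℂ B1]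
  [Ring B2] [Algebra ℂ B2] [Ring E] [Algebra ℂ E] (P1 : PreRep X t O1 B1) (P2 : PreRep X t O2 B2)
  (τ : B1 ⊗[ℂ] B2 →ₐ[ℂ] E)

lemma ldIdx_add (J i) :
    ℓ (O1 + O2) J i = ℓ O1 J i + ℓ O2 J i := by
  unfold leadIdx; aesop

/-- The coefficients of the deformed coproduct of `φ_{i,m}^J`. -/
def copPhiCf (J : ℤˣ) (i : X.I0) (m n : ℤ) : E := τ (P1.phi J i (m - n) ⊗ₜ P2.phi J i n)

/-- The coefficients of the deformed coproduct of `x_{i,m}^J`. -/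
def copXCf (J : ℤˣ) (i : X.I0) (m n : ℤ) : E :=
  if J = 1 then (if n = 0 then τ (P1.x 1 i m ⊗ₜ 1) else 0) + τ (P1.phi (-1) i (m - n) ⊗ₜ P2.x 1 i n)
  else (if n = m then τ (1 ⊗ₜ P2.x (-1) i m) else 0) + τ (P1.x (-1) i (m - n) ⊗ₜ P2.phi 1 i n)

def copPhi (J : ℤˣ) (i : X.I0) (m : ℤ) : HahnSeries ℤ E := toHahn (copPhiCf P1 P2 τ J i m)

def copX (J : ℤˣ) (i : X.I0) (m : ℤ) : HahnSeries ℤ E := toHahn (copXCf P1 P2 τ J i m)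

lemma phi_n_zero {O} {B : Type*} [Ring B] [Algebra ℂ B] (P : PreRep X t O B) {i r} (h : O i < r) :
    P.phi (-1) i r = 0 := P.phi_van _ _ _ (by aesop)

lemma phi_pos_zero {O} {B : Type*} [Ring B] [Algebra ℂ B] (P : PreRep X t O B) {i r} (h : r < 0) :
    P.phi 1 i r = 0 := P.phi_van _ _ _ (by aesop)

lemma cf_copPhi (J i m) :
    (copPhi P1 P2 τ J i m).coeff = copPhiCf P1 P2 τ J i m := by
  rcases units_eq_one_or J with rfl | rfl
  . refine cf_toHahn 0 fun n hn => ?_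
    rw [copPhiCf, P2.phi_pos_zero hn, tmul_zero, map_zero]
  . refine cf_toHahn (m - O1 i) fun n hn => ?_
    rw [copPhiCf, P1.phi_n_zero (by omega), zero_tmul, map_zero]

def copBound (O1 : X.I0 -> ℤ) (J : ℤˣ) (i : X.I0) (m : ℤ) : ℤ := if J = 1 then min 0 (m - O1 i) else min 0 m

lemma copXCf_zero {J : ℤˣ} {i} {m n : ℤ} (h : n < copBound O1 J i m) :
    copXCf P1 P2 τ J i m n = 0 := by
  unfold copBound at h; unfold copXCf; split_ifs at h with h1
  . rw [if_pos h1, if_neg (by omega), P1.phi_n_zero (by omega)]; simp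
  . rw [if_neg h1, if_neg (by omega), P2.phi_pos_zero (by omega)]; simp

lemma cf_copX (J : ℤˣ) (i) (m : ℤ) :
    (copX P1 P2 τ J i m).coeff = copXCf P1 P2 τ J i m :=
  cf_toHahn _ fun _ hn => copXCf_zero P1 P2 τ hn

abbrev phiTen (J : ℤˣ) (i : X.I0) (p : ℕ × ℕ) : E := τ (P1.phi J i (ℓ O1 J i + J * p.1) ⊗ₜ P2.phi J i (ℓ O2 J i + J * p.2))

lemma copPhi_ld (J : ℤˣ) (i) (k : ℕ) :
    copPhi P1 P2 τ J i (ℓ (O1 + O2) J i + (J : ℤ) * k) = ∑ p ∈ antidiagonal k, single (ℓ O2 J i + (J : ℤ) * p.2)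
        (phiTen P1 P2 τ J i p) := by
  have hε : (J : ℤ) * J = 1 := by simp
  ext n; rw [cf_copPhi, coeff_sum, copPhiCf, ldIdx_add]; rcases Verma.phi_cases (O := O2) J i n with ⟨b, rfl⟩ | h
  . by_cases hb : b ≤ k
    . rw [sum_eq_single (k - b, b)]
      . rw [coeff_single_same, phiTen]; grind
      . rintro ⟨a, b'⟩ h1 h2; refine coeff_single_of_ne fun h3 => h2 ?_
        aesop
      simp_all
    . rw [P1.phi_van, zero_tmul, map_zero, sum_eq_zero]
      . rintro ⟨a, b'⟩ h1; refine coeff_single_of_ne fun h3 => hb ?_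
        aesop
      grind
  . rw [P2.phi_van _ _ _ h, tmul_zero, map_zero, sum_eq_zero]; rintro ⟨a, b⟩ h1
    refine coeff_single_of_ne fun h3 => ?_
    rw [h3, add_sub_cancel_left, <-mul_assoc, hε] at h; omega

lemma copPhi_mul_cf (J : ℤˣ) (i) (k : ℕ) (y : HahnSeries ℤ E) (n : ℤ) :
    (copPhi P1 P2 τ J i (ℓ (O1 + O2) J i + J * k) * y).coeff n =
      ∑ p ∈ antidiagonal k, phiTen P1 P2 τ J i p * y.coeff (n - (ℓ O2 J i + J * p.2)) := by
  rw [copPhi_ld, sum_mul, coeff_sum]; exact sum_congr rfl fun p _ => coeff_single_mul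

lemma mul_copPhi_cf (J : ℤˣ) (i) (k : ℕ) (y : HahnSeries ℤ E) (n : ℤ) :
    (y * copPhi P1 P2 τ J i (ℓ (O1 + O2) J i + J * k)).coeff n = ∑ p ∈ antidiagonal k,
        y.coeff (n - (ℓ O2 J i + J * p.2)) * phiTen P1 P2 τ J i p := by
  rw [copPhi_ld, mul_sum, coeff_sum]; exact sum_congr rfl fun p _ => coeff_mul_single

lemma ten_mul (a a' : B1) (b b' : B2) : τ (a ⊗ₜ b) * τ (a' ⊗ₜ b') = τ ((a * a') ⊗ₜ (b * b')) := by rw [<-map_mul, tmul_mul_tmul]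

lemma tw_cf (e g) (F : ℕ -> ℤ -> HahnSeries ℤ E) (k m n) :
    (twist e g F k m).coeff n = ∑ p ∈ antidiagonal k, coeff p.1 g • (F p.2 (m + e * p.1)).coeff n := by
  simp [twist, coeff_sum]

lemma copPhi_l (J d : ℤˣ) (i j) (e : ℤ -> B2) (hψ : ∀ r n, P2.phi J i r * e n = e n * P2.phi J i r)
    (Y : ℤ -> HahnSeries ℤ E) (hY : ∀ m n, (Y m).coeff n = τ (P1.x d j (m - n) ⊗ₜ e n)) (k : ℕ) (m : ℤ) :
    copPhi P1 P2 τ J i (ℓ (O1 + O2) J i + J * k) * Y m = twist J (X.gam t J d i j)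
      (fun k m => Y m * copPhi P1 P2 τ J i (ℓ (O1 + O2) J i + J * k)) k m := by
  ext n; rw [tw_cf, copPhi_mul_cf]; simp only [mul_copPhi_cf, smul_sum, hY]
  rw [<-sum_anti_assoc k fun c a b => coeff c (X.gam t J d i j) •
    (τ (P1.x d j (m + J * c - (n - (ℓ O2 J i + J * b))) ⊗ₜ e (n - (ℓ O2 J i + J * b))) * phiTen P1 P2 τ J i (a, b))]
  refine sum_congr rfl fun p _ => ?_
  rw [phiTen, ten_mul, P1.phi_x, hψ, twist, sum_tmul, map_sum]; refine sum_congr rfl fun p' _ => ?_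
  rw [<-smul_tmul', map_smul, phiTen, ten_mul]
  grind

lemma copPhi_r (J d : ℤˣ) (i j) (e : ℤ -> B1) (hψ : ∀ r n, P1.phi J i r * e n = e n * P1.phi J i r)
    (Y : ℤ -> HahnSeries ℤ E) (hY : ∀ m n, (Y m).coeff n = τ (e (m - n) ⊗ₜ P2.x d j n)) (k : ℕ) (m : ℤ) :
    copPhi P1 P2 τ J i (ℓ (O1 + O2) J i + (J : ℤ) * k) * Y m = twist J (X.gam t J d i j)
      (fun k m => Y m * copPhi P1 P2 τ J i (ℓ (O1 + O2) J i + (J : ℤ) * k)) k m := by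
  ext n; rw [tw_cf, copPhi_mul_cf]; simp only [mul_copPhi_cf, smul_sum, hY]
  rw [Verma.sum_antidiagonal_swap k fun c a b => coeff c (X.gam t J d i j) •
    (τ (e (m + J * c - (n - (ℓ O2 J i + J * b))) ⊗ₜ P2.x d j (n - (ℓ O2 J i + J * b))) * phiTen P1 P2 τ J i (a, b))]
  refine sum_congr rfl fun p _ => ?_
  rw [phiTen, ten_mul, P2.phi_x, hψ, twist, tmul_sum, map_sum]; refine sum_congr rfl fun p' hp' => ?_
  rw [tmul_smul, map_smul, phiTen, ten_mul]
  have hp' : (p.2 : ℤ) = p'.1 + p'.2 := by aesop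
  rw [hp', show m + (J : ℤ) * p'.1 - (n - (ℓ O2 J i + J * p'.2)) = m - (n - (ℓ O2 J i + J * (p'.1 + p'.2))) by ring,
    show n - (ℓ O2 J i + (J : ℤ) * (p'.1 + p'.2)) + J * p'.1 =
    n - (ℓ O2 J i + J * p'.2) by ring]

end PreRep

end

section

section Hahn

variable {E : Type*} [Ring E]

lemma cf_mul_anti {a b : HahnSeries ℤ E} {d e : ℤ} (ha : ∀ k < d, a.coeff k = 0)
    (hb : ∀ k < e, b.coeff k = 0) (K : ℕ) : (a * b).coeff (d + e + K) = ∑ p ∈ antidiagonal K, a.coeff (d + p.1) * b.coeff (e + p.2) := by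
  rw [cf_mul_sum ((antidiagonal K).image fun p => d + p.1)]
  . rw [sum_image]
    . refine sum_congr rfl fun p hp => ?_
      have := Finset.HasAntidiagonal.mem_antidiagonal.mp hp; grind
    . intro p hp p' hp' h; aesop
  . intro k hk; by_cases h1 : k < d
    . simp_all
    . rw [hb _, mul_zero]; by_contra h2
      refine hk (Finset.mem_image.mpr ⟨((k - d).toNat, (e + K - (k - d) - e).toNat), ?_, ?_⟩)
      . rw [mem_antidiagonal]; omega
      omega

lemma cf_mul_zero {a b : HahnSeries ℤ E} {d e n} (ha : ∀ k < d, a.coeff k = 0)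
    (hb : ∀ k < e, b.coeff k = 0) (hn : n < d + e) : (a * b).coeff n = 0 := by
  rw [cf_mul_sum ∅, sum_empty]; grind

end Hahn

namespace PreRep

variable {B1 B2 E : Type*} [Ring B1] [Algebra ℂ B1]
  [Ring B2] [Algebra ℂ B2] [Ring E] [Algebra ℂ E] (P1 : PreRep X t O1 B1) (P2 : PreRep X t O2 B2)
  (τ : B1 ⊗[ℂ] B2 →ₐ[ℂ] E)

/-- The term `f ⊗ x⁺` of the deformed coproduct of `x⁺`. -/
def copB (i : X.I0) (m : ℤ) : HahnSeries ℤ E := toHahn fun n => τ (P1.phi (-1) i (m - n) ⊗ₜ P2.x 1 i n)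

/-- The term `x⁻ ⊗ f` of the deformed coproduct of `x⁻`. -/
def copD (i : X.I0) (m : ℤ) : HahnSeries ℤ E := toHahn fun n => τ (P1.x (-1) i (m - n) ⊗ₜ P2.phi 1 i n)

lemma cf_copB (i m) :
    (copB P1 P2 τ i m).coeff = fun n => τ (P1.phi (-1) i (m - n) ⊗ₜ P2.x 1 i n) :=
  cf_toHahn (m - O1 i) fun n hn => by rw [P1.phi_n_zero (by omega), zero_tmul, map_zero]

lemma cf_copD (i m) :
    (copD P1 P2 τ i m).coeff = fun n => τ (P1.x (-1) i (m - n) ⊗ₜ P2.phi 1 i n) :=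
  cf_toHahn 0 fun n hn => by rw [P2.phi_pos_zero (by omega), tmul_zero, map_zero]

lemma copX_pos (i m) :
    copX P1 P2 τ 1 i m = single 0 (τ (P1.x 1 i m ⊗ₜ 1)) + copB P1 P2 τ i m := by
  ext n; rw [cf_copX, coeff_add, coeff_single, cf_copB, copXCf, if_pos rfl]; congr 2

lemma copX_neg (i m) :
    copX P1 P2 τ (-1) i m = single m (τ (1 ⊗ₜ P2.x (-1) i m)) + copD P1 P2 τ i m := by
  ext n; simp [cf_copX, coeff_add, coeff_single, cf_copD, copXCf]

lemma copPhi_van {J i r} (h : (J) * (r - ℓ (O1 + O2) J i) < 0) :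
    copPhi P1 P2 τ J i r = 0 := by
  ext n; rw [cf_copPhi, copPhiCf, HahnSeries.coeff_zero]; by_cases h1 : J * (n - ℓ O2 J i) < 0
  . rw [P2.phi_van _ _ _ h1, tmul_zero, map_zero]
  . rw [P1.phi_van, zero_tmul, map_zero]; rw [ldIdx_add] at h
    grind

lemma copPhi_zero (J i) : copPhi P1 P2 τ J i (ℓ (O1 + O2) J i) = single (ℓ O2 J i)
      (τ (P1.phi J i (ℓ O1 J i) ⊗ₜ P2.phi J i (ℓ O2 J i))) := by
  have := copPhi_ld P1 P2 τ J i 0; simp_all [phiTen]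

lemma comm_copPhi (J ε' i j r r') :
    copPhi P1 P2 τ J i r * copPhi P1 P2 τ ε' j r' = copPhi P1 P2 τ ε' j r' * copPhi P1 P2 τ J i r := by
  rcases Verma.phi_cases (O := O1 + O2) J i r with ⟨k, rfl⟩ | h
  swap
  . rw [copPhi_van P1 P2 τ h, zero_mul, mul_zero]
  rcases Verma.phi_cases (O := O1 + O2) ε' j r' with ⟨k', rfl⟩ | h
  swap
  . rw [copPhi_van P1 P2 τ h, zero_mul, mul_zero]
  rw [copPhi_ld, copPhi_ld, Finset.sum_mul_sum, Finset.sum_mul_sum, sum_comm]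
  refine sum_congr rfl fun p _ => sum_congr rfl fun p' _ => ?_
  rw [single_mul_single, single_mul_single, add_comm, phiTen, phiTen, ten_mul, ten_mul, P1.phi_comm, P2.phi_comm]

lemma comm_copB_copD (i j r s) :
    copB P1 P2 τ i r * copD P1 P2 τ j s = copD P1 P2 τ j s * copB P1 P2 τ i r := by
  have hB : ∀ k < r - O1 i, (copB P1 P2 τ i r).coeff k = 0 := fun k hk => by
    rw [cf_copB]; dsimp only; rw [P1.phi_n_zero (by omega), zero_tmul, map_zero]
  have hD : ∀ k < (0 : ℤ), (copD P1 P2 τ j s).coeff k = 0 := fun k hk => by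
    rw [cf_copD]; dsimp only; rw [P2.phi_pos_zero (by omega), tmul_zero, map_zero]
  ext n; by_cases hn : n < r - O1 i
  . rw [cf_mul_zero hB hD (by omega), cf_mul_zero hD hB (by omega)]
  obtain ⟨K, rfl⟩ : ∃ K : ℕ, n = r - O1 i + 0 + K := ⟨(n - (r - O1 i)).toNat, by omega⟩
  rw [cf_mul_anti hB hD, add_comm (r - O1 i) 0, cf_mul_anti hD hB, cf_copB, cf_copD]
  have hneg : ∀ (p : ℕ) m, P1.phi (-1) i (r - (r - O1 i + p)) * P1.x (-1) j m = ∑ c ∈ antidiagonal p, coeff c.1 (X.gam t (-1) (-1) i j) •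
        (P1.x (-1) j (m - c.1) * P1.phi (-1) i (O1 i - c.2)) := fun p m => by
    have := P1.phi_x (-1) (-1) i j p m
    simp only [leadIdx, twist, if_neg (show (-1 : ℤˣ) ≠ 1 by decide), val_neg, val_one, neg_mul, one_mul] at this; grind
  have hpos : ∀ (l : ℕ) m, P2.phi 1 j l * P2.x 1 i m = ∑ c ∈ antidiagonal l, coeff c.1 (X.gam t (-1) (-1) i j) •
        (P2.x 1 i (m + c.1) * P2.phi 1 j c.2) := fun l m => by
    have := P2.phi_x 1 1 j i l m
    simp_all [this, X.gam_n_swap, leadIdx, twist, if_true, val_one, one_mul, Pi.zero_apply, neg_zero, zero_add]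
  simp only [zero_add, ten_mul, hneg, hpos, sum_tmul, tmul_sum, map_sum, tmul_smul, <-smul_tmul', map_smul]
  trans ∑ p ∈ antidiagonal K, ∑ p' ∈ antidiagonal p.2, coeff p.1 (X.gam t (-1) (-1) i j) •
      τ ((P1.x (-1) j (s - p'.2 - p.1) * P1.phi (-1) i (O1 i - p'.1)) ⊗ₜ
        (P2.x 1 i (r - O1 i + (p.1 + p'.1)) * P2.phi 1 j p'.2))
  . rw [<-sum_anti_assoc K fun c p l => coeff c (X.gam t (-1) (-1) i j) • τ ((P1.x (-1) j (s - l - c) * P1.phi (-1) i (O1 i - p)) ⊗ₜ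
        (P2.x 1 i (r - O1 i + (c + p)) * P2.phi 1 j l))]
    refine sum_congr rfl fun p _ => sum_congr rfl fun p' hp' => ?_
    rw [<-(by exact_mod_cast Finset.HasAntidiagonal.mem_antidiagonal.mp hp' :
      (p'.1 : ℤ) + p'.2 = p.1)]
  . symm
    trans ∑ p ∈ antidiagonal K, ∑ p' ∈ antidiagonal p.1, coeff p'.1 (X.gam t (-1) (-1) i j) •
        τ ((P1.x (-1) j (s - p'.2 - p'.1) * P1.phi (-1) i (O1 i - p.2)) ⊗ₜ
          (P2.x 1 i (r - O1 i + (p'.1 + p.2)) * P2.phi 1 j p'.2))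
    . refine sum_congr rfl fun p _ => sum_congr rfl fun p' hp' => ?_
      rw [<-(by exact_mod_cast Finset.HasAntidiagonal.mem_antidiagonal.mp hp' :
        (p'.1 : ℤ) + p'.2 = p.1), show r - (r - O1 i + p.2) = O1 i - p.2 by ring,
        show r - O1 i + p.2 + p'.1 = r - O1 i + (p'.1 + p.2) by ring,
        show s - (p'.1 + p'.2 : ℤ) = s - p'.2 - p'.1 by ring]
    . rw [sum_anti_assoc K fun c l p => coeff c (X.gam t (-1) (-1) i j) • τ ((P1.x (-1) j (s - l - c) * P1.phi (-1) i (O1 i - p)) ⊗ₜ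
          (P2.x 1 i (r - O1 i + (c + p)) * P2.phi 1 j l))]
      refine sum_congr rfl fun p _ => ?_
      rw [<-Finset.Nat.sum_antidiagonal_swap]; rfl

lemma copXX (i j r s) :
    copX P1 P2 τ 1 i r * copX P1 P2 τ (-1) j s - copX P1 P2 τ (-1) j s * copX P1 P2 τ 1 i r =
      if i = j ∧ (X.N i : ℤ) ∣ s then (X.qi t i - (X.qi t i)⁻¹)⁻¹ •
        (copPhi P1 P2 τ 1 i (r + s) - copPhi P1 P2 τ (-1) i (r + s)) else 0 := by
  rw [copX_pos, copX_neg]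
  have hAC : single 0 (τ (P1.x 1 i r ⊗ₜ 1)) * single s (τ (1 ⊗ₜ P2.x (-1) j s)) =
      single s (τ (1 ⊗ₜ P2.x (-1) j s)) * single 0 (τ (P1.x 1 i r ⊗ₜ 1)) := by
    simp [single_mul_single, add_comm, ten_mul]
  have hBD := comm_copB_copD P1 P2 τ i j r s
  have : ∀ a b c d : HahnSeries ℤ E, a * c = c * a -> b * d = d * b ->
      (a + b) * (c + d) - (c + d) * (a + b) = (a * d - d * a) + (b * c - c * b) := by
    intro a b c d h1 h2; simp only [add_mul, mul_add, h1, h2]; abel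
  rw [this _ _ _ _ hAC hBD]; ext n
  have e1 : (single 0 (τ (P1.x 1 i r ⊗ₜ 1)) * copD P1 P2 τ j s - copD P1 P2 τ j s * single 0 (τ (P1.x 1 i r ⊗ₜ 1))).coeff n =
      τ ((P1.x 1 i r * P1.x (-1) j (s - n) - P1.x (-1) j (s - n) * P1.x 1 i r) ⊗ₜ P2.phi 1 j n) := by
    simp [coeff_sub, coeff_single_mul, coeff_mul_single, cf_copD, sub_zero, ten_mul, one_mul, mul_one, sub_tmul, map_sub]
  have e2 : (copB P1 P2 τ i r * single s (τ (1 ⊗ₜ P2.x (-1) j s)) - single s (τ (1 ⊗ₜ P2.x (-1) j s)) * copB P1 P2 τ i r).coeff n =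
      τ (P1.phi (-1) i (r + s - n) ⊗ₜ
        (P2.x 1 i (n - s) * P2.x (-1) j s - P2.x (-1) j s * P2.x 1 i (n - s))) := by
    rw [coeff_sub, coeff_single_mul, coeff_mul_single, cf_copB]; dsimp only
    rw [ten_mul, ten_mul, one_mul, mul_one, tmul_sub, map_sub, show r - (n - s) = r + s - n by ring]
  rw [coeff_add, e1, e2, P1.x_x, P2.x_x]; by_cases hij : i = j
  swap
  . simp [hij]
  subst hij; simp only [true_and, sub_add_cancel]; by_cases hs : (X.N i : ℤ) ∣ s
  . by_cases hn : (X.N i : ℤ) ∣ n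
    . rw [if_pos hs, if_pos (dvd_sub hs hn), if_pos hs, coeff_smul, coeff_sub,
        cf_copPhi, cf_copPhi, copPhiCf, copPhiCf, <-smul_tmul',
        tmul_smul, map_smul, map_smul, <-smul_add, <-map_add, <-map_sub,
        sub_tmul, tmul_sub, show r + (s - n) = r + s - n by ring]
      congr 2; abel
    simp [if_pos hs, coeff_smul, coeff_sub, cf_copPhi, copPhiCf, P2.phi_dvd _ _ _ hn]
  . by_cases hn : (X.N i : ℤ) ∣ n
    . rw [if_neg hs, if_neg (fun h => hs ((dvd_sub_left hn).mp h)), if_neg hs]; simp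
    simp [if_neg hs, P2.phi_dvd _ _ _ hn]

lemma copPhi_x (J d : ℤˣ) (i j) (k : ℕ) (m : ℤ) :
    copPhi P1 P2 τ J i (ℓ (O1 + O2) J i + J * k) * copX P1 P2 τ d j m = twist J (X.gam t J d i j) (fun k m => copX P1 P2 τ d j m *
        copPhi P1 P2 τ J i (ℓ (O1 + O2) J i + J * k)) k m := by
  rcases units_eq_one_or d with rfl | rfl
  . simp only [copX_pos, mul_add, add_mul]
    rw [copPhi_l P1 P2 τ J 1 i j (fun n => if n = 0 then 1 else 0) (fun r n => by simp)
      (fun m => single 0 (τ (P1.x 1 j m ⊗ₜ 1)))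
      (fun m n => by aesop),
      copPhi_r P1 P2 τ J 1 i j (fun n => P1.phi (-1) j n) (fun r n => P1.phi_comm _ _ _ _ _ _)
      (fun m => copB P1 P2 τ j m) (fun m n => by rw [cf_copB])]
    simp only [twist, smul_add, sum_add_distrib]
  . simp only [copX_neg, mul_add, add_mul]
    rw [copPhi_r P1 P2 τ J (-1) i j (fun n => if n = 0 then 1 else 0) (fun r n => by simp)
      (fun m => single m (τ (1 ⊗ₜ P2.x (-1) j m)))
      (fun m n => by
        rw [coeff_single]; by_cases h : n = m
        . simp [h]
        . simp [h, show m - n ≠ 0 by omega]),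
      copPhi_l P1 P2 τ J (-1) i j (fun n => P2.phi 1 j n) (fun r n => P2.phi_comm _ _ _ _ _ _)
      (fun m => copD P1 P2 τ j m) (fun m n => by rw [cf_copD])]
    simp only [twist, smul_add, sum_add_distrib]

def cop : PreRep X t (O1 + O2) (HahnSeries ℤ E) where
  x := copX P1 P2 τ
  phi := copPhi P1 P2 τ
  inv J i := single (-ℓ O2 J i) (τ (P1.inv J i ⊗ₜ P2.inv J i))
  x_zero J i r hr := by
    have : ∀ n, ¬ (X.N i : ℤ) ∣ r - n ∨ ¬ (X.N i : ℤ) ∣ n := fun n => by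
      by_contra! h
      exact hr (by simpa using dvd_add h.1 h.2)
    ext n; rw [cf_copX, copXCf, P1.x_zero _ _ _ hr, P2.x_zero _ _ _ hr]; rcases this n with h | h
    . rw [P1.x_zero _ _ _ h, P1.phi_dvd _ _ _ h]; simp
    . rw [P2.x_zero _ _ _ h, P2.phi_dvd _ _ _ h]; simp
  phi_dvd J i r hr := by
    ext n; rw [cf_copPhi, copPhiCf]; by_cases h : (X.N i : ℤ) ∣ n
    . rw [P1.phi_dvd _ _ _ (fun h' => hr ((dvd_sub_left h).mp h'))]; simp
    . rw [P2.phi_dvd _ _ _ h]; simp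
  phi_van _ _ _ := copPhi_van P1 P2 τ
  phi_comm := comm_copPhi P1 P2 τ
  lead_inv J i := by
    rw [copPhi_zero, single_mul_single, ten_mul, P1.lead_inv, P2.lead_inv, add_neg_cancel, <-one_def, map_one]; rfl
  inv_lead J i := by
    rw [copPhi_zero, single_mul_single, ten_mul, P1.inv_lead, P2.inv_lead, neg_add_cancel, <-one_def, map_one]; rfl
  phi_x := copPhi_x P1 P2 τ
  x_x := copXX P1 P2 τ

end PreRep

end

section

section Kills

variable {B B' : Type*} [ACG B] [Module ℂ B] [ACG B'] [Module ℂ B']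

lemma Kills.eq_zero {p : Polynomial ℂ} (hp : p ≠ 0) {f : ℤ -> B} (h : Kills p f) (m0)
    (h0 : ∀ m, m0 < m -> f m = 0) (m) : f m = 0 := by
  obtain ⟨k, hk⟩ : ∃ k : ℕ, m0 - k < m := ⟨(m0 - m).toNat + 1, by omega⟩; induction k using strong_induction_on generalizing m with
  | _ k ih =>
    by_cases hm : m0 < m
    . exact h0 m hm
    have hc := Polynomial.trailingCoeff_nonzero_iff_nonzero.mpr hp; have h1 := h (m - p.natTrailingDegree)
    rw [sum_def, sum_eq_single p.natTrailingDegree] at h1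
    . rw [sub_add_cancel] at h1; exact (smul_eq_zero.mp h1).resolve_left hc
    . intro l hl hne; have : p.natTrailingDegree ≤ l := Polynomial.natTrailingDegree_le_of_mem_supp l hl
      rw [ih (k - 1) (by omega) (m - p.natTrailingDegree + l) (by omega), smul_zero]
    . intro hn; exact absurd (Polynomial.mem_support_iff.mpr hc) hn

/-- The family satisfies some linear recurrence. -/
def Rec (f : ℤ -> B) : Prop := ∃ p : Polynomial ℂ, p.Monic ∧ Kills p f

lemma Rec.add {f g : ℤ -> B} (hf : Rec f) (hg : Rec g) : Rec fun m => f m + g m := by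
  obtain ⟨p, hp, h⟩ := hf; obtain ⟨p', hp', h'⟩ := hg
  exact ⟨p * p', hp.mul hp', (h.of_dvd (Dvd.intro _ rfl)).add (h'.of_dvd (Dvd.intro_left _ rfl))⟩

lemma Rec.map {f : ℤ -> B} (hf : Rec f) (L : B →ₗ[ℂ] B') : Rec fun m => L (f m) := by obtain ⟨p, hp, h⟩ := hf; exact ⟨p, hp, h.map L⟩

lemma Rec.shift {f : ℤ -> B} (hf : Rec f) (s) : Rec fun m => f (s + m) := by obtain ⟨p, hp, h⟩ := hf; exact ⟨p, hp, h.shift s⟩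

lemma Rec.zero : Rec fun _ => (0 : B) := ⟨1, monic_one, kills_zero _⟩

lemma Rec.sub {f g : ℤ -> B} (hf : Rec f) (hg : Rec g) : Rec fun m => f m - g m := by
  simpa [sub_eq_add_neg] using hf.add (hg.map (-LinearMap.id))

lemma Rec.sum {I : Type*} (S : Finset I) {f : I -> ℤ -> B} (h : ∀ a, Rec (f a)) :
    Rec fun m => ∑ a ∈ S, f a m := by
  classical
  induction S using Finset.induction_on with
  | empty => simpa using Rec.zero
  | insert a S ha ih => simpa [sum_insert ha] using (h a).add ih

lemma Rec.eq_zero {f : ℤ -> B} (h : Rec f) (m0) (h0 : ∀ m, m0 < m -> f m = 0) (m) : f m = 0 := by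
  obtain ⟨p, hp, h⟩ := h; exact h.eq_zero hp.ne_zero m0 h0 m

lemma Rec.tensor {u : ℤ -> End ℂ B} (h : ∀ y, Rec fun m => u m y) (b : End ℂ B')
    (z : B ⊗[ℂ] B') : Rec fun m => tmap (u m) b z := by
  induction z using TensorProduct.induction_on with
  | zero => simpa using Rec.zero
  | tmul y y' => exact (h y).map ((TensorProduct.mk ℂ B B').flip (b y'))
  | add z z' h h' => simpa only [map_add] using h.add h'

end Kills

section Tensor

variable {V W : Type*} [ACG V] [Module ℂ V] [ACG W] [Module ℂ W]

lemma basisEquiv_map {e U : Type*} [DecidableEq e] [ACG U] [Module ℂ U] (b : Module.Basis e ℂ W)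
    (f : V →ₗ[ℂ] U) (z : W ⊗[ℂ] V) (k : e) :
    equivFinsuppOfBasisLeft b (tmap (LinearMap.id : W →ₗ[ℂ] W) f z) k = f (equivFinsuppOfBasisLeft b z k) := by
  induction z using TensorProduct.induction_on with
  | zero => simp
  | tmul y y' => simp
  | add z z' h h' => simp only [map_add, Finsupp.add_apply, h, h']

lemma eq_tmul_of_killed {I : Type*} (T : I -> End ℂ V) (v : V) (top : V →ₗ[ℂ] ℂ) (hv : top v = 1)
    (hT : ∀ y, (∀ a, T a y = 0) -> y ∈ span ℂ {v}) {z : W ⊗[ℂ] V}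
    (hz : ∀ a, tmap (LinearMap.id : W →ₗ[ℂ] W) (T a) z = 0)
    (h0 : tmap (LinearMap.id : W →ₗ[ℂ] W) top z = 0) : z = 0 := by
  classical
  let b := Module.Free.chooseBasis ℂ W; refine (equivFinsuppOfBasisLeft b).map_eq_zero_iff.mp (Finsupp.ext fun k => ?_)
  obtain ⟨c, hc⟩ := Submodule.mem_span_singleton.mp (hT (equivFinsuppOfBasisLeft b z k)
    fun a => by rw [<-basisEquiv_map, hz]; simp)
  have h2 : top (equivFinsuppOfBasisLeft b z k) = 0 := by rw [<-basisEquiv_map, h0]; simp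
  rw [<-hc, map_smul, hv, smul_eq_mul, mul_one] at h2; rw [<-hc, h2, zero_smul, Finsupp.zero_apply]

end Tensor

lemma exists_bound {E : Type*} [Zero E] (R : HahnSeries ℤ E) : ∃ a, ∀ k < a, R.coeff k = 0 :=
  ⟨R.order, fun _ hk => coeff_eq_zero_of_lt_order hk⟩

section Twisted

variable {B : Type*} [Ring B] [Algebra ℂ B]

omit [Algebra ℂ B] in
lemma cf_mul_nonneg {a b : HahnSeries ℤ B} (ha : ∀ k < 0, a.coeff k = 0)
    (hb : ∀ k < 0, b.coeff k = 0) (n : ℕ) : (a * b).coeff n = ∑ p ∈ antidiagonal n, a.coeff p.1 * b.coeff p.2 := by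
  simpa using cf_mul_anti ha hb n

lemma RelFam.scale {v : ℤˣ} {x : X.I0 -> ℤ -> B} (hx : RelFam X t v x) (c : X.I0 -> ℕ -> ℂ)
    {x' : X.I0 -> ℤ -> HahnSeries ℤ B} (h0 : ∀ i m, ∀ k < 0, (x' i m).coeff k = 0)
    (h : ∀ i m (k : ℕ), (x' i m).coeff k = c i k • x i (m - k)) : RelFam X t v x' := by
  have hneg : ∀ {a b : HahnSeries ℤ B}, (∀ k < 0, a.coeff k = 0) -> (∀ k < 0, b.coeff k = 0) ->
      ∀ k < 0, (a * b).coeff k = 0 := fun ha hb k hk =>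
    cf_mul_zero ha hb (by simpa using hk)
  have e2 : ∀ i j (n : ℕ) r s, (x' i r * x' j s).coeff n = ∑ p ∈ antidiagonal n,
      (c i p.1 * c j p.2) • (x i (r - p.1) * x j (s - p.2)) := fun i j n r s => by
    rw [cf_mul_nonneg (h0 _ _) (h0 _ _)]; exact sum_congr rfl fun p _ => by rw [h, h, smul_mul_smul_comm]
  let T : ℕ -> Finset (ℕ × ℕ × ℕ) := fun n => (range (n + 1) ×ˢ range (n + 1) ×ˢ
    range (n + 1)).filter fun q => q.1 + q.2.1 + q.2.2 = n
  have hT : ∀ {n q}, q ∈ T n ↔ q.1 + q.2.1 + q.2.2 = n := fun {n q} => by simp only [T, mem_filter, Finset.mem_product, mem_range]; omega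
  have e3 : ∀ i j k (n : ℕ) r s u, (x' i r * x' j s * x' k u).coeff n =
      ∑ q ∈ T n, (c i q.1 * c j q.2.1 * c k q.2.2) • (x i (r - q.1) * x j (s - q.2.1) * x k (u - q.2.2)) :=
    fun i j k n r s u => by
      rw [cf_mul_nonneg (hneg (h0 _ _) (h0 _ _)) (h0 _ _)]; simp only [e2, h, sum_mul, smul_mul_smul_comm]; rw [sum_sigma']
      refine sum_nbij' (fun a => (a.2.1, a.2.2, a.1.2)) (fun q => ⟨(q.1 + q.2.1, q.2.2), (q.1, q.2.1)⟩)
        ?_ ?_ ?_ ?_ ?_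
      . rintro ⟨⟨a, b⟩, ⟨d, e⟩⟩ h; rw [hT]; simp at h ⊢; omega
      . rintro ⟨a, b, d⟩ h; rw [hT] at h; simp at h ⊢; omega
      . rintro ⟨⟨a, b⟩, ⟨d, e⟩⟩ h; simp at h ⊢; omega
      . rintro ⟨a, b, d⟩ h; rfl
      . rintro ⟨⟨a, b⟩, ⟨d, e⟩⟩ h; rfl
  have key : ∀ {G : Type} [ACG G] (p g : ℂ[G]) (F : G -> HahnSeries ℤ B) (F0 : G -> B) (n : ℤ)
      (r : G), (∀ r, (F r).coeff n = act g F0 r) -> (act p F r).coeff n = act g (act p F0) r := by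
    intro G _ p g F F0 n r hF; refine (act_comp (HahnSeries.coeff.linearMap (R := ℂ) (n : ℤ)) p F r).symm.trans ?_
    rw [<-act_mul, mul_comm, act_mul]; exact congrFun (congrArg (act p) (funext hF)) r
  have g2 : ∀ i j (n : ℤ), ∃ g : ℂ[ℤ × ℤ], ∀ r : ℤ × ℤ, (x' i r.1 * x' j r.2).coeff n = act g (fun r => x i r.1 * x j r.2) r ∧
      (x' j r.2 * x' i r.1).coeff n = act g (fun r => x j r.2 * x i r.1) r := by
    intro i j n; by_cases hn : n < 0
    . refine ⟨0, fun r => ?_⟩; rw [hneg (h0 _ _) (h0 _ _) n hn, hneg (h0 _ _) (h0 _ _) n hn, map_zero]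
      exact ⟨rfl, rfl⟩
    lift n to ℕ using not_lt.mp hn
    refine ⟨∑ p ∈ antidiagonal n, AddMonoidAlgebra.single (-(p.1 : ℤ), -(p.2 : ℤ)) (c i p.1 * c j p.2), fun r => ?_⟩
    rw [e2, e2, map_sum, sumL, sumL, Finset.sum_apply, Finset.sum_apply]
    simp only [act_sgl, Prod.fst_add, Prod.snd_add, <-sub_eq_add_neg]; refine ⟨trivial, ?_⟩
    rw [<-Finset.Nat.sum_antidiagonal_swap]; exact sum_congr rfl fun p _ => by rw [mul_comm]; rfl
  have g3 : ∀ i j k (n : ℤ), ∃ g : ℂ[ℤ × ℤ × ℤ], ∀ r : ℤ × ℤ × ℤ,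
      (x' i r.1 * x' j r.2.1 * x' k r.2.2).coeff n = act g (fun r => x i r.1 * x j r.2.1 * x k r.2.2) r ∧
      (x' i r.1 * x' k r.2.2 * x' j r.2.1).coeff n = act g (fun r => x i r.1 * x k r.2.2 * x j r.2.1) r ∧
      (x' j r.2.1 * x' i r.1 * x' k r.2.2).coeff n = act g (fun r => x j r.2.1 * x i r.1 * x k r.2.2) r ∧
      (x' j r.2.1 * x' k r.2.2 * x' i r.1).coeff n = act g (fun r => x j r.2.1 * x k r.2.2 * x i r.1) r ∧
      (x' k r.2.2 * x' i r.1 * x' j r.2.1).coeff n = act g (fun r => x k r.2.2 * x i r.1 * x j r.2.1) r ∧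
      (x' k r.2.2 * x' j r.2.1 * x' i r.1).coeff n = act g (fun r => x k r.2.2 * x j r.2.1 * x i r.1) r := by
    intro i j k n; by_cases hn : n < 0
    . refine ⟨0, fun r => ?_⟩
      have e : ∀ a b d r s u, (x' a r * x' b s * x' d u).coeff n = 0 := fun a b d r s u =>
        hneg (hneg (h0 _ _) (h0 _ _)) (h0 _ _) n hn
      simp only [e, map_zero]; exact ⟨rfl, rfl, rfl, rfl, rfl, rfl⟩
    lift n to ℕ using not_lt.mp hn
    refine ⟨∑ q ∈ T n, AddMonoidAlgebra.single (-(q.1 : ℤ), -(q.2.1 : ℤ), -(q.2.2 : ℤ))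
      (c i q.1 * c j q.2.1 * c k q.2.2), fun r => ?_⟩
    simp only [e3, map_sum, sumL, Finset.sum_apply, act_sgl, Prod.fst_add, Prod.snd_add, <-sub_eq_add_neg]
    have perm : ∀ (f g : ℕ × ℕ × ℕ -> ℕ × ℕ × ℕ) (F F' : ℕ × ℕ × ℕ -> B), (∀ q, g (f q) = q ∧ f (g q) = q ∧
        (f q).1 + (f q).2.1 + (f q).2.2 = q.1 + q.2.1 + q.2.2 ∧ F q = F' (f q)) ->
        ∑ q ∈ T n, F q = ∑ q ∈ T n, F' q := fun f g F F' h =>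
      sum_nbij' f g (fun q hq => hT.mpr ((h q).2.2.1.trans (hT.mp hq)))
        (fun q hq => hT.mpr (by have := (h (g q)).2.2.1; rw [(h q).2.1] at this; exact this ▸ hT.mp hq))
        (fun q _ => (h q).1) (fun q _ => (h q).2.1) fun q _ => (h q).2.2.2
    refine ⟨trivial, perm (fun q => (q.1, q.2.2, q.2.1)) (fun q => (q.1, q.2.2, q.2.1)) _ _ ?_,
      perm (fun q => (q.2.1, q.1, q.2.2)) (fun q => (q.2.1, q.1, q.2.2)) _ _ ?_,
      perm (fun q => (q.2.2, q.1, q.2.1)) (fun q => (q.2.1, q.2.2, q.1)) _ _ ?_,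
      perm (fun q => (q.2.1, q.2.2, q.1)) (fun q => (q.2.2, q.1, q.2.1)) _ _ ?_,
      perm (fun q => (q.2.2, q.2.1, q.1)) (fun q => (q.2.2, q.2.1, q.1)) _ _ ?_⟩
    all_goals exact fun q => ⟨rfl, rfl, by dsimp only; omega, by dsimp only; congr 1; ring⟩
  have words : ∀ (p : Fin 6 -> ℂ[ℤ × ℤ × ℤ]) i j k, wordSum p (x i) (x j) (x k) = 0 ->
      wordSum p (x' i) (x' j) (x' k) = 0 := by
    intro p i j k hw; funext s; ext n; obtain ⟨g, hg⟩ := g3 i j k n; simp only [wordSum, Pi.add_apply, coeff_add]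
    rw [key _ g _ _ n s fun r => (hg r).1, key _ g _ _ n s fun r => (hg r).2.1,
      key _ g _ _ n s fun r => (hg r).2.2.1, key _ g _ _ n s fun r => (hg r).2.2.2.1,
      key _ g _ _ n s fun r => (hg r).2.2.2.2.1, key _ g _ _ n s fun r => (hg r).2.2.2.2.2]
    simp only [<-Pi.add_apply, <-map_add]; exact congrFun ((congrArg (act g) hw).trans (map_zero _)) s
  refine ⟨fun i j => ?_, fun i j hij => words _ _ _ _ (hx.serre i j hij), fun w i hi =>
    words _ _ _ _ (hx.cubic w i hi)⟩
  rw [<-exch_zero]; funext s; ext n; obtain ⟨g, hg⟩ := g2 i j n; simp only [exchDefect, Pi.sub_apply, coeff_sub]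
  rw [key _ g _ _ n s fun r => (hg r).1, key _ g _ _ n s fun r => (hg r).2, <-Pi.sub_apply, <-map_sub]
  exact congrFun ((congrArg (act g) (exch_zero.mpr (hx.quad i j))).trans (map_zero _)) s

end Twisted

end

section

lemma cf_mul_sum' {E : Type*} [Ring E] {a b : HahnSeries ℤ E} {n} (S : Finset ℤ)
    (h : ∀ k, k ∉ S -> a.coeff (n - k) * b.coeff k = 0) :
    (a * b).coeff n = ∑ k ∈ S, a.coeff (n - k) * b.coeff k := by
  rw [cf_mul_sum (S.image fun k => n - k), sum_image]
  . simp
  . simp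
  grind

namespace PreRep

variable {W V : Type*} [ACG W] [Module ℂ W]
  [ACG V] [Module ℂ V]

abbrev endTen (W V : Type*) [ACG W] [Module ℂ W] [ACG V] [Module ℂ V] :
    End ℂ W ⊗[ℂ] End ℂ V →ₐ[ℂ] End ℂ (W ⊗[ℂ] V) :=
  Module.endTensorEndAlgHom (R := ℂ) (S := ℂ) (A := ℂ)

lemma endTen_tmul (f : End ℂ W) (g : End ℂ V) :
    endTen W V (f ⊗ₜ g) = tmap f g := rfl

variable {P1 : PreRep X t O1 (End ℂ W)} {P2 : PreRep X t O2 (End ℂ V)} {w : W} {v : V}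
  {Ψ1 : LWeight X O1} {Ψ2 : LWeight X O2}

lemma cf_copB_zero {i m k} (h : k < m - O1 i) :
    (copB P1 P2 (endTen W V) i m).coeff k = 0 := by
  rw [cf_copB]; dsimp only; rw [P1.phi_n_zero (by omega), zero_tmul, map_zero]

lemma cf_copD_zero {i m k} (h : k < 0) :
    (copD P1 P2 (endTen W V) i m).coeff k = 0 := by
  simp [cf_copD, P2.phi_pos_zero h, tmul_zero, map_zero]

lemma Good.ex_rec (h : P1.Good w Ψ1) (J i) (y : W) : Rec fun m => P1.x J i m y := by
  obtain ⟨d, hd⟩ := h.ex_in_filt y; obtain ⟨p, hp, hk⟩ := h.recurrence d i J; exact ⟨p, hp, in_kill.mp (hk hd)⟩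

lemma zero_of_comm_copX_pos (h₁ : P1.Good w Ψ1) (h₂ : P2.Core v Ψ2)
    {top : V →ₗ[ℂ] ℂ} (hv : top v = 1) {R : HahnSeries ℤ (End ℂ (W ⊗[ℂ] V))}
    (hR : ∀ n z, tmap (LinearMap.id : W →ₗ[ℂ] W) top (R.coeff n z) = 0)
    (hc : ∀ i m, Commute (copX P1 P2 (endTen W V) 1 i m) R) : R = 0 := by
  obtain ⟨e, hα⟩ := exists_bound R
  have hA : ∀ i m n, Commute (endTen W V (P1.x 1 i m ⊗ₜ 1)) (R.coeff n) := by
    intro i m n; rw [Commute, SemiconjBy, <-sub_eq_zero]; refine extL fun z => ?_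
    refine Rec.eq_zero (f := fun m => (endTen W V (P1.x 1 i m ⊗ₜ 1) * R.coeff n -
      R.coeff n * endTen W V (P1.x 1 i m ⊗ₜ 1)) z) (Rec.sub ?_ ?_) (n - e + O1 i) (fun m hm => ?_) m
    . exact Rec.tensor (h₁.ex_rec 1 i) 1 (R.coeff n z)
    . exact (Rec.tensor (h₁.ex_rec 1 i) 1 z).map (R.coeff n)
    . have := congrArg (fun F => F.coeff n) (hc i m).eq
      simp only [copX_pos, add_mul, mul_add, coeff_add, coeff_single_mul, coeff_mul_single, sub_zero] at this
      rw [cf_mul_zero (fun k hk => cf_copB_zero hk) hα (by omega),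
        cf_mul_zero hα (fun k hk => cf_copB_zero hk) (by omega), add_zero, add_zero] at this
      simp_all
  have hB : ∀ i m, Commute (copB P1 P2 (endTen W V) i m) R := by
    intro i m
    have hA' : Commute (single 0 (endTen W V (P1.x 1 i m ⊗ₜ 1))) R := by
      ext n : 2; rw [coeff_single_mul, coeff_mul_single, sub_zero]; exact (hA i m n).eq
    have := (hc i m).sub_left hA'; rwa [copX_pos, add_sub_cancel_left] at this
  have key : ∀ d, ∀ y ∈ P2.filt v d, (∀ i k n w', R.coeff n (w' ⊗ₜ P2.x 1 i k y) = 0) ->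
      ∀ n w', R.coeff n (w' ⊗ₜ y) = 0 := by
    intro d y hd hy n w'; obtain ⟨K, hK⟩ : ∃ K : ℕ, n < e + K := ⟨(n - e).toNat + 1, by omega⟩
    induction K using strong_induction_on generalizing n with
    | _ K ih =>
      by_cases hn : n < e
      . rw [hα n hn, zeroL]
      refine eq_tmul_of_killed (fun a : X.I0 × ℤ => P2.x 1 a.1 a.2) v top hv
        (fun y hy => h₂.nonsing y fun i m => hy (i, m)) (fun ⟨i, k⟩ => ?_) (hR n _)
      have h1 := congrArg (fun F => F.coeff (k + n) (w' ⊗ₜ y)) (hB i (O1 i + k)).eq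
      rw [cf_mul_sum' (Icc e n), cf_mul_sum (Icc e n)] at h1
      . simp only [sumL, mul_apply, cf_copB, endTen_tmul, map_tmul, hy, Finset.sum_const_zero] at h1
        rw [sum_eq_single n] at h1
        . rw [show O1 i + k - (k + n - n) = ℓ O1 (-1) i by simp [leadIdx], add_sub_cancel_right] at h1
          have h2 := congrArg (tmap (P1.inv (-1) i) (LinearMap.id : V →ₗ[ℂ] V)) h1
          rw [map_zero, <-comp_apply, <-map_comp, LinearMap.id_comp] at h2
          have h3 : P1.inv (-1) i ∘ₗ P1.phi (-1) i (ℓ O1 (-1) i) = LinearMap.id := P1.inv_lead (-1) i; rwa [h3] at h2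
        . intro k' hk' hne; rw [mem_Icc] at hk'
          rw [ih ((k' - e).toNat + 1) (by omega) k' (by omega), map_zero]
        . intro hn'; exact absurd (Finset.mem_Icc.mpr ⟨not_lt.mp hn, le_refl n⟩) hn'
      . intro k' hk'; rw [mem_Icc, not_and_or] at hk'; by_cases hk : k' < e
        . rw [hα _ hk, zero_mul]
        . rw [cf_copB_zero (by omega), mul_zero]
      . intro k' hk'; rw [mem_Icc, not_and_or] at hk'; by_cases hk : k' < e
        . rw [hα _ hk, mul_zero]
        . rw [cf_copB_zero (by omega), zero_mul]
  have key' : ∀ d, ∀ y ∈ P2.filt v d, ∀ n w', R.coeff n (w' ⊗ₜ y) = 0 := by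
    intro d; induction d with
    | zero =>
      intro y hy; refine key 0 y hy fun i k n w' => ?_
      rw [h₂.raise_filt_zero hy, tmul_zero, map_zero]
    | succ d ih => exact fun y hy => key _ y hy fun i k => ih _ (P2.raise_in_filt h₂.raise h₂.phi_mem hy i k)
  ext n : 2; refine ext' fun w' y => ?_
  obtain ⟨d, hd⟩ := h₂.ex_in_filt y; exact key' d y hd n w'

lemma zero_of_comm_copX_neg (h₁ : P1.Good w Ψ1) (h2 : P2.Highest v Ψ2)
    {R : HahnSeries ℤ (End ℂ (W ⊗[ℂ] V))} (hR : ∀ n, R.coeff n (w ⊗ₜ v) = 0)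
    (hc : ∀ i m, Commute (copX P1 P2 (endTen W V) (-1) i m) R) : R = 0 := by
  obtain ⟨a, hα⟩ := exists_bound R
  have e1 : ∀ i m n, (copD P1 P2 (endTen W V) i m * R).coeff n = ∑ k ∈ Icc 0 (n - a),
      endTen W V (P1.x (-1) i (m - k) ⊗ₜ P2.phi 1 i k) * R.coeff (n - k) := by
    intro i m n; rw [cf_mul_sum (Icc 0 (n - a)), cf_copD]; intro k hk; rw [mem_Icc, not_and_or] at hk; by_cases h : k < 0
    . rw [cf_copD_zero h, zero_mul]
    . rw [hα _ (by omega), mul_zero]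
  have e2 : ∀ i m n, (R * copD P1 P2 (endTen W V) i m).coeff n = ∑ k ∈ Icc 0 (n - a),
      R.coeff (n - k) * endTen W V (P1.x (-1) i (m - k) ⊗ₜ P2.phi 1 i k) := by
    intro i m n; rw [cf_mul_sum' (Icc 0 (n - a)), cf_copD]; intro k hk; rw [mem_Icc, not_and_or] at hk; by_cases h : k < 0
    . rw [cf_copD_zero h, mul_zero]
    . rw [hα _ (by omega), zero_mul]
  have hD : ∀ i m, Commute (copD P1 P2 (endTen W V) i m) R := by
    intro i m; rw [Commute, SemiconjBy, <-sub_eq_zero]; ext n : 2; refine extL fun z => ?_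
    refine Rec.eq_zero (f := fun m => (copD P1 P2 (endTen W V) i m * R -
      R * copD P1 P2 (endTen W V) i m).coeff n z) ?_ (n - a) (fun m hm => ?_) m
    . simp only [coeff_sub, e1, e2, subL, sumL, mul_apply, endTen_tmul]
      have hs : ∀ k z, Rec fun m => tmap (P1.x (-1) i (m - k)) (P2.phi 1 i k) z := by
        intro k z; have := (Rec.tensor (h₁.ex_rec (-1) i) (P2.phi 1 i k) z).shift (-k); grind
      exact (Rec.sum _ fun k => hs k _).sub (Rec.sum _ fun k => (hs k z).map (R.coeff (n - k)))
    . have := congrArg (fun F => F.coeff n) (hc i m).eq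
      simp only [copX_neg, add_mul, mul_add, coeff_add, coeff_single_mul, coeff_mul_single] at this
      rw [hα _ (by omega), zero_mul, mul_zero, zero_add, zero_add] at this; rw [coeff_sub, this, sub_self, zeroL]
  have hC : ∀ i m n z, endTen W V (1 ⊗ₜ P2.x (-1) i m) (R.coeff n z) = R.coeff n (endTen W V (1 ⊗ₜ P2.x (-1) i m) z) := by
    intro i m n z; have h1 := (hc i m).sub_left (hD i m); rw [copX_neg, add_sub_cancel_right] at h1
    have := congrArg (fun F => F.coeff (n + m) z) h1.eq
    simp only [coeff_single_mul, coeff_mul_single, add_sub_cancel_right] at this; exact this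
  have k1 : ∀ w' n, R.coeff n (w' ⊗ₜ v) = 0 := by
    let Z : Submodule ℂ W := ⨅ n, ker (R.coeff n ∘ₗ (TensorProduct.mk ℂ W V).flip v)
    have hZ : ∀ w', w' ∈ Z ↔ ∀ n, R.coeff n (w' ⊗ₜ v) = 0 := fun w' => by simp [Z]
    have : (⊤ : Submodule ℂ W) ≤ Z := by
      rw [<-h₁.gen]; refine P1.iSup_filt_le ((hZ w).mpr hR) fun i m w' hw' => ?_
      rw [hZ] at hw' ⊢
      suffices h : ∀ n m, R.coeff n (P1.x (-1) i m w' ⊗ₜ v) = 0 from fun n => h n m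
      intro n; obtain ⟨K, hK⟩ : ∃ K : ℕ, n < a + K := ⟨(n - a).toNat + 1, by omega⟩
      induction K using strong_induction_on generalizing n with
      | _ K ih =>
        intro m; by_cases hn : n < a
        . rw [hα n hn, zeroL]
        have h1 := congrArg (fun F => F.coeff n (w' ⊗ₜ v)) (hD i m).eq
        simp only [e1, e2, sumL, mul_apply, hw', map_zero, Finset.sum_const_zero, endTen_tmul, map_tmul, h2.phi, tmul_smul, map_smul] at h1
        rw [sum_eq_single 0] at h1
        . rw [sub_zero, sub_zero] at h1; have h3 := Ψ2.lead_ne 1 i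
          rw [show ℓ O2 1 i = 0 by simp [leadIdx]] at h3; exact (smul_eq_zero.mp h1.symm).resolve_left h3
        . intro k hk hk0; rw [mem_Icc] at hk
          rw [ih ((n - k - a).toNat + 1) (by omega) (n - k) (by omega), smul_zero]
        . intro h0; exact absurd (Finset.mem_Icc.mpr ⟨le_refl 0, by omega⟩) h0
    exact fun w' => (hZ w').mp (this mem_top)
  ext n : 2; refine ext' fun w' y => ?_
  have : (⊤ : Submodule ℂ V) ≤ ker (R.coeff n ∘ₗ TensorProduct.mk ℂ W V w') := by
    rw [<-h2.gen]; refine P2.iSup_filt_le (k1 w' n) fun i m y hy => ?_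
    have := hC i m n (w' ⊗ₜ y); simp only [mem_ker, comp_apply, TensorProduct.mk_apply] at hy ⊢
    rw [hy, map_zero, endTen_tmul, map_tmul] at this; exact this.symm
  exact this (mem_top (x := y))

lemma cf_mul_zero' {M : Type*} [ACG M] [Module ℂ M] {z : M}
    {R S : HahnSeries ℤ (End ℂ M)} (h : ∀ n, S.coeff n z = 0) (n) : (R * S).coeff n z = 0 := by
  simp [HahnSeries.coeff_mul, sumL, mul_apply, h, map_zero]

lemma copX_pos_top (h1 : P1.Highest w Ψ1) (h2 : P2.Highest v Ψ2) (i m n) :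
    (copX P1 P2 (endTen W V) 1 i m).coeff n (w ⊗ₜ v) = 0 := by
  rw [cf_copX, copXCf, if_pos rfl, addL, endTen_tmul (P1.phi _ _ _), map_tmul, h2.raise, tmul_zero, add_zero]; split_ifs
  . rw [endTen_tmul, map_tmul, h1.raise, zero_tmul]
  . rfl

def Projects (top : V →ₗ[ℂ] ℂ) (R : HahnSeries ℤ (End ℂ (W ⊗[ℂ] V)))
    (R' : HahnSeries ℤ (End ℂ W)) : Prop :=
  ∀ n z, tmap (LinearMap.id : W →ₗ[ℂ] W) top (R.coeff n z) =
    tmap (R'.coeff n) (LinearMap.id : ℂ →ₗ[ℂ] ℂ) (tmap (LinearMap.id : W →ₗ[ℂ] W) top z)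

lemma Projects.mul {top : V →ₗ[ℂ] ℂ} {R S : HahnSeries ℤ (End ℂ (W ⊗[ℂ] V))}
    {R' S' : HahnSeries ℤ (End ℂ W)} (h : Projects top R R') (h' : Projects top S S') :
    Projects top (R * S) (R' * S') := by
  intro n z; obtain ⟨a, ha⟩ := exists_bound R; obtain ⟨a', ha'⟩ := exists_bound R'
  obtain ⟨b, hb⟩ := exists_bound S; obtain ⟨b', hb'⟩ := exists_bound S'
  have e : ∀ k, k ∉ Icc (min a a') (n - min b b') -> (k < min a a' ∨ n - k < min b b') := fun k hk => by
    grind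
  rw [cf_mul_sum (Icc (min a a') (n - min b b')), cf_mul_sum (Icc (min a a') (n - min b b')), sumL, map_sum]
  . have : ∀ (S : Finset ℤ) (F : ℤ -> End ℂ W) (z : W ⊗[ℂ] ℂ), tmap (∑ k ∈ S, F k) (LinearMap.id : ℂ →ₗ[ℂ] ℂ) z =
          ∑ k ∈ S, tmap (F k) (LinearMap.id : ℂ →ₗ[ℂ] ℂ) z := fun S F z => by
      change TensorProduct.mapBilinear (RingHom.id ℂ) W ℂ W ℂ _ _ z = _; simp
    rw [this]; refine sum_congr rfl fun k _ => ?_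
    rw [mul_apply, h, h', <-comp_apply (tmap _ _), <-map_comp]; rfl
  . intro k hk; rcases e k hk with h | h
    . simp_all
    simp_all
  . intro k hk; rcases e k hk with h | h
    . simp_all
    simp_all

lemma cop_compl (h1 : P1.Good w Ψ1) (h2 : P2.Core v Ψ2) (ht : t ≠ 0) (d) :
    (cop P1 P2 (endTen W V)).Complete d := by
  rcases units_eq_one_or d with rfl | rfl
  . let L : HahnSeries ℤ (End ℂ (W ⊗[ℂ] V)) →ₗ[ℂ] ℤ -> W ⊗[ℂ] V :=
      { toFun := fun R n => R.coeff n (w ⊗ₜ v)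
        map_add' := fun _ _ => rfl
        map_smul' := fun c R => by
          rfl }
    have h0 : ∀ i m n, ((cop P1 P2 (endTen W V)).x 1 i m).coeff n (w ⊗ₜ v) = 0 := copX_pos_top h1.toHighest h2.toHighest
    exact PreRep.compl_of L (0 : ℂ →ₗ[ℂ] _) _ ht 1 (RelFam.zero (B := ℂ) 1)
      (fun i j r s => funext fun n => cf_mul_zero' (h0 j s) n)
      (fun i j k r s u => funext fun n => cf_mul_zero' (h0 k u) n)
      fun R hR hc => zero_of_comm_copX_neg h1 h2.toHighest (fun n => congrFun hR n) hc
  . obtain ⟨top, hv, htop, hphi⟩ := h2.exists_top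
    let L : HahnSeries ℤ (End ℂ (W ⊗[ℂ] V)) →ₗ[ℂ] ℤ -> W ⊗[ℂ] V -> W ⊗[ℂ] ℂ :=
      { toFun := fun R n z => tmap (LinearMap.id : W →ₗ[ℂ] W) top (R.coeff n z)
        map_add' := fun R S => by funext n z; simp
        map_smul' := fun c R => by
          funext n z; simp }
    let L' : HahnSeries ℤ (End ℂ W) →ₗ[ℂ] ℤ -> W ⊗[ℂ] V -> W ⊗[ℂ] ℂ :=
      { toFun := fun R n z => tmap (R.coeff n) (LinearMap.id : ℂ →ₗ[ℂ] ℂ)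
          (tmap (LinearMap.id : W →ₗ[ℂ] W) top z)
        map_add' := fun R S => by funext n z; rw [coeff_add, TensorProduct.map_add_left]; rfl
        map_smul' := fun c R => by
          funext n z; rw [coeff_smul, TensorProduct.map_smul_left]; rfl }
    let x' : X.I0 -> ℤ -> HahnSeries ℤ (End ℂ W) := fun i m =>
      toHahn fun n => Ψ2.psi 1 i n • P1.x (-1) i (m - n)
    have hx' : ∀ i m, (x' i m).coeff = fun n => Ψ2.psi 1 i n • P1.x (-1) i (m - n) := fun i m =>
      cf_toHahn 0 fun n hn => by rw [Ψ2.van 1 i n (by simpa [leadIdx] using hn), zero_smul]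
    have hrel : RelFam X t (-1) x' := (h1.rel (-1)).scale (fun i k => Ψ2.psi 1 i k)
      (fun i m k hk => by
        rw [hx']; dsimp only; rw [Ψ2.van 1 i k (by simpa [leadIdx] using hk), zero_smul])
      (fun i m k => by rw [hx'])
    have hp : ∀ i m, Projects top ((cop P1 P2 (endTen W V)).x (-1) i m) (x' i m) := by
      intro i m n z; change tmap _ top ((copX P1 P2 (endTen W V) (-1) i m).coeff n z) = _
      rw [hx', cf_copX, copXCf, if_neg (by decide), addL]; induction z using TensorProduct.induction_on with
      | zero => simp
      | add z z' hz hz' =>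
        simp only [map_add] at hz hz' ⊢; rw [<-hz, <-hz']; abel
      | tmul w' y =>
        have : tmap (LinearMap.id : W →ₗ[ℂ] W) top
            ((if n = m then endTen W V (1 ⊗ₜ P2.x (-1) i m) else 0) (w' ⊗ₜ y)) = 0 := by
          split_ifs
          . simp [endTen_tmul, map_tmul, htop, tmul_zero]
          rfl
        rw [map_add, this, zero_add, endTen_tmul]; simp only [map_tmul, LinearMap.id_apply, hphi, smulL]
        rw [<-smul_eq_mul, tmul_smul, smul_tmul']
    exact PreRep.compl_of L L' _ ht (-1) hrel
      (fun i j r s => funext fun n => funext fun z => (hp i r).mul (hp j s) n z)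
      (fun i j k r s u => funext fun n => funext fun z => ((hp i r).mul (hp j s)).mul (hp k u) n z)
      fun R hR hc => zero_of_comm_copX_pos h1 h2 hv (fun n z => congrFun (congrFun hR n) z)
        (by rw [neg_neg] at hc; exact hc)

end PreRep

end

section

section HahnAct

lemma cf_smul_sum {R V : Type*} [Zero R] [AddCommMonoid V] [SMulWithZero R V] (x : HahnSeries ℤ R)
    (y : HahnModule ℤ R V) (n) (S : Finset ℤ)
    (h : ∀ k, k ∉ S -> x.coeff k • ((HahnModule.of R).symm y).coeff (n - k) = 0) :
    ((HahnModule.of R).symm (x • y)).coeff n = ∑ k ∈ S, x.coeff k • ((HahnModule.of R).symm y).coeff (n - k) := by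
  rw [HahnModule.coeff_smul]; have hb : ∀ p : ℤ × ℤ, p.1 + p.2 = n -> p.2 = n - p.1 := fun p hp => by omega
  have hm : ∀ p : ℤ × ℤ, p.1 + p.2 = n ↔ p.1 +ᵥ p.2 = n := fun p => Iff.rfl
  refine Finset.sum_bij_ne_zero (fun p _ _ => p.1) ?_ ?_ ?_ ?_
  . intro p hp h0; by_contra hS; refine h0 ?_; rw [hb p ((mem_vaddAntidiagonal _ _).mp hp).2.2]; exact h _ hS
  . intro p hp _ p' hp' _ h1; have e1 := hb p ((mem_vaddAntidiagonal _ _).mp hp).2.2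
    have e2 := hb p' ((mem_vaddAntidiagonal _ _).mp hp').2.2; exact Prod.ext h1 (by omega)
  . intro k _ h0
    refine ⟨(k, n - k), (mem_vaddAntidiagonal _ _).mpr ⟨fun h1 => h0 ?_, fun h1 => h0 ?_,
      (hm (k, n - k)).mp (by dsimp only; omega)⟩, h0, rfl⟩
    . rw [h1, zero_smul]
    . rw [h1, smul_zero]
  . intro p hp _; rw [<-hb p ((mem_vaddAntidiagonal _ _).mp hp).2.2]

variable {M : Type*} [ACG M] [Module ℂ M]

/-- The coefficients of a Laurent series with coefficients in `M`. -/
abbrev lc (f : HM M) (n : ℤ) : M := ((hof).symm f).coeff n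

lemma lc_ext {f g : HM M} (h : ∀ n, lc f n = lc g n) : f = g := HahnModule.ext f g (funext h)

lemma lc_csmul (c : ℂ) (f : HM M) (n : ℤ) : lc (c • f) n = c • lc f n := rfl

lemma ex_lc_bound (f : HM M) : ∃ a, ∀ k < a, lc f k = 0 := exists_bound _

def hahnAct : HahnSeries ℤ (End ℂ M) →ₐ[ℂ] End ℂ (HM M) where
  toFun R :=
    { toFun := fun f => hof ((HahnModule.of (End ℂ M)).symm
        (R • HahnModule.of (End ℂ M) ((hof).symm f)))
      map_add' := fun f g => smul_add R (HahnModule.of (End ℂ M) ((hof).symm f))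
        (HahnModule.of (End ℂ M) ((hof).symm g))
      map_smul' := fun c f => by
        refine lc_ext fun n => ?_
        change ((HahnModule.of (End ℂ M)).symm (R • HahnModule.of (End ℂ M)
          ((hof).symm (c • f)))).coeff n = c • ((HahnModule.of (End ℂ M)).symm
            (R • HahnModule.of (End ℂ M) ((hof).symm f))).coeff n
        obtain ⟨a, ha⟩ := exists_bound R; obtain ⟨b, hb⟩ := ex_lc_bound f
        have h : ∀ k, k ∉ Icc a (n - b) -> k < a ∨ n - k < b := fun k hk => by rw [mem_Icc, not_and_or] at hk; omega
        rw [cf_smul_sum _ _ _ (Icc a (n - b)), cf_smul_sum _ _ _ (Icc a (n - b)), smul_sum]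
        . exact sum_congr rfl fun k _ => map_smul (R.coeff k) c _
        . intro k hk; rcases h k hk with h | h
          . rw [ha k h, zero_smul]
          . change R.coeff k • lc f (n - k) = 0; rw [hb _ h, smul_zero]
        . intro k hk; rcases h k hk with h | h
          . rw [ha k h, zero_smul]
          . change R.coeff k • (c • lc f (n - k)) = 0; rw [hb _ h, smul_zero, smul_zero] }
  map_one' := extL fun f => one_smul (HahnSeries ℤ (End ℂ M)) (HahnModule.of (End ℂ M) ((hof).symm f))
  map_mul' R S := extL fun f =>
    mul_smul R S (HahnModule.of (End ℂ M) ((hof).symm f))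
  map_zero' := extL fun f => zero_smul (HahnSeries ℤ (End ℂ M)) (HahnModule.of (End ℂ M) ((hof).symm f))
  map_add' R S := extL fun f =>
    add_smul R S (HahnModule.of (End ℂ M) ((hof).symm f))
  commutes' c := extL fun f => lc_ext fun n => by
    change ((HahnModule.of (End ℂ M)).symm
      (aM ℂ (HahnSeries ℤ (End ℂ M)) c • _)).coeff n = c • lc f n
    rw [HahnSeries.algebraMap_apply, cf_smul_sum _ _ _ {0}]
    . rw [sum_singleton, C_apply, coeff_single_same, sub_zero]; rfl
    . intro k hk; rw [C_apply, coeff_single_of_ne (by simpa using hk), zero_smul]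

lemma lc_hact (R : HahnSeries ℤ (End ℂ M)) (f : HM M) (n) (S : Finset ℤ)
    (h : ∀ k, k ∉ S -> R.coeff k (lc f (n - k)) = 0) :
    lc (hahnAct R f) n = ∑ k ∈ S, R.coeff k (lc f (n - k)) :=
  cf_smul_sum R (HahnModule.of (End ℂ M) ((hof).symm f)) n S h

lemma lc_smul (c : LS) (f : HM M) (n) (S : Finset ℤ)
    (h : ∀ k, k ∉ S -> c.coeff k • (lc f (n - k)) = 0) :
    lc (c • f) n = ∑ k ∈ S, c.coeff k • (lc f (n - k)) :=
  cf_smul_sum c f n S h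

lemma lc_sgl_smul (k c) (f : HM M) (n) :
    lc ((single k c : LS) • f) n = c • lc f (n - k) := by
  rw [lc_smul _ _ _ {k}, sum_singleton, coeff_single_same]; intro j hj; rw [coeff_single_of_ne (by simpa using hj), zero_smul]

lemma lc_hact_sgl (k) (g : End ℂ M) (f : HM M) (n) :
    lc (hahnAct (single k g) f) n = g (lc f (n - k)) := by
  rw [lc_hact _ _ _ {k}, sum_singleton, coeff_single_same]; intro j hj; rw [coeff_single_of_ne (by simpa using hj), zeroL]

lemma sgl_smul_eq (k c) (f : HM M) :
    (single k c : LS) • f = hahnAct (single k (c • 1)) f :=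
  lc_ext fun n => by rw [lc_sgl_smul, lc_hact_sgl]; rfl

lemma hact_zero {R : HahnSeries ℤ (End ℂ M)} {f : HM M}
    (h : ∀ k n, R.coeff k (lc f n) = 0) : hahnAct R f = 0 :=
  lc_ext fun n => by rw [lc_hact _ _ _ ∅ fun k _ => h k _, sum_empty]; rfl

lemma hact_smul (R : HahnSeries ℤ (End ℂ M)) (c : LS) (f : HM M) :
    hahnAct R (c • f) = c • hahnAct R f := by
  obtain ⟨a, ha⟩ := exists_bound R; obtain ⟨b, hb⟩ := exists_bound c; obtain ⟨d, hd⟩ := ex_lc_bound f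
  have h1 : ∀ n, ∀ S : Finset ℤ, Icc b (n - d) ⊆ S -> lc (c • f) n = ∑ k ∈ S, c.coeff k • lc f (n - k) := by
    intro n S hS; refine lc_smul _ _ _ _ fun k hk => ?_
    have := mt (@hS k) hk; rw [mem_Icc, not_and_or] at this; by_cases hk : k < b
    . rw [hb _ hk, zero_smul]
    . rw [hd _ (by omega), smul_zero]
  have h2 : ∀ n, ∀ S : Finset ℤ, Icc a (n - d) ⊆ S -> lc (hahnAct R f) n = ∑ k ∈ S, R.coeff k (lc f (n - k)) := by
    intro n S hS; refine lc_hact _ _ _ _ fun k hk => ?_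
    have := mt (@hS k) hk; rw [mem_Icc, not_and_or] at this; by_cases hk : k < a
    . rw [ha _ hk, zeroL]
    . rw [hd _ (by omega), map_zero]
  have h1' : ∀ n < b + d, lc (c • f) n = 0 := fun n hn => by rw [h1 n (Icc b (n - d)) subset_rfl, Finset.Icc_eq_empty (by omega), sum_empty]
  have h2' : ∀ n < a + d, lc (hahnAct R f) n = 0 := fun n hn => by
    rw [h2 n (Icc a (n - d)) subset_rfl, Finset.Icc_eq_empty (by omega), sum_empty]
  refine lc_ext fun n => ?_
  rw [lc_hact _ _ _ (Icc a (n - d - b)), lc_smul _ _ _ (Icc b (n - d - a))]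
  . rw [sum_congr rfl fun k hk => by
      rw [h1 (n - k) (Icc b (n - d - a)) (Finset.Icc_subset_Icc le_rfl (by
        have := Finset.mem_Icc.mp hk; omega)), map_sum],
      sum_congr rfl (s₁ := Icc b (n - d - a)) fun k hk => by
      rw [h2 (n - k) (Icc a (n - d - b)) (Finset.Icc_subset_Icc le_rfl (by
        have := Finset.mem_Icc.mp hk; omega)), smul_sum]]
    rw [sum_comm]; refine sum_congr rfl fun j _ => sum_congr rfl fun k _ => ?_
    rw [map_smul, show n - k - j = n - j - k by ring]
  . intro k hk; rw [mem_Icc, not_and_or] at hk; by_cases h : k < b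
    . rw [hb _ h, zero_smul]
    . rw [h2' _ (by omega), smul_zero]
  . intro k hk; rw [mem_Icc, not_and_or] at hk; by_cases h : k < a
    . rw [ha _ h, zeroL]
    . rw [h1' _ (by omega), map_zero]

instance laurentSeries_smulCommClass : SMulCommClass (LS) ℂ (HM M) := SMulCommClass.symm _ _ _

/-- A linear functional applied to the coefficients. -/
def lfun (T : M →ₗ[ℂ] ℂ) (f : HM M) : LS := HahnSeries.map ((hof).symm f) T

lemma cf_lfun (T : M →ₗ[ℂ] ℂ) (f : HM M) (n) : (lfun T f).coeff n = T (lc f n) := rfl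

lemma lfun_add (T : M →ₗ[ℂ] ℂ) (f g : HM M) : lfun T (f + g) = lfun T f + lfun T g := by
  ext n; rw [coeff_add, cf_lfun, cf_lfun, cf_lfun, <-map_add]; rfl

lemma lfun_smul (T : M →ₗ[ℂ] ℂ) (c : LS) (f : HM M) :
    lfun T (c • f) = c * lfun T f := by
  obtain ⟨b, hb⟩ := exists_bound c; obtain ⟨d, hd⟩ := ex_lc_bound f; ext n
  have h : ∀ k, k ∉ Icc b (n - d) -> k < b ∨ n - k < d := fun k hk => by rw [mem_Icc, not_and_or] at hk; omega
  rw [cf_lfun, lc_smul _ _ _ (Icc b (n - d)), cf_mul_sum (Icc b (n - d)), map_sum]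
  . exact sum_congr rfl fun k _ => by rw [map_smul, cf_lfun, smul_eq_mul]
  . intro k hk; rcases h k hk with h | h
    . rw [hb _ h, zero_mul]
    . rw [cf_lfun, hd _ h, map_zero, mul_zero]
  . intro k hk; rcases h k hk with h | h
    . rw [hb _ h, zero_smul]
    . rw [hd _ h, smul_zero]

end HahnAct

end

section

namespace PreRep

section Hull

variable {V : Type*} [ACG V] [Module ℂ V]
  (P : PreRep X t O (End ℂ V)) (S : Submodule ℂ V)

def hull : Submodule ℂ V := sInf {Z | S ≤ Z ∧ ∀ i m, ∀ y ∈ Z, P.x (-1) i m y ∈ Z}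

lemma le_hull : S ≤ P.hull S := le_sInf fun _ h => h.1

lemma low_in_hull (i m) {y : V} (hy : y ∈ P.hull S) : P.x (-1) i m y ∈ P.hull S := by
  rw [hull, Submodule.mem_sInf] at hy ⊢; grind

variable {S}

lemma hull_le {Z : Submodule ℂ V} (h0 : S ≤ Z) (h1 : ∀ i m, ∀ y ∈ Z, P.x (-1) i m y ∈ Z) :
    P.hull S ≤ Z := sInf_le ⟨h0, h1⟩

lemma phi_in_hull (hS : ∀ J i r, ∀ y ∈ S, P.phi J i r y ∈ S) (J i r) {y : V}
    (hy : y ∈ P.hull S) : P.phi J i r y ∈ P.hull S := by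
  suffices h : P.hull S ≤ ⨅ r, (P.hull S).comap (P.phi J i r) from (mem_iInf _).mp (h hy) r
  refine P.hull_le (le_iInf fun r y hy => P.le_hull S (hS _ _ _ _ hy)) fun j m y hy => ?_
  rw [mem_iInf] at hy ⊢; intro r; rw [mem_comap]; rcases P.phi_cases J i r with ⟨k, rfl⟩ | h
  . rw [phi_x']; exact Submodule.sum_mem _ fun p _ => smul_mem _ _ (P.low_in_hull S _ _ (hy _))
  simp_all

lemma inv_in_hull (ht : t ≠ 0) (hS : ∀ J i, ∀ y ∈ S, P.inv J i y ∈ S) (J i) {y : V}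
    (hy : y ∈ P.hull S) : P.inv J i y ∈ P.hull S := by
  suffices h : P.hull S ≤ (P.hull S).comap (P.inv J i) from h hy
  refine P.hull_le (fun y hy => P.le_hull S (hS _ _ _ hy)) fun j m y hy => ?_
  have h1 : ∀ z, P.phi J i (ℓ O J i) (P.inv J i z) = z := congrL (P.lead_inv J i)
  have h2 : ∀ z, P.inv J i (P.phi J i (ℓ O J i) z) = z := congrL (P.inv_lead J i)
  have h3 := congrArg (P.inv J i) (P.lead_x ht J (-1) i j m (P.inv J i y)); rw [h1, h2, map_smul] at h3
  have hc : (t ^ 2) ^ (J * ((-1 : ℤˣ) : ℤ) * X.symCartan i j) ≠ 0 := zpow_ne_zero _ (pow_ne_zero 2 ht)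
  rw [mem_comap]; refine (smul_mem_iff _ hc).mp ?_; rw [<-h3]; exact P.low_in_hull S _ _ hy

lemma raise_in_hull (hr : ∀ i m, ∀ y ∈ S, P.x 1 i m y = 0) (hS : ∀ J i r, ∀ y ∈ S, P.phi J i r y ∈ S)
    (i m) {y : V} (hy : y ∈ P.hull S) : P.x 1 i m y ∈ P.hull S := by
  suffices h : P.hull S ≤ P.hull S ⊓ (P.hull S).comap (P.x 1 i m) from (h hy).2
  refine P.hull_le (fun y hy => ⟨P.le_hull S hy, ?_⟩) fun j s y hy => ⟨P.low_in_hull S _ _ hy.1, ?_⟩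
  . simp_all
  . obtain ⟨c, hc⟩ := P.x_x_apply i j m s y; rw [mem_coe, mem_comap, hc]
    exact add_mem (P.low_in_hull S _ _ hy.2) (smul_mem _ _
      (sub_mem (P.phi_in_hull hS _ _ _ hy.1) (P.phi_in_hull hS _ _ _ hy.1)))

end Hull

end PreRep

namespace LWeight

variable (Ψ1 : LWeight X O1) (Ψ2 : LWeight X O2)

lemma mul_eq_zero {J i m n}
    (hn : n ∉ uIcc (ℓ O2 J i) (m - ℓ O1 J i)) : Ψ1.psi J i (m - n) * Ψ2.psi J i n = 0 := by
  by_cases h : J * (n - ℓ O2 J i) < 0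
  . rw [Ψ2.van _ _ _ h, mul_zero]
  . rw [Ψ1.van, zero_mul]; rw [Finset.mem_uIcc, not_and_or] at hn
    rcases units_eq_one_or J with rfl | rfl <;> simp at h hn ⊢ <;> omega

def mul : LWeight X (O1 + O2) where
  psi J i m := ∑ n ∈ uIcc (ℓ O2 J i) (m - ℓ O1 J i), Ψ1.psi J i (m - n) * Ψ2.psi J i n
  dvd J i r hr := sum_eq_zero fun n _ => by
    by_cases h : (X.N i : ℤ) ∣ n
    . rw [Ψ1.dvd _ _ _ fun h' => hr ((dvd_sub_left h).mp h'), zero_mul]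
    . rw [Ψ2.dvd _ _ _ h, mul_zero]
  van J i r hr := sum_eq_zero fun n _ => by
    rw [PreRep.ldIdx_add] at hr; by_cases h : J * (n - ℓ O2 J i) < 0
    . rw [Ψ2.van _ _ _ h, mul_zero]
    . rw [Ψ1.van, zero_mul]; grind
  lead_ne J i := by
    rw [PreRep.ldIdx_add, add_sub_cancel_left, Finset.uIcc_self, sum_singleton, add_sub_cancel_right]
    exact mul_ne_zero (Ψ1.lead_ne _ _) (Ψ2.lead_ne _ _)

lemma mul_psi {J i m} (S : Finset ℤ)
    (hS : ∀ n, n ∉ S -> Ψ1.psi J i (m - n) * Ψ2.psi J i n = 0) :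
    (Ψ1.mul Ψ2).psi J i m = ∑ n ∈ S, Ψ1.psi J i (m - n) * Ψ2.psi J i n := by
  rw [mul]
  have e : ∀ S' : Finset ℤ, (∀ n, n ∉ S' -> Ψ1.psi J i (m - n) * Ψ2.psi J i n = 0) ->
      ∑ n ∈ S', Ψ1.psi J i (m - n) * Ψ2.psi J i n = ∑ᶠ n, Ψ1.psi J i (m - n) * Ψ2.psi J i n := fun S' h =>
    (finsum_eq_sum_of_support_subset _ fun n hn => by_contra fun h' => hn (h n h')).symm
  rw [e _ hS, <-e _ fun n => Ψ1.mul_eq_zero Ψ2]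

end LWeight

section Quotients

variable {U M : Type*} [Ring U] [Algebra ℂ U] [ACG M] [Module ℂ M]
  (ρ : U →ₐ[ℂ] End ℂ M) (Z : Submodule ℂ M) (hZ : ∀ a, ∀ z ∈ Z, ρ a z ∈ Z)

/-- The restriction of an action to a stable subspace. -/
def resAct : U →ₐ[ℂ] End ℂ Z where
  toFun a := (ρ a).restrict (hZ a)
  map_one' := extL fun z => Subtype.ext (by simp)
  map_mul' a b := extL fun z => Subtype.ext (by simp)
  map_zero' := extL fun z => Subtype.ext (by simp)
  map_add' a b := extL fun z => Subtype.ext (by simp)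
  commutes' c := extL fun z => Subtype.ext (by simp)

variable {Z' : Type*} [ACG Z'] [Module ℂ Z'] (ρ' : U →ₐ[ℂ] End ℂ Z') (N : Submodule ℂ Z')
  (hN : ∀ a, ∀ z ∈ N, ρ' a z ∈ N)

/-- The action on the quotient by a stable subspace. -/
def quotAct : U →ₐ[ℂ] End ℂ (Z' ⧸ N) where
  toFun a := N.mapQ N (ρ' a) (hN a)
  map_one' := linearMap_qext _ (extL fun z => by simp)
  map_mul' a b := linearMap_qext _ (extL fun z => by simp)
  map_zero' := linearMap_qext _ (extL fun z => by simp)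
  map_add' a b := linearMap_qext _ (extL fun z => by simp)
  commutes' c := linearMap_qext _ (extL fun z => by simp)

variable {δ : ℤˣ} {g : X.I0 -> ℤ -> U}

lemma RelFam.restrict (h : RelFam X t δ fun i m => ρ (g i m)) :
    RelFam X t δ fun i m => resAct ρ Z hZ (g i m) :=
  h.of_words (compRight ℂ Z.subtype) (lcomp ℂ M Z.subtype)
    (fun _ hb => extL fun z => Subtype.ext (congrL hb z))
    (fun _ _ _ _ => rfl) (fun _ _ _ _ _ _ => rfl)

lemma RelFam.quot (h : RelFam X t δ fun i m => ρ' (g i m)) :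
    RelFam X t δ fun i m => quotAct ρ' N hN (g i m) :=
  h.of_words (lcomp ℂ _ N.mkQ) (compRight ℂ N.mkQ)
    (fun b hb => extL fun z => by
      obtain ⟨z, rfl⟩ := N.mkQ_surjective z; exact congrL hb z)
    (fun _ _ _ _ => rfl) (fun _ _ _ _ _ _ => rfl)

end Quotients

section RegularAtOne

/-- The rational functions that are regular at `1`. -/
def regOne : Subalgebra ℂ (RF) where
  carrier := {f | f.denom.eval 1 ≠ 0}
  mul_mem' {f g} hf hg := by
    rw [mem_ofPred_eq] at hf hg ⊢; refine fun h => mul_ne_zero hf hg ?_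
    rw [<-eval_mul]; exact eval_eq_zero_of_dvd_of_eval_eq_zero (RatFunc.denom_mul_dvd f g) h
  add_mem' {f g} hf hg := by
    rw [mem_ofPred_eq] at hf hg ⊢; refine fun h => mul_ne_zero hf hg ?_
    rw [<-eval_mul]; exact eval_eq_zero_of_dvd_of_eval_eq_zero (RatFunc.denom_add_dvd f g) h
  algebraMap_mem' c := by simp

lemma div_in_regOne (p : Polynomial ℂ) {q : Polynomial ℂ} (hq : q.eval 1 ≠ 0) :
    aM _ (RF) p / aM _ (RF) q ∈ regOne := fun h =>
  hq (eval_eq_zero_of_dvd_of_eval_eq_zero (RatFunc.denom_div_dvd p q) h)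

lemma ex_eq_add_of_regOne {f} (hf : f ∈ regOne) :
    ∃ c, ∃ g ∈ regOne, f = RC c + (Rx - 1) * g := by
  have hd : aM _ (RF) f.denom ≠ 0 := by simpa using denom_ne_zero f
  have h1 : (f.num - pC (f.num.eval 1 / f.denom.eval 1) * f.denom).IsRoot 1 := by
    rw [Polynomial.IsRoot, eval_sub, eval_mul, Polynomial.eval_C, div_mul_cancel₀ _ hf, sub_self]
  obtain ⟨r, hr⟩ := Polynomial.dvd_iff_isRoot.mpr h1; refine ⟨f.num.eval 1 / f.denom.eval 1, _, div_in_regOne r hf, ?_⟩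
  have h2 := congrArg (aM _ (RF)) hr; simp only [map_sub, map_mul, algebraMap_C, algebraMap_X, map_one] at h2
  nth_rw 1 [<-num_div_denom f]
  grind

lemma one_notMem {g} (hg : g ∈ regOne) : (Rx - 1) * g ≠ 1 := by
  intro h; have hd : aM _ (RF) g.denom ≠ 0 := by simpa using denom_ne_zero g
  have h1 : (Rx - 1) * aM _ (RF) g.num = aM _ (RF) g.denom := by rw [<-num_div_denom g] at h; grind
  rw [<-algebraMap_X, <-map_one (aM (Polynomial ℂ) (RF)), <-map_sub, <-map_mul] at h1
  have h2 := congrArg (eval 1) (RatFunc.algebraMap_injective ℂ h1)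
  rw [eval_mul, eval_sub, Polynomial.eval_X, eval_one, sub_self, zero_mul] at h2; exact hg h2.symm

lemma zpow_X_in_regOne (k : ℤ) : Rx ^ k ∈ regOne := by
  have hX : Rx ∈ regOne := by have := div_in_regOne pX (q := 1) (by simp); simp_all
  have hX' : Rx⁻¹ ∈ regOne := by have := div_in_regOne 1 (q := pX) (by simp); simp_all
  rcases k with k | k
  . aesop
  . rw [zpow_negSucc, <-inv_pow]; exact pow_mem hX' _

lemma coe_zpow_X (k) : ((Rx ^ k : RF) : LS) = single k 1 := by rw [map_zpow₀, coe_X, <-RatFunc.single_zpow]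

lemma coe_C_ratFunc (c) : ((RC c : RF) : LS) = HahnSeries.C c := by
  rw [<-algebraMap_C]; exact (RatFunc.coe_coe (pC c)).symm.trans (by simp)

end RegularAtOne

end

section

namespace Fusion

open PreRep

variable {W V : Type*} [ACG W] [Module ℂ W]
  [ACG V] [Module ℂ V] (P1 : PreRep X t O1 (End ℂ W)) (P2 : PreRep X t O2 (End ℂ V))
  (w : W) (v : V)

/-- The deformed coproduct, acting on Laurent series. -/
def deformed : PreRep X t (O1 + O2) (End ℂ (HM (W ⊗[ℂ] V))) := (cop P1 P2 (endTen W V)).map hahnAct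

def topSer : HM (W ⊗[ℂ] V) := hof (single 0 (w ⊗ₜ[ℂ] v))

def topSpan : Submodule ℂ (HM (W ⊗[ℂ] V)) := span ℂ {z | ∃ f ∈ regOne, z = (f : LS) • topSer w v}

def lattice : Submodule ℂ (HM (W ⊗[ℂ] V)) := (deformed P1 P2).hull (topSpan w v)

variable {P1 P2 w v} {Ψ1 : LWeight X O1} {Ψ2 : LWeight X O2}

lemma lc_top (n) : lc (topSer w v) n = if n = 0 then w ⊗ₜ v else 0 := by
  by_cases h : n = 0
  . rw [if_pos h, h]; exact coeff_single_same 0 _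
  . rw [if_neg h]; exact coeff_single_of_ne h

lemma smul_top_in {f} (hf : f ∈ regOne) :
    (f : LS) • topSer w v ∈ topSpan w v := subset_span ⟨f, hf, rfl⟩

lemma topSpan_smul {f} (hf : f ∈ regOne) {z : HM (W ⊗[ℂ] V)}
    (hz : z ∈ topSpan w v) : (f : LS) • z ∈ topSpan w v := by
  induction hz using span_induction with
  | mem z hz =>
    obtain ⟨g, hg, rfl⟩ := hz; rw [smul_smul, <-map_mul]; exact smul_top_in (mul_mem hf hg)
  | zero => simp
  | add z z' _ _ h h' => rw [smul_add]; exact add_mem h h'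
  | smul c z _ h => rw [smul_comm]; exact smul_mem _ _ h

lemma act_topSpan {R : HahnSeries ℤ (End ℂ (W ⊗[ℂ] V))}
    (hR : hahnAct R (topSer w v) ∈ topSpan w v) {z : HM (W ⊗[ℂ] V)}
    (hz : z ∈ topSpan w v) : hahnAct R z ∈ topSpan w v := by
  induction hz using span_induction with
  | mem z hz =>
    obtain ⟨g, hg, rfl⟩ := hz; rw [hact_smul]; exact topSpan_smul hg hR
  | zero => simp
  | add z z' _ _ h h' => rw [map_add]; exact add_mem h h'
  | smul c z _ h => rw [map_smul]; exact smul_mem _ _ h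

lemma raise_topSpan (h1 : P1.Highest w Ψ1) (h2 : P2.Highest v Ψ2) (i m)
    {z : HM (W ⊗[ℂ] V)} (hz : z ∈ topSpan w v) : (deformed P1 P2).x 1 i m z = 0 := by
  change hahnAct (copX P1 P2 (endTen W V) 1 i m) z = 0
  have h0 : hahnAct (copX P1 P2 (endTen W V) 1 i m) (topSer w v) = 0 := hact_zero fun k n => by
    rw [lc_top]; split_ifs
    . exact copX_pos_top h1 h2 i m k
    simp
  induction hz using span_induction with
  | mem z hz =>
    obtain ⟨g, hg, rfl⟩ := hz; rw [hact_smul, h0, smul_zero]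
  | zero => rw [map_zero]
  | add z z' _ _ h h' => simp_all
  | smul c z _ h => simp_all

lemma phi_top (h1 : P1.Highest w Ψ1) (h2 : P2.Highest v Ψ2) (J i m) (S : Finset ℤ)
    (hS : ∀ n, n ∉ S -> Ψ1.psi J i (m - n) * Ψ2.psi J i n = 0) :
    (deformed P1 P2).phi J i m (topSer w v) = ∑ n ∈ S, (Ψ1.psi J i (m - n) * Ψ2.psi J i n) • (((Rx ^ n : RF) : LS) • topSer w v) := by
  refine lc_ext fun n => ?_
  have e : ∀ k, (copPhi P1 P2 (endTen W V) J i m).coeff k (w ⊗ₜ v) = (Ψ1.psi J i (m - k) * Ψ2.psi J i k) • (w ⊗ₜ[ℂ] v) := fun k => by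
    rw [cf_copPhi, copPhiCf, endTen_tmul, map_tmul, h1.phi, h2.phi, tmul_smul, <-smul_tmul', smul_smul, mul_comm]
  have lsum : ∀ (S : Finset ℤ) (F : ℤ -> HM (W ⊗[ℂ] V)), lc (∑ k ∈ S, F k) n = ∑ k ∈ S, lc (F k) n := by
    intro S F; induction S using Finset.induction_on with
    | empty => rfl
    | insert a S ha ih => rw [sum_insert ha, sum_insert ha, <-ih]; rfl
  rw [lsum]; change lc (hahnAct (copPhi P1 P2 (endTen W V) J i m) (topSer w v)) n = _
  rw [lc_hact _ _ _ {n}, sum_singleton, sub_self, lc_top, if_pos rfl, e]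
  . have e' : ∀ k, lc ((Ψ1.psi J i (m - k) * Ψ2.psi J i k) • (((Rx ^ k : RF) : LS) • topSer w v)) n =
        (Ψ1.psi J i (m - k) * Ψ2.psi J i k) • (if n - k = 0 then w ⊗ₜ[ℂ] v else 0) := fun k => by
      rw [lc_csmul, coe_zpow_X, lc_sgl_smul, lc_top, one_smul]
    simp only [e']; by_cases hn : n ∈ S
    . rw [Finset.sum_eq_single_of_mem n hn, sub_self, if_pos rfl]; intro k _ hk
      rw [if_neg (by omega), smul_zero]
    . rw [hS n hn, zero_smul, sum_eq_zero]; intro k hk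
      rw [if_neg fun h => hn (by grind), smul_zero]
  . intro k hk; rw [lc_top, if_neg (fun h => hk (Finset.mem_singleton.mpr (by omega))), map_zero]

lemma phi_topSpan (h1 : P1.Highest w Ψ1) (h2 : P2.Highest v Ψ2) (J i m)
    {z : HM (W ⊗[ℂ] V)} (hz : z ∈ topSpan w v) : (deformed P1 P2).phi J i m z ∈ topSpan w v := by
  refine act_topSpan ?_ hz; change (deformed P1 P2).phi J i m (topSer w v) ∈ topSpan w v
  rw [phi_top h1 h2 J i m _ fun n => Ψ1.mul_eq_zero Ψ2]
  exact Submodule.sum_mem _ fun n _ => smul_mem _ _ (smul_top_in (zpow_X_in_regOne n))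

lemma _root_.PreRep.Highest.inv_apply {O} {P : PreRep X t O (End ℂ V)} {e} (h : P.Highest v e)
    (J i) : P.inv J i v = (e.psi J i (ℓ O J i))⁻¹ • v := by
  have h1 : P.inv J i (P.phi J i (ℓ O J i) v) = v := congrL (P.inv_lead J i) v
  rw [h.phi, map_smul] at h1; rw [eq_inv_smul_iff₀ (e.lead_ne J i), h1]

lemma inv_topSpan (h1 : P1.Highest w Ψ1) (h2 : P2.Highest v Ψ2) (J i)
    {z : HM (W ⊗[ℂ] V)} (hz : z ∈ topSpan w v) : (deformed P1 P2).inv J i z ∈ topSpan w v := by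
  refine act_topSpan ?_ hz
  have : hahnAct (single (-ℓ O2 J i) (endTen W V (P1.inv J i ⊗ₜ P2.inv J i))) (topSer w v) =
      ((Ψ1.psi J i (ℓ O1 J i))⁻¹ * (Ψ2.psi J i (ℓ O2 J i))⁻¹) • (((Rx ^ (-ℓ O2 J i) : RF) : LS) • topSer w v) := by
    refine lc_ext fun n => ?_
    rw [lc_csmul, coe_zpow_X, lc_sgl_smul, lc_hact_sgl, lc_top, one_smul]; split_ifs
    . rw [endTen_tmul, map_tmul, h1.inv_apply, h2.inv_apply, tmul_smul, <-smul_tmul', smul_smul, mul_comm]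
    rfl
  change hahnAct (single _ _) _ ∈ _; rw [this]; exact smul_mem _ _ (smul_top_in (zpow_X_in_regOne _))

lemma lat_smul {f} (hf : f ∈ regOne) {z : HM (W ⊗[ℂ] V)}
    (hz : z ∈ lattice P1 P2 w v) : (f : LS) • z ∈ lattice P1 P2 w v := by
  let Y : Submodule ℂ (HM (W ⊗[ℂ] V)) := (lattice P1 P2 w v).comap (toLinearMap ℂ _ (f : LS))
  have h : lattice P1 P2 w v ≤ Y := hull_le _ (fun z hz => le_hull _ _ (topSpan_smul hf hz)) fun i m z hz => by
    change (f : LS) • hahnAct (copX P1 P2 (endTen W V) (-1) i m) z ∈ lattice P1 P2 w v; rw [<-hact_smul]; exact low_in_hull _ _ i m hz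
  exact h hz

lemma lfun_lat (h₁ : P1.Highest w Ψ1) (h2 : P2.Highest v Ψ2) : ∃ T : W ⊗[ℂ] V →ₗ[ℂ] ℂ,
    lfun T (topSer w v) = 1 ∧ (∀ i m z, lfun T ((deformed P1 P2).x (-1) i m z) = 0) ∧
    ∀ z ∈ lattice P1 P2 w v, ∃ f ∈ regOne, lfun T z = (f : LS) := by
  obtain ⟨τ1, a1, a2, -⟩ := h₁.exists_top; obtain ⟨τ2, b1, b2, -⟩ := h2.exists_top
  let T : W ⊗[ℂ] V →ₗ[ℂ] ℂ := LinearMap.mul' ℂ ℂ ∘ₗ tmap τ1 τ2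
  have hT : ∀ i m k y, T ((copX P1 P2 (endTen W V) (-1) i m).coeff k y) = 0 := by
    intro i m k y; rw [cf_copX, copXCf, if_neg (by decide)]; induction y using TensorProduct.induction_on with
    | zero => simp
    | add y y' h h' => rw [map_add, map_add, h, h', add_zero]
    | tmul y y' =>
      rw [addL, map_add]
      have e : T ((if k = m then endTen W V (1 ⊗ₜ P2.x (-1) i m) else 0) (y ⊗ₜ y')) = 0 := by
        split_ifs
        . rw [endTen_tmul, map_tmul]; simp [T, b2]
        rfl
      rw [e, zero_add, endTen_tmul, map_tmul]; simp [T, a2]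
  have h1 : lfun T (topSer w v) = 1 := by
    ext n; rw [cf_lfun, lc_top, coeff_one]; split_ifs
    . simp [T, a1, b1]
    rfl
  have hx : ∀ i m z, lfun T ((deformed P1 P2).x (-1) i m z) = 0 := fun i m z => by
    ext n; change T (lc (hahnAct (copX P1 P2 (endTen W V) (-1) i m) z) n) = 0
    obtain ⟨a, ha⟩ := exists_bound (copX P1 P2 (endTen W V) (-1) i m); obtain ⟨b, hb⟩ := ex_lc_bound z
    rw [lc_hact _ _ _ (Icc a (n - b)), map_sum]
    . exact sum_eq_zero fun k _ => hT i m k _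
    . intro k hk; rw [mem_Icc, not_and_or] at hk; by_cases h : k < a
      . rw [ha _ h, zeroL]
      . rw [hb _ (by omega), map_zero]
  refine ⟨T, h1, hx, ?_⟩
  let Y : Submodule ℂ (HM (W ⊗[ℂ] V)) := {
      carrier := {z | ∃ f ∈ regOne, lfun T z = (f : LS)}
      zero_mem' := ⟨0, zero_mem _, by
        rw [map_zero]; rfl⟩
      add_mem' := by rintro z z' ⟨f, hf, e⟩ ⟨f', hf', e'⟩; exact ⟨f + f', add_mem hf hf', by rw [lfun_add, e, e', map_add]⟩
      smul_mem' := by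
        rintro c z ⟨f, hf, e⟩; refine ⟨c • f, Subalgebra.smul_mem _ hf c, ?_⟩; rw [smul_def, map_mul, <-e]
        rw [algebraMap_eq_C, coe_C_ratFunc, C_apply]; ext n; rw [coeff_single_mul, sub_zero, cf_lfun, cf_lfun]; exact map_smul T c _ }
  suffices h : lattice P1 P2 w v ≤ Y from fun z hz => h hz
  refine hull_le _ (Submodule.span_le.mpr ?_) fun i m z _ => ⟨0, zero_mem _, by rw [hx, map_zero]⟩
  rintro _ ⟨f, hf, rfl⟩; exact ⟨f, hf, by rw [lfun_smul, h1, mul_one]⟩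

end Fusion

end

section

namespace Fusion

open PreRep

variable {W V : Type*} [ACG W] [Module ℂ W]
  [ACG V] [Module ℂ V] {P1 : PreRep X t O1 (End ℂ W)} {P2 : PreRep X t O2 (End ℂ V)}
  {w : W} {v : V} {Ψ1 : LWeight X O1} {Ψ2 : LWeight X O2}

section Recurrence

variable (P1 P2 w v) in
def bounded (d : ℕ) : Submodule ℂ (HM (W ⊗[ℂ] V)) where
  carrier := {z | ∀ n, lc z n ∈ map₂ (TensorProduct.mk ℂ W V) (P1.filt w d) (P2.filt v d)}
  zero_mem' _ := zero_mem _
  add_mem' h h' n := add_mem (h n) (h' n)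
  smul_mem' c _ h n := smul_mem _ c (h n)

lemma top_in_bdd (d) : topSer w v ∈ bounded P1 P2 w v d := fun n => by
  rw [lc_top]; split_ifs
  . exact apply_mem_map₂ _ (P1.self_in_filt w d) (P2.self_in_filt v d)
  simp

lemma bdd_mono {d e} (h : d ≤ e) : bounded P1 P2 w v d ≤ bounded P1 P2 w v e := fun _ hz n =>
  Submodule.map₂_le_map₂ (P1.filt_mono w h) (P2.filt_mono v h) (hz n)

lemma low_in_bdd (h2 : P2.Highest v Ψ2) {d} (i m) {z : HM (W ⊗[ℂ] V)}
    (hz : z ∈ bounded P1 P2 w v d) : (deformed P1 P2).x (-1) i m z ∈ bounded P1 P2 w v (d + 1) := by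
  intro n; change lc (hahnAct (copX P1 P2 (endTen W V) (-1) i m) z) n ∈ _
  obtain ⟨a, ha⟩ := exists_bound (copX P1 P2 (endTen W V) (-1) i m); obtain ⟨b, hb⟩ := ex_lc_bound z
  rw [lc_hact _ _ _ (Icc a (n - b))]
  . refine Submodule.sum_mem _ fun k _ => ?_
    rw [cf_copX, copXCf, if_neg (by decide)]
    suffices h : map₂ (TensorProduct.mk ℂ W V) (P1.filt w d) (P2.filt v d) ≤
        (map₂ (TensorProduct.mk ℂ W V) (P1.filt w (d + 1)) (P2.filt v (d + 1))).comap
          ((if k = m then endTen W V (1 ⊗ₜ P2.x (-1) i m) else 0) + endTen W V (P1.x (-1) i (m - k) ⊗ₜ P2.phi 1 i k)) from h (hz _)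
    refine Submodule.map₂_le.mpr fun y hy y' hy' => ?_
    rw [mem_comap, addL]; refine add_mem ?_ ?_
    . split_ifs
      . exact apply_mem_map₂ _ (P1.filt_le_succ w d hy) (P2.low_in_filt hy' i m)
      simp
    . exact apply_mem_map₂ _ (P1.low_in_filt hy i _)
        (P2.filt_le_succ v d (P2.phi_in_filt h2.phi_mem hy' _ _ _))
  . intro k hk; rw [mem_Icc, not_and_or] at hk; by_cases h : k < a
    . simp_all
    . rw [hb _ (by omega), map_zero]

lemma kills_hact {p : Polynomial ℂ} {R : ℤ -> HahnSeries ℤ (End ℂ (W ⊗[ℂ] V))}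
    {F : Submodule ℂ (W ⊗[ℂ] V)} (h : ∀ j, F ≤ killSpace p fun m => (R m).coeff j)
    {z : HM (W ⊗[ℂ] V)} (hz : ∀ n, lc z n ∈ F) : Kills p fun m => hahnAct (R m) z := by
  intro m
  have e : (p.sum fun k c => c • hahnAct (R (m + k)) z) = hahnAct (p.sum fun k c => c • R (m + k)) z := by
    simp only [sum_def, map_sum, sumL, map_smul, smulL]
  rw [e]; refine hact_zero fun j n => ?_
  have := h j (hz n) m; simp_all [sum_def, coeff_sum, coeff_smul, sumL, smulL]

lemma tw_kills_hact {p : Polynomial ℂ} {R : ℤ -> HahnSeries ℤ (End ℂ (W ⊗[ℂ] V))}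
    {F : Submodule ℂ (W ⊗[ℂ] V)} (h : ∀ j, F ≤ killSpace p fun m => (R m).coeff (j + m))
    {z : HM (W ⊗[ℂ] V)} (hz : ∀ n, lc z n ∈ F) (m) :
    (p.sum fun k c => c • (((Rx ^ (-(k : ℤ)) : RF) : LS) • hahnAct (R (m + k)) z)) = 0 := by
  have e : (p.sum fun k c => c • (((Rx ^ (-(k : ℤ)) : RF) : LS) • hahnAct (R (m + k)) z)) =
      hahnAct (p.sum fun k c => c • (single (-(k : ℤ)) 1 * R (m + k))) z := by
    simp only [sum_def, map_sum, sumL, map_smul, smulL, map_mul, mul_apply, coe_zpow_X, sgl_smul_eq, one_smul]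
  rw [e]; refine hact_zero fun j n => ?_
  have := h (j - m) (hz n) m
  simpa only [sum_def, coeff_sum, coeff_smul, sumL, smulL, coeff_single_mul, one_mul, sub_neg_eq_add,
    show ∀ k : ℕ, j - m + (m + k) = j + k from fun k => by ring] using this

lemma map₂_le_killSpace_left {F : Submodule ℂ W} {G : Submodule ℂ V} {p : Polynomial ℂ} {u : ℤ -> End ℂ W}
    (h : F ≤ killSpace p u) (g : End ℂ V) :
    map₂ (TensorProduct.mk ℂ W V) F G ≤ killSpace p fun m => endTen W V (u m ⊗ₜ g) :=
  Submodule.map₂_le.mpr fun _ hy y' _ =>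
    in_kill.mpr ((in_kill.mp (h hy)).map ((TensorProduct.mk ℂ W V).flip (g y')))

lemma map₂_le_killSpace_right {F : Submodule ℂ W} {G : Submodule ℂ V} {p : Polynomial ℂ} {u : ℤ -> End ℂ V}
    (h : G ≤ killSpace p u) (g : End ℂ W) :
    map₂ (TensorProduct.mk ℂ W V) F G ≤ killSpace p fun m => endTen W V (g ⊗ₜ u m) :=
  Submodule.map₂_le.mpr fun y _ _ hy' =>
    in_kill.mpr ((in_kill.mp (h hy')).map (TensorProduct.mk ℂ W V (g y)))

lemma kill_shift {B : Type*} [ACG B] [Module ℂ B] {p : Polynomial ℂ} {u : ℤ -> End ℂ B} (s) :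
    killSpace p u ≤ killSpace p fun m => u (m - s) := fun y hy => by
  have := (in_kill.mp hy).shift (-s); simp_all [in_kill, neg_add_eq_sub]

lemma ex_split (h1 : P1.Good w Ψ1) (h2 : P2.Good v Ψ2) (J i d) :
    ∃ p1 p2 : Polynomial ℂ, p1.Monic ∧ p2.Monic ∧ ∀ z ∈ bounded P1 P2 w v d,
      ∃ a b : ℤ -> HM (W ⊗[ℂ] V), (∀ m, (deformed P1 P2).x J i m z = a m + b m) ∧ Kills p1 a ∧
      ∀ m, (p2.sum fun k c => c • (((Rx ^ (-(k : ℤ)) : RF) : LS) • b (m + k))) = 0 := by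
  obtain ⟨p1, hp1, k1⟩ := h1.recurrence d i J; obtain ⟨p2, hp2, k2⟩ := h2.recurrence d i J
  refine ⟨p1, p2, hp1, hp2, fun z hz => ?_⟩; rcases units_eq_one_or J with rfl | rfl
  . refine ⟨fun m => hahnAct (single 0 (endTen W V (P1.x 1 i m ⊗ₜ 1))) z,
      fun m => hahnAct (copB P1 P2 (endTen W V) i m) z, fun m => ?_, kills_hact (fun j => ?_) hz,
      tw_kills_hact (fun j => ?_) hz⟩
    . change hahnAct (copX P1 P2 (endTen W V) 1 i m) z = _; rw [copX_pos, map_add, addL]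
    . by_cases hj : j = 0
      . subst hj; simp only [coeff_single_same]; exact map₂_le_killSpace_left k1 1
      . simp only [coeff_single_of_ne hj]; exact fun y _ => kills_zero p1
    . simp only [cf_copB]
      have := map₂_le_killSpace_right (F := P1.filt w d) (k2.trans (kill_shift (-j))) (P1.phi (-1) i (-j))
      grind
  . refine ⟨fun m => hahnAct (copD P1 P2 (endTen W V) i m) z, fun m => hahnAct (single m (endTen W V (1 ⊗ₜ P2.x (-1) i m))) z, fun m => ?_,
      kills_hact (fun j => ?_) hz,
      tw_kills_hact (R := fun m => single m (endTen W V (1 ⊗ₜ P2.x (-1) i m))) (fun j => ?_) hz⟩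
    . change hahnAct (copX P1 P2 (endTen W V) (-1) i m) z = _
      rw [copX_neg, map_add, addL, add_comm]
    . simp only [cf_copD]; exact map₂_le_killSpace_left (k1.trans (kill_shift j)) _
    . by_cases hj : j = 0
      . subst hj; simp only [zero_add, coeff_single_same]; exact map₂_le_killSpace_right k2 1
      . have : ∀ m : ℤ, j + m ≠ m := fun m => by omega
        simp only [coeff_single_of_ne (this _)]; exact fun y _ => kills_zero p2

end Recurrence

section Lattice

variable (P1 P2 w v)

def Lat : Type _ := ↥(lattice P1 P2 w v)

instance : ACG (Lat P1 P2 w v) := inferInstanceAs (ACG ↥(lattice P1 P2 w v))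

instance : Module ℂ (Lat P1 P2 w v) := inferInstanceAs (Module ℂ ↥(lattice P1 P2 w v))

variable {P1 P2 w v}

def Lat.val : Lat P1 P2 w v →ₗ[ℂ] HM (W ⊗[ℂ] V) := (lattice P1 P2 w v).subtype

lemma Lat.val_mem (z : Lat P1 P2 w v) : z.val ∈ lattice P1 P2 w v := z.2

lemma Lat.val_injective : Function.Injective (Lat.val (P1 := P1) (P2 := P2) (w := w) (v := v)) := Subtype.val_injective

def Lat.mk (z : HM (W ⊗[ℂ] V)) (hz : z ∈ lattice P1 P2 w v) : Lat P1 P2 w v := ⟨z, hz⟩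

lemma Lat.val_mk (z : HM (W ⊗[ℂ] V)) (hz : z ∈ lattice P1 P2 w v) : (Lat.mk z hz).val = z := rfl

/-- Multiplication by a function that is regular at `1`. -/
def Lat.times {f} (hf : f ∈ regOne) : Lat P1 P2 w v →ₗ[ℂ] Lat P1 P2 w v where
  toFun z := Lat.mk ((f : LS) • z.val) (lat_smul hf z.val_mem)
  map_add' z z' := Lat.val_injective (smul_add (f : LS) z.val z'.val)
  map_smul' c z := Lat.val_injective (smul_comm (f : LS) c z.val)

lemma Lat.val_times {f} (hf : f ∈ regOne) (z : Lat P1 P2 w v) :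
    (Lat.times hf z).val = (f : LS) • z.val := rfl

lemma X_sub_one_in : (Rx - 1 : RF) ∈ regOne := sub_mem (by simpa using zpow_X_in_regOne 1) (one_mem _)

variable (P1 P2 w v) in
def special : Submodule ℂ (Lat P1 P2 w v) := LinearMap.range (Lat.times X_sub_one_in)

lemma in_spec {z : Lat P1 P2 w v} : z ∈ special P1 P2 w v ↔ ∃ z' : Lat P1 P2 w v, ((Rx - 1 : RF) : LS) • z'.val = z.val :=
  ⟨fun ⟨z', h⟩ => ⟨z', congrArg Lat.val h⟩, fun ⟨z', h⟩ => ⟨z', Lat.val_injective h⟩⟩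

lemma mkQ_eq_mkQ {z y z' : Lat P1 P2 w v} (h : ((Rx - 1 : RF) : LS) • z'.val = z.val - y.val) :
    (special P1 P2 w v).mkQ z = (special P1 P2 w v).mkQ y := by
  rw [<-sub_eq_zero, <-map_sub, mkQ_apply, mk_eq_zero, in_spec]; exact ⟨z', by rw [h, map_sub]⟩

lemma mkQ_times {f} (hf : f ∈ regOne) : ∃ c : ℂ, ∀ z : Lat P1 P2 w v,
    (special P1 P2 w v).mkQ (Lat.times hf z) = c • (special P1 P2 w v).mkQ z := by
  obtain ⟨c, g, hg, e⟩ := ex_eq_add_of_regOne hf; refine ⟨c, fun z => ?_⟩; rw [<-map_smul]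
  refine mkQ_eq_mkQ (z' := Lat.times hg z) ?_; have h1 : (Rx - 1) * g = f - RC c := by rw [e]; ring
  have h2 : (c • z).val = ((RC c : RF) : LS) • z.val := by
    rw [coe_C_ratFunc, C_apply]; refine lc_ext fun n => ?_
    rw [lc_sgl_smul, sub_zero, map_smul, lc_csmul]
  rw [Lat.val_times, Lat.val_times, h2, smul_smul, <-map_mul, h1, map_sub, sub_smul]

lemma mkQ_times_zpow (k) (z : Lat P1 P2 w v) :
    (special P1 P2 w v).mkQ (Lat.times (zpow_X_in_regOne k) z) = (special P1 P2 w v).mkQ z := by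
  have step : ∀ k, (special P1 P2 w v).mkQ (Lat.times (zpow_X_in_regOne (k + 1)) z) =
      (special P1 P2 w v).mkQ (Lat.times (zpow_X_in_regOne k) z) := by
    intro k; refine mkQ_eq_mkQ (z' := Lat.times (zpow_X_in_regOne k) z) ?_
    have h : (Rx - 1) * Rx ^ k = (Rx ^ (k + 1) - Rx ^ k : RF) := by rw [sub_mul, one_mul, zpow_add_one₀ X_ne_zero, mul_comm]
    rw [Lat.val_times, Lat.val_times, smul_smul, <-map_mul, h, map_sub, sub_smul]
  induction k using Int.induction_on with
  | zero =>
    congr 1; refine Lat.val_injective ?_; rw [Lat.val_times, zpow_zero, map_one, one_smul]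
  | succ k ih => rw [step, ih]
  | pred k ih =>
    grind

end Lattice

section Quotient

variable (ht : t ≠ 0) (hq : Generic t) (hμ : X.IsShift (O1 + O2))
  (h1 : P1.Good w Ψ1) (h2 : P2.Core v Ψ2)

def act : SA X t (O1 + O2) →ₐ[ℂ] End ℂ (HM (W ⊗[ℂ] V)) := hahnAct.comp ((cop P1 P2 (endTen W V)).lift ht hq hμ (cop_compl h1 h2 ht))

lemma act_genX (J i m) :
    act ht hq hμ h1 h2 (genX _ J i m) = (deformed P1 P2).x J i m :=
  congrArg hahnAct (lift_genX _ ht hq hμ _ J i m)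

lemma act_gPhi (J i m) :
    act ht hq hμ h1 h2 (genPhi _ J i m) = (deformed P1 P2).phi J i m :=
  congrArg hahnAct (lift_gPhi _ ht hq hμ _ J i m)

lemma act_genInv (J i) :
    act ht hq hμ h1 h2 (genInv _ J i) = (deformed P1 P2).inv J i :=
  congrArg hahnAct (lift_genInv _ ht hq hμ _ J i)

lemma act_smul (a : SA X t (O1 + O2)) (f : LS) (z : HM (W ⊗[ℂ] V)) :
    act ht hq hμ h1 h2 a (f • z) = f • act ht hq hμ h1 h2 a z := hact_smul _ f z

lemma act_in_lat (a : SA X t (O1 + O2)) {z : HM (W ⊗[ℂ] V)}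
    (hz : z ∈ lattice P1 P2 w v) : act ht hq hμ h1 h2 a z ∈ lattice P1 P2 w v := by
  let _ : Module (SA X t (O1 + O2)) (HM (W ⊗[ℂ] V)) := compHom _ (act ht hq hμ h1 h2).toRingHom
  have _ : IsScalarTower ℂ (SA X t (O1 + O2)) (HM (W ⊗[ℂ] V)) := ⟨fun c a y => by
    change act ht hq hμ h1 h2 (c • a) y = c • act ht hq hμ h1 h2 a y; simp⟩
  refine smul_in_of_gens ht hq (lattice P1 P2 w v) ?_ ?_ ?_ a hz
  . intro J i m z hz; change act ht hq hμ h1 h2 (genX _ J i m) z ∈ _; rw [act_genX]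
    rcases units_eq_one_or J with rfl | rfl
    . exact raise_in_hull _ (fun i m y hy => raise_topSpan h1.toHighest h2.toHighest i m hy)
        (fun J i r y hy => phi_topSpan h1.toHighest h2.toHighest J i r hy) i m hz
    . exact low_in_hull _ _ i m hz
  . intro J i m z hz; change act ht hq hμ h1 h2 (genPhi _ J i m) z ∈ _; rw [act_gPhi]
    exact phi_in_hull _ (fun J i r y hy => phi_topSpan h1.toHighest h2.toHighest J i r hy) J i m hz
  . intro J i z hz; change act ht hq hμ h1 h2 (genInv _ J i) z ∈ _; rw [act_genInv]
    exact inv_in_hull _ ht (fun J i y hy => inv_topSpan h1.toHighest h2.toHighest J i hy) J i hz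

def latAct : SA X t (O1 + O2) →ₐ[ℂ] End ℂ (Lat P1 P2 w v) :=
  resAct (act ht hq hμ h1 h2) (lattice P1 P2 w v) fun a _ hz => act_in_lat ht hq hμ h1 h2 a hz

lemma val_latAct (a : SA X t (O1 + O2)) (z : Lat P1 P2 w v) :
    (latAct ht hq hμ h1 h2 a z).val = act ht hq hμ h1 h2 a z.val := rfl

lemma latAct_spec (a : SA X t (O1 + O2)) (z : Lat P1 P2 w v)
    (hz : z ∈ special P1 P2 w v) : latAct ht hq hμ h1 h2 a z ∈ special P1 P2 w v := by
  obtain ⟨z', e⟩ := in_spec.mp hz; refine in_spec.mpr ⟨latAct ht hq hμ h1 h2 a z', ?_⟩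
  rw [val_latAct, val_latAct, <-e, act_smul]

variable (P1 P2 w v) in
abbrev Fus : Type _ := Lat P1 P2 w v ⧸ special P1 P2 w v

def fusAct : SA X t (O1 + O2) →ₐ[ℂ] End ℂ (Fus P1 P2 w v) :=
  quotAct (latAct ht hq hμ h1 h2) (special P1 P2 w v) (latAct_spec ht hq hμ h1 h2)

lemma top_in_lat : topSer w v ∈ lattice P1 P2 w v := le_hull _ _ (by
  have := smul_top_in (w := w) (v := v) (one_mem regOne); simp_all)

variable (P1 P2 w v) in
def fusVec : Fus P1 P2 w v := (special P1 P2 w v).mkQ (Lat.mk (topSer w v) top_in_lat)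

def fusRep : PreRep X t (O1 + O2) (End ℂ (Fus P1 P2 w v)) := (PreRep.ofAlgebra ht hq hμ).map (fusAct ht hq hμ h1 h2)

lemma fusRp_x (J i m) {z z' : Lat P1 P2 w v}
    (hz : z'.val = (deformed P1 P2).x J i m z.val) : (fusRep ht hq hμ h1 h2).x J i m ((special P1 P2 w v).mkQ z) =
      (special P1 P2 w v).mkQ z' :=
  congrArg (special P1 P2 w v).mkQ (Lat.val_injective ((congrL (act_genX ht hq hμ h1 h2 J i m) z.val).trans hz.symm))

lemma fusRp_phi (J i m) {z z' : Lat P1 P2 w v}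
    (hz : z'.val = (deformed P1 P2).phi J i m z.val) : (fusRep ht hq hμ h1 h2).phi J i m ((special P1 P2 w v).mkQ z) =
      (special P1 P2 w v).mkQ z' :=
  congrArg (special P1 P2 w v).mkQ (Lat.val_injective ((congrL (act_gPhi ht hq hμ h1 h2 J i m) z.val).trans hz.symm))

lemma fusRp_rel (d) : RelFam X t d ((fusRep ht hq hμ h1 h2).x d) := by
  have h := (cop_compl h1 h2 ht d).map hahnAct
  have h' : RelFam X t d fun i m => act ht hq hμ h1 h2 (genX _ d i m) := by simp only [act_genX]; exact h
  have h3 : RelFam X t d fun i m => latAct ht hq hμ h1 h2 (genX _ d i m) :=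
    h'.restrict (act ht hq hμ h1 h2) (lattice P1 P2 w v) fun a _ hz => act_in_lat ht hq hμ h1 h2 a hz
  exact h3.quot _ _ (latAct_spec ht hq hμ h1 h2)

end Quotient

end Fusion

end

section

lemma lfun_sub {M : Type*} [ACG M] [Module ℂ M] (T : M →ₗ[ℂ] ℂ) (f g : HM M) :
    lfun T (f - g) = lfun T f - lfun T g := by
  rw [eq_sub_iff_add_eq, <-lfun_add, sub_add_cancel]

namespace Fusion

open PreRep

variable {W V : Type*} [ACG W] [Module ℂ W]
  [ACG V] [Module ℂ V] {P1 : PreRep X t O1 (End ℂ W)} {P2 : PreRep X t O2 (End ℂ V)}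
  {w : W} {v : V} {Ψ1 : LWeight X O1} {Ψ2 : LWeight X O2}
  (ht : t ≠ 0) (hq : Generic t) (hμ : X.IsShift (O1 + O2))
  (h1 : P1.Good w Ψ1) (h2 : P2.Core v Ψ2)

lemma x_in_lat (h1 : P1.Highest w Ψ1) (h2 : P2.Highest v Ψ2) (J i m)
    {z : HM (W ⊗[ℂ] V)} (hz : z ∈ lattice P1 P2 w v) :
    (deformed P1 P2).x J i m z ∈ lattice P1 P2 w v := by
  rcases units_eq_one_or J with rfl | rfl
  . exact raise_in_hull _ (fun i m y hy => raise_topSpan h1 h2 i m hy)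
      (fun J i r y hy => phi_topSpan h1 h2 J i r hy) i m hz
  . exact low_in_hull _ _ i m hz

lemma filt_le (d) : (fusRep ht hq hμ h1 h2).filt (fusVec P1 P2 w v) d ≤
    ((bounded P1 P2 w v d).comap Lat.val).map (special P1 P2 w v).mkQ := by
  induction d with
  | zero =>
    refine (span_singleton_le_iff_mem _ _).mpr ⟨_, ?_, rfl⟩; exact top_in_bdd 0
  | succ d ih =>
    refine filt_succ_le _ (ih.trans (Submodule.map_mono (Submodule.comap_mono (bdd_mono (Nat.le_succ d))))) ?_
    intro i m y hy; obtain ⟨z, hz, rfl⟩ := ih hy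
    exact ⟨Lat.mk _ (x_in_lat h1.toHighest h2.toHighest (-1) i m z.val_mem),
      low_in_bdd h2.toHighest i m hz, (fusRp_x ht hq hμ h1 h2 (-1) i m (Lat.val_mk _ _)).symm⟩

lemma ex_kills (g2 : P2.Good v Ψ2) (d i J) :
    ∃ p : Polynomial ℂ, p.Monic ∧ ∀ z : Lat P1 P2 w v, z.val ∈ bounded P1 P2 w v d ->
      Kills p fun m => (fusRep ht hq hμ h1 h2).x J i m ((special P1 P2 w v).mkQ z) := by
  obtain ⟨p1, p2, hp1, hp2, hs⟩ := ex_split h1 g2 J i d; refine ⟨p1 * p2, hp1.mul hp2, fun z hz => ?_⟩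
  obtain ⟨a, b, hab, ha, hb⟩ := hs z.val hz
  let y : ℤ -> Lat P1 P2 w v := fun m => Lat.mk _ (x_in_lat h1.toHighest h2.toHighest J i m z.val_mem)
  have hy : ∀ m, (fusRep ht hq hμ h1 h2).x J i m ((special P1 P2 w v).mkQ z) = (special P1 P2 w v).mkQ (y m) :=
    fun m => fusRp_x ht hq hμ h1 h2 J i m (Lat.val_mk _ _)
  let g : ℤ -> Lat P1 P2 w v := fun m =>
    ∑ k ∈ p2.support, p2.coeff k • Lat.times (zpow_X_in_regOne (-(k : ℤ))) (y (m + k))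
  let L : ℕ -> HM (W ⊗[ℂ] V) →ₗ[ℂ] HM (W ⊗[ℂ] V) := fun k =>
    p2.coeff k • toLinearMap ℂ _ ((Rx ^ (-(k : ℤ)) : RF) : LS)
  have hb' : ∀ m, ∑ k ∈ p2.support, L k (b (m + k)) = 0 := hb; have ha' : ∀ m, ∑ j ∈ p1.support, p1.coeff j • a (m + j) = 0 := ha
  have hg : ∀ m, (g m).val = ∑ k ∈ p2.support, L k (a (m + k)) := fun m => by
    rw [<-add_zero (∑ k ∈ p2.support, _), <-hb' m, <-sum_add_distrib, map_sum]; refine sum_congr rfl fun k _ => ?_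
    rw [<-map_add, <-hab, map_smul]; rfl
  have hk : Kills p1 g := fun m => Lat.val_injective (by
    rw [sum_def, map_sum, map_zero]
    have e : ∀ j ∈ p1.support, (p1.coeff j • g (m + j)).val = ∑ k ∈ p2.support, L k (p1.coeff j • a (m + k + j)) :=
      fun j _ => by
        rw [map_smul, hg]; change (p1.coeff j • LinearMap.id (R := ℂ) (M := HM (W ⊗[ℂ] V))) (∑ k ∈ p2.support, L k (a (m + j + k))) = _
        rw [map_sum]; refine sum_congr rfl fun k _ => ?_
        rw [map_smul, add_right_comm]; rfl
    rw [sum_congr rfl e, sum_comm]; refine sum_eq_zero fun k _ => ?_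
    rw [<-map_sum, ha', map_zero])
  have hk' := kills_iff.mp (hk.map (special P1 P2 w v).mkQ); rw [kills_iff, map_mul, act_mul, <-hk']; congr 1
  funext m; rw [act_aeval_sgl, sum_def, map_sum]; refine sum_congr rfl fun k _ => ?_
  rw [map_smul, mkQ_times_zpow, nsmul_one, hy]

lemma fusVec_notMem : fusVec P1 P2 w v ∉ (fusRep ht hq hμ h1 h2).lowSpan := by
  obtain ⟨T, hT1, hT2, hT3⟩ := lfun_lat h1.toHighest h2.toHighest
  let Y : Submodule ℂ (Lat P1 P2 w v) := {
      carrier := {z | lfun T z.val = 0}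
      zero_mem' := by rw [mem_ofPred_eq, map_zero]; ext n; exact map_zero T
      add_mem' := fun {z z'} h h' => by rw [mem_ofPred_eq] at *; rw [map_add, lfun_add, h, h', add_zero]
      smul_mem' := fun c z h => by
        rw [mem_ofPred_eq] at *; rw [map_smul]; ext n; rw [cf_lfun, lc_csmul, map_smul, <-cf_lfun, h]; exact smul_zero c }
  intro hm
  have hle : (fusRep ht hq hμ h1 h2).lowSpan ≤ Y.map (special P1 P2 w v).mkQ := by
    refine iSup_le fun a => ?_
    rintro _ ⟨y, rfl⟩; obtain ⟨z, rfl⟩ := (special P1 P2 w v).mkQ_surjective y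
    exact ⟨Lat.mk _ (x_in_lat h1.toHighest h2.toHighest (-1) a.1 a.2 z.val_mem), hT2 _ _ _,
      (fusRp_x ht hq hμ h1 h2 (-1) a.1 a.2 (Lat.val_mk _ _)).symm⟩
  obtain ⟨z, hz, e⟩ := hle hm; rw [fusVec, <-sub_eq_zero, <-map_sub, mkQ_apply, mk_eq_zero, in_spec] at e
  obtain ⟨z', e⟩ := e; obtain ⟨f, hf, hf'⟩ := hT3 z'.val z'.val_mem; rw [map_sub Lat.val] at e
  have e' := congrArg (lfun T) e; have hz' : lfun T z.val = 0 := hz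
  rw [lfun_smul, lfun_sub, hz', Lat.val_mk, hT1, hf', <-map_mul, zero_sub] at e'
  have inj : ∀ f g : RF, (f : LS) = (g : LS) -> f = g := fun f g h => RingHom.injective _ h
  refine one_notMem (neg_mem hf) (inj _ _ ?_); rw [mul_neg, map_neg, e', neg_neg, map_one]

lemma fusRp_good (g2 : P2.Good v Ψ2) :
    (fusRep ht hq hμ h1 h2).Good (fusVec P1 P2 w v) (Ψ1.mul Ψ2) where
  raise i m := by
    rw [fusVec, fusRp_x ht hq hμ h1 h2 1 i m (z' := 0), map_zero]; rw [Lat.val_mk, map_zero]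
    refine (raise_topSpan h1.toHighest h2.toHighest i m ?_).symm
    have := smul_top_in (w := w) (v := v) (one_mem regOne); rwa [map_one, one_smul] at this
  phi J i r := by
    have hS : ∀ n, n ∉ uIcc (ℓ O2 J i) (r - ℓ O1 J i) ->
      Ψ1.psi J i (r - n) * Ψ2.psi J i n = 0 := fun n => Ψ1.mul_eq_zero Ψ2
    rw [Ψ1.mul_psi Ψ2 _ hS, fusVec, fusRp_phi ht hq hμ h1 h2 J i r (z' := ∑ n ∈ uIcc (ℓ O2 J i) (r - ℓ O1 J i),
      (Ψ1.psi J i (r - n) * Ψ2.psi J i n) • Lat.times (zpow_X_in_regOne n) (Lat.mk (topSer w v) top_in_lat))]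
    . rw [map_sum, sum_smul]; refine sum_congr rfl fun n _ => ?_
      rw [map_smul, mkQ_times_zpow]
    . rw [Lat.val_mk, phi_top h1.toHighest h2.toHighest J i r _ hS, map_sum]; rfl
  gen := by
    set F := ⨆ d, (fusRep ht hq hμ h1 h2).filt (fusVec P1 P2 w v) d with hF
    have hlow : ∀ i m y, y ∈ F -> (fusRep ht hq hμ h1 h2).x (-1) i m y ∈ F := fun i m y hy => by
      rw [hF, in_iSup_filt] at hy ⊢; obtain ⟨d, hd⟩ := hy; exact ⟨d + 1, low_in_filt _ hd i m⟩
    let Y : Submodule ℂ (HM (W ⊗[ℂ] V)) := (F.comap (special P1 P2 w v).mkQ).map Lat.val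
    have hY : lattice P1 P2 w v ≤ Y := by
      refine hull_le _ (Submodule.span_le.mpr ?_) ?_
      . rintro _ ⟨f, hf, rfl⟩; obtain ⟨c, hc⟩ := mkQ_times (P1 := P1) (P2 := P2) (w := w) (v := v) hf
        refine ⟨Lat.times hf (Lat.mk (topSer w v) top_in_lat), ?_, rfl⟩; change (special P1 P2 w v).mkQ _ ∈ F; rw [hc]
        exact smul_mem _ _ (mem_iSup_of_mem 0 (self_in_filt _ _ 0))
      . rintro i m _ ⟨z, hz, rfl⟩
        refine ⟨Lat.mk _ (x_in_lat h1.toHighest h2.toHighest (-1) i m z.val_mem), ?_, rfl⟩; change (special P1 P2 w v).mkQ _ ∈ F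
        rw [<-fusRp_x ht hq hμ h1 h2 (-1) i m (z := z) (Lat.val_mk _ _)]; exact hlow i m _ hz
    refine eq_top_iff.mpr fun y _ => ?_
    obtain ⟨z, rfl⟩ := (special P1 P2 w v).mkQ_surjective y; obtain ⟨z', hz', e⟩ := hY z.val_mem; rw [<-Lat.val_injective e]; exact hz'
  notMem := fusVec_notMem ht hq hμ h1 h2
  rel := fusRp_rel ht hq hμ h1 h2
  recurrence d i J := by
    obtain ⟨p, hp, hk⟩ := ex_kills ht hq hμ h1 h2 g2 d i J
    refine ⟨p, hp, fun y hy => in_kill.mpr ?_⟩; obtain ⟨z, hz, rfl⟩ := filt_le ht hq hμ h1 h2 d hy; exact hk z hz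

end Fusion

end

section

namespace PtMod

variable {V1 : PtMod X t O1} {V2 : PtMod X t O2}
  (ht : t ≠ 0) (hq : Generic t) (hμ1 : X.IsShift O1) (hμ2 : X.IsShift O2)
  (hμ : X.IsShift (O1 + O2)) {Ψ1 : LWeight X O1} {Ψ2 : LWeight X O2}
  (h1 : (V1.rep ht hq hμ1).Good V1.vec Ψ1) (h2 : (V2.rep ht hq hμ2).Core V2.vec Ψ2)

lemma lauImage {T : ℤ -> SA X t O1 ⊗[ℂ] SA X t O2}
    (R : HahnSeries ℤ (End ℂ (V1.carrier ⊗[ℂ] V2.carrier))) (h : ∀ k, tensorAct V1 V2 (T k) = R.coeff k)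
    (f : TensorLaurent V1 V2) : IsLaurentImage V1 V2 T f (hahnAct R f) := by
  intro n; obtain ⟨a, ha⟩ := exists_bound R; obtain ⟨b, hb⟩ := ex_lc_bound f
  have h0 : ∀ k, k ∉ Icc a (n - b) -> R.coeff k (lc f (n - k)) = 0 := by
    intro k hk; rw [mem_Icc, not_and_or] at hk; by_cases h : k < a
    . rw [ha _ h, zeroL]
    . rw [hb _ (by omega), map_zero]
  have hsub : Function.support (fun k => R.coeff k (lc f (n - k))) ⊆ (Icc a (n - b) : Finset ℤ) :=
    fun k hk => by_contra fun h => hk (h0 k h)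
  simp only [h]
  exact ⟨(Finset.finite_toSet _).subset hsub, (lc_hact R f n _ h0).trans (finsum_eq_sum_of_support_subset _ hsub).symm⟩

def fusion : PtMod X t (O1 + O2) := ofRep (Fusion.fusAct ht hq hμ h1 h2) (Fusion.fusVec _ _ V1.vec V2.vec)

lemma fusion_good (g2 : (V2.rep ht hq hμ2).Good V2.vec Ψ2) :
    ((fusion ht hq hμ1 hμ2 hμ h1 h2).rep ht hq hμ).Good (fusion ht hq hμ1 hμ2 hμ h1 h2).vec (Ψ1.mul Ψ2) :=
  Fusion.fusRp_good ht hq hμ h1 h2 g2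

lemma isDeformedAction : IsDeformedAction V1 V2 (O1 + O2) (Fusion.act ht hq hμ h1 h2) where
  xPlus i m f := by
    rw [Fusion.act_genX]; refine lauImage _ (fun k => ?_) f; refine Eq.trans ?_ (congrFun (PreRep.cf_copX _ _ _ 1 i m) k).symm
    rw [PreRep.copXCf, if_pos rfl, deltaXPlus, map_add]; congr 1; split_ifs
    . exact congrArg (tmap (lsmul ℂ ℂ V1.carrier (genX O1 1 i m)))
        (map_one (lsmul ℂ ℂ V2.carrier))
    . exact map_zero _
  xMinus i m f := by
    rw [Fusion.act_genX]; refine lauImage _ (fun k => ?_) f; refine Eq.trans ?_ (congrFun (PreRep.cf_copX _ _ _ (-1) i m) k).symm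
    rw [PreRep.copXCf, if_neg (by decide), deltaXMinus, map_add]; congr 1; split_ifs
    . exact congrArg (fun a => tmap a (lsmul ℂ ℂ V2.carrier (genX O2 (-1) i m)))
        (map_one (lsmul ℂ ℂ V1.carrier))
    . exact map_zero _
  phi J i m f := by
    rw [Fusion.act_gPhi]; refine lauImage _ (fun k => ?_) f
    exact (congrFun (PreRep.cf_copPhi (V1.rep ht hq hμ1) (V2.rep ht hq hμ2) (PreRep.endTen _ _) J i m) k).symm

lemma fusionLattice_eq : fusionLattice V1 V2 (Fusion.act ht hq hμ h1 h2) =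
    Fusion.lattice (V1.rep ht hq hμ1) (V2.rep ht hq hμ2) V1.vec V2.vec := by
  refine le_antisymm (Submodule.span_le.mpr ?_) (PreRep.hull_le _ (Submodule.span_mono ?_) ?_)
  . rintro _ ⟨f, a, hf, rfl⟩
    exact Fusion.lat_smul hf (Fusion.act_in_lat ht hq hμ h1 h2 a Fusion.top_in_lat)
  . rintro _ ⟨f, hf, rfl⟩; exact ⟨f, 1, hf, by rw [map_one]; rfl⟩
  . intro i m z hz; rw [<-Fusion.act_genX ht hq hμ h1 h2]; induction hz using span_induction with
    | mem z hz =>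
      obtain ⟨f, a, hf, rfl⟩ := hz; refine subset_span ⟨f, genX _ (-1) i m * a, hf, ?_⟩; rw [Fusion.act_smul, map_mul]; rfl
    | zero => rw [map_zero]; exact zero_mem _
    | add z z' _ _ h h' => rw [map_add]; exact add_mem h h'
    | smul c z _ h => rw [map_smul]; exact smul_mem _ _ h

lemma isFusionProduct {R1 : X.I0 -> RF} {R2 : X.I0 -> RF} (hR1 : IsHighest V1 R1) (hR2 : IsHighest V2 R2) :
    IsFusionProduct V1 V2 (fusion ht hq hμ1 hμ2 hμ h1 h2) := by
  refine ⟨⟨R1, hR1⟩, ⟨R2, hR2⟩, rfl, Fusion.act ht hq hμ h1 h2, isDeformedAction ht hq hμ1 hμ2 hμ h1 h2, ?_⟩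
  have e := fusionLattice_eq ht hq hμ1 hμ2 hμ h1 h2
  let I : fusionLattice V1 V2 (Fusion.act ht hq hμ h1 h2) →ₗ[ℂ]
      Fusion.Lat (V1.rep ht hq hμ1) (V2.rep ht hq hμ2) V1.vec V2.vec :=
    { toFun := fun z => Fusion.Lat.mk z.1 (e ▸ z.2)
      map_add' := fun _ _ => rfl
      map_smul' := fun _ _ => rfl }
  have hι : ∀ z : Fusion.Lat (V1.rep ht hq hμ1) (V2.rep ht hq hμ2) V1.vec V2.vec,
      ∃ y : fusionLattice V1 V2 (Fusion.act ht hq hμ h1 h2), (y : TensorLaurent V1 V2) = z.val ∧ I y = z :=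
    fun z => ⟨⟨z.val, e.symm ▸ z.val_mem⟩, rfl, rfl⟩
  refine ⟨(Fusion.special _ _ _ _).mkQ ∘ₗ I, fun y => ?_, fun z => ?_, fun a z z' h => ?_, fun z h => ?_⟩
  . obtain ⟨z, rfl⟩ := (Fusion.special _ _ _ _).mkQ_surjective y; obtain ⟨y, -, hy⟩ := hι z
    exact ⟨y, congrArg _ hy⟩
  . refine (mk_eq_zero _).trans (Fusion.in_spec.trans ⟨?_, ?_⟩)
    . rintro ⟨z', h⟩; obtain ⟨y, hy, -⟩ := hι z'; exact ⟨y, by rw [hy]; exact h.symm⟩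
    . rintro ⟨y, h⟩; exact ⟨I y, h.symm⟩
  . exact congrArg (Fusion.special _ _ _ _).mkQ (Fusion.Lat.val_injective h)
  . exact congrArg (Fusion.special _ _ _ _).mkQ (Fusion.Lat.val_injective h)

end PtMod

end

section

section Expansions

lemma injective_eval₂_inv : Function.Injective
    (eval₂RingHom (RC : ℂ →+* RF) (Rx : RF)⁻¹) := by
  rw [injective_iff_map_eq_zero]; intro p hp; let _ : Invertible (Rx : RF)⁻¹ := invertibleOfNonzero (inv_ne_zero X_ne_zero)
  have h := Polynomial.eval₂_reverse_mul_pow (RC : ℂ →+* RF) (Rx : RF)⁻¹ p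
  rw [Polynomial.coe_eval₂RingHom] at hp; rw [hp, invOf_eq_inv, inv_inv] at h
  have h2 := (mul_eq_zero.mp h).resolve_right (pow_ne_zero _ (inv_ne_zero X_ne_zero))
  have h3 : aM (Polynomial ℂ) (RF) p.reverse = 0 := by
    rw [<-h2, <-algebraMap_X, <-algebraMap_eq_C, <-aeval_def, Polynomial.aeval_algebraMap_apply, Polynomial.aeval_X_left_apply]
  simp_all

def invVar : RF →+* RF := RatFunc.liftRingHom (eval₂RingHom (RC : ℂ →+* RF) Rx⁻¹)
    (nonZeroDivisors_le_comap_nonZeroDivisors_of_injective _ injective_eval₂_inv)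

lemma invVar_aM (p : Polynomial ℂ) : invVar (aM _ _ p) = p.eval₂ RC Rx⁻¹ := RatFunc.liftRingHom_algebraMap _ _ p

def atZero : RF →+* LS where
  toFun f := (f : LS)
  map_one' := map_one _
  map_mul' := map_mul _
  map_zero' := map_zero _
  map_add' := map_add _

/-- The expansion at `∞`, as a series in `1 / z`. -/
def atInfty : RF →+* LS := atZero.comp invVar

lemma cf_atZero (f m) : (atZero f).coeff m = expandZero f m := rfl

lemma cf_inf (f m) : (atInfty f).coeff (-m) = expandInfty f m := by
  change ((atZero (invVar f)).coeff (-m)) = _; rw [invVar, RatFunc.liftRingHom_apply]; rfl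

lemma atZero_C (c) : atZero (RC c) = HahnSeries.C c := coe_C_ratFunc c

lemma atZero_X : atZero Rx = single 1 1 := coe_X

lemma inf_C (c) : atInfty (RC c) = HahnSeries.C c := by
  rw [atInfty, RingHom.comp_apply, <-atZero_C, <-algebraMap_C, invVar_aM, eval₂_C, algebraMap_C]

lemma inf_X : atInfty Rx = single (-1) 1 := by
  rw [atInfty, RingHom.comp_apply, <-algebraMap_X, invVar_aM, eval₂_X, map_inv₀, atZero_X, HahnSeries.inv_single, inv_one]

lemma cf_poly_mul (f : Polynomial ℂ →+* LS) {s} (hC : ∀ c, f (pC c) = HahnSeries.C c)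
    (hX : f pX = single s 1) (p : Polynomial ℂ) (y : LS) (m) :
    (f p * y).coeff m = ∑ k ∈ range (p.natDegree + 1), p.coeff k * y.coeff (m - k * s) := by
  conv_lhs => rw [p.as_sum_range_C_mul_X_pow]
  simp [map_sum, sum_mul, coeff_sum, map_mul, map_pow, hC, hX, HahnSeries.single_pow, C_apply, single_mul_single, zero_add, one_pow, mul_one, coeff_single_mul, nsmul_eq_mul]

lemma cf_poly (f : Polynomial ℂ →+* LS) {s : ℤ} (hC : ∀ c, f (pC c) = HahnSeries.C c)
    (hX : f pX = single s 1) (hs : s ≠ 0) (p : Polynomial ℂ) (k : ℕ) :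
    (f p).coeff (k * s) = p.coeff k := by
  rw [<-mul_one (f _), cf_poly_mul f hC hX]
  simp only [coeff_one, sub_eq_zero, mul_left_inj' hs, Nat.cast_inj, mul_ite, mul_one, mul_zero]; rw [Finset.sum_ite_eq]; split_ifs with h
  . rfl
  . rw [mem_range, not_lt] at h; exact (Polynomial.coeff_eq_zero_of_natDegree_lt (by omega)).symm

lemma cf_poly_zero (f : Polynomial ℂ →+* LS) {s} (hC : ∀ c, f (pC c) = HahnSeries.C c)
    (hX : f pX = single s 1) (p : Polynomial ℂ) {m} (hm : ∀ k : ℕ, m ≠ k * s) :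
    (f p).coeff m = 0 := by
  rw [<-mul_one (f _), cf_poly_mul f hC hX]; refine sum_eq_zero fun k _ => ?_
  grind [coeff_one, mul_zero]

lemma cf_map_mul (E : RF →+* LS) {s} (hC : ∀ c, E (RC c) = HahnSeries.C c)
    (hX : E Rx = single s 1) (p : Polynomial ℂ) (y : LS) (m) :
    (E (aM _ _ p) * y).coeff m = ∑ k ∈ range (p.natDegree + 1), p.coeff k * y.coeff (m - k * s) :=
  cf_poly_mul (E.comp (aM _ _)) (fun c => by tauto)
    (by tauto) p y m

lemma cf_map_poly (E : RF →+* LS) {s : ℤ} (hC : ∀ c, E (RC c) = HahnSeries.C c)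
    (hX : E Rx = single s 1) (hs : s ≠ 0) (p : Polynomial ℂ) (k : ℕ) :
    (E (aM _ _ p)).coeff (k * s) = p.coeff k :=
  cf_poly (E.comp (aM _ _)) (fun c => by tauto)
    (by tauto) hs p k

lemma order_eq {x : LS} {n} (h : ∀ k < n, x.coeff k = 0) (h0 : x.coeff n ≠ 0) : x.order = n := by
  refine le_antisymm (HahnSeries.order_le_of_coeff_ne_zero h0) (not_lt.mp fun hn => ?_); have hx : x ≠ 0 := fun hx => h0 (by rw [hx]; rfl)
  exact HahnSeries.coeff_order_eq_zero.not.mpr hx (h _ hn)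

lemma order_atZero {f : RF} (h1 : f.denom.eval 0 ≠ 0) (h2 : f.num.eval 0 ≠ 0) : (atZero f).order = 0 := by
  have key : ∀ p : Polynomial ℂ, p.eval 0 ≠ 0 -> (atZero (aM _ _ p)).order = 0 := fun p hp =>
    order_eq (fun k hk => cf_poly_zero (atZero.comp (aM _ _)) (s := 1) (fun c => by simp [atZero_C, algebraMap_C])
      (by simp [atZero_X, algebraMap_X]) p fun j => by omega) (by
      have := cf_map_poly atZero atZero_C atZero_X one_ne_zero p 0
      simp_all [Nat.cast_zero, zero_mul, this, Polynomial.coeff_zero_eq_eval_zero])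
  have hf : f ≠ 0 := fun h => h2 (by simp_all)
  have hd : aM _ (RF) f.denom ≠ 0 := by simpa using denom_ne_zero f
  have h : f * aM _ (RF) f.denom = aM _ (RF) f.num := by
    nth_rw 1 [<-num_div_denom f]
    grind
  have h' := congrArg (fun x => (atZero x).order) h; simp only [map_mul] at h'
  simp_all [key _ h1, key _ h2, add_zero]

lemma order_inf {f : RF} (hf : f ≠ 0) : (atInfty f).order = -f.intDegree := by
  have key : ∀ p : Polynomial ℂ, p ≠ 0 -> (atInfty (aM _ _ p)).order = -p.natDegree := fun p hp =>
    order_eq (fun k hk => by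
      rw [<-mul_one (atInfty _), cf_map_mul atInfty inf_C inf_X]; refine sum_eq_zero fun j hj => ?_
      grind [coeff_one, mem_range]) (by
      have := cf_map_poly atInfty inf_C inf_X (by norm_num) p p.natDegree
      simp_all)
  have hd : aM _ (RF) f.denom ≠ 0 := by simpa using denom_ne_zero f
  have h : f * aM _ (RF) f.denom = aM _ (RF) f.num := by
    nth_rw 1 [<-num_div_denom f]
    grind
  have h' := congrArg (fun x => (atInfty x).order) h; simp only [map_mul] at h'
  rw [order_mul ((map_ne_zero _).mpr hf) ((map_ne_zero _).mpr hd), key _ (denom_ne_zero f), key _ (RatFunc.num_ne_zero hf)] at h'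
  rw [RatFunc.intDegree]; omega

lemma kills_expand (f) (h0 : f.denom.eval 0 ≠ 0) : ∃ p : Polynomial ℂ, p.Monic ∧ Kills p fun m => expandZero f m - expandInfty f m := by
  set q := f.denom with hq; have hd : aM _ (RF) q ≠ 0 := by simpa using denom_ne_zero f
  have h : aM _ (RF) q * f = aM _ (RF) f.num := by
    nth_rw 1 [<-num_div_denom f]
    grind
  have e : ∀ (p : Polynomial ℂ) m, (atZero (aM _ _ p)).coeff m = (atInfty (aM _ _ p)).coeff (-m) := by
    intro p m
    rw [<-mul_one (atZero _), <-mul_one (atInfty _), cf_map_mul atZero atZero_C atZero_X, cf_map_mul atInfty inf_C inf_X]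
    grind [coeff_one]
  have hD : ∀ m, ∑ k ∈ range (q.natDegree + 1), q.coeff k * (expandZero f (m - k) - expandInfty f (m - k)) = 0 := by
    intro m; have h1 := e f.num m
    rw [<-h, map_mul, map_mul, cf_map_mul atZero atZero_C atZero_X, cf_map_mul atInfty inf_C inf_X, <-sub_eq_zero,
      <-sum_sub_distrib] at h1
    rw [<-h1]; refine sum_congr rfl fun k _ => ?_
    rw [mul_sub, <-cf_atZero, <-cf_inf, mul_one, mul_neg_one, neg_sub, sub_neg_eq_add, neg_add_eq_sub]
  have hq0 : q.coeff 0 ≠ 0 := by rwa [Polynomial.coeff_zero_eq_eval_zero]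
  refine ⟨pC (q.coeff 0)⁻¹ * q.reverse, ?_, Kills.mul (fun m => ?_) _⟩
  . rw [Polynomial.Monic, Polynomial.leadingCoeff_mul, Polynomial.leadingCoeff_C, Polynomial.reverse_leadingCoeff,
      Polynomial.trailingCoeff, (Polynomial.natTrailingDegree_eq_zero (p := q)).mpr (Or.inr hq0), inv_mul_cancel₀ hq0]
  . rw [sum_over_range' _ (by simp) (q.natDegree + 1) (Nat.lt_succ_of_le q.reverse_natDegree_le), <-hD (m + q.natDegree),
      <-Finset.sum_range_reflect]
    refine sum_congr rfl fun k hk => ?_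
    rw [mem_range] at hk; rw [coeff_reverse, revAt_le (by omega), smul_eq_mul]; grind

end Expansions

end

section

section PowerSubfield

variable {N : ℕ}

/-- The substitution of `z ^ N` for `z` in Laurent series. -/
def powVar (hN : 0 < N) : LS →+* LS := HahnSeries.embDomainRingHom (AddMonoidHom.mulLeft N)
    (fun a b h => by simpa [hN.ne'] using h) (fun a b => by simp [hN])

lemma cf_powVar (hN : 0 < N) (x : LS) {m : ℤ} (hm : ¬ (N : ℤ) ∣ m) : (powVar hN x).coeff m = 0 :=
  HahnSeries.embDomain_of_notMem_range fun ⟨k, hk⟩ => hm ⟨k, hk.symm⟩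

lemma powVar_sgl (hN : 0 < N) (k c) : powVar hN (single k c) = single (N * k) c := HahnSeries.embDomain_single

def powSub (hN : 0 < N) : Subfield (RF) := (powVar hN).fieldRange.comap atZero ⊓ (powVar hN).fieldRange.comap atInfty

lemma C_in_powSub (hN : 0 < N) (c) : RC c ∈ powSub hN := ⟨⟨single 0 c, by rw [atZero_C, powVar_sgl, mul_zero]; rfl⟩,
    ⟨single 0 c, by rw [inf_C, powVar_sgl, mul_zero]; rfl⟩⟩

lemma X_pow_in_powSub (hN : 0 < N) : Rx ^ N ∈ powSub hN :=
  ⟨⟨single 1 1, by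
    rw [map_pow, atZero_X, powVar_sgl, HahnSeries.single_pow, one_pow, nsmul_eq_mul]⟩,
    ⟨single (-1) 1, by
    rw [map_pow, inf_X, powVar_sgl, HahnSeries.single_pow, one_pow, nsmul_eq_mul]⟩⟩

lemma expandZero_zero {hN : 0 < N} {f : RF} (hf : f ∈ powSub hN) {m : ℤ} (hm : ¬ (N : ℤ) ∣ m) :
    expandZero f m = 0 := by
  obtain ⟨x, hx⟩ := hf.1; rw [<-cf_atZero, <-hx, cf_powVar hN x hm]

lemma expInf_zero {hN : 0 < N} {f : RF} (hf : f ∈ powSub hN) {m : ℤ} (hm : ¬ (N : ℤ) ∣ m) :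
    expandInfty f m = 0 := by
  obtain ⟨x, hx⟩ := hf.2; rw [<-cf_inf, <-hx, cf_powVar hN x fun h => hm ((dvd_neg).mp h)]

lemma dvd_intDegree {hN : 0 < N} {f} (hf : f ∈ powSub hN) (h0 : f ≠ 0) : (N : ℤ) ∣ f.intDegree := by
  by_contra h; have h1 := expInf_zero hf h; rw [<-cf_inf, <-order_inf h0] at h1
  exact h0 ((map_eq_zero _).mp (HahnSeries.coeff_order_eq_zero.mp h1))

end PowerSubfield

/-- Tuples of rational functions in `z ^ N_i` that are highest weights. -/
structure IsPowWt (O : X.I0 -> ℤ) (R : X.I0 -> RF) : Prop where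
  rational : IsRationalWeight O R
  mem : ∀ i, R i ∈ powSub (X.N_pos i)

namespace IsPowWt

variable {R R1 R2 : X.I0 -> RF}

lemma ne_zero (h : IsPowWt O R) (i) : R i ≠ 0 := fun h0 => (h.rational i).2.1 (by
  rw [h0, num_zero, eval_zero])

lemma isShift (h : IsPowWt O R) : X.IsShift O := fun i hi => by
  have := dvd_intDegree (h.mem i) (h.ne_zero i); rwa [(h.rational i).2.2, TwistedType.N, if_pos hi] at this

lemma mul (h1 : IsPowWt O1 R1) (h2 : IsPowWt O2 R2) : IsPowWt (O1 + O2) (R1 * R2) where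
  rational i := by
    obtain ⟨a1, a2, a3⟩ := h1.rational i; obtain ⟨b1, b2, b3⟩ := h2.rational i
    refine ⟨fun h => mul_ne_zero a1 b1 ?_, fun h => mul_ne_zero a2 b2 ?_, ?_⟩
    . rw [<-eval_mul]; exact eval_eq_zero_of_dvd_of_eval_eq_zero (RatFunc.denom_mul_dvd _ _) h
    . rw [<-eval_mul]; exact eval_eq_zero_of_dvd_of_eval_eq_zero (RatFunc.num_mul_dvd _ _) h
    . rw [Pi.mul_apply, RatFunc.intDegree_mul (h1.ne_zero i) (h2.ne_zero i), a3, b3, Pi.add_apply]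
  mem i := mul_mem (h1.mem i) (h2.mem i)

lemma inv (h : IsPowWt O R) : IsPowWt (-O) R⁻¹ where
  rational i := by
    obtain ⟨a1, a2, a3⟩ := h.rational i; refine ⟨fun h' => a2 ?_, fun h' => a1 ?_, ?_⟩
    . exact eval_eq_zero_of_dvd_of_eval_eq_zero (RatFunc.denom_inv_dvd (h.ne_zero i)) h'
    . exact eval_eq_zero_of_dvd_of_eval_eq_zero (RatFunc.num_inv_dvd (h.ne_zero i)) h'
    . rw [Pi.inv_apply, RatFunc.intDegree_inv, a3, Pi.neg_apply]
  mem i := inv_mem (h.mem i)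

lemma const (g : X.I0 -> ℂˣ) : IsPowWt (X := X) 0 fun i => RC (g i : ℂ) where
  rational i := ⟨by simp, by simp, by simp⟩
  mem i := C_in_powSub _ _

lemma pref (i a) :
    IsPowWt (fun j => (prefWeight X i a j).intDegree) (prefWeight X i a) where
  rational j := by
    refine ⟨?_, ?_, rfl⟩ <;> rw [prefWeight] <;> split_ifs
    . have : (1 - (RC (a : ℂ) * Rx) ^ X.N i : RF) = aM _ _ (1 - (pC (a : ℂ) * pX) ^ X.N i) := by simp
      rw [this, RatFunc.denom_algebraMap]; simp
    . simp
    . have : (1 - (RC (a : ℂ) * Rx) ^ X.N i : RF) = aM _ _ (1 - (pC (a : ℂ) * pX) ^ X.N i) := by simp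
      rw [this, RatFunc.num_algebraMap]; simp [(X.N_pos i).ne']
    . simp
  mem j := by
    rw [prefWeight]; split_ifs with h
    . subst h; rw [mul_pow]
      exact sub_mem (one_mem _) (mul_mem (pow_mem (C_in_powSub _ _) _) (X_pow_in_powSub _))
    . exact one_mem _

/-- The expansions of a tuple of rational functions. -/
def toLWt (h : IsPowWt O R) : LWeight X O where
  psi J i m := if J = 1 then expandZero (R i) m else expandInfty (R i) m
  dvd J i r hr := by
    split_ifs
    . exact expandZero_zero (h.mem i) hr
    . exact expInf_zero (h.mem i) hr
  van J i r hr := by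
    obtain ⟨a1, a2, a3⟩ := h.rational i; rcases units_eq_one_or J with rfl | rfl
    . rw [if_pos rfl, <-cf_atZero]; refine coeff_eq_zero_of_lt_order ?_; rw [order_atZero a1 a2]
      simpa [leadIdx] using hr
    . rw [if_neg (by decide), <-cf_inf]; refine coeff_eq_zero_of_lt_order ?_
      rw [order_inf (h.ne_zero i), a3]; simpa [leadIdx] using hr
  lead_ne J i := by
    obtain ⟨a1, a2, a3⟩ := h.rational i; rcases units_eq_one_or J with rfl | rfl
    . rw [if_pos rfl, <-cf_atZero]
      have e : ℓ O 1 i = (atZero (R i)).order := by rw [order_atZero a1 a2]; simp [leadIdx]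
      rw [e, Ne, coeff_order_eq_zero, map_eq_zero]; exact h.ne_zero i
    . rw [if_neg (by decide), <-cf_inf]
      have e : -ℓ O (-1) i = (atInfty (R i)).order := by rw [order_inf (h.ne_zero i), a3]; simp [leadIdx]
      rw [e, Ne, coeff_order_eq_zero, map_eq_zero]; exact h.ne_zero i

lemma isExpansion (h : IsPowWt O R) : IsExpansion h.toLWt R := fun i m => by
  refine ⟨?_, ?_⟩ <;> dsimp only [toLWt]
  . rw [if_pos rfl]
  . rw [if_neg (by decide)]

lemma rational_toLWt (h : IsPowWt O R) : h.toLWt.Rational := fun i => by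
  obtain ⟨p, hp, hk⟩ := kills_expand (R i) (h.rational i).1; refine ⟨p, hp, ?_⟩
  simpa only [(h.isExpansion i _).1, (h.isExpansion i _).2] using hk

end IsPowWt

lemma IsExpansion.mul {Ψ1 : LWeight X O1} {Ψ2 : LWeight X O2} {R1 R2 : X.I0 -> RF} (h1 : IsExpansion Ψ1 R1)
    (h2 : IsExpansion Ψ2 R2) : IsExpansion (Ψ1.mul Ψ2) (R1 * R2) := fun i m => by
  constructor
  . have h0 : ∀ n, n ∉ uIcc (ℓ O2 1 i) (m - ℓ O1 1 i) -> Ψ1.psi 1 i (m - n) * Ψ2.psi 1 i n = 0 := fun n => Ψ1.mul_eq_zero Ψ2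
    rw [Ψ1.mul_psi Ψ2 _ h0, <-cf_atZero, Pi.mul_apply, mul_comm, map_mul, cf_mul_sum]
    . exact sum_congr rfl fun n _ => by rw [(h1 i _).1, (h2 i _).1, mul_comm]; rfl
    . intro n hn; have := h0 n hn; rwa [(h1 i _).1, (h2 i _).1, mul_comm] at this
  . have h0 : ∀ n, n ∉ uIcc (ℓ O2 (-1) i) (m - ℓ O1 (-1) i) ->
        Ψ1.psi (-1) i (m - n) * Ψ2.psi (-1) i n = 0 := fun n => Ψ1.mul_eq_zero Ψ2
    have e : ∀ n, Ψ1.psi (-1) i (m - n) * Ψ2.psi (-1) i n = (atInfty (R2 i)).coeff (-n) * (atInfty (R1 i)).coeff (-m - -n) := fun n => by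
      rw [(h1 i _).2, (h2 i _).2, mul_comm, <-cf_inf, <-cf_inf]; congr 2; ring
    rw [Ψ1.mul_psi Ψ2 _ h0, <-cf_inf, Pi.mul_apply, mul_comm, map_mul,
      cf_mul_sum ((uIcc (ℓ O2 (-1) i) (m - ℓ O1 (-1) i)).map (Equiv.neg ℤ).toEmbedding)]
    . rw [Finset.sum_map]; exact sum_congr rfl fun n _ => e n
    . intro n hn; have := e (-n); rw [neg_neg] at this; rw [<-this]
      refine h0 _ fun hn' => hn (Finset.mem_map.mpr ⟨-n, hn', neg_neg n⟩)

end

section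

section Factorization

variable {N : ℕ}

/-- The factors of a rational function in `z ^ N`. -/
def powFactor (N : ℕ) (a : ℂˣ) (s : Bool) : RF :=
  if s then 1 - (RC (a : ℂ) * Rx) ^ N else (1 - (RC (a : ℂ) * Rx) ^ N)⁻¹

lemma ex_fact (hN : 0 < N) (Q : Polynomial ℂ) (h0 : Q.coeff 0 ≠ 0) : ∃ (c : ℂˣ) (l : List ℂˣ),
    aM _ (RF) (expand ℂ N Q) = RC (c : ℂ) * (l.map fun a => powFactor N a true).prod := by
  induction hn : Q.natDegree generalizing Q with
  | zero =>
    rw [Polynomial.eq_C_of_natDegree_eq_zero hn]; exact ⟨mk0 _ h0, [], by simp⟩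
  | succ n ih =>
    obtain ⟨r, hr⟩ := IsAlgClosed.exists_root Q (by
      rw [Polynomial.degree_eq_natDegree (fun h => h0 (by rw [h]; rfl)), hn]; exact_mod_cast n.succ_ne_zero)
    obtain ⟨Q', rfl⟩ := Polynomial.dvd_iff_isRoot.mpr hr; rw [Polynomial.mul_coeff_zero] at h0
    have hr0 : r ≠ 0 := fun h => by simp [h] at h0
    have hQ' : Q' ≠ 0 := fun h => by simp [h] at h0
    rw [Polynomial.natDegree_mul (Polynomial.X_sub_C_ne_zero r) hQ', Polynomial.natDegree_X_sub_C] at hn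
    obtain ⟨c, l, h⟩ := ih Q' (right_ne_zero_of_mul h0) (by omega); obtain ⟨a, ha⟩ := IsAlgClosed.exists_pow_nat_eq r⁻¹ hN
    have ha0 : a ≠ 0 := fun h => by rw [h, zero_pow hN.ne'] at ha; exact inv_ne_zero hr0 ha.symm
    refine ⟨c * mk0 (-r) (neg_ne_zero.mpr hr0), mk0 a ha0 :: l, ?_⟩
    have e : RC r * RC r⁻¹ = (1 : RF) := by rw [<-map_mul, mul_inv_cancel₀ hr0, map_one]
    rw [map_mul, map_mul, h, List.map_cons, List.prod_cons, powFactor, if_pos rfl, map_sub, expand_X,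
      expand_C, map_sub, map_pow, algebraMap_X, algebraMap_C, val_mul, val_mk0,
      val_mk0, mul_pow, <-map_pow, ha, map_mul, map_neg]
    linear_combination (-RC (c : ℂ) * Rx ^ N * (l.map fun a => powFactor N a true).prod) * e

lemma ex_powFactor (hN : 0 < N) {u v : ℤ -> ℂ} {d : ℤ} (hu : ∀ m < 0, u m = 0) (hu0 : u 0 ≠ 0)
    (hv : ∀ m, d < m -> v m = 0) (hud : ∀ m, ¬ (N : ℤ) ∣ m -> u m = 0) {p : Polynomial ℂ} (hp : p ≠ 0)
    (hk : ∀ m, ∑ k ∈ range (p.natDegree + 1), p.coeff k * (u (m + N * k) - v (m + N * k)) = 0) :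
    ∃ (c : ℂˣ) (l : List (ℂˣ × Bool)), ∀ m, expandZero (RC (c : ℂ) * (l.map fun a => powFactor N a.1 a.2).prod) m = u m ∧
      expandInfty (RC (c : ℂ) * (l.map fun a => powFactor N a.1 a.2).prod) m = v m := by
  set B := p.reverse with hB
  have hB0 : B.coeff 0 ≠ 0 := by rw [hB, Polynomial.coeff_zero_reverse]; exact Polynomial.leadingCoeff_ne_zero.mpr hp
  let F : (ℤ -> ℂ) -> ℤ -> ℂ := fun f m => ∑ k ∈ range (B.natDegree + 1), B.coeff k * f (m - N * k)
  have hF : F u = F v := by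
    funext m; rw [<-sub_eq_zero]; simp only [F]; rw [<-sum_sub_distrib]
    have e : ∀ k, B.coeff k * u (m - N * k) - B.coeff k * v (m - N * k) = B.coeff k * (u (m - N * k) - v (m - N * k)) := fun k => by ring
    rw [sum_congr rfl fun k _ => e k, <-sum_over_range B (f := fun k c => c * (u (m - N * k) - v (m - N * k))) (by simp),
      sum_over_range' B (by simp) (p.natDegree + 1) (Nat.lt_succ_of_le p.reverse_natDegree_le),
      <-hk (m - N * p.natDegree), <-Finset.sum_range_reflect]
    refine sum_congr rfl fun k hk => ?_
    rw [mem_range] at hk; rw [hB, coeff_reverse, revAt_le (by omega), show p.natDegree - (p.natDegree + 1 - 1 - k) = k by omega]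
    have : m - N * ((p.natDegree + 1 - 1 - k : ℕ) : ℤ) = m - N * p.natDegree + N * k := by
      rw [show ((p.natDegree + 1 - 1 - k : ℕ) : ℤ) = p.natDegree - k by omega]; ring
    rw [this]
  have hF1 : ∀ m < 0, F u m = 0 := fun m hm => sum_eq_zero fun k _ => by
    have : 0 ≤ (N : ℤ) * k := by positivity
    rw [hu _ (by omega), mul_zero]
  have hF2 : ∀ m, d + N * B.natDegree < m -> F u m = 0 := fun m hm => by
    rw [hF]; refine sum_eq_zero fun k hk => ?_
    rw [mem_range] at hk; have : (N : ℤ) * k ≤ N * B.natDegree := by gcongr; omega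
    rw [hv _ (by omega), mul_zero]
  have hF3 : ∀ m, ¬ (N : ℤ) ∣ m -> F u m = 0 := fun m hm => sum_eq_zero fun k _ => by
    rw [hud _ fun h => hm ((dvd_sub_left (Dvd.intro _ rfl)).mp h), mul_zero]
  let A : Polynomial ℂ := ∑ j ∈ range ((d + N * B.natDegree).toNat + 1), Polynomial.monomial j (F u (N * j))
  have hA : ∀ j, A.coeff j = F u (N * j) := fun j => by
    simp only [A, Polynomial.finsetSum_coeff, Polynomial.coeff_monomial]; rw [Finset.sum_ite_eq']; split_ifs with h
    . rfl
    . rw [mem_range, not_lt] at h; refine (hF2 _ ?_).symm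
      have : (j : ℤ) ≤ N * j := le_mul_of_one_le_left (by omega) (by omega); omega
  have hA0 : A.coeff 0 ≠ 0 := by
    rw [hA]; simp only [F]; rw [Finset.sum_eq_single_of_mem 0 (by simp)]
    . simpa using mul_ne_zero hB0 hu0
    . intro k _ hk; have : 0 < (N : ℤ) * k := by positivity
      rw [hu _ (by simp; omega), mul_zero]
  have key : ∀ (E : RF →+* LS) (s : ℤ) (x : LS) (f : ℤ -> ℂ), s * s = 1 ->
      (∀ c, E (RC c) = HahnSeries.C c) -> E Rx = single s 1 -> (∀ m, x.coeff (s * m) = f m) -> F f = F u ->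
      E (aM _ _ (expand ℂ N A) / aM _ _ (expand ℂ N B)) = x := by
    intro E s x f hs hC hX hx hf; have hs0 : s ≠ 0 := fun h => by simp [h] at hs
    let w : Polynomial ℂ →+* LS := (E.comp (aM _ _)).comp (expand ℂ N).toRingHom
    have hφC : ∀ c, w (pC c) = HahnSeries.C c := fun c => by change E (aM _ _ (expand ℂ N (pC c))) = _; rw [expand_C, algebraMap_C, hC]
    have hφX : w pX = single (N * s) 1 := by
      change E (aM _ _ (expand ℂ N pX)) = _; rw [expand_X, map_pow, map_pow, algebraMap_X, hX, HahnSeries.single_pow, one_pow, nsmul_eq_mul]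
    have hB1 : aM _ (RF) (expand ℂ N B) ≠ 0 := by
      rw [Ne, map_eq_zero_iff _ (RatFunc.algebraMap_injective ℂ), Polynomial.expand_eq_zero hN]; exact fun h => hB0 (by rw [h]; rfl)
    rw [map_div₀, div_eq_iff ((map_ne_zero _).mpr hB1), mul_comm]; change w A = w B * x; ext m
    obtain ⟨m, rfl⟩ : ∃ m', m = s * m' := ⟨s * m, by rw [<-mul_assoc, hs, one_mul]⟩; rw [cf_poly_mul w hφC hφX]
    have e : ∀ k : ℕ, x.coeff (s * m - k * (N * s)) = f (m - N * k) := fun k => by rw [<-hx]; congr 1; ring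
    simp only [e]; change _ = F f m; rw [hf]; by_cases h : ∃ k : ℕ, m = N * k
    . obtain ⟨k, rfl⟩ := h; rw [<-hA, <-cf_poly w hφC hφX (mul_ne_zero (by omega) hs0) A k]; congr 1
      ring
    . rw [cf_poly_zero w hφC hφX]
      . symm; by_cases hm : (N : ℤ) ∣ m
        . obtain ⟨k, rfl⟩ := hm; refine hF1 _ (not_le.mp fun h0 => h ⟨k.toNat, ?_⟩)
          rw [Int.toNat_of_nonneg (nonneg_of_mul_nonneg_right h0 (by omega))]
        . exact hF3 m hm
      . intro k hk; refine h ⟨k, mul_left_cancel₀ hs0 (hk.trans (by ring))⟩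
  obtain ⟨c, l, hl⟩ := ex_fact hN A hA0; obtain ⟨c', l', hl'⟩ := ex_fact hN B hB0
  refine ⟨c * c'⁻¹, l.map (fun a => (a, true)) ++ l'.map (fun a => (a, false)), ?_⟩
  have e : RC ((c * c'⁻¹ : ℂˣ) : ℂ) * ((l.map (fun a => (a, true)) ++ l'.map (fun a => (a, false))).map fun a => powFactor N a.1 a.2).prod =
      aM _ (RF) (expand ℂ N A) / aM _ _ (expand ℂ N B) := by
    have h : (l'.map fun a => powFactor N a false).prod = ((l'.map fun a => powFactor N a true).prod)⁻¹ := by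
      rw [List.prod_inv, map_map]; rfl
    rw [hl, hl', List.map_append, map_map, map_map, List.prod_append, val_mul, map_mul, Units.val_inv_eq_inv_val,
      map_inv₀, div_eq_mul_inv, mul_inv, mul_mul_mul_comm, <-h]
    rfl
  intro m; rw [e, <-cf_atZero, <-cf_inf]; constructor
  . rw [key atZero 1 (toHahn u) u (by norm_num) atZero_C atZero_X (fun m => by rw [one_mul, cf_toHahn 0 hu]) rfl, cf_toHahn 0 hu]
  . have hv' : ∀ m < -d, (fun m => v (-m)) m = 0 := fun m hm => hv _ (by omega)
    rw [key atInfty (-1) (toHahn fun m => v (-m)) v (by norm_num) inf_C inf_X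
      (fun m => by rw [cf_toHahn _ hv', neg_one_mul]; exact congrArg v (neg_neg m)) hF.symm, cf_toHahn _ hv']
    exact congrArg v (neg_neg m)

end Factorization

end

section

namespace PtMod

variable (ht : t ≠ 0) (hq : Generic t)

def simpleOf {R : X.I0 -> RF} (h : IsPowWt O R) : PtMod X t O := simple ht hq h.isShift h.toLWt

lemma isL_simpleOf {R : X.I0 -> RF} (h : IsPowWt O R) : IsL (simpleOf ht hq h) R :=
  isL_simple ht hq h.isShift h.rational_toLWt h.rational h.isExpansion

lemma core_simpleOf {R : X.I0 -> RF} (h : IsPowWt O R) :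
    ((simpleOf ht hq h).rep ht hq h.isShift).Core (simpleOf ht hq h).vec h.toLWt :=
  simple_core ht hq h.isShift h.toLWt

lemma _root_.PreRep.Core.finrank_eq_one {V : Type*} [ACG V] [Module ℂ V] {P : PreRep X t O (End ℂ V)}
    {v : V} {e} (h : P.Core v e) (hΨ : ∀ i m, e.psi 1 i m = e.psi (-1) i m) : finrank ℂ V = 1 := by
  have h0 : ∀ i m, P.x (-1) i m v = 0 := fun i m => by
    refine h.span_inf (h.nonsing _ fun j s => ?_) (P.low_in_lowSpan i m v); obtain ⟨c, hc⟩ := P.x_x_apply j i s m v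
    rw [hc, h.raise, h.phi, h.phi, hΨ, sub_self, smul_zero, map_zero, zero_add]
  have hle : (⊤ : Submodule ℂ V) ≤ span ℂ {v} := by
    rw [<-h.gen]; refine P.iSup_filt_le (mem_span_singleton_self v) fun i m y hy => ?_
    obtain ⟨c, rfl⟩ := Submodule.mem_span_singleton.mp hy; rw [map_smul, h0, smul_zero]; exact zero_mem _
  exact _root_.finrank_eq_one v h.ne_zero fun y => Submodule.mem_span_singleton.mp (hle mem_top)

def constRp (g : X.I0 -> ℂˣ) : PtMod X t 0 := simpleOf ht hq (IsPowWt.const g)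

lemma isConstantRp_constRp (g : X.I0 -> ℂˣ) : IsConstantRep (constRp ht hq g) := by
  refine ⟨⟨g, isL_simpleOf ht hq (IsPowWt.const g)⟩, (core_simpleOf ht hq (IsPowWt.const g)).finrank_eq_one fun i m => ?_⟩
  rw [((IsPowWt.const g).isExpansion i m).1, ((IsPowWt.const g).isExpansion i m).2, <-cf_atZero, <-cf_inf,
    atZero_C, inf_C, C_apply]
  by_cases hm : m = 0
  . rw [hm, neg_zero]
  . rw [coeff_single_of_ne hm, coeff_single_of_ne (neg_ne_zero.mpr hm)]

def Reachable {κ} (K : PtMod X t κ) (R : X.I0 -> RF) : Prop :=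
  ∃ (O : X.I0 -> ℤ) (h : IsPowWt O R) (W : PtMod X t O) (L : List (Σ ν : X.I0 -> ℤ, PtMod X t ν)),
    (∀ P ∈ L, IsPrefundamental P.2) ∧ IsIteratedFusion K L W ∧
    ∃ e, IsExpansion e R ∧ (W.rep ht hq h.isShift).Good W.vec e

lemma reachable_const (g : X.I0 -> ℂˣ) : Reachable ht hq (constRp ht hq g) fun i => RC (g i : ℂ) :=
  ⟨0, IsPowWt.const g, constRp ht hq g, [], by simp, IsIteratedFusion.nil, _, (IsPowWt.const g).isExpansion,
    (core_simpleOf ht hq (IsPowWt.const g)).good ht (IsPowWt.const g).rational_toLWt⟩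

variable {κ : X.I0 -> ℤ} {K : PtMod X t κ} {R : X.I0 -> RF}

lemma Reachable.mul {ht : t ≠ 0} {hq : Generic t} (h : Reachable ht hq K R)
    {R' : X.I0 -> RF} (hR' : IsPowWt O R') (hp : IsPrefundamental (simpleOf ht hq hR')) :
    Reachable ht hq K (R * R') := by
  obtain ⟨ν, hR, W, L, hL, hW, e, hΨ, g⟩ := h; have c := core_simpleOf ht hq hR'
  refine ⟨ν + O, hR.mul hR', fusion ht hq hR.isShift hR'.isShift (hR.mul hR').isShift g c, L ++ [⟨O, simpleOf ht hq hR'⟩], ?_,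
    hW.snoc (isFusionProduct ht hq hR.isShift hR'.isShift (hR.mul hR').isShift g c
      (isHighest ht hq hR.isShift g.toHighest (fun d i => g.recurrence d i (-1)) hR.rational hΨ)
      (isL_simpleOf ht hq hR').1), _, hΨ.mul hR'.isExpansion,
    fusion_good ht hq hR.isShift hR'.isShift (hR.mul hR').isShift g c (c.good ht hR'.rational_toLWt)⟩
  intro P hP; rw [List.mem_append, List.mem_singleton] at hP; rcases hP with hP | rfl
  . exact hL P hP
  . exact hp

open Classical in
lemma Reachable.mul_mulSingle {ht : t ≠ 0} {hq : Generic t} (h : Reachable ht hq K R)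
    (i) (l : List (ℂˣ × Bool)) :
    Reachable ht hq K (R * Pi.mulSingle i (l.map fun a => powFactor (X.N i) a.1 a.2).prod) := by
  induction l with
  | nil => simpa using h
  | cons a l ih =>
    have e : R * Pi.mulSingle i ((a :: l).map fun a => powFactor (X.N i) a.1 a.2).prod =
        R * Pi.mulSingle i (l.map fun a => powFactor (X.N i) a.1 a.2).prod * Pi.mulSingle i (powFactor (X.N i) a.1 a.2) := by
      rw [List.map_cons, List.prod_cons, Pi.mulSingle_mul]; ring
    have e' : prefWeight X i a.1 = Pi.mulSingle i (powFactor (X.N i) a.1 true) := by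
      funext j; rw [prefWeight, powFactor, if_pos rfl]; by_cases h : j = i
      . subst h; rw [if_pos rfl, Pi.mulSingle_eq_same]
      . rw [if_neg h, Pi.mulSingle_eq_of_ne h]
    rw [e]; obtain ⟨a, s⟩ := a; cases s with
    | true =>
      rw [<-e']; exact ih.mul (IsPowWt.pref i a) ⟨i, a, Or.inl (isL_simpleOf ht hq _)⟩
    | false =>
      have e2 : Pi.mulSingle i (powFactor (X.N i) a false) = (prefWeight X i a)⁻¹ := by
        rw [e']; funext j; rw [Pi.inv_apply]; by_cases h : j = i
        . subst h; rw [Pi.mulSingle_eq_same, Pi.mulSingle_eq_same]; rfl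
        . rw [Pi.mulSingle_eq_of_ne h, Pi.mulSingle_eq_of_ne h, inv_one]
      rw [e2]; exact ih.mul (IsPowWt.pref i a).inv ⟨i, a, Or.inr (isL_simpleOf ht hq _)⟩

lemma reachable_of_factors (g : X.I0 -> ℂˣ) (l : X.I0 -> List (ℂˣ × Bool)) :
    Reachable ht hq (constRp ht hq g) fun i => RC (g i : ℂ) * ((l i).map fun a => powFactor (X.N i) a.1 a.2).prod := by
  classical
  have key : ∀ s : Finset X.I0, Reachable ht hq (constRp ht hq g)
      ((fun i => RC (g i : ℂ)) * ∏ i ∈ s, Pi.mulSingle i ((l i).map fun a => powFactor (X.N i) a.1 a.2).prod) := by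
    intro s; induction s using Finset.induction_on with
    | empty =>
      rw [Finset.prod_empty, mul_one]; exact reachable_const ht hq g
    | insert a s ha ih =>
      rw [prod_insert ha, mul_left_comm, mul_comm]; exact ih.mul_mulSingle a (l a)
  have := key univ; rwa [Finset.univ_prod_mulSingle] at this

end PtMod

end

section

lemma ex_com_eigenvec {I V : Type*} [ACG V] [Module ℂ V] (T : I -> End ℂ V)
    (hT : ∀ i j, T i * T j = T j * T i) (Z : Submodule ℂ V) [FiniteDimensional ℂ Z] (hZ : Z ≠ ⊥)
    (h : ∀ i, ∀ y ∈ Z, T i y ∈ Z) : ∃ v ∈ Z, v ≠ 0 ∧ ∀ i, ∃ c : ℂ, T i v = c • v := by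
  induction hn : finrank ℂ Z using strong_induction_on generalizing Z with
  | _ n ih =>
    by_cases hs : ∀ i, ∃ c : ℂ, ∀ y ∈ Z, T i y = c • y
    . obtain ⟨v, hv, h0⟩ := Submodule.exists_mem_ne_zero_of_ne_bot hZ
      exact ⟨v, hv, h0, fun i => (hs i).imp fun c hc => hc v hv⟩
    . push Not at hs
      obtain ⟨i, hi⟩ := hs; have : Nontrivial Z := (Submodule.nontrivial_iff_ne_bot).mpr hZ
      obtain ⟨c, hc⟩ := Module.End.exists_eigenvalue ((T i).restrict (h i))
      obtain ⟨y, hy⟩ := hc.exists_hasEigenvector; obtain ⟨z, hz, hzc⟩ := hi c; have hle : Z ⊓ eigenspace (T i) c ≤ Z := inf_le_left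
      have hlt : Z ⊓ eigenspace (T i) c < Z := lt_of_le_of_ne hle fun e =>
        hzc (Module.End.mem_eigenspace_iff.mp (e.ge hz).2)
      have : FiniteDimensional ℂ ↥(Z ⊓ eigenspace (T i) c) := finiteDimensional_of_le hle
      obtain ⟨v, hv, h0⟩ := ih _ (hn ▸ Submodule.finrank_lt_finrank_of_lt hlt) (Z ⊓ eigenspace (T i) c)
        ((ne_bot_iff _).mpr ⟨y, ⟨y.2, Module.End.mem_eigenspace_iff.mpr
          (congrArg Subtype.val hy.apply_eq_smul)⟩, fun e => hy.2 (Subtype.ext e)⟩)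
        (fun j z hz => ⟨h j z hz.1, by
          have h1 := hz.2; simp only [mem_coe, mem_eigenspace_iff] at h1 ⊢; rw [<-mul_apply, hT, mul_apply, h1, map_smul]⟩) rfl
      exact ⟨v, hv.1, h0⟩

lemma ex_poly_rel {V : Type*} [ACG V] [Module ℂ V] (Z : Submodule ℂ V) [FiniteDimensional ℂ Z]
    (f : ℕ -> V) (hf : ∀ k, f k ∈ Z) : ∃ p : Polynomial ℂ, p ≠ 0 ∧ ∑ k ∈ range (p.natDegree + 1), p.coeff k • f k = 0 := by
  let e := (Polynomial.basisMonomials ℂ).constr ℂ (fun k => (⟨f k, hf k⟩ : Z))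
  have hφ : ¬ Function.Injective e := fun h => Polynomial.not_finite (R := ℂ) (Module.Finite.of_injective e h)
  rw [<-ker_eq_bot, Submodule.eq_bot_iff] at hφ
  push Not at hφ
  obtain ⟨p, hp, h0⟩ := hφ; refine ⟨p, h0, ?_⟩
  have h1 : e p = ∑ k ∈ range (p.natDegree + 1), p.coeff k • (⟨f k, hf k⟩ : Z) := by
    conv_lhs => rw [p.as_sum_range, map_sum]
    refine sum_congr rfl fun k _ => ?_
    rw [<-mul_one (p.coeff k), <-smul_eq_mul, <-Polynomial.smul_monomial, map_smul, smul_eq_mul, mul_one,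
      <-congrFun (Polynomial.coe_basisMonomials ℂ) k, Module.Basis.constr_basis]
  have h2 := congrArg Subtype.val (h1.symm.trans (LinearMap.mem_ker.mp hp)); simpa using h2

lemma smul_in_hull (ht : t ≠ 0) (hq : Generic t) (hμ : X.IsShift O)
    {M : Type*} [ACG M] [Module ℂ M] [Module (SA X t O) M]
    [IsScalarTower ℂ (SA X t O) M] {v : M} {e : LWeight X O}
    (hraise : ∀ i m, (modRp ht hq hμ M).x 1 i m v = 0)
    (hphi : ∀ J i r, (modRp ht hq hμ M).phi J i r v = e.psi J i r • v) (a : SA X t O) {y : M}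
    (hy : y ∈ (modRp ht hq hμ M).hull (span ℂ {v})) :
    a • y ∈ (modRp ht hq hμ M).hull (span ℂ {v}) := by
  set P := modRp ht hq hμ M
  have hr : ∀ i m, ∀ z ∈ span ℂ {v}, P.x 1 i m z = 0 := fun i m z hz => by
    obtain ⟨c, rfl⟩ := Submodule.mem_span_singleton.mp hz; simp_all
  have hp : ∀ J i r, ∀ z ∈ span ℂ {v}, P.phi J i r z ∈ span ℂ {v} := fun J i r z hz => by
    obtain ⟨c, rfl⟩ := Submodule.mem_span_singleton.mp hz; rw [map_smul, hphi]
    exact smul_mem _ _ (smul_mem _ _ (mem_span_singleton_self v))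
  have hi : ∀ J i, ∀ z ∈ span ℂ {v}, P.inv J i z ∈ span ℂ {v} := fun J i z hz => by
    obtain ⟨c, rfl⟩ := Submodule.mem_span_singleton.mp hz; have h1 := congrL (P.inv_lead J i) v
    rw [mul_apply, hphi, map_smul, Module.End.one_apply] at h1; rw [map_smul, <-inv_smul_smul₀ (e.lead_ne J i) (P.inv J i v), h1]
    exact smul_mem _ _ (smul_mem _ _ (mem_span_singleton_self v))
  refine smul_in_of_gens ht hq _ (fun J i m z hz => ?_) (fun J i m z hz => P.phi_in_hull hp J i m hz)
    (fun J i z hz => P.inv_in_hull ht hi J i hz) a hy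
  rcases units_eq_one_or J with rfl | rfl
  . exact P.raise_in_hull hr hp i m hz
  . exact P.low_in_hull _ i m hz

namespace InCategoryO

variable (ht : t ≠ 0) (hq : Generic t) (hμ : X.IsShift O)
  {S : Type*} [ACG S] [Module ℂ S] [Module (SA X t O) S]
  [IsScalarTower ℂ (SA X t O) S]

def shiftWt (ht : t ≠ 0) (w : Weight X) (n : X.I0 -> ℕ) : Weight X := fun i =>
  w i * ∏ j, (mk0 (t ^ 2) (pow_ne_zero 2 ht) ^ X.symCartan j i) ^ n j

lemma coe_shiftWt (w : Weight X) (n : X.I0 -> ℕ) (i) :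
    (shiftWt ht w n i : ℂ) = w i * ∏ j, ((t ^ 2) ^ X.symCartan j i) ^ n j := by
  simp [shiftWt]

lemma in_wtSpacePlus {w : Weight X} {y : S} :
    y ∈ weightSpacePlus X t O S w ↔ ∀ i, (modRp ht hq hμ S).phi 1 i (ℓ O 1 i) y = (w i : ℂ) • y := by
  have e1 : ∀ i, ℓ O 1 i = 0 := fun i => by simp [leadIdx]
  simp only [weightSpacePlus, mem_iInf, mem_eigenspace_iff, e1]; rfl

lemma raise_in_wtSpace {w : Weight X} {n : X.I0 -> ℕ} {y : S}
    (hy : y ∈ weightSpacePlus X t O S (shiftWt ht w n)) (j m) :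
    (modRp ht hq hμ S).x 1 j m y ∈ weightSpacePlus X t O S (shiftWt ht w (n + Pi.single j 1)) := by
  classical
  rw [in_wtSpacePlus ht hq hμ] at hy ⊢; intro i; rw [PreRep.lead_x _ ht, hy, map_smul, smul_smul]
  congr 1; simp only [coe_shiftWt, Pi.add_apply, pow_add, prod_mul_distrib]
  rw [Finset.prod_eq_single_of_mem (f := fun x => ((t ^ 2) ^ X.symCartan x i) ^
    (Pi.single j 1 : X.I0 -> ℕ) x) j (mem_univ j) (fun b _ hb => by simp [hb])]
  simp only [Pi.single_eq_same, pow_one, val_one, one_mul, X.symCartan_symm j i]; ring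

lemma exists_maximal (hO : InCategoryO X t O S) [Nontrivial S] :
    ∃ w, weightSpacePlus X t O S w ≠ ⊥ ∧ ∀ y ∈ weightSpacePlus X t O S w, ∀ i m, (modRp ht hq hμ S).x 1 i m y = 0 := by
  classical
  have hex : ∃ w, weightSpacePlus X t O S w ≠ ⊥ := by
    by_contra! h
    have h1 := hO.decompPlus.submodule_iSup_eq_top
    simp_all [show weightSpacePlus X t O S = fun _ => ⊥ from funext h, iSup_bot]
  obtain ⟨w, hω⟩ := hex; obtain ⟨F, hF⟩ := hO.bounded; let A : Set (X.I0 -> ℕ) := {n | weightSpacePlus X t O S (shiftWt ht w n) ≠ ⊥}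
  have hB : ∀ ω0 : Weight X, ∃ B, ∀ k : X.I0 -> ℕ, shiftWt ht w k = ω0 -> ∑ i, k i ≤ B := fun ω0 => by
    by_cases h : ∃ k, shiftWt ht w k = ω0
    . obtain ⟨k, hk⟩ := h; refine ⟨∑ i, k i, fun k' hk' => le_of_eq ?_⟩
      have : k' = k := PreRep.wt_inj ht hq 1 fun i => by
        have h1 := congrArg (Units.val) (congrFun (hk'.trans hk.symm) i)
        rw [coe_shiftWt, coe_shiftWt] at h1; simp_all [val_one, one_mul, X.symCartan_symm i]
      rw [this]
    simp_all
  choose B hB using hB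
  have hA : BddAbove ((fun n => ∑ i, n i) '' A) := by
    refine ⟨∑ ω0 ∈ F, B ω0, ?_⟩; rintro _ ⟨n, hn, rfl⟩; obtain ⟨ω0, h0, k, hk⟩ := hF _ (Or.inl hn)
    have h1 := hB ω0 (n + k) (funext fun i => Units.ext (by
      simp [hk i, coe_shiftWt, Pi.add_apply, pow_add, prod_mul_distrib, mul_assoc]))
    simp only [Pi.add_apply, sum_add_distrib] at h1
    exact (Nat.le_add_right _ _).trans (h1.trans (Finset.single_le_sum (f := B) (fun _ _ => Nat.zero_le _) h0))
  have hne : (0 : X.I0 -> ℕ) ∈ A := by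
    have : shiftWt ht w 0 = w := funext fun i => by simp [shiftWt]
    change weightSpacePlus X t O S (shiftWt ht w 0) ≠ ⊥; rwa [this]
  obtain ⟨n, hn, hmax⟩ := Nat.sSup_mem (Set.Nonempty.image _ ⟨0, hne⟩) hA; refine ⟨_, hn, fun y hy i m => ?_⟩; by_contra h0
  have h1 : n + Pi.single i 1 ∈ A := (ne_bot_iff _).mpr ⟨_, raise_in_wtSpace ht hq hμ hy i m, h0⟩
  have h2 := le_csSup hA (Set.mem_image_of_mem _ h1); rw [<-hmax] at h2; simp [sum_add_distrib] at h2

lemma ex_hw (hO : InCategoryO X t O S) (hS : IsSimpleModule (SA X t O) S) :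
    ∃ (v : S) (e : LWeight X O), (modRp ht hq hμ S).Highest v e := by
  have : Nontrivial S := IsSimpleModule.nontrivial (SA X t O) S
  set P := modRp ht hq hμ S with hP; obtain ⟨w, hω, hraise⟩ := hO.exists_maximal ht hq hμ; have := hO.finitePlus w
  obtain ⟨v, hv, h0, hc⟩ := ex_com_eigenvec (fun a : ℤˣ × X.I0 × ℤ => P.phi a.1 a.2.1 a.2.2)
    (fun a b => P.phi_comm _ _ _ _ _ _) _ hω (fun a y hy => by
      rw [in_wtSpacePlus ht hq hμ] at hy ⊢; intro i; rw [<-mul_apply, <-hP, P.phi_comm, mul_apply, hy, map_smul])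
  choose p hψ using hc
  have hz : ∀ J i r, P.phi J i r = 0 -> p (J, i, r) = 0 := fun J i r h => by
    have := hψ (J, i, r); rw [h, zeroL, eq_comm, smul_eq_zero] at this; exact this.resolve_right h0
  let e : LWeight X O := {
      psi := fun J i r => p (J, i, r)
      dvd := fun J i r h => hz J i r (P.phi_dvd J i r h)
      van := fun J i r h => hz J i r (P.phi_van J i r h)
      lead_ne := fun J i h => h0 (by
        have h1 := hψ (J, i, ℓ O J i); rw [h, zero_smul] at h1; have h2 := congrL (P.inv_lead J i) v; rw [mul_apply, h1, map_zero] at h2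
        exact h2.symm) }
  have hphi : ∀ J i r, P.phi J i r v = e.psi J i r • v := fun J i r => hψ (J, i, r)
  have hr := fun i m => hraise v hv i m
  refine ⟨v, e, PreRep.Highest.of_ne_zero ht hq h0 hr hphi ?_⟩
  let N : Submodule (SA X t O) S := { P.hull (span ℂ {v}) with smul_mem' := fun a y hy => smul_in_hull ht hq hμ hr hphi a hy }
  have hN : N = ⊤ := (eq_bot_or_eq_top N).resolve_left ((ne_bot_iff _).mpr
    ⟨v, P.le_hull _ (mem_span_singleton_self v), h0⟩)
  have h1 : P.hull (span ℂ {v}) ≤ ⨆ d, P.filt v d :=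
    P.hull_le (le_iSup (P.filt v) 0) fun i m y hy => by
      obtain ⟨d, hd⟩ := P.in_iSup_filt.mp hy; exact P.in_iSup_filt.mpr ⟨d + 1, P.low_in_filt hd i m⟩
  exact eq_top_iff.mpr fun y _ => h1 (hN.ge (mem_top : y ∈ (⊤ : Submodule (SA X t O) S)))

lemma exists_factors (hO : InCategoryO X t O S) {v : S} {e} (h : (modRp ht hq hμ S).Highest v e) :
    ∃ (g : X.I0 -> ℂˣ) (l : X.I0 -> List (ℂˣ × Bool)),
      IsExpansion e fun i => RC (g i : ℂ) * ((l i).map fun a => powFactor (X.N i) a.1 a.2).prod := by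
  classical
  suffices H : ∀ i, ∃ (c : ℂˣ) (l : List (ℂˣ × Bool)), ∀ m,
      expandZero (RC (c : ℂ) * (l.map fun a => powFactor (X.N i) a.1 a.2).prod) m = e.psi 1 i m ∧
      expandInfty (RC (c : ℂ) * (l.map fun a => powFactor (X.N i) a.1 a.2).prod) m = e.psi (-1) i m by
    choose g l hγ using H; exact ⟨g, l, fun i m => ⟨(hγ i m).1.symm, (hγ i m).2.symm⟩⟩
  intro i; set P := modRp ht hq hμ S; let w : Weight X := fun j => mk0 _ (PreRep.wtVal_ne ht e 1 (0 + Pi.single i 1) j)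
  have hx : ∀ m, P.x (-1) i m v ∈ weightSpacePlus X t O S w := fun m =>
    (in_wtSpacePlus ht hq hμ).mpr
      (P.low_in_wt ht (fun J j => by rw [h.phi]; simp [PreRep.wtVal]) i m 1)
  have := hO.finitePlus w; obtain ⟨p, hp, hsum⟩ := ex_poly_rel _ (fun k : ℕ => P.x (-1) i (X.N i * k) v) fun k => hx _
  have e1 : ℓ O 1 i = 0 := by simp [leadIdx]
  have e2 : ℓ O (-1) i = O i := by simp [leadIdx]
  refine ex_powFactor (d := O i) (X.N_pos i) (fun m hm => e.van 1 i m (by simp_all)) (e1 ▸ e.lead_ne 1 i)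
    (fun m hm => e.van (-1) i m (by simp_all)) (fun m hm => e.dvd 1 i m hm) hp fun m => ?_
  have h1 := congrArg (P.x 1 i m) hsum; rw [map_sum, map_zero] at h1
  have h2 : ∀ k : ℕ, P.x 1 i m (P.x (-1) i (X.N i * k) v) =
      (X.qi t i - (X.qi t i)⁻¹)⁻¹ • ((e.psi 1 i (m + X.N i * k) - e.psi (-1) i (m + X.N i * k)) • v) := fun k => by
    have h3 := congrL (P.x_x i i m (X.N i * k)) v
    rw [if_pos ⟨rfl, dvd_mul_right _ _⟩, subL, mul_apply, mul_apply, h.raise,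
      map_zero, sub_zero, smulL, subL, h.phi, h.phi, <-sub_smul] at h3
    exact h3
  have h4 : (X.qi t i - (X.qi t i)⁻¹)⁻¹ • (∑ k ∈ range (p.natDegree + 1),
      p.coeff k * (e.psi 1 i (m + X.N i * k) - e.psi (-1) i (m + X.N i * k))) • v = 0 := by
    rw [<-h1, sum_smul, smul_sum]; refine sum_congr rfl fun k _ => ?_
    rw [map_smul, h2, mul_smul, smul_comm]
  rw [smul_eq_zero, smul_eq_zero] at h4; exact (h4.resolve_left (inv_ne_zero (X.qi_sub_ne ht hq i))).resolve_right h.ne_zero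

end InCategoryO

end

section

lemma LWeight.shift_eq {μ' : X.I0 -> ℤ} {P : LWeight X O} {Ψ' : LWeight X μ'}
    (h : ∀ i m, P.psi (-1) i m = Ψ'.psi (-1) i m) : O = μ' := by
  have key : ∀ {O μ' : X.I0 -> ℤ} {P : LWeight X O} {Ψ' : LWeight X μ'},
      (∀ i m, P.psi (-1) i m = Ψ'.psi (-1) i m) -> ∀ i, O i ≤ μ' i := fun {O μ' P Ψ'} h i => by
    by_contra hlt; have e : ∀ O : X.I0 -> ℤ, ℓ O (-1) i = O i := fun O => by simp [leadIdx]
    have h1 := P.lead_ne (-1) i; rw [h, Ψ'.van] at h1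
    . exact h1 rfl
    . rw [e, e]; simp; omega
  exact funext fun i => le_antisymm (key h i) (key (fun i m => (h i m).symm) i)

lemma isSubqOf_of_in {R S W : Type*} [Ring R] [ACG S] [Module R S] [ACG W] [Module R W]
    [IsSimpleModule R S] (N : Submodule R (W × S)) {v : S} {w : W} (h0 : v ≠ 0) (hN : (w, v) ∈ N) (hv : (0, v) ∉ N) :
    IsSubquotientOf R S W := by
  have hker : N.comap (inr R W S) = ⊥ := (eq_bot_or_eq_top _).resolve_right fun e => hv (e.ge (mem_top : v ∈ _))
  let f := (LinearMap.fst R W S).comp N.subtype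
  have hf : Function.Injective f := by
    rw [<-ker_eq_bot, LinearMap.ker_eq_bot']; rintro ⟨⟨a, b⟩, hy⟩ h1; obtain rfl : a = 0 := h1
    have hb : b ∈ N.comap (inr R W S) := hy; rw [hker, Submodule.mem_bot] at hb; exact Subtype.ext (Prod.ext rfl hb)
  let k := ((LinearMap.snd R W S).comp N.subtype).comp (ofInjective f hf).symm.toLinearMap
  have hk : Function.Surjective k := by
    rw [<-LinearMap.range_eq_top]
    refine (eq_bot_or_eq_top _).resolve_left ((ne_bot_iff _).mpr
      ⟨v, ⟨ofInjective f hf ⟨_, hN⟩, ?_⟩, h0⟩)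
    simp [k]
  refine ⟨(ker k).map (LinearMap.range f).subtype, LinearMap.range f, Submodule.map_subtype_le _ _, ⟨?_⟩⟩
  rw [Submodule.submoduleOf, Submodule.comap_map_eq_of_injective (Submodule.subtype_injective _)]
  exact (k.quotKerEquivOfSurjective hk).symm

lemma PreRep.Highest.isSubqOf (ht : t ≠ 0) (hq : Generic t) (hμ : X.IsShift O)
    {S W : Type*} [ACG S] [Module ℂ S] [Module (SA X t O) S] [IsScalarTower ℂ (SA X t O) S]
    [ACG W] [Module ℂ W] [Module (SA X t O) W] [IsScalarTower ℂ (SA X t O) W]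
    [IsSimpleModule (SA X t O) S] {v : S} {w : W} {e}
    (h : (modRp ht hq hμ S).Highest v e) (g : (modRp ht hq hμ W).Highest w e) :
    IsSubquotientOf (SA X t O) S W := by
  set P := modRp ht hq hμ (W × S)
  have hx : ∀ J i m (y : W × S), P.x J i m y = ((modRp ht hq hμ W).x J i m y.1, (modRp ht hq hμ S).x J i m y.2) :=
    fun _ _ _ _ => rfl
  have hp : ∀ J i m (y : W × S), P.phi J i m y =
      ((modRp ht hq hμ W).phi J i m y.1, (modRp ht hq hμ S).phi J i m y.2) := fun _ _ _ _ => rfl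
  let N : Submodule (SA X t O) (W × S) := { P.hull (span ℂ {(w, v)}) with
      smul_mem' := fun a y hy => smul_in_hull ht hq hμ (e := e) (fun i m => by rw [hx, h.raise, g.raise]; rfl)
        (fun J i r => by rw [hp, h.phi, g.phi]; rfl) a hy }
  have hN : (w, v) ∈ N := P.le_hull _ (mem_span_singleton_self _)
  have hle : P.hull (span ℂ {(w, v)}) ≤
      span ℂ {(w, v)} ⊔ (modRp ht hq hμ W).lowSpan.prod (modRp ht hq hμ S).lowSpan :=
    P.hull_le le_sup_left fun i m y _ => mem_sup_right
      ⟨PreRep.low_in_lowSpan _ i m y.1, PreRep.low_in_lowSpan _ i m y.2⟩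
  have hv : (0, v) ∉ N := fun hmem => by
    obtain ⟨a, ha, b, hb, hab⟩ := Submodule.mem_sup.mp (hle hmem)
    obtain ⟨c, rfl⟩ := Submodule.mem_span_singleton.mp ha; have e1 : c • w + b.1 = 0 := congrArg Prod.fst hab
    have e2 : c • v + b.2 = v := congrArg Prod.snd hab
    have hc : c = 0 := by
      by_contra hc; refine g.notMem ((smul_mem_iff _ hc).mp ?_); rw [eq_neg_of_add_eq_zero_left e1]; exact Submodule.neg_mem _ hb.1
    rw [hc, zero_smul, zero_add] at e2; exact h.notMem (e2 ▸ hb.2)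
  exact isSubqOf_of_in N h.ne_zero hN hv

end

end

/-- `t` is a choice of the square root of `q` that occurs in the definition of the algebras. -/
theorem corollary5p9 (X : TwistedType) (q t : ℂ) (hq0 : q ≠ 0)
    (hq : ∀ n : ℕ, 0 < n → q ^ n ≠ 1) (ht : t ^ 2 = q)
    (μ : X.I0 → ℤ) (hμ : X.IsShift μ)
    (S : Type*) [AddCommGroup S] [Module ℂ S] [Module (ShiftedAlgebra X t μ) S]
    [IsScalarTower ℂ (ShiftedAlgebra X t μ) S]
    (hO : InCategoryO X t μ S) (hS : IsSimpleModule (ShiftedAlgebra X t μ) S) :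
    ∃ (κ : X.I0 → ℤ) (K : PtMod X t κ) (L : List (Σ ν : X.I0 → ℤ, PtMod X t ν))
      (W : PtMod X t μ),
      IsConstantRep K ∧ (∀ P ∈ L, IsPrefundamental P.2) ∧
      IsIteratedFusion K L W ∧ InCategoryO X t μ W.carrier ∧
      IsSubquotientOf (ShiftedAlgebra X t μ) S W.carrier := by
  subst ht
  have ht : t ≠ 0 := fun h => hq0 (by rw [h]; norm_num)
  obtain ⟨v, Ψ, h⟩ := hO.ex_hw ht hq hμ hS
  obtain ⟨γ, l, hΨ⟩ := hO.exists_factors ht hq hμ h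
  obtain ⟨μ', hR, W, L, hL, hW, Ψ', hΨ', g⟩ := PtMod.reachable_of_factors ht hq γ l
  obtain rfl : μ = μ' := LWeight.shift_eq (P := Ψ) (Ψ' := Ψ') fun i m => (hΨ i m).2.trans (hΨ' i m).2.symm
  have e : Ψ'.psi = Ψ.psi := by
    funext ε i m
    rcases Int.units_eq_one_or ε with rfl | rfl
    · exact (hΨ' i m).1.trans (hΨ i m).1.symm
    · exact (hΨ' i m).2.trans (hΨ i m).2.symm
  have g' : (modRp ht hq hμ W.carrier).Highest W.vec Ψ := ⟨g.raise, fun ε i r => e ▸ g.phi ε i r, g.gen, g.notMem⟩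
  exact ⟨0, PtMod.constRp ht hq γ, L, W, PtMod.isConstantRp_constRp ht hq γ, hL, hW,
    (PtMod.isHighest ht hq hR.isShift g.toHighest (fun d i => g.recurrence d i (-1)) hR.rational hΨ').inO,
    h.isSubqOf ht hq hμ g'⟩
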